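/- Graphs are finite, simple and undirected. For a graph $G$ and $A\subseteq V(G)$ write $\overline A=V(G)\setminus A$, and let $\operatorname{mm}(A)$ be the maximum size of a matching in the bipartite graph $G[A,\overline A]$ formed by the edges of $G$ between $A$ and $\overline A$. The cut $(A,\overline A)$ is a *split* if $|A|,|\overline A|\ge 2$ and all vertices of $A$ that have a neighbour in $\overline A$ have the same neighbourhood in $\overline A$. Put $\operatorname{sm}(A)=1$ if $(A,\overline A)$ is a split, and $\operatorname{sm}(A)=\operatorname{mm}(A)$ otherwise. A *branch decomposition* $(T,\delta)$ of $G$ is a tree $T$ of maximum degree at most $3$ together with a bijection $\delta$ from the leaves of $T$ to $V(G)$ (the vertex of a one-vertex tree counts as a leaf). Each edge $e$ of $T$ induces a cut of $G$, given by the leaves in the two components of $T-e$; the *sm-width* of $(T,\delta)$ is the maximum of $\operatorname{sm}(A)$ over all cuts $(A,\overline A)$ induced by edges of $T$ (and $0$ if $T$ has no edge). For $X\subseteq V(G)$, a *certificate* of $X$ is a subgraph of $G$ with vertex set $X$ that is a family of vertex-disjoint paths (isolated vertices being paths of length zero) or a Hamiltonian cycle of $G$. A certificate $x$ of $A$ is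 *completed* by a certificate $z$ of $\overline A$ if a Hamiltonian cycle of $G$ can be obtained from $x\cup z$ by adding edges of $G$ between $A$ and $\overline A$; $x$ is *important* if some certificate of $\overline A$ completes it. A set $S$ of certificates of $A$ is *preserving* if for every certificate $y$ of $A$ there is an $x\in S$ that is completed by every certificate of $\overline A$ that completes $y$. The *class* of a path of a certificate of $A$ with endpoints $u,v$ (possibly $u=v$) is the unordered pair $\{N(u)\setminus A,\,N(v)\setminus A\}$, and two certificates of $A$ are *path equivalent* if there is a bijection between their paths that keeps the classes. **Theorem.** 1. There is an algorithm that, given a graph $G$ and a branch decomposition $(T,\delta)$ of $G$, decides whether $G$ has a Hamiltonian cycle in time $\mathcal O^*(2^{24k^2})$, where $k$ is the sm-width of $(T,\delta)$; that is, in at most $C\,(|V(G)|+|V(T)|)^{c}\,2^{24k^2}$ steps for absolute constants $C$ and $c$. (Steps are elementary operations of a program on linked lists: building a cell, head, tail, test for nil, and loop control, each at unit cost; so the bound also holds on a random access machine. Graphs are given by adjacency matrices, and $k$ is not part of the input.) 2. For every graph $G$ and $A\subseteq V(G)$, every important certificate of $A$ has at most $\operatorname{mm}(A)$ paths (a Hamiltonian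 cycle has no paths). 3. There is an absolute constant $C$ such that for every graph $G$ on $n$ vertices, every $k$ and every $A\subseteq V(G)$ with $\operatorname{sm}(A)\le k$, there is a preserving set of pairwise path-inequivalent certificates of $A$ of size at most $C\,(n+4^{k^2})$. -/

import Mathlib

namespace SMWidth

/-! ## A model of computation with a step count

Programs manipulate binary trees ("cons cells") through pointer operations: building a cell, taking
the head or the tail of a cell, testing for `nil`, and while loops.  Every elementary operation
costs one step; there is no equality test on whole trees, no arithmetic and no other operation whose
cost could depend on the size of the data.  This is the usual first-order cons/head/tail WHILE
language in variable-free form: `t` steps are simulated by `O(t)` steps of a random access machine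
with machine words of `O(log (t + input size))` bits, and Turing machines are simulated with constant
overhead. -/

/-- The values: binary trees of cons cells. -/
inductive Data : Type
  | nil : Data
  | cons : Data → Data → Data

namespace Data

/-- Head of a cell (`nil` for `nil`). -/
def head : Data → Data
  | nil => nil
  | cons a _ => a

/-- Tail of a cell (`nil` for `nil`). -/
def tail : Data → Data
  | nil => nil
  | cons _ b => b

/-- A list of values as a chain of cells. -/
def ofList : List Data → Data
  | [] => nil
  | a :: l => cons a (ofList l)

/-- A natural number in unary: a list of that many `nil`s. -/
def ofNat (n : ℕ) : Data := ofList (List.replicate n nil)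

open Classical in
/-- The bit which says whether `p` holds: `nil` for no, a cell for yes. -/
noncomputable def ofProp (p : Prop) : Data := if p then cons nil nil else nil

/-- The adjacency matrix of a graph on `{0, …, n - 1}`, as the list of its rows. -/
noncomputable def ofGraph {n : ℕ} (G : SimpleGraph (Fin n)) : Data :=
  ofList (List.ofFn fun i => ofList (List.ofFn fun j => ofProp (G.Adj i j)))

end Data

/-- Programs.  Each one computes a partial function `Data → Data`. -/
inductive Prog : Type
  /-- return the input -/
  | id : Prog
  /-- return `nil` -/
  | nil : Prog
  /-- return the head of the input -/
  | head : Prog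
  /-- return the tail of the input -/
  | tail : Prog
  /-- run both programs on the input and return a new cell with the two results -/
  | cons : Prog → Prog → Prog
  /-- `comp f g`: run `g` on the input, then `f` on the result -/
  | comp : Prog → Prog → Prog
  /-- `ite c f g`: run `c` on the input; run `f` on the input if the result is a cell,
  and `g` on the input if it is `nil` -/
  | ite : Prog → Prog → Prog → Prog
  /-- `loop c f`: as long as `c` returns a cell on the current value, replace that value
  by the result of `f` on it -/
  | loop : Prog → Prog → Prog

/-- `Run p x y t`: on input `x`, the program `p` halts with output `y` after exactly `t` steps. -/
inductive Run : Prog → Data → Data → ℕ → Prop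
  | id (x : Data) : Run Prog.id x x 1
  | nil (x : Data) : Run Prog.nil x Data.nil 1
  | head (x : Data) : Run Prog.head x x.head 1
  | tail (x : Data) : Run Prog.tail x x.tail 1
  | cons {f g : Prog} {x y z : Data} {s t : ℕ} :
      Run f x y s → Run g x z t → Run (Prog.cons f g) x (Data.cons y z) (s + t + 1)
  | comp {f g : Prog} {x y z : Data} {s t : ℕ} :
      Run g x y s → Run f y z t → Run (Prog.comp f g) x z (s + t + 1)
  | ite_cell {c f g : Prog} {x a b y : Data} {s t : ℕ} :
      Run c x (Data.cons a b) s → Run f x y t → Run (Prog.ite c f g) x y (s + t + 1)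
  | ite_nil {c f g : Prog} {x y : Data} {s t : ℕ} :
      Run c x Data.nil s → Run g x y t → Run (Prog.ite c f g) x y (s + t + 1)
  | loop_stop {c f : Prog} {x : Data} {s : ℕ} :
      Run c x Data.nil s → Run (Prog.loop c f) x x (s + 1)
  | loop_step {c f : Prog} {x a b y z : Data} {s t u : ℕ} :
      Run c x (Data.cons a b) s → Run f x y t → Run (Prog.loop c f) y z u →
        Run (Prog.loop c f) x z (s + t + u + 1)

/-! ## Cuts, branch decompositions and split-matching-width -/

section Width

variable {V W : Type*}

/-- `mm(A)`: the largest number of edges of a matching of the bipartite graph `G[A, V ∖ A]`. -/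
noncomputable def mm (G : SimpleGraph V) (A : Set V) : ℕ :=
  sSup {r | ∃ M : (G.between A Aᶜ).Subgraph, M.IsMatching ∧ M.edgeSet.ncard = r}

/-- The cut `(A, V ∖ A)` is a split: both sides have at least two vertices, and all vertices of `A`
that have a neighbour outside `A` have the same neighbourhood outside `A`. -/
def IsSplit (G : SimpleGraph V) (A : Set V) : Prop :=
  2 ≤ A.ncard ∧ 2 ≤ Aᶜ.ncard ∧
    ∀ u ∈ A, ∀ v ∈ A, (G.neighborSet u ∩ Aᶜ).Nonempty → (G.neighborSet v ∩ Aᶜ).Nonempty →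
      G.neighborSet u ∩ Aᶜ = G.neighborSet v ∩ Aᶜ

open Classical in
/-- The split-matching value of the cut `(A, V ∖ A)`. -/
noncomputable def sm (G : SimpleGraph V) (A : Set V) : ℕ :=
  if IsSplit G A then 1 else mm G A

/-- A leaf of a tree: a vertex of degree at most one (degree zero occurs only in the tree with a
single vertex). -/
def IsLeaf (T : SimpleGraph W) (x : W) : Prop := (T.neighborSet x).ncard ≤ 1

/-- A branch decomposition `(T, δ)` of a graph with vertex set `V`: a tree `T` (with vertex set `W`)
of maximum degree at most three and a bijection `δ` from the leaves of `T` to `V`. -/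
structure BranchDecomposition (V W : Type*) where
  tree : SimpleGraph W
  isTree : tree.IsTree
  subcubic : ∀ x, (tree.neighborSet x).ncard ≤ 3
  δ : {x : W // IsLeaf tree x} ≃ V

/-- For an edge `xy` of `T`, the set of vertices of the graph that sit at the leaves of the component
of `T - xy` which contains `x`. -/
def BranchDecomposition.side (D : BranchDecomposition V W) (x y : W) : Set V :=
  {v | (D.tree.deleteEdges {s(x, y)}).Reachable x (D.δ.symm v)}

/-- The sm-width of a branch decomposition of `G`: the maximum of `sm` over the cuts that are induced
by the edges of the tree (`0` if there is no edge). -/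
noncomputable def BranchDecomposition.smWidth (D : BranchDecomposition V W)
    (G : SimpleGraph V) : ℕ :=
  ⨆ e : D.tree.Dart, sm G (D.side e.fst e.snd)

end Width

/-- The input of the algorithm: the adjacency matrix of `G`, the adjacency matrix of `T`, and, for
each vertex of `G`, the number of the leaf of `T` at which it sits. -/
noncomputable def encodeInput {n m : ℕ} (G : SimpleGraph (Fin n))
    (D : BranchDecomposition (Fin n) (Fin m)) : Data :=
  Data.ofList [Data.ofGraph G, Data.ofGraph D.tree,
    Data.ofList (List.ofFn fun v : Fin n => Data.ofNat (D.δ.symm v).1)]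

/-! ## Hamiltonian cycles and certificates -/

section Certificates

variable {V : Type*} [DecidableEq V] {G : SimpleGraph V}

/-- The subgraph `H` of `G` is a Hamiltonian cycle of `G`. -/
def IsHamCycle (H : G.Subgraph) : Prop :=
  ∃ (a : V) (p : G.Walk a a), p.IsHamiltonianCycle ∧ H = p.toSubgraph

/-- `H` consists of vertex-disjoint paths, isolated vertices being paths of length zero: it has no
cycle and all its degrees are at most two. -/
def IsDisjointPaths (H : G.Subgraph) : Prop :=
  H.coe.IsAcyclic ∧ ∀ v, (H.neighborSet v).ncard ≤ 2

/-- The certificates of `X`: the subgraphs of `G` with vertex set `X` that consist of vertex-disjoint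
paths, or of a Hamiltonian cycle of `G`. -/
def cert (G : SimpleGraph V) (X : Set V) : Set G.Subgraph :=
  {H | H.verts = X ∧ (IsDisjointPaths H ∨ IsHamCycle H)}

/-- The certificates that arise from the union of `x` and `y` by adding edges of `G` between the
vertex set of `x` and that of `y`. -/
def conc (x y : G.Subgraph) : Set G.Subgraph :=
  {z | z ∈ cert G (x.verts ∪ y.verts) ∧ x ⊔ y ≤ z ∧
    ∀ u v, z.Adj u v → x.Adj u v ∨ y.Adj u v ∨
      (u ∈ x.verts ∧ v ∈ y.verts) ∨ (u ∈ y.verts ∧ v ∈ x.verts)}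

/-- `x`, a certificate of `A`, can be completed by a certificate `z` of the complement of `A`. -/
def CompletesTo (x z : G.Subgraph) : Prop := ∃ w ∈ conc x z, IsHamCycle w

/-- A certificate of `A` is important if some certificate of the complement of `A` completes it to a
Hamiltonian cycle of `G`. -/
def IsImportant (A : Set V) (x : G.Subgraph) : Prop :=
  x ∈ cert G A ∧ ∃ z ∈ cert G Aᶜ, CompletesTo x z

/-- The set `S` preserves the set `S'` of certificates of `A`: each `y ∈ S'` has some `x ∈ S` which
is completed to a Hamiltonian cycle by every certificate of the complement of `A` that
completes `y`. -/
def Preserves (A : Set V) (S S' : Set G.Subgraph) : Prop :=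
  ∀ y ∈ S', ∃ x ∈ S, ∀ z ∈ cert G Aᶜ, CompletesTo y z → CompletesTo x z

/-- The paths of a certificate: its components without cycles (a Hamiltonian cycle has none). -/
def paths (H : G.Subgraph) : Set H.coe.ConnectedComponent :=
  {c | c.toSimpleGraph.IsAcyclic}

/-- `q` is the class of the path `c` of `H`: the unordered pair of the neighbourhoods, outside the
vertex set of `H`, of the endpoints `u`, `v` of `c` (with `u = v` if `c` is a single vertex). -/
def HasPathClass (H : G.Subgraph) (c : H.coe.ConnectedComponent) (q : Sym2 (Set V)) : Prop :=
  ∃ u v : H.verts, {w | w ∈ c.supp ∧ (H.neighborSet w).ncard ≤ 1} = {u, v} ∧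
    q = s(G.neighborSet u \ H.verts, G.neighborSet v \ H.verts)

/-- There is a bijection between the paths of `H` and those of `H'` that keeps the path classes. -/
def PathEquivalent (H H' : G.Subgraph) : Prop :=
  ∃ σ : paths H ≃ paths H', ∀ (P : paths H) (q : Sym2 (Set V)),
    HasPathClass H P q ↔ HasPathClass H' (σ P) q

end Certificates

end SMWidth

/-! A Hamiltonian cycle, cut along `(A, Aᶜ)`, leaves a system of directed paths in `A`. Label a
vertex of `A` by its neighbourhood outside `A`. Whether two paths can be merged along a crossing
edge depends only on the labels of the two vertices joined, so a sequence of merges can be replayed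
on every path system with the same multiset of (label of start, label of end) (`Mrg.lifts`). This
exchange principle carries both the algorithm and the statement on preserving sets.

Algorithm. For each directed edge of the tree a table stores the vertices on its side together with
states, lists of (start, end) pairs kept up to permutation. At a node, states of two disjoint sets
are concatenated, closed under adding edges between the sets, cleared of those that no cycle can
use, and relabelled by representatives of the neighbourhood classes. Replaying merges from states to
paths shows that every state is realized (`Sound.join`); replaying them from the trace of a cycle to
states shows that every trace is found (`Complete.join`). The side of the tree opposite to the leaf
of vertex `0` then decides: a Hamiltonian cycle exists iff some state there is a single path with
both ends adjacent to `0`. A node has at most two further neighbours, and an inner node carries no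
vertex, so every set met in a join is a side of the decomposition and has `sm` at most `k`
(`Decomp.good_prefix`).

Number of states. At a split all useful ends have the same label, so a state is just a number of
paths. Otherwise a greedy matching has at most `k` edges; by maximality its at most `2k` vertices
cover all crossing edges, which leaves at most `2k` paths and at most `2^k + k` labels
(`Fine.join`). In the course of a join the two kinds mix, and the number of states stays below `N =
(n+2)^4 (4^(k+2)+1)^(4k)` (`Fine.mid`, `Mid.small`). Duplicates are found by linear scans, so the
time is `N^2` up to a polynomial factor, and `16k^2 + 40k ≤ 24k^2 + 50` gives the exponent
(`stBound_le`).

Step counts are derived compositionally. `Cmp` says that some program computes a function within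
given costs, `Sm` is the calculus of polynomial-time functions with polynomially bounded values, and
`Big` bounds the costs of folds over the long lists of states by a weight times a polynomial.

Certificates. A certificate of `A` is completed by one of `Aᶜ` exactly if both are traces of one
Hamiltonian cycle (`completesTo_iff`). The edges by which the cycle leaves the paths of a trace form
a matching across the cut, which bounds the number of paths. If two traces have the same multiset of
unordered path classes, the paths of one can be turned around so that the ordered labels agree, and
the exchange principle puts it in the place of the other (`exists_exchange`). So one representative
for each value of `state` preserves all certificates, and these values are counted as above
(`ncard_states_le`). -/

namespace SMWidth

/-! ## Programs on typed data -/

/-- Types whose values are encoded by binary trees, with a notion of being bounded by a number. -/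
class Enc (α : Type) where
  enc : α → Data
  bd : ℕ → α → Prop
  bd_mono : ∀ {s s' : ℕ} {a : α}, s ≤ s' → bd s a → bd s' a

open Enc

instance : Enc Unit where
  enc _ := Data.nil
  bd _ _ := True
  bd_mono _ h := h

instance : Enc Bool where
  enc b := if b then Data.cons Data.nil Data.nil else Data.nil
  bd _ _ := True
  bd_mono _ h := h

instance : Enc ℕ where
  enc := Data.ofNat
  bd s a := a ≤ s
  bd_mono h h' := h'.trans h

instance {α β : Type} [Enc α] [Enc β] : Enc (α × β) where
  enc p := Data.cons (enc p.1) (enc p.2)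
  bd s p := bd s p.1 ∧ bd s p.2
  bd_mono h h' := ⟨bd_mono h h'.1, bd_mono h h'.2⟩

instance {α : Type} [Enc α] : Enc (List α) where
  enc l := Data.ofList (l.map enc)
  bd s l := l.length ≤ s ∧ ∀ a ∈ l, bd s a
  bd_mono h h' := ⟨h'.1.trans h, fun a ha => bd_mono h (h'.2 a ha)⟩

variable {α β γ ι : Type} [Enc α] [Enc β] [Enc γ] [Enc ι]

@[simp] theorem enc_pair (a : α) (b : β) : enc (a, b) = Data.cons (enc a) (enc b) := rfl
@[simp] theorem enc_nil : enc ([] : List α) = Data.nil := rfl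
@[simp] theorem enc_cons (a : α) (l : List α) : enc (a :: l) = Data.cons (enc a) (enc l) := rfl
@[simp] theorem enc_true : enc true = Data.cons Data.nil Data.nil := rfl
@[simp] theorem enc_false : enc false = Data.nil := rfl
theorem enc_replicate (n : ℕ) : enc (List.replicate n ()) = enc n := by
  simp only [enc, List.map_replicate]; rfl

/-- Some program computes `f`, on input `a` in at most `c a` steps. -/
def Cmp (f : α → β) (c : α → ℕ) : Prop :=
  ∃ P : Prog, ∀ a, ∃ t ≤ c a, Run P (enc a) (enc (f a)) t

namespace Cmp

theorem mono {f : α → β} {c d : α → ℕ} (h : Cmp f c) (hcd : ∀ a, c a ≤ d a) : Cmp f d := by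
  obtain ⟨P, hP⟩ := h
  refine ⟨P, fun a => ?_⟩
  obtain ⟨t, ht, hr⟩ := hP a
  exact ⟨t, ht.trans (hcd a), hr⟩

theorem id : Cmp (fun a : α => a) (fun _ => 1) := ⟨Prog.id, fun _ => ⟨1, le_rfl, Run.id _⟩⟩

theorem comp {f : α → β} {g : β → γ} {c : α → ℕ} {d : β → ℕ} (hg : Cmp g d) (hf : Cmp f c) :
    Cmp (fun a => g (f a)) (fun a => c a + d (f a) + 1) := by
  obtain ⟨P, hP⟩ := hf
  obtain ⟨Q, hQ⟩ := hg
  refine ⟨Prog.comp Q P, fun a => ?_⟩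
  obtain ⟨t, ht, hr⟩ := hP a
  obtain ⟨u, hu, hq⟩ := hQ (f a)
  exact ⟨_, by dsimp only; omega, Run.comp hr hq⟩

theorem pair {f : α → β} {g : α → γ} {c d : α → ℕ} (hf : Cmp f c) (hg : Cmp g d) :
    Cmp (fun a => (f a, g a)) (fun a => c a + d a + 1) := by
  obtain ⟨P, hP⟩ := hf
  obtain ⟨Q, hQ⟩ := hg
  refine ⟨Prog.cons P Q, fun a => ?_⟩
  obtain ⟨t, ht, hr⟩ := hP a
  obtain ⟨u, hu, hq⟩ := hQ a
  exact ⟨_, by dsimp only; omega, Run.cons hr hq⟩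

theorem fst {f : α → β × γ} {c : α → ℕ} (hf : Cmp f c) :
    Cmp (fun a => (f a).1) (fun a => c a + 2) := by
  obtain ⟨P, hP⟩ := hf
  refine ⟨Prog.comp Prog.head P, fun a => ?_⟩
  obtain ⟨t, ht, hr⟩ := hP a
  exact ⟨_, by dsimp only; omega, Run.comp hr (Run.head _)⟩

theorem snd {f : α → β × γ} {c : α → ℕ} (hf : Cmp f c) :
    Cmp (fun a => (f a).2) (fun a => c a + 2) := by
  obtain ⟨P, hP⟩ := hf
  refine ⟨Prog.comp Prog.tail P, fun a => ?_⟩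
  obtain ⟨t, ht, hr⟩ := hP a
  exact ⟨_, by dsimp only; omega, Run.comp hr (Run.tail _)⟩

theorem nil : Cmp (fun _ : α => ([] : List β)) (fun _ => 1) :=
  ⟨Prog.nil, fun _ => ⟨1, le_rfl, Run.nil _⟩⟩

theorem consList {f : α → β} {g : α → List β} {c d : α → ℕ} (hf : Cmp f c) (hg : Cmp g d) :
    Cmp (fun a => f a :: g a) (fun a => c a + d a + 1) := by
  obtain ⟨P, hP⟩ := pair hf hg
  exact ⟨P, hP⟩

theorem tailList {f : α → List β} {c : α → ℕ} (hf : Cmp f c) :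
    Cmp (fun a => (f a).tail) (fun a => c a + 2) := by
  obtain ⟨P, hP⟩ := hf
  refine ⟨Prog.comp Prog.tail P, fun a => ?_⟩
  obtain ⟨t, ht, hr⟩ := hP a
  refine ⟨t + 1 + 1, by dsimp only; omega, ?_⟩
  have := Run.comp hr (Run.tail _)
  dsimp only
  revert this
  cases f a <;> exact fun h => h

theorem true' : Cmp (fun _ : α => true) (fun _ => 3) :=
  ⟨Prog.cons Prog.nil Prog.nil, fun _ => ⟨3, le_rfl, Run.cons (Run.nil _) (Run.nil _)⟩⟩

theorem false' : Cmp (fun _ : α => false) (fun _ => 1) :=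
  ⟨Prog.nil, fun _ => ⟨1, le_rfl, Run.nil _⟩⟩

theorem cond {b : α → Bool} {f g : α → β} {c d e : α → ℕ} (hb : Cmp b c) (hf : Cmp f d)
    (hg : Cmp g e) :
    Cmp (fun a => bif b a then f a else g a)
      (fun a => c a + (bif b a then d a else e a) + 1) := by
  obtain ⟨B, hB⟩ := hb
  obtain ⟨P, hP⟩ := hf
  obtain ⟨Q, hQ⟩ := hg
  refine ⟨Prog.ite B P Q, fun a => ?_⟩
  obtain ⟨r, hr, hr'⟩ := hB a
  obtain ⟨t, ht, ht'⟩ := hP a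
  obtain ⟨u, hu, hu'⟩ := hQ a
  dsimp only
  cases hba : b a
  · rw [hba] at hr'
    exact ⟨r + u + 1, by simp only [cond_false]; omega, Run.ite_nil hr' hu'⟩
  · rw [hba] at hr'
    exact ⟨r + t + 1, by simp only [cond_true]; omega, Run.ite_cell hr' ht'⟩

theorem isEmpty {f : α → List β} {c : α → ℕ} (hf : Cmp f c) :
    Cmp (fun a => (f a).isEmpty) (fun a => c a + 4) := by
  obtain ⟨P, hP⟩ := hf
  refine ⟨Prog.ite P Prog.nil (Prog.cons Prog.nil Prog.nil), fun a => ?_⟩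
  obtain ⟨t, ht, hr⟩ := hP a
  dsimp only
  cases hf : f a with
  | nil =>
    rw [hf] at hr
    exact ⟨_, by omega, Run.ite_nil hr (Run.cons (Run.nil _) (Run.nil _))⟩
  | cons b l =>
    rw [hf] at hr
    exact ⟨t + 1 + 1, by omega, Run.ite_cell hr (Run.nil _)⟩

/-- Programs have no variables, so the list is computed twice, once for the test and once to take
its head; hence the factor 2. -/
theorem headD {f : α → List β} {g : α → β} {c d : α → ℕ} (hf : Cmp f c) (hg : Cmp g d) :
    Cmp (fun a => (f a).headD (g a)) (fun a => 2 * c a + d a + 3) := by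
  obtain ⟨P, hP⟩ := hf
  obtain ⟨Q, hQ⟩ := hg
  refine ⟨Prog.ite P (Prog.comp Prog.head P) Q, fun a => ?_⟩
  obtain ⟨t, ht, hr⟩ := hP a
  obtain ⟨u, hu, hq⟩ := hQ a
  dsimp only
  cases hf : f a with
  | nil =>
    rw [hf] at hr
    exact ⟨_, by omega, Run.ite_nil hr hq⟩
  | cons b l =>
    rw [hf] at hr
    exact ⟨_, by omega, Run.ite_cell hr (Run.comp hr (Run.head _))⟩

/-- The number of steps of a left fold. -/
def foldCost (f : γ → β → α → β) (c : γ × β × α → ℕ) (x : γ) : List α → β → ℕ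
  | [], _ => 40
  | a :: l, b => c (x, b, a) + 40 + foldCost f c x l (f x b a)

omit [Enc α] [Enc β] [Enc γ] in
-- A bound is required only for the accumulators of prefixes, those that really occur. In the
-- applications a step is cheap only because these accumulators satisfy an invariant.
theorem foldCost_le (f : γ → β → α → β) (c : γ × β × α → ℕ) (x : γ) (l : List α) (b : β) (T : ℕ)
    (h : ∀ l₁ a l₂, l = l₁ ++ a :: l₂ → c (x, l₁.foldl (f x) b, a) ≤ T) :
    foldCost f c x l b ≤ (l.length + 1) * (T + 40) := by
  induction l generalizing b with
  | nil => simp only [foldCost, List.length_nil]; omega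
  | cons a l ih =>
    have h1 := h [] a l rfl
    have h2 := ih (f x b a) (fun l₁ a' l₂ h' => h (a :: l₁) a' l₂ (by rw [h']; rfl))
    simp only [foldCost, List.length_cons]
    simp only [List.foldl_nil] at h1
    nlinarith

/-- The loop works on the triple (context, remaining list, accumulator), and the remaining list is
the guard. The 40 steps per round in `foldCost` pay for taking the triple apart and rebuilding it.
-/
theorem foldlAux {f : γ → β → α → β} {c : γ × β × α → ℕ}
    (hf : Cmp (fun x : γ × β × α => f x.1 x.2.1 x.2.2) c) :
    Cmp (fun x : γ × List α × β => x.2.1.foldl (f x.1) x.2.2)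
      (fun x => foldCost f c x.1 x.2.1 x.2.2) := by
  obtain ⟨Q, hQ⟩ := hf
  let Lst := Prog.comp Prog.head Prog.tail
  let step := Prog.cons Prog.head (Prog.cons (Prog.comp Prog.tail Lst)
    (Prog.comp Q (Prog.cons Prog.head (Prog.cons (Prog.comp Prog.tail Prog.tail)
      (Prog.comp Prog.head Lst)))))
  refine ⟨Prog.comp (Prog.comp Prog.tail Prog.tail) (Prog.loop Lst step), ?_⟩
  rintro ⟨x, l, b⟩
  -- The spare 5 steps pay for reading the accumulator off the final triple.
  have key : ∀ (l : List α) (b : β), ∃ t, t + 5 ≤ foldCost f c x l b ∧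
      Run (Prog.loop Lst step) (enc (x, l, b)) (enc (x, ([] : List α), l.foldl (f x) b)) t := by
    intro l
    induction l with
    | nil =>
      intro b
      exact ⟨_, by simp only [foldCost]; omega, Run.loop_stop (Run.comp (Run.tail _) (Run.head _))⟩
    | cons a l ih =>
      intro b
      obtain ⟨u, hu, hu'⟩ := hQ (x, b, a)
      obtain ⟨t, ht, ht'⟩ := ih (f x b a)
      have hL : Run Lst (enc (x, a :: l, b)) (Data.cons (enc a) (enc l)) 3 :=
        Run.comp (Run.tail _) (Run.head _)
      have hs : Run step (enc (x, a :: l, b)) (enc (x, l, f x b a)) _ :=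
        Run.cons (Run.head _) (Run.cons (Run.comp hL (Run.tail _))
          (Run.comp (Run.cons (Run.head _) (Run.cons (Run.comp (Run.tail _) (Run.tail _))
            (Run.comp hL (Run.head _)))) hu'))
      exact ⟨_, by simp only [foldCost] at hu ⊢; omega, Run.loop_step hL hs ht'⟩
  obtain ⟨t, ht, hr⟩ := key l b
  exact ⟨_, by simp only; omega, Run.comp hr (Run.comp (Run.tail _) (Run.tail _))⟩

/-- Folding over a list that depends on the context. -/
theorem foldl {f : γ → β → α → β} {l : γ → List α} {b : γ → β} {c : γ × β × α → ℕ} {d e : γ → ℕ}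
    (hf : Cmp (fun x : γ × β × α => f x.1 x.2.1 x.2.2) c) (hl : Cmp l d) (hb : Cmp b e) :
    Cmp (fun x => (l x).foldl (f x) (b x))
      (fun x => d x + e x + foldCost f c x (l x) (b x) + 4) :=
  (comp (foldlAux hf) (pair id (pair hl hb))).mono fun x => by simp only; omega

end Cmp

/-! ## Programs of polynomial cost -/

/-- Some program computes `f` in polynomial time, and the values are polynomially bounded. -/
def Sm (f : α → β) : Prop :=
  ∃ (c : α → ℕ) (K : ℕ), Cmp f c ∧ ∀ s a, bd s a → c a ≤ (s + 2) ^ K ∧ bd ((s + 2) ^ K) (f a)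

/-- Polynomial bounds are normalized to powers of `s + 2`. Since the base is at least 2, constants,
sums, products and substitutions are all absorbed by the exponent. -/
theorem pow_add_le (s a b : ℕ) : (s + 2) ^ a + (s + 2) ^ b ≤ (s + 2) ^ (a + b + 1) := by
  have h1 : (s + 2) ^ a ≤ (s + 2) ^ (a + b) := Nat.pow_le_pow_right (by omega) (by omega)
  have h2 : (s + 2) ^ b ≤ (s + 2) ^ (a + b) := Nat.pow_le_pow_right (by omega) (by omega)
  rw [pow_succ]; nlinarith [Nat.zero_le (s * (s + 2) ^ (a + b))]

theorem pow_add_two_le (s a : ℕ) : (s + 2) ^ a + 2 ≤ (s + 2) ^ (a + 2) := by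
  have h1 : 1 ≤ (s + 2) ^ a := Nat.one_le_pow _ _ (by omega)
  rw [pow_add]; nlinarith [mul_self_nonneg s]

theorem pow_pow_le (s a b : ℕ) : ((s + 2) ^ a + 2) ^ b ≤ (s + 2) ^ ((a + 2) * b) := by
  rw [pow_mul]; exact Nat.pow_le_pow_left (pow_add_two_le s a) b

theorem le_pow_of_le (s K : ℕ) {a : ℕ} (h : a ≤ 2 ^ K) : a ≤ (s + 2) ^ K :=
  h.trans (Nat.pow_le_pow_left (by omega) K)

theorem pow_mono {s a b : ℕ} (h : a ≤ b) : (s + 2) ^ a ≤ (s + 2) ^ b :=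
  Nat.pow_le_pow_right (by omega) h

theorem le_pow_one (s : ℕ) {K : ℕ} (hK : 1 ≤ K) : s ≤ (s + 2) ^ K :=
  (by omega : s ≤ s + 2).trans (Nat.le_self_pow (by omega) _)

/-- A quantity which is at most a polynomial in the bound. -/
def PB {α : Type} [Enc α] (c : α → ℕ) : Prop := ∃ K, ∀ s a, bd s a → c a ≤ (s + 2) ^ K

theorem PB.add {c d : α → ℕ} (hc : PB c) (hd : PB d) : PB (fun a => c a + d a) := by
  obtain ⟨K, hK⟩ := hc
  obtain ⟨L, hL⟩ := hd
  exact ⟨K + L + 1, fun s a h => (add_le_add (hK s a h) (hL s a h)).trans (pow_add_le s K L)⟩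

theorem PB.mul {c d : α → ℕ} (hc : PB c) (hd : PB d) : PB (fun a => c a * d a) := by
  obtain ⟨K, hK⟩ := hc
  obtain ⟨L, hL⟩ := hd
  exact ⟨K + L, fun s a h => (Nat.mul_le_mul (hK s a h) (hL s a h)).trans (by rw [pow_add])⟩

theorem PB.const (k : ℕ) : PB (fun _ : α => k) :=
  ⟨k, fun s _ _ => le_pow_of_le s k (Nat.lt_two_pow_self).le⟩

/-- The values of `f` are polynomially bounded. -/
def BB (f : α → β) : Prop := ∃ K, ∀ s a, bd s a → bd ((s + 2) ^ K) (f a)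

theorem PB.comp {d : β → ℕ} {f : α → β} (hd : PB d) (hf : BB f) : PB (fun a => d (f a)) := by
  obtain ⟨K, hK⟩ := hd
  obtain ⟨L, hL⟩ := hf
  exact ⟨(L + 2) * K, fun s a ha => (hK _ _ (hL s a ha)).trans (pow_pow_le s L K)⟩

theorem BB.comp {f : α → β} {g : β → γ} (hg : BB g) (hf : BB f) : BB (fun a => g (f a)) := by
  obtain ⟨K, hK⟩ := hg
  obtain ⟨L, hL⟩ := hf
  exact ⟨(L + 2) * K, fun s a ha => bd_mono (pow_pow_le s L K) (hK _ _ (hL s a ha))⟩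

theorem BB.pair {f : α → β} {g : α → γ} (hf : BB f) (hg : BB g) : BB (fun a => (f a, g a)) := by
  obtain ⟨K, hK⟩ := hf
  obtain ⟨L, hL⟩ := hg
  exact ⟨K + L, fun s a ha => ⟨bd_mono (pow_mono (by omega)) (hK s a ha),
    bd_mono (pow_mono (by omega)) (hL s a ha)⟩⟩

theorem sm_iff {f : α → β} : Sm f ↔ BB f ∧ ∃ c, PB c ∧ Cmp f c := by
  constructor
  · rintro ⟨c, K, h, hK⟩
    exact ⟨⟨K, fun s a ha => (hK s a ha).2⟩, c, ⟨K, fun s a ha => (hK s a ha).1⟩, h⟩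
  · rintro ⟨⟨K, hK⟩, c, ⟨L, hL⟩, h⟩
    exact ⟨c, K + L, h, fun s a ha => ⟨(hL s a ha).trans (pow_mono (by omega)),
      bd_mono (pow_mono (by omega)) (hK s a ha)⟩⟩

namespace Sm

theorem bb {f : α → β} (h : Sm f) : BB f := (sm_iff.1 h).1

theorem id : Sm (fun a : α => a) :=
  sm_iff.2 ⟨⟨1, fun s _ ha => bd_mono (le_pow_one s le_rfl) ha⟩, _, PB.const 1, Cmp.id⟩

theorem comp {f : α → β} {g : β → γ} (hg : Sm g) (hf : Sm f) : Sm (fun a => g (f a)) := by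
  obtain ⟨hf, c, hc, hf'⟩ := sm_iff.1 hf
  obtain ⟨hg, d, hd, hg'⟩ := sm_iff.1 hg
  exact sm_iff.2 ⟨hg.comp hf, _, (hc.add (hd.comp hf)).add (PB.const 1), Cmp.comp hg' hf'⟩

theorem pair {f : α → β} {g : α → γ} (hf : Sm f) (hg : Sm g) : Sm (fun a => (f a, g a)) := by
  obtain ⟨hf, c, hc, hf'⟩ := sm_iff.1 hf
  obtain ⟨hg, d, hd, hg'⟩ := sm_iff.1 hg
  exact sm_iff.2 ⟨hf.pair hg, _, (hc.add hd).add (PB.const 1), Cmp.pair hf' hg'⟩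

theorem fst {f : α → β × γ} (hf : Sm f) : Sm (fun a => (f a).1) := by
  obtain ⟨⟨K, hf⟩, c, hc, hf'⟩ := sm_iff.1 hf
  exact sm_iff.2 ⟨⟨K, fun s a ha => (hf s a ha).1⟩, _, hc.add (PB.const 2), Cmp.fst hf'⟩

theorem snd {f : α → β × γ} (hf : Sm f) : Sm (fun a => (f a).2) := by
  obtain ⟨⟨K, hf⟩, c, hc, hf'⟩ := sm_iff.1 hf
  exact sm_iff.2 ⟨⟨K, fun s a ha => (hf s a ha).2⟩, _, hc.add (PB.const 2), Cmp.snd hf'⟩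

theorem nil : Sm (fun _ : α => ([] : List β)) :=
  sm_iff.2 ⟨⟨0, fun s a _ => ⟨by simp, by simp⟩⟩, _, PB.const 1, Cmp.nil⟩

theorem true' : Sm (fun _ : α => true) := sm_iff.2 ⟨⟨0, fun _ _ _ => trivial⟩, _, PB.const 3, Cmp.true'⟩
theorem false' : Sm (fun _ : α => false) :=
  sm_iff.2 ⟨⟨0, fun _ _ _ => trivial⟩, _, PB.const 1, Cmp.false'⟩

theorem consList {f : α → β} {g : α → List β} (hf : Sm f) (hg : Sm g) :
    Sm (fun a => f a :: g a) := by
  obtain ⟨⟨K, hf⟩, c, hc, hf'⟩ := sm_iff.1 hf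
  obtain ⟨⟨L, hg⟩, d, hd, hg'⟩ := sm_iff.1 hg
  refine sm_iff.2 ⟨⟨K + L + 1, fun s a ha => ⟨?_, ?_⟩⟩, _, (hc.add hd).add (PB.const 1),
    Cmp.consList hf' hg'⟩
  · have h1 := (hg s a ha).1
    have h2 := pow_add_le s K L
    have h3 : 1 ≤ (s + 2) ^ K := Nat.one_le_pow _ _ (by omega)
    simp only [List.length_cons]; omega
  · intro b hb
    rcases List.mem_cons.1 hb with rfl | hb
    · exact bd_mono (pow_mono (by omega)) (hf s a ha)
    · exact bd_mono (pow_mono (by omega)) ((hg s a ha).2 b hb)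

theorem tailList {f : α → List β} (hf : Sm f) : Sm (fun a => (f a).tail) := by
  obtain ⟨⟨K, hf⟩, c, hc, hf'⟩ := sm_iff.1 hf
  refine sm_iff.2 ⟨⟨K, fun s a ha => ⟨?_, fun b hb => (hf s a ha).2 b (List.mem_of_mem_tail hb)⟩⟩, _,
    hc.add (PB.const 2), Cmp.tailList hf'⟩
  have := (hf s a ha).1
  simp only [List.length_tail]; omega

theorem cond {b : α → Bool} {f g : α → β} (hb : Sm b) (hf : Sm f) (hg : Sm g) :
    Sm (fun a => bif b a then f a else g a) := by
  obtain ⟨-, e, he, hb'⟩ := sm_iff.1 hb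
  obtain ⟨⟨K, hf⟩, c, hc, hf'⟩ := sm_iff.1 hf
  obtain ⟨⟨L, hg⟩, d, hd, hg'⟩ := sm_iff.1 hg
  refine sm_iff.2 ⟨⟨K + L, fun s a ha => ?_⟩, _, (he.add (hc.add hd)).add (PB.const 1),
    (Cmp.cond hb' hf' hg').mono fun a => ?_⟩
  · dsimp only
    cases b a
    · exact bd_mono (pow_mono (Nat.le_add_left L K)) (hg s a ha)
    · exact bd_mono (pow_mono (Nat.le_add_right K L)) (hf s a ha)
  · cases b a <;> simp only [cond_true, cond_false] <;> omega

theorem isEmpty {f : α → List β} (hf : Sm f) : Sm (fun a => (f a).isEmpty) := by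
  obtain ⟨-, c, hc, hf'⟩ := sm_iff.1 hf
  exact sm_iff.2 ⟨⟨0, fun _ _ _ => trivial⟩, _, hc.add (PB.const 4), Cmp.isEmpty hf'⟩

theorem headD {f : α → List β} {g : α → β} (hf : Sm f) (hg : Sm g) :
    Sm (fun a => (f a).headD (g a)) := by
  obtain ⟨⟨K, hf⟩, c, hc, hf'⟩ := sm_iff.1 hf
  obtain ⟨⟨L, hg⟩, d, hd, hg'⟩ := sm_iff.1 hg
  refine sm_iff.2 ⟨⟨K + L, fun s a ha => ?_⟩, _,
    ((((PB.const 2).mul hc).add hd).add (PB.const 3)), Cmp.headD hf' hg'⟩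
  have := hf s a ha
  dsimp only
  revert this
  cases f a with
  | nil => exact fun _ => bd_mono (pow_mono (Nat.le_add_left L K)) (hg s a ha)
  | cons b l => exact fun h => bd_mono (pow_mono (Nat.le_add_right K L)) (h.2 b (by simp))

/-- Iterating a polynomial-time step can make the accumulator explode, so a polynomial bound for the
accumulators of all prefixes is assumed in `hacc`. It yields both the bound for the result and,
through the cost of the step, the bound for the time. -/
theorem foldl {f : γ → β → α → β} {l : γ → List α} {b : γ → β}
    (hf : Sm (fun x : γ × β × α => f x.1 x.2.1 x.2.2)) (hl : Sm l) (hb : Sm b)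
    (hacc : ∃ K, ∀ s x, bd s x → ∀ l₁, l₁ <+: l x → bd ((s + 2) ^ K) (l₁.foldl (f x) (b x))) :
    Sm (fun x => (l x).foldl (f x) (b x)) := by
  obtain ⟨-, c, ⟨C, hc⟩, hf'⟩ := sm_iff.1 hf
  obtain ⟨hlb, d, hd, hl'⟩ := sm_iff.1 hl
  obtain ⟨-, e, he, hb'⟩ := sm_iff.1 hb
  obtain ⟨K, hK⟩ := hacc
  obtain ⟨L, hL⟩ := hlb
  refine sm_iff.2 ⟨⟨K, fun s x hx => hK s x hx _ List.prefix_rfl⟩, _, ?_,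
    Cmp.foldl hf' hl' hb'⟩
  refine ((hd.add he).add ?_).add (PB.const 4)
  refine ⟨L + 1 + ((K + L + 1 + 2) * C + 6 + 1), fun s x hx => ?_⟩
  have hlen := (hL s x hx).1
  have h1 : (s + 2) ^ L + 1 ≤ (s + 2) ^ (L + 1) := pow_add_le s L 0
  have h2 := pow_add_le s ((K + L + 1 + 2) * C) 6
  have h3 : 40 ≤ (s + 2) ^ 6 := le_pow_of_le s 6 (by norm_num)
  refine (Cmp.foldCost_le _ _ _ _ _ (((s + 2) ^ (K + L + 1) + 2) ^ C) fun l₁ a l₂ hl => ?_).trans ?_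
  · refine hc _ _ ⟨bd_mono (le_pow_one s (by omega)) hx, bd_mono (pow_mono (by omega))
      (hK s x hx l₁ ⟨a :: l₂, hl.symm⟩), bd_mono (pow_mono (by omega)) ((hL s x hx).2 a ?_)⟩
    rw [hl]; simp
  · rw [pow_add _ (L + 1)]
    have h4 := pow_pow_le s (K + L + 1) C
    exact Nat.mul_le_mul (by omega) (by omega)

end Sm
variable {α β γ ι : Type} [Enc α] [Enc β] [Enc γ] [Enc ι]

/-! ### Boolean and list operations in polynomial time -/

namespace Sm

theorem not' {b : α → Bool} (hb : Sm b) : Sm (fun a => !b a) := by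
  refine (cond hb false' true').comp id |> fun h => ?_
  convert h using 2 with a
  cases b a <;> rfl

theorem and' {b c : α → Bool} (hb : Sm b) (hc : Sm c) : Sm (fun a => b a && c a) := by
  convert cond hb hc false' using 2 with a
  cases b a <;> rfl

theorem or' {b c : α → Bool} (hb : Sm b) (hc : Sm c) : Sm (fun a => b a || c a) := by
  convert cond hb true' hc using 2 with a
  cases b a <;> rfl

theorem reverse {f : α → List β} (hf : Sm f) : Sm (fun a => (f a).reverse) := by
  have h : Sm (fun l : List β => l.foldl (fun acc a => a :: acc) []) := by
    refine foldl (f := fun _ acc a => a :: acc) (l := fun l => l) (b := fun _ => [])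
      (consList id.snd.snd id.snd.fst) id nil ⟨1, fun s x hx l₁ hl => ?_⟩
    rw [List.foldl_flip_cons_eq_append']
    simp only [List.append_nil]
    refine bd_mono (le_pow_one s le_rfl) ⟨?_, fun a ha => hx.2 a (hl.subset (by simpa using ha))⟩
    simpa using hl.length_le.trans hx.1
  convert h.comp hf using 2 with a
  rw [List.foldl_flip_cons_eq_append']; simp

theorem mapRev {l : α → List β} {g : α → β → γ} (hl : Sm l)
    (hg : Sm (fun x : α × β => g x.1 x.2)) :
    Sm (fun a => (l a).foldl (fun acc b => g a b :: acc) []) := by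
  obtain ⟨K, hK⟩ := hg.bb
  obtain ⟨L, hL⟩ := hl.bb
  refine foldl (f := fun a acc b => g a b :: acc) (b := fun _ => [])
      (consList (hg.comp (id.fst.pair id.snd.snd)) id.snd.fst) hl nil
      ⟨L + (L + 1 + 2) * K, fun s x hx l₁ hl₁ => ?_⟩
  have : l₁.foldl (fun acc b => g x b :: acc) [] = (l₁.map (g x)).reverse := by
    rw [← List.foldl_map (g := fun acc b => b :: acc), List.foldl_flip_cons_eq_append']; simp
  rw [this]
  refine ⟨?_, ?_⟩
  · simpa using (hl₁.length_le.trans (hL s x hx).1).trans (pow_mono (by omega))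
  · intro c hc
    obtain ⟨b, hb, rfl⟩ : ∃ b ∈ l₁, g x b = c := by simpa using hc
    refine bd_mono ((pow_pow_le s (L + 1) K).trans (pow_mono (by omega)))
      (hK _ (x, b) ⟨bd_mono (le_pow_one s (by omega)) hx, bd_mono (pow_mono (by omega))
      ((hL s x hx).2 b (hl₁.subset hb))⟩)

theorem map {l : α → List β} {g : α → β → γ} (hl : Sm l)
    (hg : Sm (fun x : α × β => g x.1 x.2)) : Sm (fun a => (l a).map (g a)) := by
  convert (mapRev hl hg).reverse using 2 with a
  rw [← List.foldl_map (g := fun acc b => b :: acc), List.foldl_flip_cons_eq_append']; simp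

theorem append {f g : α → List β} (hf : Sm f) (hg : Sm g) : Sm (fun a => f a ++ g a) := by
  obtain ⟨K, hK⟩ := hf.bb
  obtain ⟨L, hL⟩ := hg.bb
  have h : Sm (fun a => (f a).reverse.foldl (fun acc a => a :: acc) (g a)) := by
    refine foldl (f := fun _ acc a => a :: acc) (consList id.snd.snd id.snd.fst)
      hf.reverse hg ⟨K + L + 1, fun s x hx l₁ hl₁ => ?_⟩
    rw [List.foldl_flip_cons_eq_append']
    have h1 := hl₁.length_le
    have h2 := pow_add_le s K L
    have h3 := (hK s x hx).1
    have h4 := (hL s x hx).1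
    refine ⟨?_, fun a ha => ?_⟩
    · simp only [List.length_reverse, List.length_append] at h1 ⊢; omega
    · rcases List.mem_append.1 ha with ha | ha
      · exact bd_mono (pow_mono (by omega)) ((hK s x hx).2 a
          (by simpa using hl₁.subset (by simpa using ha)))
      · exact bd_mono (pow_mono (by omega)) ((hL s x hx).2 a ha)
  convert h using 2 with a
  rw [List.foldl_flip_cons_eq_append']; simp

theorem flatMap {l : α → List β} {g : α → β → List γ} (hl : Sm l)
    (hg : Sm (fun x : α × β => g x.1 x.2)) : Sm (fun a => (l a).flatMap (g a)) := by
  obtain ⟨K, hK⟩ := hg.bb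
  obtain ⟨L, hL⟩ := hl.bb
  have h : Sm (fun a => (l a).foldl (fun acc b => acc ++ g a b) []) := by
    refine foldl (f := fun a acc b => acc ++ g a b) (b := fun _ => [])
      (append id.snd.fst (hg.comp (id.fst.pair id.snd.snd))) hl nil
      ⟨L + (L + 1 + 2) * K, fun s x hx l₁ hl₁ => ?_⟩
    have : l₁.foldl (fun acc b => acc ++ g x b) [] = l₁.flatMap (g x) := by
      have : ∀ acc : List γ, l₁.foldl (fun acc b => acc ++ g x b) acc = acc ++ l₁.flatMap (g x) := by
        clear hl₁
        induction l₁ with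
        | nil => simp
        | cons a l ih => intro acc; simp [ih]
      simpa using this []
    rw [this]
    have key : ∀ b ∈ l₁, bd ((s + 2) ^ ((L + 1 + 2) * K)) (g x b) := fun b hb =>
      bd_mono (pow_pow_le s (L + 1) K)
        (hK _ (x, b) ⟨bd_mono (le_pow_one s (by omega)) hx, bd_mono (pow_mono (by omega))
        ((hL s x hx).2 b (hl₁.subset hb))⟩)
    refine ⟨?_, ?_⟩
    · rw [List.length_flatMap, pow_add]
      refine (List.sum_le_card_nsmul _ ((s + 2) ^ ((L + 1 + 2) * K)) ?_).trans ?_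
      · intro y hy
        obtain ⟨b, hb, rfl⟩ := List.mem_map.1 hy
        exact (key b hb).1
      · rw [List.length_map, smul_eq_mul]
        exact Nat.mul_le_mul_right _ (hl₁.length_le.trans (hL s x hx).1)
    · intro c hc
      obtain ⟨b, hb, hc⟩ := List.mem_flatMap.1 hc
      exact bd_mono (pow_mono (by omega)) ((key b hb).2 c hc)
  convert h using 2 with a
  have : ∀ (l₁ : List β) (acc : List γ),
      l₁.foldl (fun acc b => acc ++ g a b) acc = acc ++ l₁.flatMap (g a) := by
    intro l₁
    induction l₁ with
    | nil => simp
    | cons a l ih => intro acc; simp [ih]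
  simpa using (this (l a) []).symm

theorem filter {l : α → List β} {p : α → β → Bool} (hl : Sm l)
    (hp : Sm (fun x : α × β => p x.1 x.2)) : Sm (fun a => (l a).filter (p a)) := by
  convert flatMap hl (g := fun a b => bif p a b then [b] else []) (cond hp (consList id.snd nil) nil)
    using 2 with a
  induction l a with
  | nil => rfl
  | cons b l ih => rw [List.filter_cons, List.flatMap_cons, ih]; cases p a b <;> rfl

theorem any {l : α → List β} {p : α → β → Bool} (hl : Sm l)
    (hp : Sm (fun x : α × β => p x.1 x.2)) : Sm (fun a => (l a).any (p a)) := by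
  convert (filter hl hp).isEmpty.not' using 2 with a
  rw [Bool.eq_iff_iff]
  simp

theorem all {l : α → List β} {p : α → β → Bool} (hl : Sm l)
    (hp : Sm (fun x : α × β => p x.1 x.2)) : Sm (fun a => (l a).all (p a)) := by
  convert (any hl (p := fun a b => !p a b) hp.not').not' using 2 with a
  rw [List.all_eq_not_any_not]

/-! ### Numbers -/

/-- A unary numeral and a list of units have the same code. Arithmetic thus reduces to lists:
successor is `cons`, truncated subtraction is `drop`, comparison is a test for emptiness. -/
theorem ofUnits {f : α → ℕ} : Sm (fun a => List.replicate (f a) ()) ↔ Sm f := by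
  have e : ∀ n : ℕ, enc (List.replicate n ()) = enc n := enc_replicate
  constructor
  · rintro ⟨c, K, ⟨P, hP⟩, h⟩
    refine ⟨c, K, ⟨P, fun a => ?_⟩, fun s a ha => ⟨(h s a ha).1, ?_⟩⟩
    · simpa only [e] using hP a
    · have := (h s a ha).2.1
      rwa [List.length_replicate] at this
  · rintro ⟨c, K, ⟨P, hP⟩, h⟩
    refine ⟨c, K, ⟨P, fun a => ?_⟩, fun s a ha => ⟨(h s a ha).1,
      (List.length_replicate ..).trans_le (h s a ha).2, fun _ _ => trivial⟩⟩
    simpa only [e] using hP a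

theorem unit : Sm (fun _ : α => ()) :=
  sm_iff.2 ⟨⟨0, fun _ _ _ => trivial⟩, _, PB.const 1, Prog.nil, fun _ => ⟨1, le_rfl, Run.nil _⟩⟩

theorem length {f : α → List β} (hf : Sm f) : Sm (fun a => (f a).length) := by
  rw [← ofUnits]
  convert map hf (g := fun _ _ => ()) unit using 2 with a
  simp

theorem zero : Sm (fun _ : α => 0) := by
  rw [← ofUnits]; exact nil

theorem succ {f : α → ℕ} (hf : Sm f) : Sm (fun a => f a + 1) := by
  rw [← ofUnits]
  exact consList unit (ofUnits.2 hf)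

theorem dropList {f : α → List β} {g : α → ℕ} (hf : Sm f) (hg : Sm g) :
    Sm (fun a => (f a).drop (g a)) := by
  obtain ⟨K, hK⟩ := hf.bb
  have h : ∀ (u : List Unit) (l : List β), u.foldl (fun acc _ => acc.tail) l = l.drop u.length := by
    intro u
    induction u with
    | nil => simp
    | cons _ u ih => intro l; simp [ih]
  have : Sm (fun a => (List.replicate (g a) ()).foldl (fun acc _ => acc.tail) (f a)) := by
    refine foldl (f := fun _ acc _ => acc.tail) (tailList id.snd.fst) (ofUnits.2 hg) hf
      ⟨K, fun s x hx l₁ _ => ?_⟩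
    rw [h]
    exact ⟨by simpa using Nat.le_add_right_of_le (hK s x hx).1,
      fun a ha => (hK s x hx).2 a (List.mem_of_mem_drop ha)⟩
  simpa only [h, List.length_replicate] using this

theorem getD {f : α → List β} {g : α → ℕ} {d : α → β} (hf : Sm f) (hg : Sm g) (hd : Sm d) :
    Sm (fun a => (f a).getD (g a) (d a)) := by
  convert headD (dropList hf hg) hd using 2 with a
  simp [List.head?_drop]

theorem sub {f g : α → ℕ} (hf : Sm f) (hg : Sm g) : Sm (fun a => f a - g a) := by
  rw [← ofUnits]
  convert dropList (ofUnits.2 hf) hg using 2 with a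
  simp

theorem le {f g : α → ℕ} (hf : Sm f) (hg : Sm g) : Sm (fun a => decide (f a ≤ g a)) := by
  convert isEmpty (ofUnits.2 (sub hf hg)) using 2 with a
  rw [Bool.eq_iff_iff]
  simp [Nat.sub_eq_zero_iff_le]

theorem eqNat {f g : α → ℕ} (hf : Sm f) (hg : Sm g) : Sm (fun a => f a == g a) := by
  convert and' (le hf hg) (le hg hf) using 2 with a
  rw [Bool.eq_iff_iff]
  simp [Nat.le_antisymm_iff]

theorem range {f : α → ℕ} (hf : Sm f) : Sm (fun a => List.range (f a)) := by
  have h : ∀ u : List Unit, u.foldl (fun acc _ => acc.length :: acc) [] =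
      (List.range u.length).reverse := by
    intro u
    induction u using List.reverseRecOn with
    | nil => rfl
    | append_singleton u _ ih => simp [ih, List.range_succ]
  obtain ⟨K, hK⟩ := hf.bb
  have : Sm (fun a => (List.replicate (f a) ()).foldl (fun acc _ => acc.length :: acc) []) := by
    refine foldl (f := fun _ acc _ => acc.length :: acc) (consList id.snd.fst.length id.snd.fst)
      (ofUnits.2 hf) nil ⟨K, fun s x hx l₁ hl₁ => ?_⟩
    rw [h]
    have h1 := hl₁.length_le
    simp only [List.length_replicate] at h1
    have h2 := hK s x hx
    change f x ≤ _ at h2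
    refine ⟨by simpa using h1.trans h2, fun a ha => ?_⟩
    have : a < l₁.length := by simpa using ha
    change a ≤ _
    omega
  convert this.reverse using 2 with a
  rw [h]; simp

theorem eqBool {f g : α → Bool} (hf : Sm f) (hg : Sm g) : Sm (fun a => f a == g a) := by
  convert cond hf hg hg.not' using 2 with a
  cases f a <;> cases g a <;> rfl

end Sm

/-! ## The operations of the algorithm on a single state -/

/-- A state: the pairs (start, end) of the paths of a system of directed paths. -/
abbrev St : Type := List (ℕ × ℕ)

/-- The entry of a Boolean matrix. -/
def mat (G : List (List Bool)) (u v : ℕ) : Bool := (G.getD u []).getD v false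

def memb (A : List ℕ) (u : ℕ) : Bool := A.any fun a => a == u

/-- The vertices outside `A`. -/
def outside (G : List (List Bool)) (A : List ℕ) : List ℕ :=
  (List.range G.length).filter fun v => !memb A v

/-- Whether `u` and `v` have the same neighbours in `O`. -/
def sameNb (G : List (List Bool)) (O : List ℕ) (u v : ℕ) : Bool :=
  O.all fun w => mat G u w == mat G v w

/-- The first vertex of `A` with the same neighbours in `O` as `u`. -/
def reprOf (G : List (List Bool)) (A O : List ℕ) (u : ℕ) : ℕ :=
  (A.filter fun v => sameNb G O u v).headD u

/-- Whether `u` has a neighbour in `O`. -/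
def alive (G : List (List Bool)) (O : List ℕ) (u : ℕ) : Bool := O.any fun w => mat G u w

/-- A maximal matching between `A` and `O`, found greedily. -/
def greedy {V : Type} (r : V → V → Bool) (eq : V → V → Bool) (A O : List V) : List (V × V) :=
  (A.flatMap fun a => O.map fun o => (a, o)).foldl
    (fun M e => bif r e.1 e.2 && M.all fun p => !eq p.1 e.1 && !eq p.2 e.2 then e :: M else M) []

def eqPair (p q : ℕ × ℕ) : Bool := p.1 == q.1 && p.2 == q.2

def countOf (p : ℕ × ℕ) (s : St) : ℕ := (s.filter fun q => eqPair q p).length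

/-- Whether two states are permutations of each other. -/
def samePerm (s t : St) : Bool := (s ++ t).all fun p => countOf p s == countOf p t

/-- Removes the first occurrence of `p`. -/
def remove (p : ℕ × ℕ) (s : St) : St :=
  (s.foldl (fun acc q => bif !acc.1 && eqPair q p then (true, acc.2) else (acc.1, q :: acc.2))
    (false, [])).2

/-- Whether `uv` is an edge between `A` and `B`. -/
def cross (G : List (List Bool)) (A B : List ℕ) (u v : ℕ) : Bool :=
  mat G u v && ((memb A u && memb B v) || (memb B u && memb A v))

/-- The states obtained by adding one edge between `A` and `B`. -/
def merges (G : List (List Bool)) (A B : List ℕ) (s : St) : List St :=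
  s.flatMap fun p => (remove p s).flatMap fun q =>
    bif cross G A B p.2 q.1 then [(p.1, q.2) :: remove q (remove p s)] else []

def okState (G : List (List Bool)) (O : List ℕ) (M : List (ℕ × ℕ)) (s : St) : Bool :=
  decide (s.length ≤ (M ++ M).length) && s.all fun e => alive G O e.1 && alive G O e.2

def relabel (G : List (List Bool)) (A O : List ℕ) (s : St) : St :=
  s.map fun e => (reprOf G A O e.1, reprOf G A O e.2)

/-! ### The operations on single states run in polynomial time -/

section
variable {α : Type} [Enc α] {G : α → List (List Bool)} {A B O : α → List ℕ} {u v : α → ℕ}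
  {M s t : α → List (ℕ × ℕ)} {p q : α → ℕ × ℕ}

namespace Sm

theorem mat (hG : Sm G) (hu : Sm u) (hv : Sm v) : Sm fun a => mat (G a) (u a) (v a) :=
  getD (getD hG hu nil) hv false'

theorem memb (hA : Sm A) (hu : Sm u) : Sm fun a => memb (A a) (u a) :=
  any hA (p := fun a b => b == u a) (eqNat id.snd (hu.comp id.fst))

theorem outside (hG : Sm G) (hA : Sm A) : Sm fun a => outside (G a) (A a) :=
  filter (range hG.length) (p := fun a v => !SMWidth.memb (A a) v)
    (memb (hA.comp id.fst) id.snd).not'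

theorem sameNb (hG : Sm G) (hO : Sm O) (hu : Sm u) (hv : Sm v) :
    Sm fun a => sameNb (G a) (O a) (u a) (v a) :=
  all hO (p := fun a w => SMWidth.mat (G a) (u a) w == SMWidth.mat (G a) (v a) w)
    (eqBool (mat (hG.comp id.fst) (hu.comp id.fst) id.snd)
      (mat (hG.comp id.fst) (hv.comp id.fst) id.snd))

theorem reprOf (hG : Sm G) (hA : Sm A) (hO : Sm O) (hu : Sm u) :
    Sm fun a => reprOf (G a) (A a) (O a) (u a) :=
  headD (filter hA (p := fun a v => SMWidth.sameNb (G a) (O a) (u a) v)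
    (sameNb (hG.comp id.fst) (hO.comp id.fst) (hu.comp id.fst) id.snd)) hu

theorem alive (hG : Sm G) (hO : Sm O) (hu : Sm u) : Sm fun a => alive (G a) (O a) (u a) :=
  any hO (p := fun a w => SMWidth.mat (G a) (u a) w)
    (mat (hG.comp id.fst) (hu.comp id.fst) id.snd)

theorem greedy (hG : Sm G) (hA : Sm A) (hO : Sm O) :
    Sm fun a => greedy (SMWidth.mat (G a)) (fun u v => u == v) (A a) (O a) := by
  have hprod : Sm fun a => (A a).flatMap fun u => (O a).map fun o => (u, o) :=
    flatMap hA (g := fun a u => (O a).map fun o => (u, o))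
      (map (hO.comp id.fst) (g := fun (x : α × ℕ) o => (x.2, o)) (pair id.fst.snd id.snd))
  obtain ⟨K, hK⟩ := hprod.bb
  refine foldl (f := fun a M e => bif SMWidth.mat (G a) e.1 e.2 &&
    M.all fun p => !(p.1 == e.1) && !(p.2 == e.2) then e :: M else M) ?_ hprod nil
    ⟨K, fun s x hx l₁ hl₁ => ?_⟩
  · refine cond (and' (mat (hG.comp id.fst) id.snd.snd.fst id.snd.snd.snd)
      (all id.snd.fst (p := fun (x : α × List (ℕ × ℕ) × ℕ × ℕ) p =>
        !(p.1 == x.2.2.1) && !(p.2 == x.2.2.2)) ?_)) (consList id.snd.snd id.snd.fst) id.snd.fst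
    exact and' (eqNat id.snd.fst id.fst.snd.snd.fst).not' (eqNat id.snd.snd id.fst.snd.snd.snd).not'
  · have key : ∀ (l acc : List (ℕ × ℕ)) (T : ℕ), acc.length + l.length ≤ T → (∀ e ∈ acc, bd T e) →
        (∀ e ∈ l, bd T e) → bd T (l.foldl (fun M e => bif SMWidth.mat (G x) e.1 e.2 &&
    M.all fun p => !(p.1 == e.1) && !(p.2 == e.2) then e :: M else M) acc) := by
      intro l
      induction l with
      | nil => exact fun acc T h1 h2 _ => ⟨by simpa using h1, h2⟩
      | cons e l ih =>
        intro acc T h1 h2 h3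
        refine ih _ T ?_ ?_ fun e he => h3 e (List.mem_cons_of_mem _ he)
        · simp only [List.length_cons] at h1
          dsimp only
          cases (SMWidth.mat (G x) e.1 e.2 && acc.all fun p => !(p.1 == e.1) && !(p.2 == e.2)) <;>
            simp <;> omega
        · dsimp only
          cases (SMWidth.mat (G x) e.1 e.2 && acc.all fun p => !(p.1 == e.1) && !(p.2 == e.2))
          · exact h2
          · intro e' he'
            rcases List.mem_cons.1 he' with rfl | he'
            · exact h3 _ List.mem_cons_self
            · exact h2 _ he'
    exact key _ _ _ (by simpa using hl₁.length_le.trans (hK s x hx).1) (by simp)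
      fun e he => (hK s x hx).2 e (hl₁.subset he)

theorem eqPair (hp : Sm p) (hq : Sm q) : Sm fun a => eqPair (p a) (q a) :=
  and' (eqNat hp.fst hq.fst) (eqNat hp.snd hq.snd)

theorem countOf (hp : Sm p) (hs : Sm s) : Sm fun a => countOf (p a) (s a) :=
  length (filter hs (p := fun a q => SMWidth.eqPair q (p a)) (eqPair id.snd (hp.comp id.fst)))

theorem samePerm (hs : Sm s) (ht : Sm t) : Sm fun a => samePerm (s a) (t a) :=
  all (append hs ht) (p := fun a p => SMWidth.countOf p (s a) == SMWidth.countOf p (t a))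
    (eqNat (countOf id.snd (hs.comp id.fst)) (countOf id.snd (ht.comp id.fst)))

theorem remove (hp : Sm p) (hs : Sm s) : Sm fun a => remove (p a) (s a) := by
  obtain ⟨K, hK⟩ := hs.bb
  refine snd (foldl (f := fun a acc q => bif !acc.1 && SMWidth.eqPair q (p a) then (true, acc.2)
    else (acc.1, q :: acc.2)) ?_ hs (pair false' nil) ⟨K, fun S x hx l₁ hl₁ => ?_⟩)
  · exact cond (and' id.snd.fst.fst.not' (eqPair id.snd.snd (hp.comp id.fst)))
      (pair true' id.snd.fst.snd) (pair id.snd.fst.fst (consList id.snd.snd id.snd.fst.snd))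
  · have key : ∀ (l : List (ℕ × ℕ)) (acc : Bool × List (ℕ × ℕ)) (T : ℕ),
        acc.2.length + l.length ≤ T → (∀ e ∈ acc.2, bd T e) →
        (∀ e ∈ l, bd T e) → bd T (l.foldl (fun acc q => bif !acc.1 && SMWidth.eqPair q (p x) then
          (true, acc.2) else (acc.1, q :: acc.2)) acc) := by
      intro l
      induction l with
      | nil => exact fun acc T h1 h2 _ => ⟨trivial, by simpa using h1, h2⟩
      | cons e l ih =>
        intro acc T h1 h2 h3
        refine ih _ T ?_ ?_ fun e he => h3 e (List.mem_cons_of_mem _ he)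
        · simp only [List.length_cons] at h1
          dsimp only
          cases (!acc.1 && SMWidth.eqPair e (p x)) <;> simp <;> omega
        · dsimp only
          cases (!acc.1 && SMWidth.eqPair e (p x))
          · intro e' he'
            rcases List.mem_cons.1 he' with rfl | he'
            · exact h3 _ List.mem_cons_self
            · exact h2 _ he'
          · exact h2
    exact key _ _ _ (by simpa using hl₁.length_le.trans (hK S x hx).1) (by simp)
      fun e he => (hK S x hx).2 e (hl₁.subset he)

theorem cross (hG : Sm G) (hA : Sm A) (hB : Sm B) (hu : Sm u) (hv : Sm v) :
    Sm fun a => cross (G a) (A a) (B a) (u a) (v a) :=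
  and' (mat hG hu hv) (or' (and' (memb hA hu) (memb hB hv)) (and' (memb hB hu) (memb hA hv)))

theorem merges (hG : Sm G) (hA : Sm A) (hB : Sm B) (hs : Sm s) :
    Sm fun a => merges (G a) (A a) (B a) (s a) := by
  have hr : Sm fun x : α × (ℕ × ℕ) => SMWidth.remove x.2 (s x.1) := remove id.snd (hs.comp id.fst)
  have hr' : Sm fun x : (α × (ℕ × ℕ)) × (ℕ × ℕ) =>
      SMWidth.remove x.2 (SMWidth.remove x.1.2 (s x.1.1)) := remove id.snd (hr.comp id.fst)
  have hc : Sm fun x : (α × (ℕ × ℕ)) × (ℕ × ℕ) =>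
      SMWidth.cross (G x.1.1) (A x.1.1) (B x.1.1) x.1.2.2 x.2.1 :=
    cross (G := fun x : (α × (ℕ × ℕ)) × (ℕ × ℕ) => G x.1.1) (hG.comp id.fst.fst)
      (hA.comp id.fst.fst) (hB.comp id.fst.fst) id.fst.snd.snd id.snd.fst
  have hb : Sm fun x : (α × (ℕ × ℕ)) × (ℕ × ℕ) =>
      bif SMWidth.cross (G x.1.1) (A x.1.1) (B x.1.1) x.1.2.2 x.2.1 then
      [(x.1.2.1, x.2.2) :: SMWidth.remove x.2 (SMWidth.remove x.1.2 (s x.1.1))] else [] :=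
    cond hc (consList (consList (pair id.fst.snd.fst id.snd.snd) hr') nil) nil
  have hf : Sm fun x : α × (ℕ × ℕ) => (SMWidth.remove x.2 (s x.1)).flatMap fun q =>
      bif SMWidth.cross (G x.1) (A x.1) (B x.1) x.2.2 q.1 then
      [(x.2.1, q.2) :: SMWidth.remove q (SMWidth.remove x.2 (s x.1))] else [] :=
    flatMap hr hb
  exact flatMap hs hf

theorem okState (hG : Sm G) (hO : Sm O) (hM : Sm M) (hs : Sm s) :
    Sm fun a => okState (G a) (O a) (M a) (s a) := by
  have h1 : Sm fun a => decide ((s a).length ≤ (M a ++ M a).length) :=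
    le hs.length (append hM hM).length
  have h2 : Sm fun x : α × (ℕ × ℕ) => SMWidth.alive (G x.1) (O x.1) x.2.1 :=
    alive (hG.comp id.fst) (hO.comp id.fst) id.snd.fst
  have h3 : Sm fun x : α × (ℕ × ℕ) => SMWidth.alive (G x.1) (O x.1) x.2.2 :=
    alive (hG.comp id.fst) (hO.comp id.fst) id.snd.snd
  have h4 : Sm fun a => (s a).all fun e =>
      SMWidth.alive (G a) (O a) e.1 && SMWidth.alive (G a) (O a) e.2 :=
    all hs (and' h2 h3)
  exact and' h1 h4

theorem relabel (hG : Sm G) (hA : Sm A) (hO : Sm O) (hs : Sm s) :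
    Sm fun a => relabel (G a) (A a) (O a) (s a) := by
  have h1 : Sm fun x : α × (ℕ × ℕ) => SMWidth.reprOf (G x.1) (A x.1) (O x.1) x.2.1 :=
    reprOf (hG.comp id.fst) (hA.comp id.fst) (hO.comp id.fst) id.snd.fst
  have h2 : Sm fun x : α × (ℕ × ℕ) => SMWidth.reprOf (G x.1) (A x.1) (O x.1) x.2.2 :=
    reprOf (hG.comp id.fst) (hA.comp id.fst) (hO.comp id.fst) id.snd.snd
  have h3 := map hs (g := fun a e => (SMWidth.reprOf (G a) (A a) (O a) e.1,
    SMWidth.reprOf (G a) (A a) (O a) e.2)) (pair h1 h2)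
  unfold SMWidth.relabel
  exact h3

end Sm
end

/-! ## Correctness of the operations on states -/

theorem eqPair_iff {p q : ℕ × ℕ} : eqPair p q = true ↔ p = q := by
  simp [eqPair, Prod.ext_iff]

theorem countOf_eq (p : ℕ × ℕ) (s : St) : countOf p s = s.count p := by
  rw [countOf, List.count_eq_length_filter]
  congr 2

/-- Multiplicities need to be compared only for pairs that occur in one of the two lists; all others
have multiplicity zero in both. -/
theorem samePerm_iff {s t : St} : samePerm s t = true ↔ s.Perm t := by
  simp only [samePerm, countOf_eq, List.all_eq_true, beq_iff_eq]
  rw [List.perm_iff_count]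
  constructor
  · intro h p
    by_cases hp : p ∈ s ++ t
    · exact h p hp
    · simp only [List.mem_append, not_or] at hp
      rw [List.count_eq_zero_of_not_mem hp.1, List.count_eq_zero_of_not_mem hp.2]
  · exact fun h p _ => h p

/-- The flag in the accumulator records whether `p` has been dropped already. The fold reverses what
it keeps, so the order is lost; states matter only up to permutation. -/
theorem perm_remove {p : ℕ × ℕ} {s : St} (hp : p ∈ s) : (p :: remove p s).Perm s := by
  have h1 : ∀ (s acc : St), (s.foldl (fun (acc : Bool × St) q => bif !acc.1 && eqPair q p then
      (true, acc.2) else (acc.1, q :: acc.2)) (true, acc)).2.Perm (acc ++ s) := by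
    intro s
    induction s with
    | nil => simp
    | cons q s ih =>
      intro acc
      refine (ih (q :: acc)).trans ?_
      simpa using (List.perm_middle (a := q) (l₁ := acc) (l₂ := s)).symm
  have h2 : ∀ (s acc : St), p ∈ s → (p :: (s.foldl (fun (acc : Bool × St) q =>
      bif !acc.1 && eqPair q p then (true, acc.2) else (acc.1, q :: acc.2))
      (false, acc)).2).Perm (acc ++ s) := by
    intro s
    induction s with
    | nil => simp
    | cons q s ih =>
      intro acc hp
      rw [List.foldl_cons]
      by_cases hq : q = p
      · have : eqPair q p = true := eqPair_iff.2 hq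
        simp only [this, Bool.not_false, Bool.and_self, cond_true]
        subst hq
        exact ((h1 s acc).cons q).trans List.perm_middle.symm
      · have : eqPair q p = false := by
          rw [← Bool.not_eq_true, eqPair_iff]; exact hq
        simp only [this, Bool.and_false, cond_false]
        refine (ih (q :: acc) ((List.mem_cons.1 hp).resolve_left (Ne.symm hq))).trans ?_
        simpa using (List.perm_middle (a := q) (l₁ := acc) (l₂ := s)).symm
  exact h2 s [] hp

theorem memb_iff {A : List ℕ} {u : ℕ} : memb A u = true ↔ u ∈ A := by simp [memb]

theorem mem_outside {G : List (List Bool)} {A : List ℕ} {u : ℕ} :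
    u ∈ outside G A ↔ u < G.length ∧ u ∉ A := by
  simp only [outside, List.mem_filter, List.mem_range, ← memb_iff (A := A), Bool.not_eq_true',
    Bool.not_eq_true]

/-- One step of merging two paths along an edge of the relation `X`. -/
def Mrg {V : Type*} (X : V → V → Prop) (s s' : Multiset (V × V)) : Prop :=
  ∃ a b c d t, s = (a, b) ::ₘ (c, d) ::ₘ t ∧ X b c ∧ s' = (a, d) ::ₘ t

/-- With `exists_mem_merges`, this identifies `merges` with one step of `Mrg` on the underlying
multisets. The second pair is taken from what remains after removing the first, so a path is never
closed up with itself. -/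
theorem mem_merges {G : List (List Bool)} {A B : List ℕ} {s t : St} (h : t ∈ merges G A B s) :
    Mrg (fun u v => cross G A B u v = true) (s : Multiset (ℕ × ℕ)) t := by
  simp only [merges, List.mem_flatMap] at h
  obtain ⟨p, hp, q, hq, h⟩ := h
  cases hX : cross G A B p.2 q.1
  · simp [hX] at h
  · simp only [hX, cond_true, List.mem_singleton] at h
    subst h
    refine ⟨p.1, p.2, q.1, q.2, (remove q (remove p s) : St), ?_, hX, rfl⟩
    exact (Multiset.coe_eq_coe.2 (((perm_remove hq).cons p).trans (perm_remove hp))).symm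

theorem exists_mem_merges {G : List (List Bool)} {A B : List ℕ} {s : St} {t : Multiset (ℕ × ℕ)}
    (h : Mrg (fun u v => cross G A B u v = true) (s : Multiset (ℕ × ℕ)) t) :
    ∃ t' ∈ merges G A B s, (t' : Multiset (ℕ × ℕ)) = t := by
  obtain ⟨a, b, c, d, r, hs, hX, rfl⟩ := h
  have hp : (a, b) ∈ s := by
    rw [← Multiset.mem_coe, hs]; exact Multiset.mem_cons_self _ _
  have h1 : ((remove (a, b) s : St) : Multiset (ℕ × ℕ)) = (c, d) ::ₘ r := by
    have := Multiset.coe_eq_coe.2 (perm_remove hp)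
    rw [hs, ← Multiset.cons_coe] at this
    exact (Multiset.cons_inj_right _).1 this
  have hq : (c, d) ∈ remove (a, b) s := by
    rw [← Multiset.mem_coe, h1]; exact Multiset.mem_cons_self _ _
  have h2 : ((remove (c, d) (remove (a, b) s) : St) : Multiset (ℕ × ℕ)) = r := by
    have := Multiset.coe_eq_coe.2 (perm_remove hq)
    rw [h1, ← Multiset.cons_coe] at this
    exact (Multiset.cons_inj_right _).1 this
  refine ⟨(a, d) :: remove (c, d) (remove (a, b) s), ?_, ?_⟩
  · simp only [merges, List.mem_flatMap]
    exact ⟨_, hp, _, hq, by simp [hX]⟩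
  · rw [← h2]; rfl

/-! ## Lists of pairwise inequivalent states -/

/-- Inserts a state unless an equivalent one is present. -/
def insertSt (t : St) (J : List St) : List St := bif J.any (samePerm t) then J else t :: J

/-- All unions of a state of `S` and a state of `S'`. -/
def combine (S S' : List St) : List St :=
  S.foldl (fun J s => S'.foldl (fun J t => insertSt (s ++ t) J) J) []

/-- One round of adding edges between `A` and `B`. -/
def roundSt (G : List (List Bool)) (A B : List ℕ) (I : List St) : List St :=
  I.foldl (fun J s => (merges G A B s).foldl (fun J t => insertSt t J) J) I

/-- As many rounds as there are vertices. -/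
def saturate (G : List (List Bool)) (A B : List ℕ) (I : List St) : List St :=
  G.foldl (fun J _ => roundSt G A B J) I

/-- Drops useless states and replaces vertices by the representatives of their classes. -/
def trim (G : List (List Bool)) (A O : List ℕ) (M : List (ℕ × ℕ)) (I : List St) : List St :=
  I.foldl (fun J s => bif okState G O M s then insertSt (relabel G A O s) J else J) []

/-- Inequivalence of the members turns a count of the multisets that satisfy `Q` into a bound for
the length of the list. Every list that arises in a join is tame for a suitable `Q`, which bounds
all intermediate lists at once. -/
structure Tame (Q : St → Prop) (J : List St) : Prop where
  pairwise : J.Pairwise fun s t => ¬ s.Perm t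
  all : ∀ t ∈ J, Q t

variable {Q Q' : St → Prop} {J S S' I : List St} {t : St}

theorem Tame.nil : Tame Q [] := ⟨List.Pairwise.nil, by simp⟩

theorem insertSt_eq (t : St) (J : List St) :
    (insertSt t J = J ∧ ∃ t' ∈ J, t.Perm t') ∨ (insertSt t J = t :: J ∧ ∀ t' ∈ J, ¬ t.Perm t') := by
  cases h : J.any (samePerm t)
  · refine Or.inr ⟨by simp [insertSt, h], ?_⟩
    simpa [samePerm_iff, ← Bool.not_eq_true] using h
  · refine Or.inl ⟨by simp [insertSt, h], ?_⟩
    simpa [samePerm_iff] using h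

theorem Tame.insertSt (h : Tame Q J) (ht : Q t) : Tame Q (insertSt t J) := by
  rcases insertSt_eq t J with ⟨h1, -⟩ | ⟨h1, h2⟩
  · rwa [h1]
  · rw [h1]
    refine ⟨List.pairwise_cons.2 ⟨h2, h.pairwise⟩, fun t' ht' => ?_⟩
    rcases List.mem_cons.1 ht' with rfl | ht'
    · exact ht
    · exact h.all _ ht'

theorem subset_insertSt (t : St) (J : List St) : J ⊆ SMWidth.insertSt t J := by
  rcases insertSt_eq t J with ⟨h1, -⟩ | ⟨h1, -⟩ <;> rw [h1] <;> simp

theorem exists_mem_insertSt (t : St) (J : List St) : ∃ t' ∈ SMWidth.insertSt t J, t.Perm t' := by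
  rcases insertSt_eq t J with ⟨h1, h2⟩ | ⟨h1, -⟩ <;> rw [h1]
  · exact h2
  · exact ⟨t, List.mem_cons_self, List.Perm.refl t⟩

/-- An invariant of a fold. -/
theorem foldl_inv {α β : Type*} {f : β → α → β} (P : β → Prop) {l : List α} {b : β} (hb : P b)
    (hf : ∀ b, ∀ a ∈ l, P b → P (f b a)) : P (l.foldl f b) := by
  induction l generalizing b with
  | nil => exact hb
  | cons a l ih =>
    exact ih (hf b a List.mem_cons_self hb) fun b a' ha' => hf b a' (List.mem_cons_of_mem _ ha')

/-- Something that is established at `a` and kept afterwards holds after a fold over `l ∋ a`. -/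
theorem foldl_reach {α β : Type*} {f : β → α → β} (P : β → Prop) {l : List α} {b : β} {a : α}
    (ha : a ∈ l) (h1 : ∀ b, P (f b a)) (hf : ∀ b a, P b → P (f b a)) : P (l.foldl f b) := by
  induction l generalizing b with
  | nil => simp at ha
  | cons a' l ih =>
    rcases List.mem_cons.1 ha with rfl | ha
    · exact foldl_inv (b := f b a) P (h1 b) fun b a _ => hf b a
    · exact ih ha

theorem Tame.insertAll {l : List St} (h : Tame Q J) (hl : ∀ t ∈ l, Q t) :
    Tame Q (l.foldl (fun J t => SMWidth.insertSt t J) J) :=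
  foldl_inv (Tame Q) h fun _ t ht h => h.insertSt (hl t ht)

theorem Tame.combineStep {s : St} (h : Tame Q J) (hQ : ∀ t ∈ S', Q (s ++ t)) :
    Tame Q (S'.foldl (fun J t => SMWidth.insertSt (s ++ t) J) J) :=
  foldl_inv (Tame Q) h fun _ t ht h => h.insertSt (hQ t ht)

theorem tame_combine (hQ : ∀ s ∈ S, ∀ t ∈ S', Q (s ++ t)) : Tame Q (combine S S') :=
  foldl_inv (Tame Q) Tame.nil fun _ s hs h => h.combineStep (hQ s hs)

theorem exists_mem_combine {s : St} (hs : s ∈ S) (ht : t ∈ S') :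
    ∃ r ∈ combine S S', (s ++ t).Perm r := by
  refine foldl_reach (fun J => ∃ r ∈ J, (s ++ t).Perm r) hs (fun J => ?_) ?_
  · refine foldl_reach (fun J => ∃ r ∈ J, (s ++ t).Perm r) ht
      (fun J => exists_mem_insertSt (s ++ t) J) ?_
    rintro J t' ⟨r, hr, h⟩
    exact ⟨r, subset_insertSt _ _ hr, h⟩
  · rintro J s' ⟨r, hr, h⟩
    refine foldl_inv (fun J => ∃ r ∈ J, (s ++ t).Perm r) ⟨r, hr, h⟩ ?_
    rintro J t' - ⟨r, hr, h⟩
    exact ⟨r, subset_insertSt _ _ hr, h⟩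

variable {G : List (List Bool)} {A B O : List ℕ} {M : List (ℕ × ℕ)}

theorem Tame.roundSt (h : Tame Q I) (hQ : ∀ s, Q s → ∀ t ∈ merges G A B s, Q t) :
    Tame Q (roundSt G A B I) :=
  foldl_inv (Tame Q) h fun _ s hs h' => h'.insertAll (hQ s (h.all s hs))

theorem subset_insertAll (l : List St) : J ⊆ l.foldl (fun J t => SMWidth.insertSt t J) J :=
  foldl_inv (fun J' => J ⊆ J') (List.Subset.refl J) fun J' t _ h => List.Subset.trans h (subset_insertSt t J')

theorem subset_roundSt : I ⊆ SMWidth.roundSt G A B I :=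
  foldl_inv (fun J => I ⊆ J) (List.Subset.refl I) fun _ _ _ h => List.Subset.trans h (subset_insertAll _)

theorem exists_mem_roundSt {s : St} (hs : s ∈ I) (ht : t ∈ merges G A B s) :
    ∃ r ∈ SMWidth.roundSt G A B I, t.Perm r := by
  refine foldl_reach (fun J => ∃ r ∈ J, t.Perm r) hs (fun J => ?_) ?_
  · refine foldl_reach (fun J => ∃ r ∈ J, t.Perm r) ht
      (fun J => exists_mem_insertSt t J) ?_
    rintro J t' ⟨r, hr, h⟩
    exact ⟨r, subset_insertSt _ _ hr, h⟩
  · rintro J s' ⟨r, hr, h⟩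
    exact ⟨r, subset_insertAll _ hr, h⟩

theorem Tame.saturate (h : Tame Q I) (hQ : ∀ s, Q s → ∀ t ∈ merges G A B s, Q t) :
    Tame Q (saturate G A B I) :=
  foldl_inv (Tame Q) h fun _ _ _ h' => h'.roundSt hQ

/-- Everything that is reached by at most as many merges as there are rounds is found. -/
theorem exists_mem_saturate {s : St} (hs : s ∈ I) {t : Multiset (ℕ × ℕ)} (hlen : s.length ≤ G.length)
    (h : Relation.ReflTransGen (Mrg fun u v => cross G A B u v = true) (s : Multiset (ℕ × ℕ)) t) :
    ∃ r ∈ SMWidth.saturate G A B I, (r : Multiset (ℕ × ℕ)) = t := by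
  have key : ∀ (g : List (List Bool)) (I : List St) (s : St), s ∈ I → s.length ≤ g.length →
      Relation.ReflTransGen (Mrg fun u v => cross G A B u v = true) (s : Multiset (ℕ × ℕ)) t →
      ∃ r ∈ g.foldl (fun J _ => SMWidth.roundSt G A B J) I, (r : Multiset (ℕ × ℕ)) = t := by
    intro g
    induction g with
    | nil =>
      intro I s hs hlen h
      obtain rfl : s = [] := List.length_eq_zero_iff.1 (Nat.le_zero.1 hlen)
      refine ⟨[], hs, ?_⟩
      rcases Relation.ReflTransGen.cases_head h with h | ⟨_, ⟨a, b, c, d, t, h, -⟩, -⟩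
      · exact h
      · exact absurd h.symm (Multiset.cons_ne_zero)
    | cons x g ih =>
      intro I s hs hlen h
      rw [List.foldl_cons]
      rcases Relation.ReflTransGen.cases_head h with h | ⟨s', hs', h⟩
      · refine ⟨s, ?_, h⟩
        exact foldl_inv (fun J => s ∈ J) (subset_roundSt hs) fun J _ _ h => subset_roundSt h
      · obtain ⟨s₁, hs₁, rfl⟩ := exists_mem_merges hs'
        obtain ⟨r, hr, hr'⟩ := exists_mem_roundSt hs hs₁
        rw [Multiset.coe_eq_coe.2 hr'] at h
        refine ih _ r hr ?_ h
        -- A merge replaces two pairs by one, so each round that is used up shortens the state; a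
        -- state of at most as many pairs as there are rounds is exhausted in time.
        obtain ⟨a, b, c, d, t', h1, -, h2⟩ := hs'
        have e1 := congrArg Multiset.card h1
        have e2 := congrArg Multiset.card h2
        simp only [Multiset.coe_card, Multiset.card_cons] at e1 e2
        rw [← hr'.length_eq]
        simp only [List.length_cons] at hlen
        omega
  exact key G I s hs hlen h

theorem tame_trim (hQ : ∀ s ∈ I, okState G O M s = true → Q (relabel G A O s)) :
    Tame Q (trim G A O M I) := by
  refine foldl_inv (Tame Q) Tame.nil fun J s hs h => ?_
  cases hk : okState G O M s
  · exact h
  · exact h.insertSt (hQ s hs hk)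

theorem exists_mem_trim {s : St} (hs : s ∈ I) (hk : okState G O M s = true) :
    ∃ r ∈ trim G A O M I, (relabel G A O s).Perm r := by
  refine foldl_reach (fun J => ∃ r ∈ J, (relabel G A O s).Perm r) hs (fun J => ?_) ?_
  · rw [hk]; exact exists_mem_insertSt _ _
  · rintro J s' ⟨r, hr, h⟩
    cases okState G O M s'
    · exact ⟨r, hr, h⟩
    · exact ⟨r, subset_insertSt _ _ hr, h⟩

theorem length_trim_le (l : List St) :
    (l.foldl (fun J s => bif okState G O M s then insertSt (relabel G A O s) J else J) J).length ≤
      J.length + l.length := by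
  induction l generalizing J with
  | nil => simp
  | cons s l ih =>
    refine ih.trans ?_
    have : (SMWidth.insertSt (relabel G A O s) J).length ≤ J.length + 1 := by
      rcases insertSt_eq (relabel G A O s) J with ⟨h1, -⟩ | ⟨h1, -⟩ <;> rw [h1] <;> simp
    simp only [List.length_cons]
    cases okState G O M s <;> simp only [cond_true, cond_false] <;> omega

/-! ## The cost of the operations on lists of states -/

theorem Sm.cost {α β : Type} [Enc α] [Enc β] {f : α → β} (h : Sm f) :
    ∃ c K, Cmp f c ∧ (∀ s a, bd s a → c a ≤ (s + 2) ^ K) ∧ ∀ s a, bd s a → bd ((s + 2) ^ K) (f a) := by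
  obtain ⟨c, K, h, hK⟩ := h
  exact ⟨c, K, h, fun s a ha => (hK s a ha).1, fun s a ha => (hK s a ha).2⟩

/-- On the domain `D`, the quantity `a` is at most `w` times a polynomial in `s`. -/
def Big {ι : Type} (D : ι → Prop) (s w a : ι → ℕ) : Prop :=
  ∃ K, ∀ i, D i → a i ≤ w i * (s i + 2) ^ K

namespace Big

variable {ι : Type} {D : ι → Prop} {s w w' a b : ι → ℕ}

theorem mono (h : Big D s w a) (hab : ∀ i, D i → b i ≤ a i) : Big D s w b := by
  obtain ⟨K, hK⟩ := h
  exact ⟨K, fun i hi => (hab i hi).trans (hK i hi)⟩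

theorem weight (h : Big D s w a) (hw : ∀ i, D i → w i ≤ w' i) : Big D s w' a := by
  obtain ⟨K, hK⟩ := h
  exact ⟨K, fun i hi => (hK i hi).trans (Nat.mul_le_mul_right _ (hw i hi))⟩

theorem add (ha : Big D s w a) (hb : Big D s w b) : Big D s w (fun i => a i + b i) := by
  obtain ⟨K, hK⟩ := ha
  obtain ⟨L, hL⟩ := hb
  refine ⟨K + L + 1, fun i hi => ?_⟩
  have h1 := Nat.mul_le_mul_left (w i) (pow_add_le (s i) K L)
  have h2 := hK i hi
  have h3 := hL i hi
  rw [mul_add] at h1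
  dsimp only
  omega

theorem mul (ha : Big D s w a) (hb : Big D s w' b) :
    Big D s (fun i => w i * w' i) (fun i => a i * b i) := by
  obtain ⟨K, hK⟩ := ha
  obtain ⟨L, hL⟩ := hb
  refine ⟨K + L, fun i hi => (Nat.mul_le_mul (hK i hi) (hL i hi)).trans_eq ?_⟩
  rw [pow_add]; ring

theorem poly (hw : ∀ i, 1 ≤ w i) {K : ℕ} (h : ∀ i, D i → a i ≤ (s i + 2) ^ K) : Big D s w a :=
  ⟨K, fun i hi => (h i hi).trans (Nat.le_mul_of_pos_left _ (hw i))⟩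

theorem const (hw : ∀ i, 1 ≤ w i) (k : ℕ) : Big D s w (fun _ => k) :=
  poly hw (K := k) fun i _ => le_pow_of_le (s i) k Nat.lt_two_pow_self.le

theorem cond {p : ι → Bool} (ha : Big D s w a) (hb : Big D s w b) :
    Big D s w (fun i => bif p i then a i else b i) :=
  (ha.add hb).mono fun i _ => by cases p i <;> simp

theorem self : Big D s w w := ⟨0, fun i _ => by simp⟩

theorem comap {κ : Type} {E : κ → Prop} (h : Big D s w a) (g : κ → ι) (hg : ∀ k, E k → D (g k)) :
    Big E (fun k => s (g k)) (fun k => w (g k)) fun k => a (g k) := by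
  obtain ⟨K, hK⟩ := h
  exact ⟨K, fun k hk => hK _ (hg k hk)⟩

/-- Replacing the bound by a polynomial in it. -/
theorem base {M : ℕ} (h : Big D (fun i => (s i + 2) ^ M) w a) : Big D s w a := by
  obtain ⟨K, hK⟩ := h
  exact ⟨_, fun i hi => (hK i hi).trans (Nat.mul_le_mul_left _ (pow_pow_le _ _ _))⟩

/-- The cost of a fold whose steps have bounded cost. -/
theorem fold {α β γ : Type} {f : γ → β → α → β} {c : γ × β × α → ℕ} {x : ι → γ} {l : ι → List α}
    {b : ι → β} (hw : ∀ i, 1 ≤ w i) (hl : Big D s w' fun i => (l i).length + 1)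
    (h : Big (fun j : ι × List α × α => D j.1 ∧ ∃ l₂, l j.1 = j.2.1 ++ j.2.2 :: l₂)
      (fun j => s j.1) (fun j => w j.1)
      (fun j => c (x j.1, j.2.1.foldl (f (x j.1)) (b j.1), j.2.2))) :
    Big D s (fun i => w' i * w i) fun i => Cmp.foldCost f c (x i) (l i) (b i) := by
  obtain ⟨K, h⟩ := h
  have h1 : Big D s w fun i => w i * (s i + 2) ^ K := ⟨K, fun i _ => le_rfl⟩
  refine (hl.mul (h1.add (const hw 40))).mono fun i hi => ?_
  exact Cmp.foldCost_le f c (x i) (l i) (b i) _ fun l₁ a l₂ hl => h (i, l₁, a) ⟨hi, l₂, hl⟩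

end Big

theorem one_le_succ {ι : Type} (N : ι → ℕ) : ∀ i, 1 ≤ N i + 1 := fun _ => Nat.le_add_left 1 _

variable {δ : Type} [Enc δ]

/-- At most `N` states, all of them bounded by `s`. -/
def Small (s N : ℕ) (J : List St) : Prop := J.length ≤ N ∧ ∀ t ∈ J, bd s t

/-- The new state is compared with at most `N` others, each time in polynomial time, so the weight
is linear in `N`. Here and below an index starts with the size bound `s` and the bound `N` for the
number of states; as the exponent in `Big` does not depend on the index, it is uniform over all
inputs. -/
theorem insertSt_cmp : ∃ c, Cmp (fun x : St × List St => insertSt x.1 x.2) c ∧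
    Big (fun i : ℕ × ℕ × St × List St => bd i.1 i.2.2.1 ∧ Small i.1 i.2.1 i.2.2.2)
      (fun i => i.1) (fun i => i.2.1 + 1) fun i => c i.2.2 := by
  have h1 : Sm fun x : St × Bool × St => x.2.1 || samePerm x.1 x.2.2 :=
    Sm.or' Sm.id.snd.fst (Sm.samePerm Sm.id.fst Sm.id.snd.snd)
  obtain ⟨c, K, h2, h3, -⟩ := h1.cost
  have h4 := Cmp.foldlAux (f := fun (t : St) b t' => b || samePerm t t') h2
  have h5 := Cmp.cond (h4.comp (Cmp.id.fst.pair (Cmp.id.snd.pair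
    (Cmp.false' (α := St × List St))))) Cmp.id.snd (Cmp.consList Cmp.id.fst Cmp.id.snd)
  have e : ∀ (t : St) (J : List St) b, J.foldl (fun b t' => b || samePerm t t') b =
      (b || J.any (samePerm t)) := by
    intro t J
    induction J with
    | nil => simp
    | cons t' J ih => intro b; simp [ih, Bool.or_assoc]
  have h6 : (fun x : St × List St => insertSt x.1 x.2) = fun x =>
      bif x.2.foldl (fun b t' => b || samePerm x.1 t') false then x.2 else x.1 :: x.2 := by
    funext x
    simp [insertSt, e]
  rw [h6]
  refine ⟨_, h5, ?_⟩
  have hw := one_le_succ fun i : ℕ × ℕ × St × List St => i.2.1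
  refine Big.add (Big.add (Big.add (Big.add (Big.const hw _) ?_) (Big.const hw _)) ?_)
    (Big.const hw _)
  · have hl : Big (fun i : ℕ × ℕ × St × List St => bd i.1 i.2.2.1 ∧ Small i.1 i.2.1 i.2.2.2)
      (fun i => i.1) (fun i => i.2.1 + 1) fun i => i.2.2.2.length + 1 :=
      Big.self.mono fun i hi => Nat.succ_le_succ hi.2.1
    refine (Big.fold (w := fun _ => 1) (fun _ => le_rfl) hl
      (Big.poly (fun _ => le_rfl) (K := K) ?_)).weight fun i _ => (by simp)
    rintro i ⟨hi, l₂, hl⟩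
    exact h3 i.1.1 _ ⟨hi.1, trivial, hi.2.2 _ (by simp only [hl]; simp)⟩
  · refine (Big.const hw 7).mono fun i _ => ?_
    cases List.foldl _ _ _ <;> simp

/-- Inserting a computed state. -/
theorem insertSt_step {h : δ → St} (hh : Sm h) :
    ∃ c, Cmp (fun x : δ × List St => insertSt (h x.1) x.2) c ∧
    Big (fun i : ℕ × ℕ × δ × List St => bd i.1 i.2.2.1 ∧ Small i.1 i.2.1 i.2.2.2)
      (fun i => i.1) (fun i => i.2.1 + 1) fun i => c i.2.2 := by
  obtain ⟨c, h1, h2⟩ := insertSt_cmp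
  obtain ⟨d, L, h3, h4, h5⟩ := hh.cost
  refine ⟨_, h1.comp ((h3.comp Cmp.id.fst).pair Cmp.id.snd), ?_⟩
  have hw := one_le_succ fun i : ℕ × ℕ × δ × List St => i.2.1
  refine Big.add (Big.add (Big.add (Big.add (Big.add (Big.add (Big.const hw _) ?_) (Big.const hw _))
    (Big.const hw _)) (Big.const hw _)) ?_) (Big.const hw _)
  · exact Big.poly hw fun i hi => h4 _ _ hi.1
  -- The computed state is bounded only by a power of `s`; the bound is instantiated at this power,
  -- and `Big.base` returns to `s`.
  · refine (h2.comap (fun i : ℕ × ℕ × δ × List St => ((i.1 + 2) ^ (L + 1), i.2.1, h i.2.2.1, i.2.2.2))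
      fun i hi => ?_).base
    exact ⟨bd_mono (pow_mono (by omega)) (h5 _ _ hi.1), hi.2.1,
      fun t ht => bd_mono (le_pow_one _ (by omega)) (hi.2.2 t ht)⟩

/-- Inserting all members of a computed list of states. -/
theorem insertAll_step {h : δ → List St} (hh : Sm h) :
    ∃ c, Cmp (fun x : δ × List St => (h x.1).foldl (fun J t => insertSt t J) x.2) c ∧
    Big (fun i : ℕ × ℕ × δ × List St => bd i.1 i.2.2.1 ∧ ∀ l₁, l₁ <+: h i.2.2.1 →
      Small i.1 i.2.1 (l₁.foldl (fun J t => insertSt t J) i.2.2.2))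
      (fun i => i.1) (fun i => i.2.1 + 1) fun i => c i.2.2 := by
  obtain ⟨c, h1, h2⟩ := insertSt_cmp
  obtain ⟨d, L, h3, h4, h5⟩ := hh.cost
  have h6 : Cmp (fun x : Unit × List St × St => insertSt x.2.2 x.2.1) _ :=
    h1.comp (Cmp.id.snd.snd.pair Cmp.id.snd.fst)
  have hu : Cmp (fun _ : δ × List St => ()) (fun _ => 1) := ⟨Prog.nil, fun _ => ⟨1, le_rfl, Run.nil _⟩⟩
  have h7 := (Cmp.foldlAux (f := fun (_ : Unit) (J : List St) (t : St) => insertSt t J) h6).comp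
    (hu.pair ((h3.comp Cmp.id.fst).pair Cmp.id.snd))
  refine ⟨_, h7, ?_⟩
  have hw := one_le_succ fun i : ℕ × ℕ × δ × List St => i.2.1
  have hw' := one_le_succ fun i : (ℕ × ℕ × δ × List St) × List St × St => i.1.2.1
  refine Big.add (Big.add (Big.add (Big.add (Big.const hw _) (Big.add (Big.add (Big.add
    (Big.add (Big.const hw _) ?_) (Big.const hw _)) (Big.const hw _)) (Big.const hw _)))
    (Big.const hw _)) ?_) (Big.const hw _)
  · exact Big.poly hw fun i hi => h4 _ _ hi.1
  · refine (Big.fold (w' := fun _ => 1) hw (l := fun i : ℕ × ℕ × δ × List St => h i.2.2.1)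
      (b := fun i => i.2.2.2) (x := fun _ => ())
      (Big.add (Big.poly (fun _ => le_rfl) fun i hi => (h5 _ _ hi.1).1) (Big.const (fun _ => le_rfl) 1))
      (Big.add (Big.add (Big.const hw' _) ?_) (Big.const hw' _))).weight fun i _ => (by simp)
    refine (h2.comap (fun i : (ℕ × ℕ × δ × List St) × List St × St =>
      ((i.1.1 + 2) ^ (L + 1), i.1.2.1, i.2.2, i.2.1.foldl (fun J t => insertSt t J) i.1.2.2.2))
      ?_).base
    rintro ⟨i, l₁, a⟩ ⟨hi, l₂, hl⟩
    have h8 := hi.2 l₁ ⟨_, hl.symm⟩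
    exact ⟨bd_mono (pow_mono (by omega)) ((h5 _ _ hi.1).2 a (by simp only [hl]; simp)), h8.1,
        fun t ht => bd_mono (le_pow_one _ (by omega)) (h8.2 t ht)⟩

/-- Each of the `|S| · |S'|` insertions scans at most `N` states, and this product is itself at most
`N + 1`, which gives the square. The invariant `Q` keeps all partial results below `N`. -/
theorem combine_cmp : ∃ c, Cmp (fun x : List St × List St => combine x.1 x.2) c ∧
    Big (fun i : ℕ × ℕ × (List St × List St) => ∃ Q, (∀ J, Tame Q J → Small i.1 i.2.1 J) ∧
      (∀ s ∈ i.2.2.1, ∀ t ∈ i.2.2.2, Q (s ++ t)) ∧ (∀ s ∈ i.2.2.1, bd i.1 s) ∧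
      (∀ s ∈ i.2.2.2, bd i.1 s) ∧ (i.2.2.1.length + 1) * (i.2.2.2.length + 1) ≤ i.2.1 + 1)
      (fun i => i.1) (fun i => (i.2.1 + 1) ^ 2) fun i => c i.2.2 := by
  have h1 : Sm fun x : St × St => x.1 ++ x.2 := Sm.append Sm.id.fst Sm.id.snd
  obtain ⟨c, h2, h3⟩ := insertSt_step h1
  have h4 : Cmp (fun x : St × List St × St => insertSt (x.1 ++ x.2.2) x.2.1) _ :=
    h2.comp ((Cmp.id.fst.pair Cmp.id.snd.snd).pair Cmp.id.snd.fst)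
  have h5 := Cmp.foldlAux (f := fun (s : St) (J : List St) (t : St) => insertSt (s ++ t) J) h4
  have h6 : Cmp (fun x : List St × List St × St =>
      x.1.foldl (fun J t => insertSt (x.2.2 ++ t) J) x.2.1) _ :=
    h5.comp (Cmp.id.snd.snd.pair (Cmp.id.fst.pair Cmp.id.snd.fst))
  have h7 := Cmp.foldlAux (f := fun (S' : List St) (J : List St) (s : St) =>
      S'.foldl (fun J t => insertSt (s ++ t) J) J) h6
  have h8 : Cmp (fun x : List St × List St => combine x.1 x.2) _ :=
    h7.comp (Cmp.id.snd.pair (Cmp.id.fst.pair Cmp.nil))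
  refine ⟨_, h8, ?_⟩
  have hw : ∀ i : ℕ × ℕ × (List St × List St), 1 ≤ (i.2.1 + 1) ^ 2 := fun i =>
    Nat.one_le_pow _ _ (by omega)
  have hw' : ∀ i : (ℕ × ℕ × (List St × List St)) × List St × St,
    1 ≤ (i.1.2.2.2.length + 1) * (i.1.2.1 + 1) := fun i => Nat.mul_pos (by omega) (by omega)
  have hw'' := one_le_succ fun i : ((ℕ × ℕ × (List St × List St)) × List St × St) × List St × St =>
    i.1.1.2.1
  refine Big.add (Big.add (Big.const hw _) ?_) (Big.const hw _)
  refine (Big.fold (l := fun i : ℕ × ℕ × (List St × List St) => i.2.2.1) (b := fun i => [])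
    (x := fun i => i.2.2.2)
    (w := fun i : ℕ × ℕ × (List St × List St) => (i.2.2.2.length + 1) * (i.2.1 + 1))
    (w' := fun i : ℕ × ℕ × (List St × List St) => i.2.2.1.length + 1)
    (fun i => Nat.mul_pos (by omega) (by omega)) Big.self
    (Big.add (Big.add (Big.const hw' _) (Big.fold
      (w := fun i : (ℕ × ℕ × (List St × List St)) × List St × St => i.1.2.1 + 1)
      (l := fun i : (ℕ × ℕ × (List St × List St)) × List St × St => i.1.2.2.2)
      (x := fun i => i.2.2)
      (b := fun i => i.2.1.foldl (fun J s => i.1.2.2.2.foldl (fun J t => insertSt (s ++ t) J) J) [])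
      (fun _ => Nat.le_add_left 1 _) Big.self
      (Big.add (Big.add (Big.const hw'' _) ?_) (Big.const hw'' _)))) (Big.const hw' _))).weight ?_
  · refine h3.comap (fun i : ((ℕ × ℕ × (List St × List St)) × List St × St) × List St × St =>
      (i.1.1.1, i.1.1.2.1, (i.1.2.2, i.2.2), _)) ?_
    rintro ⟨⟨⟨s, N, S, S'⟩, l₁, a⟩, m₁, b⟩ ⟨⟨⟨Q, hQ, hQ', hS, hS', -⟩, l₂, hl⟩, m₂, hm⟩
    simp only at hQ hQ' hS hS' hl hm ⊢
    have ha : a ∈ S := by rw [hl]; simp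
    have hb : b ∈ S' := by rw [hm]; simp
    have hJ : Tame Q (l₁.foldl (fun J s => S'.foldl (fun J t => insertSt (s ++ t) J) J) []) :=
      tame_combine fun s hs => hQ' s (by rw [hl]; simp [hs])
    exact ⟨⟨hS a ha, hS' b hb⟩, hQ _ (hJ.combineStep (S' := m₁) (s := a) fun t ht =>
        hQ' a ha t (by rw [hm]; simp [ht]))⟩
  · rintro ⟨s, N, S, S'⟩ ⟨Q, -, -, -, -, h⟩
    simp only at h ⊢
    calc _ = (S.length + 1) * (S'.length + 1) * (N + 1) := by ring
      _ ≤ (N + 1) * (N + 1) := Nat.mul_le_mul_right _ h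
      _ = _ := by ring

variable {δ : Type} [Enc δ]

/-- The data that the operations on lists of states depend on. -/
abbrev Ctx : Type := List (List Bool) × List ℕ × List ℕ

/-- At most `N` states are treated, each with polynomially many merges, and every insertion scans at
most `N` states. The invariant has to be closed under merging, so that the growing list stays short.
-/
theorem roundSt_cmp : ∃ c, Cmp (fun x : Ctx × List St => roundSt x.1.1 x.1.2.1 x.1.2.2 x.2) c ∧
    Big (fun i : ℕ × ℕ × (Ctx × List St) => bd i.1 i.2.2.1 ∧ ∃ Q,
      (∀ J, Tame Q J → Small i.1 i.2.1 J) ∧ Tame Q i.2.2.2 ∧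
      ∀ s, Q s → ∀ t ∈ merges i.2.2.1.1 i.2.2.1.2.1 i.2.2.1.2.2 s, Q t)
      (fun i => i.1) (fun i => (i.2.1 + 1) ^ 2) fun i => c i.2.2 := by
  have h1 : Sm fun x : Ctx × St => merges x.1.1 x.1.2.1 x.1.2.2 x.2 :=
    Sm.merges Sm.id.fst.fst Sm.id.fst.snd.fst Sm.id.fst.snd.snd Sm.id.snd
  obtain ⟨c, h2, h3⟩ := insertAll_step h1
  have h4 : Cmp (fun x : Ctx × List St × St =>
      (merges x.1.1 x.1.2.1 x.1.2.2 x.2.2).foldl (fun J t => insertSt t J) x.2.1) _ :=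
    h2.comp ((Cmp.id.fst.pair Cmp.id.snd.snd).pair Cmp.id.snd.fst)
  have h5 := Cmp.foldlAux (f := fun (x : Ctx) (J : List St) (s : St) =>
    (merges x.1 x.2.1 x.2.2 s).foldl (fun J t => insertSt t J) J) h4
  have h6 := h5.comp (Cmp.id.fst.pair (Cmp.id.snd.pair (Cmp.id.snd (α := Ctx × List St))))
  unfold roundSt
  refine ⟨_, h6, ?_⟩
  have hw : ∀ i : ℕ × ℕ × (Ctx × List St), 1 ≤ (i.2.1 + 1) ^ 2 := fun i =>
    Nat.one_le_pow _ _ (by omega)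
  have hw' := one_le_succ fun i : (ℕ × ℕ × (Ctx × List St)) × List St × St => i.1.2.1
  refine Big.add (Big.add (Big.const hw _) ?_) (Big.const hw _)
  refine (Big.fold (l := fun i : ℕ × ℕ × (Ctx × List St) => i.2.2.2) (b := fun i => i.2.2.2)
    (x := fun i => i.2.2.1)
    (w := fun i : ℕ × ℕ × (Ctx × List St) => i.2.1 + 1)
    (w' := fun i : ℕ × ℕ × (Ctx × List St) => i.2.1 + 1)
    (fun i => by omega) (Big.self.mono ?_) (Big.add (Big.add (Big.const hw' _) ?_)
    (Big.const hw' _))).weight fun i _ => (by rw [sq])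
  · rintro i ⟨-, Q, hQ, hI, -⟩
    exact Nat.succ_le_succ (hQ _ hI).1
  · refine h3.comap (fun i : (ℕ × ℕ × (Ctx × List St)) × List St × St =>
      (i.1.1, i.1.2.1, (i.1.2.2.1, i.2.2), _)) ?_
    rintro ⟨⟨s, N, x, I⟩, l₁, a⟩ ⟨⟨hx, Q, hQ, hI, hQ'⟩, l₂, hl⟩
    simp only at hQ hQ' hx hI hl ⊢
    have ha : a ∈ I := by rw [hl]; simp
    refine ⟨⟨hx, (hQ _ hI).2 a ha⟩, fun m₁ hm => ?_⟩
    have hJ : Tame Q (l₁.foldl (fun J s =>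
        (merges x.1 x.2.1 x.2.2 s).foldl (fun J t => insertSt t J) J) I) :=
      foldl_inv (Tame Q) hI fun _ s hs h' => h'.insertAll (hQ' s (hI.all s (by rw [hl]; simp [hs])))
    exact hQ _ (hJ.insertAll fun t ht => hQ' a (hI.all a ha) t (hm.subset ht))

/-- Iterating a computable function along a list. -/
theorem Cmp.iterate {α β γ : Type} [Enc α] [Enc β] [Enc γ] {F : γ → β → β} {l : γ → List α}
    {c : γ × β → ℕ} {d : γ → ℕ} (hF : Cmp (fun x : γ × β => F x.1 x.2) c) (hl : Cmp l d) :
    Cmp (fun x : γ × β => (l x.1).foldl (fun b _ => F x.1 b) x.2) (fun x => d x.1 + 20 +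
      Cmp.foldCost (fun y b (_ : α) => F y b) (fun x => 20 + c (x.1, x.2.1)) x.1 (l x.1) x.2) := by
  have h4 : Cmp (fun x : γ × β × α => F x.1 x.2.1) (fun x => 20 + c (x.1, x.2.1)) :=
    (hF.comp (Cmp.id.fst.pair Cmp.id.snd.fst)).mono fun x => by omega
  exact ((Cmp.foldlAux (f := fun x b (_ : α) => F x b) h4).comp
    (Cmp.id.fst.pair ((hl.comp Cmp.id.fst).pair Cmp.id.snd))).mono fun x => by simp only; omega

/-- The number of rounds is the number of rows of the matrix, so it only contributes to the
polynomial factor. -/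
theorem saturate_cmp : ∃ c, Cmp (fun x : Ctx × List St => saturate x.1.1 x.1.2.1 x.1.2.2 x.2) c ∧
    Big (fun i : ℕ × ℕ × (Ctx × List St) => bd i.1 i.2.2.1 ∧ ∃ Q,
      (∀ J, Tame Q J → Small i.1 i.2.1 J) ∧ Tame Q i.2.2.2 ∧
      ∀ s, Q s → ∀ t ∈ merges i.2.2.1.1 i.2.2.1.2.1 i.2.2.1.2.2 s, Q t)
      (fun i => i.1) (fun i => (i.2.1 + 1) ^ 2) fun i => c i.2.2 := by
  obtain ⟨c, h2, h3⟩ := roundSt_cmp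
  unfold saturate
  have h4 : Cmp (fun x : Ctx => x.1) _ := Cmp.id.fst
  refine ⟨_, Cmp.iterate (F := fun (x : Ctx) (I : List St) => roundSt x.1 x.2.1 x.2.2 I)
    (l := fun x : Ctx => x.1) h2 h4, ?_⟩
  have hw : ∀ i : ℕ × ℕ × (Ctx × List St), 1 ≤ (i.2.1 + 1) ^ 2 := fun i =>
    Nat.one_le_pow _ _ (by omega)
  have hw' : ∀ i : (ℕ × ℕ × (Ctx × List St)) × List (List Bool) × List Bool,
    1 ≤ (i.1.2.1 + 1) ^ 2 := fun i => Nat.one_le_pow _ _ (by omega)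
  refine Big.add (Big.const hw _) ?_
  refine (Big.fold (l := fun i : ℕ × ℕ × (Ctx × List St) => i.2.2.1.1) (b := fun i => i.2.2.2)
    (x := fun i => i.2.2.1) (w := fun i : ℕ × ℕ × (Ctx × List St) => (i.2.1 + 1) ^ 2)
    (w' := fun _ => 1) hw (Big.add (Big.poly (fun _ => le_rfl) (K := 1) ?_)
      (Big.const (fun _ => le_rfl) 1)) (Big.add (Big.const hw' _) ?_)).weight fun i _ =>
      (by rw [one_mul])
  · rintro i ⟨hx, -⟩
    exact hx.1.1.trans (le_pow_one _ le_rfl)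
  · refine h3.comap (fun i : (ℕ × ℕ × (Ctx × List St)) × List (List Bool) × List Bool =>
      (i.1.1, i.1.2.1, (i.1.2.2.1, _))) ?_
    rintro ⟨⟨s, N, x, I⟩, l₁, a⟩ ⟨⟨hx, Q, hQ, hI, hQ'⟩, l₂, hl⟩
    simp only at hQ hQ' hx hI hl ⊢
    exact ⟨hx, Q, hQ, foldl_inv (Tame Q) hI fun _ _ _ h' => h'.roundSt hQ', hQ'⟩

/-- No invariant is needed here: each treated state contributes at most one new state, so the result
is never longer than the list that is trimmed. -/
theorem trim_cmp :
    ∃ c, Cmp (fun x : (Ctx × List (ℕ × ℕ)) × List St => trim x.1.1.1 x.1.1.2.1 x.1.1.2.2 x.1.2 x.2) c ∧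
    Big (fun i : ℕ × ℕ × ((Ctx × List (ℕ × ℕ)) × List St) => bd i.1 i.2.2.1 ∧
      Small i.1 i.2.1 i.2.2.2)
      (fun i => i.1) (fun i => (i.2.1 + 1) ^ 2) fun i => c i.2.2 := by
  have h1 : Sm fun x : (Ctx × List (ℕ × ℕ)) × St => relabel x.1.1.1 x.1.1.2.1 x.1.1.2.2 x.2 :=
    Sm.relabel Sm.id.fst.fst.fst Sm.id.fst.fst.snd.fst Sm.id.fst.fst.snd.snd Sm.id.snd
  have h2 : Sm fun x : (Ctx × List (ℕ × ℕ)) × St => okState x.1.1.1 x.1.1.2.2 x.1.2 x.2 :=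
    Sm.okState Sm.id.fst.fst.fst Sm.id.fst.fst.snd.snd Sm.id.fst.snd Sm.id.snd
  obtain ⟨c, h3, h4⟩ := insertSt_step h1
  obtain ⟨d, L, h5, h6, -⟩ := h2.cost
  obtain ⟨K, hK⟩ := h1.bb
  have h7 : Cmp (fun x : (Ctx × List (ℕ × ℕ)) × List St × St => bif okState x.1.1.1 x.1.1.2.2 x.1.2 x.2.2
      then insertSt (relabel x.1.1.1 x.1.1.2.1 x.1.1.2.2 x.2.2) x.2.1 else x.2.1) _ :=
    (h5.comp (Cmp.id.fst.pair Cmp.id.snd.snd)).cond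
      (h3.comp ((Cmp.id.fst.pair Cmp.id.snd.snd).pair Cmp.id.snd.fst)) Cmp.id.snd.fst
  have h8 := Cmp.foldlAux (f := fun (x : Ctx × List (ℕ × ℕ)) (J : List St) (s : St) =>
    bif okState x.1.1 x.1.2.2 x.2 s then insertSt (relabel x.1.1 x.1.2.1 x.1.2.2 s) J else J) h7
  have h9 : Cmp (fun x : (Ctx × List (ℕ × ℕ)) × List St =>
      trim x.1.1.1 x.1.1.2.1 x.1.1.2.2 x.1.2 x.2) _ :=
    h8.comp (Cmp.id.fst.pair (Cmp.id.snd.pair Cmp.nil))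
  refine ⟨_, h9, ?_⟩
  have hw : ∀ i : ℕ × ℕ × ((Ctx × List (ℕ × ℕ)) × List St), 1 ≤ (i.2.1 + 1) ^ 2 := fun i =>
    Nat.one_le_pow _ _ (by omega)
  have hw' := one_le_succ fun i : (ℕ × ℕ × ((Ctx × List (ℕ × ℕ)) × List St)) × List St × St => i.1.2.1
  refine Big.add (Big.add (Big.const hw _) ?_) (Big.const hw _)
  refine (Big.fold (l := fun i : ℕ × ℕ × ((Ctx × List (ℕ × ℕ)) × List St) => i.2.2.2)
    (b := fun i => []) (x := fun i => i.2.2.1)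
    (w := fun i : ℕ × ℕ × ((Ctx × List (ℕ × ℕ)) × List St) => i.2.1 + 1)
    (w' := fun i : ℕ × ℕ × ((Ctx × List (ℕ × ℕ)) × List St) => i.2.1 + 1)
    (fun i => by omega) (Big.self.mono ?_) (Big.add (Big.add (Big.add (Big.add (Big.const hw' _) ?_)
      (Big.const hw' _)) ?_) (Big.const hw' _))).weight fun i _ => (by rw [sq])
  · rintro i ⟨-, hI⟩
    exact Nat.succ_le_succ hI.1
  · refine Big.poly hw' (K := L) ?_
    rintro ⟨⟨s, N, x, I⟩, l₁, a⟩ ⟨⟨hx, hI⟩, l₂, hl⟩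
    exact h6 _ _ ⟨hx, hI.2 a (by simp only at hl; rw [hl]; simp)⟩
  · refine Big.cond (Big.add (Big.add (Big.const hw' _) (h4.comap (fun i : (ℕ × ℕ × ((Ctx ×
      List (ℕ × ℕ)) × List St)) × List St × St => ((i.1.1 + 2) ^ (K + 1), i.1.2.1,
      (i.1.2.2.1, i.2.2), i.2.1.foldl (fun J s => bif okState i.1.2.2.1.1.1 i.1.2.2.1.1.2.2 i.1.2.2.1.2 s
        then insertSt (relabel i.1.2.2.1.1.1 i.1.2.2.1.1.2.1 i.1.2.2.1.1.2.2 s) J else J) []))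
        ?_).base) (Big.const hw' _)) (Big.const hw' _)
    rintro ⟨⟨s, N, x, I⟩, l₁, a⟩ ⟨⟨hx, hI⟩, l₂, hl⟩
    simp only at hl hx hI ⊢
    have hl' : ∀ t ∈ l₁ ++ a :: l₂, bd s t := fun t ht => hI.2 t (by rw [hl]; exact ht)
    refine ⟨bd_mono (le_pow_one _ (by omega)) ⟨hx, hl' a (by simp)⟩, ?_, ?_⟩
    · refine (length_trim_le l₁).trans ?_
      have := hI.1
      rw [hl] at this
      simp at this ⊢
      omega
    · have h10 : Tame (fun t => bd ((s + 2) ^ (K + 1)) t) _ := tame_trim (I := l₁) (G := x.1.1)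
        (A := x.1.2.1) (O := x.1.2.2) (M := x.2) fun t ht _ =>
        bd_mono (pow_mono (by omega)) (hK s (x, t) ⟨hx, hl' t (by simp [ht])⟩)
      exact h10.all

/-! ## Systems of directed paths -/

section
variable {V : Type*} [Inhabited V] {r X : V → V → Prop} {A B U : Set V} {L : List (List V)}

/-- First and last vertex of a path. -/
def ends (p : List V) : V × V := (p.head?.getD default, p.getLast?.getD default)

def endsOf (L : List (List V)) : Multiset (V × V) := (L.map ends : List (V × V))

/-- `L` is a partition of `A` into paths of the relation `r`. -/
structure PathSys (r : V → V → Prop) (A : Set V) (L : List (List V)) : Prop where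
  ne : ∀ p ∈ L, p ≠ []
  chain : ∀ p ∈ L, p.IsChain r
  nodup : L.flatten.Nodup
  mem : ∀ v, v ∈ L.flatten ↔ v ∈ A

/-- `v` follows `u` on a path of `L`. -/
def Follows (L : List (List V)) (u v : V) : Prop := ∃ p ∈ L, [u, v] <:+: p

theorem ends_fst_mem {p : List V} (hp : p ≠ []) : (ends p).1 ∈ p := by
  cases p with
  | nil => exact absurd rfl hp
  | cons a l => simp [ends]

theorem ends_snd_mem {p : List V} (hp : p ≠ []) : (ends p).2 ∈ p := by
  simp only [ends, List.getLast?_eq_some_getLast hp, Option.getD_some]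
  exact List.getLast_mem hp

theorem ends_append {p q : List V} (hp : p ≠ []) (hq : q ≠ []) :
    ends (p ++ q) = ((ends p).1, (ends q).2) := by
  simp only [ends, List.head?_append, List.getLast?_append, List.getLast?_eq_some_getLast hq,
    List.head?_eq_some_head hp]
  rfl

theorem endsOf_cons (p : List V) (L : List (List V)) : endsOf (p :: L) = ends p ::ₘ endsOf L := rfl

theorem endsOf_append (L L' : List (List V)) : endsOf (L ++ L') = endsOf L + endsOf L' := by
  simp [endsOf]

theorem endsOf_perm {L L' : List (List V)} (h : L.Perm L') : endsOf L = endsOf L' :=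
  Multiset.coe_eq_coe.2 (h.map _)

theorem exists_perm_of_endsOf {e : V × V} {t : Multiset (V × V)} (h : endsOf L = e ::ₘ t) :
    ∃ p L', L.Perm (p :: L') ∧ ends p = e ∧ endsOf L' = t := by
  have : e ∈ L.map ends := by
    rw [← Multiset.mem_coe]; change e ∈ endsOf L; rw [h]; exact Multiset.mem_cons_self _ _
  obtain ⟨p, hp, rfl⟩ := List.mem_map.1 this
  obtain ⟨l₁, l₂, rfl⟩ := List.append_of_mem hp
  refine ⟨p, l₁ ++ l₂, List.perm_middle, rfl, ?_⟩
  rw [endsOf_perm List.perm_middle, endsOf_cons] at h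
  exact (Multiset.cons_inj_right _).1 h

omit [Inhabited V] in
theorem PathSys.perm {L' : List (List V)} (h : PathSys r A L) (hL : L.Perm L') :
    PathSys r A L' where
  ne p hp := h.ne p (hL.mem_iff.2 hp)
  chain p hp := h.chain p (hL.mem_iff.2 hp)
  nodup := hL.flatten.nodup_iff.1 h.nodup
  mem v := by rw [← h.mem, hL.flatten.mem_iff]

omit [Inhabited V] in
theorem PathSys.append {L' : List (List V)} (h : PathSys r A L) (h' : PathSys r B L')
    (hAB : Disjoint A B) : PathSys r (A ∪ B) (L ++ L') where
  ne p hp := (List.mem_append.1 hp).elim (h.ne p) (h'.ne p)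
  chain p hp := (List.mem_append.1 hp).elim (h.chain p) (h'.chain p)
  nodup := by
    rw [List.flatten_append, List.nodup_append]
    refine ⟨h.nodup, h'.nodup, fun a ha b hb hab => ?_⟩
    subst hab
    exact Set.disjoint_left.1 hAB ((h.mem _).1 ha) ((h'.mem _).1 hb)
  mem v := by
    rw [List.flatten_append, List.mem_append, h.mem, h'.mem]; rfl

omit [Inhabited V] in
theorem follows_perm {L L' : List (List V)} (h : L.Perm L') (u v : V) :
    Follows L u v ↔ Follows L' u v := by
  simp only [Follows, h.mem_iff]

omit [Inhabited V] in
theorem infix_pair_append {p q : List V} {u v : V} (h : [u, v] <:+: p ++ q) :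
    [u, v] <:+: p ∨ [u, v] <:+: q ∨ (p.getLast? = some u ∧ q.head? = some v) := by
  induction p with
  | nil => exact Or.inr (Or.inl h)
  | cons a p ih =>
    rw [List.cons_append, List.infix_cons_iff] at h
    rcases h with h | h
    · cases p with
      | nil =>
        rw [List.nil_append, List.cons_prefix_cons] at h
        obtain ⟨rfl, h⟩ := h
        obtain ⟨t, rfl⟩ := h
        exact Or.inr (Or.inr ⟨rfl, rfl⟩)
      | cons b p =>
        rw [List.cons_append, List.cons_prefix_cons, List.cons_prefix_cons] at h
        obtain ⟨rfl, rfl, -⟩ := h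
        exact Or.inl ⟨[], p, rfl⟩
    · rcases ih h with h | h | h
      · exact Or.inl (h.trans (List.suffix_cons a p).isInfix)
      · exact Or.inr (Or.inl h)
      · refine Or.inr (Or.inr ⟨?_, h.2⟩)
        rw [List.getLast?_cons, h.1]; rfl

/-- A merge of the pairs of end points can be carried out on the paths. -/
theorem PathSys.merge (h : PathSys r A L) (hX : ∀ u v, X u v → r u v) {s : Multiset (V × V)}
    (hs : Mrg X (endsOf L) s) : ∃ L', PathSys r A L' ∧ endsOf L' = s ∧
      (∀ u v, Follows L u v → Follows L' u v) ∧
      ∀ u v, Follows L' u v → Follows L u v ∨ X u v := by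
  obtain ⟨a, b, c, d, t, h1, h2, rfl⟩ := hs
  obtain ⟨p, L₁, hp, hpe, h1⟩ := exists_perm_of_endsOf h1
  obtain ⟨q, L₂, hq, hqe, h1⟩ := exists_perm_of_endsOf h1
  have hpq : L.Perm (p :: q :: L₂) := hp.trans (hq.cons p)
  have h' := h.perm hpq
  have hpn := h'.ne p (by simp)
  have hqn := h'.ne q (by simp)
  have hb : p.getLast? = some b := by
    have := congrArg Prod.snd hpe
    simpa [ends, List.getLast?_eq_some_getLast hpn] using this
  have hc : q.head? = some c := by
    have := congrArg Prod.fst hqe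
    simpa [ends, List.head?_eq_some_head hqn] using this
  have hfl : ((p ++ q) :: L₂).flatten = (p :: q :: L₂).flatten := by simp
  refine ⟨(p ++ q) :: L₂, ⟨?_, ?_, hfl ▸ h'.nodup, fun v => hfl ▸ h'.mem v⟩, ?_, ?_, ?_⟩
  · intro x hx
    rcases List.mem_cons.1 hx with rfl | hx
    · simp [hpn]
    · exact h'.ne x (by simp [hx])
  · intro x hx
    rcases List.mem_cons.1 hx with rfl | hx
    · rw [List.isChain_append]
      refine ⟨h'.chain p (by simp), h'.chain q (by simp), ?_⟩
      intro x hx y hy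
      rw [hb, Option.mem_def, Option.some_inj] at hx
      rw [hc, Option.mem_def, Option.some_inj] at hy
      subst hx hy
      exact hX _ _ h2
    · exact h'.chain x (by simp [hx])
  · rw [endsOf_cons, ends_append hpn hqn, hpe, hqe, h1]
  · intro u v huv
    rw [follows_perm hpq] at huv
    obtain ⟨x, hx, hi⟩ := huv
    simp only [List.mem_cons] at hx
    rcases hx with rfl | rfl | hx
    · exact ⟨x ++ q, by simp, hi.trans (List.prefix_append _ _).isInfix⟩
    · exact ⟨p ++ x, by simp, hi.trans (List.suffix_append _ _).isInfix⟩
    · exact ⟨x, by simp [hx], hi⟩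
  · rintro u v ⟨x, hx, hi⟩
    rw [follows_perm hpq]
    rcases List.mem_cons.1 hx with rfl | hx
    · rcases infix_pair_append hi with hi | hi | ⟨hi, hi'⟩
      · exact Or.inl ⟨p, by simp, hi⟩
      · exact Or.inl ⟨q, by simp, hi⟩
      · rw [hb, Option.some_inj] at hi
        rw [hc, Option.some_inj] at hi'
        subst hi hi'
        exact Or.inr h2
    · exact Or.inl ⟨x, by simp [hx], hi⟩

theorem PathSys.merges (h : PathSys r A L) (hX : ∀ u v, X u v → r u v) {s : Multiset (V × V)}
    (hs : Relation.ReflTransGen (Mrg X) (endsOf L) s) : ∃ L', PathSys r A L' ∧ endsOf L' = s ∧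
      (∀ u v, Follows L u v → Follows L' u v) ∧
      ∀ u v, Follows L' u v → Follows L u v ∨ X u v := by
  induction hs with
  | refl => exact ⟨L, h, rfl, fun _ _ h => h, fun _ _ h => Or.inl h⟩
  | tail _ hs ih =>
    obtain ⟨L₁, h₁, rfl, h₂, h₃⟩ := ih
    obtain ⟨L₂, h₄, h₅, h₆, h₇⟩ := h₁.merge hX hs
    refine ⟨L₂, h₄, h₅, fun u v h => h₆ u v (h₂ u v h), fun u v h => ?_⟩
    rcases h₇ u v h with h | h
    · exact h₃ u v h
    · exact Or.inr h

end

/-- Merges only depend on labels of the vertices that determine the relation. -/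
theorem Mrg.lift {V Λ : Type*} {X : V → V → Prop} {lam : V → Λ}
    (hX : ∀ b b' c c', lam b = lam b' → lam c = lam c' → X b c → X b' c')
    {s₁ s₂ s₁' : Multiset (V × V)} (h : s₁.map (Prod.map lam lam) = s₂.map (Prod.map lam lam))
    (h₁ : Mrg X s₁ s₁') :
    ∃ s₂', Mrg X s₂ s₂' ∧ s₁'.map (Prod.map lam lam) = s₂'.map (Prod.map lam lam) := by
  obtain ⟨a, b, c, d, t, rfl, hbc, rfl⟩ := h₁
  simp only [Multiset.map_cons] at h
  obtain ⟨⟨a', b'⟩, hp, hab⟩ := Multiset.mem_map.1 (h ▸ Multiset.mem_cons_self _ _)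
  obtain ⟨s₃, rfl⟩ := Multiset.exists_cons_of_mem hp
  rw [Multiset.map_cons, hab, Multiset.cons_inj_right] at h
  obtain ⟨⟨c', d'⟩, hq, hcd⟩ := Multiset.mem_map.1 (h ▸ Multiset.mem_cons_self _ _)
  obtain ⟨s₄, rfl⟩ := Multiset.exists_cons_of_mem hq
  rw [Multiset.map_cons, hcd, Multiset.cons_inj_right] at h
  simp only [Prod.map_apply, Prod.mk.injEq] at hab hcd
  refine ⟨(a', d') ::ₘ s₄, ⟨a', b', c', d', s₄, rfl, hX _ _ _ _ hab.2.symm hcd.1.symm hbc, rfl⟩, ?_⟩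
  simp only [Multiset.map_cons, Prod.map_apply, h, hab.1, hcd.2]

theorem Mrg.lifts {V Λ : Type*} {X : V → V → Prop} {lam : V → Λ}
    (hX : ∀ b b' c c', lam b = lam b' → lam c = lam c' → X b c → X b' c')
    {s₁ s₂ s₁' : Multiset (V × V)} (h : s₁.map (Prod.map lam lam) = s₂.map (Prod.map lam lam))
    (h₁ : Relation.ReflTransGen (Mrg X) s₁ s₁') :
    ∃ s₂', Relation.ReflTransGen (Mrg X) s₂ s₂' ∧
      s₁'.map (Prod.map lam lam) = s₂'.map (Prod.map lam lam) := by
  induction h₁ with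
  | refl => exact ⟨s₂, .refl, h⟩
  | tail _ h₁ ih =>
    obtain ⟨t, ht, ht'⟩ := ih
    obtain ⟨t', h₂, h₃⟩ := h₁.lift hX ht'
    exact ⟨t', ht.tail h₂, h₃⟩

theorem Mrg.add {V : Type*} {X : V → V → Prop} {s s' : Multiset (V × V)} (h : Mrg X s s')
    (t : Multiset (V × V)) : Mrg X (s + t) (s' + t) := by
  obtain ⟨a, b, c, d, u, rfl, hbc, rfl⟩ := h
  exact ⟨a, b, c, d, u + t, by simp, hbc, by simp⟩

theorem Mrg.adds {V : Type*} {X : V → V → Prop} {s s' : Multiset (V × V)}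
    (h : Relation.ReflTransGen (Mrg X) s s') (t : Multiset (V × V)) :
    Relation.ReflTransGen (Mrg X) (s + t) (s' + t) := by
  induction h with
  | refl => exact .refl
  | tail _ h ih => exact ih.tail (h.add t)

/-! ## The trace of a Hamiltonian cycle on a set -/

section
variable {V : Type*} [Inhabited V] {X : V → V → Prop} {A B U : Set V} {L : List (List V)}
  {f : V → V}

/-- `L` is the system of the maximal paths of `f` in `A`. -/
structure Compat (f : V → V) (A : Set V) (L : List (List V)) : Prop where
  sys : PathSys (fun u v => f u = v) A L
  last : ∀ p ∈ L, f (ends p).2 ∉ A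
  head : ∀ p ∈ L, ∀ u, f u = (ends p).1 → u ∉ A

/-- Cutting a path at all places where it enters or leaves `A`. -/
theorem exists_pieces (f : V → V) (A : Set V) (p : List V) (hp : p ≠ [])
    (hc : p.IsChain fun u v => f u = v)
    (hX : ∀ u v, [u, v] <:+: p → ¬(u ∈ A ↔ v ∈ A) → X u v) :
    ∃ q ps, (q :: ps).flatten = p ∧
      (∀ x ∈ q :: ps, x ≠ [] ∧ x.IsChain (fun u v => f u = v) ∧
        ((∀ v ∈ x, v ∈ A) ∨ ∀ v ∈ x, v ∉ A)) ∧
      (∀ x ∈ q :: ps, (ends x).2 = (ends p).2 ∨ ¬((ends x).2 ∈ A ↔ f (ends x).2 ∈ A)) ∧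
      (∀ x ∈ ps, ∃ u, (ends x).1 = f u ∧ ¬(u ∈ A ↔ f u ∈ A)) ∧
      ∀ x t, Relation.ReflTransGen (Mrg X) ((x, (ends q).2) ::ₘ (endsOf ps + t))
        ((x, (ends p).2) ::ₘ t) := by
  induction p with
  | nil => exact absurd rfl hp
  | cons a l ih =>
    cases l with
    | nil =>
      refine ⟨[a], [], rfl, ?_, ?_, by simp, fun x t => ?_⟩
      · simp only [List.mem_singleton, forall_eq]
        exact ⟨by simp, hc, em _⟩
      · simp
      · simpa [endsOf] using Relation.ReflTransGen.refl
    | cons b l =>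
      have hab : f a = b := hc.rel
      obtain ⟨q, ps, h1, h2, h3, h4, h5⟩ := ih (by simp) hc.of_cons fun u v h =>
        hX u v (h.trans (List.suffix_cons _ _).isInfix)
      have hq := h2 q (by simp)
      obtain ⟨q', rfl⟩ : ∃ q', q = b :: q' := by
        obtain ⟨hq, -⟩ := hq
        cases q with
        | nil => exact absurd rfl hq
        | cons c q' =>
          simp only [List.flatten_cons, List.cons_append, List.cons.injEq] at h1
          exact ⟨q', by rw [h1.1]⟩
      have el : (ends (a :: b :: l)).2 = (ends (b :: l)).2 := by simp [ends]
      by_cases hcol : a ∈ A ↔ b ∈ A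
      · have eq : (ends (a :: b :: q')).2 = (ends (b :: q')).2 := by simp [ends]
        refine ⟨a :: b :: q', ps, ?_, ?_, ?_, h4, ?_⟩
        · simp only [List.flatten_cons, List.cons_append, List.cons.injEq, true_and] at h1 ⊢
          exact h1
        · intro x hx
          rcases List.mem_cons.1 hx with rfl | hx
          · refine ⟨by simp, List.IsChain.cons_cons hab hq.2.1, ?_⟩
            refine hq.2.2.imp (fun h v hv => ?_) fun h v hv => ?_
            · rcases List.mem_cons.1 hv with rfl | hv
              · exact hcol.2 (h b (by simp))
              · exact h v hv
            · rcases List.mem_cons.1 hv with rfl | hv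
              · exact fun h' => h b (by simp) (hcol.1 h')
              · exact h v hv
          · exact h2 x (by simp [hx])
        · intro x hx
          rw [el]
          rcases List.mem_cons.1 hx with rfl | hx
          · rw [eq]; exact h3 _ (by simp)
          · exact h3 x (by simp [hx])
        · intro x t
          rw [eq, el]; exact h5 x t
      -- Here `a` and `b` lie on different sides, so `a` becomes a piece of its own, and the
      -- crossing edge from `a` to `b` provides the merge that undoes the cut.
      · refine ⟨[a], (b :: q') :: ps, ?_, ?_, ?_, ?_, ?_⟩
        · rw [List.flatten_cons, h1]; rfl
        · intro x hx
          rcases List.mem_cons.1 hx with rfl | hx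
          · exact ⟨by simp, by simp, by simpa using em _⟩
          · exact h2 x hx
        · intro x hx
          rcases List.mem_cons.1 hx with rfl | hx
          · exact Or.inr (by simpa [ends, hab] using hcol)
          · rw [el]; exact h3 x hx
        · intro x hx
          rcases List.mem_cons.1 hx with rfl | hx
          · exact ⟨a, by simp [ends, hab], by rwa [hab]⟩
          · exact h4 x hx
        · intro x t
          refine Relation.ReflTransGen.head ?_ (el ▸ h5 x t)
          refine ⟨x, a, b, (ends (b :: q')).2, endsOf ps + t, ?_, hX a b ⟨[], l, rfl⟩ hcol, rfl⟩
          rw [endsOf_cons]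
          simp [ends]

/-- Cutting all paths of a system. -/
theorem Compat.exists_pieces (hf : Function.Injective f) (A : Set V) {D : Set V}
    (h : Compat f D L)
    (hX : ∀ u v, u ∈ D → v ∈ D → f u = v → ¬(u ∈ A ↔ v ∈ A) → X u v) :
    ∃ L', L'.flatten = L.flatten ∧
      (∀ x ∈ L', x ≠ [] ∧ x.IsChain (fun u v => f u = v) ∧
        ((∀ v ∈ x, v ∈ A) ∨ ∀ v ∈ x, v ∉ A)) ∧
      (∀ x ∈ L', f (ends x).2 ∉ D ∨ ¬((ends x).2 ∈ A ↔ f (ends x).2 ∈ A)) ∧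
      (∀ x ∈ L', ∀ u, f u = (ends x).1 → u ∉ D ∨ ¬(u ∈ A ↔ f u ∈ A)) ∧
      Relation.ReflTransGen (Mrg X) (endsOf L') (endsOf L) := by
  have key : ∀ L : List (List V), (∀ p ∈ L, p ≠ [] ∧ p.IsChain (fun u v => f u = v) ∧
      (∀ v ∈ p, v ∈ D) ∧ f (ends p).2 ∉ D ∧ ∀ u, f u = (ends p).1 → u ∉ D) →
      ∃ L', L'.flatten = L.flatten ∧
      (∀ x ∈ L', x ≠ [] ∧ x.IsChain (fun u v => f u = v) ∧
        ((∀ v ∈ x, v ∈ A) ∨ ∀ v ∈ x, v ∉ A)) ∧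
      (∀ x ∈ L', f (ends x).2 ∉ D ∨ ¬((ends x).2 ∈ A ↔ f (ends x).2 ∈ A)) ∧
      (∀ x ∈ L', ∀ u, f u = (ends x).1 → u ∉ D ∨ ¬(u ∈ A ↔ f u ∈ A)) ∧
      Relation.ReflTransGen (Mrg X) (endsOf L') (endsOf L) := by
    intro L
    induction L with
    | nil => exact fun _ => ⟨[], rfl, by simp, by simp, by simp, .refl⟩
    | cons p L ih =>
      intro hL
      obtain ⟨L', h1, h2, h3, h4, h5⟩ := ih fun p hp => hL p (by simp [hp])
      obtain ⟨hp1, hp2, hp3, hp4, hp5⟩ := hL p (by simp)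
      obtain ⟨q, ps, k1, k2, k3, k4, k5⟩ := SMWidth.exists_pieces (X := X) f A p hp1 hp2 (by
        intro u v huv hA
        refine hX u v (hp3 u (huv.subset (by simp))) (hp3 v (huv.subset (by simp))) ?_ hA
        simpa using hp2.infix huv)
      have hq1 : (ends q).1 = (ends p).1 := by
        have := (k2 q (by simp)).1
        rw [← k1]
        cases q with
        | nil => exact absurd rfl this
        | cons a q => simp [ends]
      refine ⟨q :: ps ++ L', by rw [List.flatten_append, k1, h1]; rfl, ?_, ?_, ?_, ?_⟩
      · intro x hx
        exact (List.mem_append.1 hx).elim (k2 x) (h2 x)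
      · intro x hx
        refine (List.mem_append.1 hx).elim (fun hx => ?_) (h3 x)
        exact (k3 x hx).imp (fun h => by rw [h]; exact hp4) id
      · intro x hx
        refine (List.mem_append.1 hx).elim (fun hx => ?_) (h4 x)
        intro u hu
        rcases List.mem_cons.1 hx with rfl | hx
        · exact Or.inl (hp5 u (hu.trans hq1))
        -- A later piece starts right after a cut; as `f` is injective, the vertex before the cut is
        -- the only predecessor.
        · obtain ⟨u', hu', hA⟩ := k4 x hx
          obtain rfl := hf (hu.trans hu')
          exact Or.inr hA
      · have e1 : endsOf (q :: ps ++ L') = ((ends q).1, (ends q).2) ::ₘ (endsOf ps + endsOf L') := by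
          rw [endsOf_append, endsOf_cons, Multiset.cons_add]
        have e2 : endsOf (p :: L) = endsOf L + {((ends q).1, (ends p).2)} := by
          rw [endsOf_cons, hq1, add_comm, Multiset.singleton_add]
        rw [e1, e2]
        refine (k5 _ _).trans ?_
        have := Mrg.adds h5 {((ends q).1, (ends p).2)}
        rwa [add_comm, Multiset.singleton_add] at this
  refine key L fun p hp => ⟨h.sys.ne p hp, h.sys.chain p hp, fun v hv => ?_, h.last p hp, h.head p hp⟩
  exact (h.sys.mem v).1 (List.mem_flatten.2 ⟨p, hp, hv⟩)

open Classical in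
/-- Dividing monochromatic pieces into those in `A` and those outside. -/
theorem exists_pieces_divide {L' : List (List V)} {D : Set V} (hn : L'.flatten.Nodup)
    (hm : ∀ v, v ∈ L'.flatten ↔ v ∈ D)
    (h2 : ∀ x ∈ L', x ≠ [] ∧ x.IsChain (fun u v => f u = v) ∧
        ((∀ v ∈ x, v ∈ A) ∨ ∀ v ∈ x, v ∉ A))
    (h3 : ∀ x ∈ L', f (ends x).2 ∉ D ∨ ¬((ends x).2 ∈ A ↔ f (ends x).2 ∈ A))
    (h4 : ∀ x ∈ L', ∀ u, f u = (ends x).1 → u ∉ D ∨ ¬(u ∈ A ↔ f u ∈ A)) :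
    ∃ L₁ L₂, Compat f (D ∩ A) L₁ ∧ Compat f (D \ A) L₂ ∧ (L₁ ++ L₂).Perm L' := by
  have hA : ∀ x ∈ L', ((ends x).1 ∈ A → ∀ v ∈ x, v ∈ A) ∧ ((ends x).1 ∉ A → ∀ v ∈ x, v ∉ A) := by
    intro x hx
    obtain ⟨k1, -, k3⟩ := h2 x hx
    have := ends_fst_mem k1
    rcases k3 with k3 | k3
    · exact ⟨fun _ => k3, fun h => absurd (k3 _ this) h⟩
    · exact ⟨fun h => absurd h (k3 _ this), fun _ => k3⟩
  refine ⟨L'.filter fun x => (ends x).1 ∈ A, L'.filter fun x => ¬ (ends x).1 ∈ A,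
    ⟨⟨?_, ?_, ?_, ?_⟩, ?_, ?_⟩, ⟨⟨?_, ?_, ?_, ?_⟩, ?_, ?_⟩, ?_⟩
  · exact fun p hp => (h2 p (List.mem_of_mem_filter hp)).1
  · exact fun p hp => (h2 p (List.mem_of_mem_filter hp)).2.1
  · exact hn.sublist List.filter_sublist.flatten
  · intro v
    rw [Set.mem_inter_iff, ← hm]
    simp only [List.mem_flatten, List.mem_filter, decide_eq_true_eq]
    constructor
    · rintro ⟨x, ⟨hx, hxA⟩, hv⟩
      exact ⟨⟨x, hx, hv⟩, (hA x hx).1 hxA v hv⟩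
    · rintro ⟨⟨x, hx, hv⟩, hvA⟩
      exact ⟨x, ⟨hx, by_contra fun h => (hA x hx).2 h v hv hvA⟩, hv⟩
  · intro p hp
    simp only [List.mem_filter, decide_eq_true_eq] at hp
    have := (hA p hp.1).1 hp.2 _ (ends_snd_mem (h2 p hp.1).1)
    rintro ⟨h5, h6⟩
    rcases h3 p hp.1 with h | h
    · exact h h5
    · exact h ⟨fun _ => h6, fun _ => this⟩
  · intro p hp u hu
    simp only [List.mem_filter, decide_eq_true_eq] at hp
    rintro ⟨h5, h6⟩
    rcases h4 p hp.1 u hu with h | h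
    · exact h h5
    · exact h ⟨fun _ => hu ▸ hp.2, fun _ => h6⟩
  · exact fun p hp => (h2 p (List.mem_of_mem_filter hp)).1
  · exact fun p hp => (h2 p (List.mem_of_mem_filter hp)).2.1
  · exact hn.sublist List.filter_sublist.flatten
  · intro v
    rw [Set.mem_sdiff, ← hm]
    simp only [List.mem_flatten, List.mem_filter, decide_eq_true_eq]
    constructor
    · rintro ⟨x, ⟨hx, hxA⟩, hv⟩
      exact ⟨⟨x, hx, hv⟩, (hA x hx).2 hxA v hv⟩
    · rintro ⟨⟨x, hx, hv⟩, hvA⟩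
      exact ⟨x, ⟨hx, fun h => hvA ((hA x hx).1 h v hv)⟩, hv⟩
  · intro p hp
    simp only [List.mem_filter, decide_eq_true_eq] at hp
    have := (hA p hp.1).2 hp.2 _ (ends_snd_mem (h2 p hp.1).1)
    rintro ⟨h5, h6⟩
    rcases h3 p hp.1 with h | h
    · exact h h5
    · exact h ⟨fun h => absurd h this, fun h => absurd h h6⟩
  · intro p hp u hu
    simp only [List.mem_filter, decide_eq_true_eq] at hp
    rintro ⟨h5, h6⟩
    rcases h4 p hp.1 u hu with h | h
    · exact h h5
    · exact h ⟨fun h => absurd h h6, fun h => absurd (hu ▸ h) hp.2⟩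
  · simpa using List.filter_append_perm (fun x => decide ((ends x).1 ∈ A)) L'

/-- The trace of a cycle on a disjoint union is merged from the traces on the two parts. -/
theorem Compat.divide (hf : Function.Injective f) (h : Compat f (A ∪ B) L) (hAB : Disjoint A B)
    (hX : ∀ u v, f u = v → (u ∈ A ∧ v ∈ B) ∨ (u ∈ B ∧ v ∈ A) → X u v) :
    ∃ L₁ L₂, Compat f A L₁ ∧ Compat f B L₂ ∧
      Relation.ReflTransGen (Mrg X) (endsOf L₁ + endsOf L₂) (endsOf L) := by
  obtain ⟨L', h1, h2, h3, h4, h5⟩ := h.exists_pieces (X := X) hf A (fun u v hu hv huv hA => by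
    refine hX u v huv ?_
    rcases hu with hu | hu <;> rcases hv with hv | hv
    · exact absurd ⟨fun _ => hv, fun _ => hu⟩ hA
    · exact Or.inl ⟨hu, hv⟩
    · exact Or.inr ⟨hu, hv⟩
    · exact absurd ⟨fun h => absurd hu (Set.disjoint_left.1 hAB h),
        fun h => absurd hv (Set.disjoint_left.1 hAB h)⟩ hA)
  obtain ⟨L₁, L₂, k1, k2, k3⟩ := exists_pieces_divide (h1 ▸ h.sys.nodup)
    (fun v => h1 ▸ h.sys.mem v) h2 h3 h4
  rw [Set.union_inter_cancel_left] at k1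
  rw [Set.union_sdiff_left, sdiff_eq_left.2 hAB.symm] at k2
  exact ⟨L₁, L₂, k1, k2, by rw [← endsOf_append, endsOf_perm k3]; exact h5⟩

omit [Inhabited V] in
-- The paths are disjoint, so vertices picked one from each path are distinct. The choices used
-- below are the first and the last vertices.
theorem PathSys.nodup_map {r : V → V → Prop} (h : PathSys r A L) (g : List V → V)
    (hg : ∀ p ∈ L, g p ∈ p) : (L.map g).Nodup := by
  have h1 := h.nodup
  have : ∀ L : List (List V), L.flatten.Nodup → (∀ p ∈ L, g p ∈ p) → (L.map g).Nodup := by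
    intro L
    induction L with
    | nil => simp
    | cons p L ih =>
      intro h1 hg
      rw [List.flatten_cons, List.nodup_append] at h1
      rw [List.map_cons, List.nodup_cons]
      refine ⟨fun hp => ?_, ih h1.2.1 fun p hp => hg p (by simp [hp])⟩
      obtain ⟨q, hq, hqp⟩ := List.mem_map.1 hp
      exact h1.2.2 _ (hg p (by simp)) _ (List.mem_flatten.2 ⟨q, hq, hg q (by simp [hq])⟩) hqp.symm
  exact this L h1 hg

/-- The number of paths is at most the size of a cover of the edges that leave `A`. -/
theorem Compat.length_le (hf : Function.Injective f) (h : Compat f A L) (C : List V)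
    (hC : ∀ u, u ∈ A → f u ∉ A → u ∈ C ∨ f u ∈ C) : L.length ≤ C.length := by
  classical
  -- Each path is charged to a cover vertex of the edge that leaves its end: the end itself or its
  -- successor. Ends are distinct, successors are distinct by injectivity of `f`, and an end lies in
  -- `A` while a successor of an end does not; so no vertex is charged twice.
  let g : List V → V := fun p => if (ends p).2 ∈ C then (ends p).2 else f (ends p).2
  have hmem : ∀ p ∈ L, (ends p).2 ∈ A := fun p hp =>
    (h.sys.mem _).1 (List.mem_flatten.2 ⟨p, hp, ends_snd_mem (h.sys.ne p hp)⟩)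
  have h1 : (L.map fun p => (ends p).2).Nodup :=
    h.sys.nodup_map _ fun p hp => ends_snd_mem (h.sys.ne p hp)
  have h2 : (L.map g).Nodup := by
    rw [List.Nodup, List.pairwise_map] at h1 ⊢
    refine h1.imp_of_mem fun {p q} hp hq hpq => ?_
    simp only [g]
    split_ifs
    · exact hpq
    · exact fun e => h.last q hq (e ▸ hmem p hp)
    · exact fun e => h.last p hp (e ▸ hmem q hq)
    · exact fun e => hpq (hf e)
  rw [← List.length_map (f := g)]
  refine (List.subperm_of_subset h2 fun v hv => ?_).length_le
  obtain ⟨p, hp, rfl⟩ := List.mem_map.1 hv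
  simp only [g]
  split_ifs with h3
  · exact h3
  · exact (hC _ (hmem p hp) (h.last p hp)).resolve_left h3

end

/-! ## Counting states -/

/-- Such a multiset is coded by a list of its members, padded with `none` to length `ℓ`; each of the
`ℓ` places has `E.card + 1` possible values. -/
theorem card_multiset_le {α : Type*} [DecidableEq α] (E : Finset α) (ℓ : ℕ)
    (S : Finset (Multiset α)) (h : ∀ m ∈ S, Multiset.card m ≤ ℓ ∧ ∀ a ∈ m, a ∈ E) :
    S.card ≤ (E.card + 1) ^ ℓ := by
  have h1 : (Fintype.piFinset fun _ : Fin ℓ => E.insertNone).card = (E.card + 1) ^ ℓ := by simp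
  rw [← h1]
  refine Finset.card_le_card_of_injOn (fun m i => m.toList[(i : ℕ)]?) ?_ ?_
  · intro m hm
    rw [Finset.mem_coe, Fintype.mem_piFinset]
    intro i
    rw [Finset.mem_insertNone]
    intro a ha
    exact (h m hm).2 a (Multiset.mem_toList.1 (List.mem_of_getElem? ha))
  · intro m hm m' hm' e
    rw [← Multiset.coe_toList m, ← Multiset.coe_toList m']
    congr 1
    apply List.ext_getElem?
    intro i
    by_cases hi : i < ℓ
    · exact congrFun e ⟨i, hi⟩
    · have l1 := (h m hm).1
      have l2 := (h m' hm').1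
      rw [List.getElem?_eq_none (by rw [Multiset.length_toList]; omega),
        List.getElem?_eq_none (by rw [Multiset.length_toList]; omega)]

/-- The number of pairwise inequivalent states when at most `ℓ` pairs lie outside a set `F`. -/
theorem length_le_of_pairwise {α : Type*} [DecidableEq α] (E F : Finset α) (n ℓ : ℕ)
    (J : List (List α)) (hJ : J.Pairwise fun s t => ¬ s.Perm t)
    (h : ∀ s ∈ J, s.length ≤ n ∧ (∀ e ∈ s, e ∈ E) ∧ (s.filter fun e => e ∉ F).length ≤ ℓ) :
    J.length ≤ (n + 1) ^ F.card * (E.card + 1) ^ ℓ := by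
  classical
  let S : Finset (Multiset α) := (J.map (Multiset.ofList : List α → Multiset α)).toFinset
  have hS : S.card = J.length := by
    rw [List.toFinset_card_of_nodup, List.length_map]
    exact List.pairwise_map.2 (hJ.imp fun h h' => h (Multiset.coe_eq_coe.1 h'))
  let R : Finset (Multiset α) := S.image fun m => m.filter fun e => e ∉ F
  have hR : R.card ≤ (E.card + 1) ^ ℓ := by
    refine card_multiset_le E ℓ R fun m hm => ?_
    simp only [R, S, Finset.mem_image, List.mem_toFinset, List.mem_map] at hm
    obtain ⟨-, ⟨s, hs, rfl⟩, rfl⟩ := hm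
    refine ⟨?_, fun a ha => ?_⟩
    · simpa using (h s hs).2.2
    · exact (h s hs).2.1 a (by simpa using (Multiset.mem_filter.1 ha).1)
  have h2 : ((Fintype.piFinset fun _ : F => Finset.range (n + 1)) ×ˢ R).card ≤
      (n + 1) ^ F.card * (E.card + 1) ^ ℓ := by
    rw [Finset.card_product]
    refine Nat.mul_le_mul (le_of_eq ?_) hR
    simp
  rw [← hS]
  refine le_trans ?_ h2
  -- A multiset is determined by its multiplicities on `F` and by the submultiset of the members
  -- outside `F`.
  refine Finset.card_le_card_of_injOn (fun m => (fun e : F => m.count (e : α),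
    m.filter fun e => e ∉ F)) ?_ ?_
  · intro m hm
    rw [Finset.mem_coe, Finset.mem_product]
    refine ⟨?_, Finset.mem_image_of_mem _ hm⟩
    rw [Fintype.mem_piFinset]
    intro e
    simp only [S, Finset.mem_coe, List.mem_toFinset, List.mem_map] at hm
    obtain ⟨s, hs, rfl⟩ := hm
    rw [Finset.mem_range]
    have := (h s hs).1
    have h3 := List.count_le_length (a := (e : α)) (l := s)
    simp only [Multiset.coe_count]
    omega
  · intro m hm m' hm' e
    simp only [Prod.mk.injEq] at e
    ext a
    by_cases ha : a ∈ F
    · exact congrFun e.1 ⟨a, ha⟩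
    · have := congrArg (Multiset.count a) e.2
      rwa [Multiset.count_filter_of_pos (p := fun e => e ∉ F) ha,
        Multiset.count_filter_of_pos (p := fun e => e ∉ F) ha] at this

/-! ## Greedy matchings -/

section
variable {V : Type} {r eq : V → V → Bool} {A O : List V}

/-- An edge is rejected only if it shares an end with an edge chosen before, and chosen edges are
never given up. So the result is a matching, and its ends cover all edges between `A` and `O`. -/
theorem greedy_spec (heq : ∀ u v, eq u v = true ↔ u = v) :
    (∀ e ∈ greedy r eq A O, e.1 ∈ A ∧ e.2 ∈ O ∧ r e.1 e.2 = true) ∧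
    ((greedy r eq A O).map Prod.fst).Nodup ∧ ((greedy r eq A O).map Prod.snd).Nodup ∧
    ∀ a ∈ A, ∀ o ∈ O, r a o = true →
      a ∈ (greedy r eq A O).map Prod.fst ∨ o ∈ (greedy r eq A O).map Prod.snd := by
  let step : List (V × V) → V × V → List (V × V) := fun M e =>
    bif r e.1 e.2 && M.all fun p => !eq p.1 e.1 && !eq p.2 e.2 then e :: M else M
  have key : ∀ (l M : List (V × V)), (∀ e ∈ M, e.1 ∈ A ∧ e.2 ∈ O ∧ r e.1 e.2 = true) →
      (M.map Prod.fst).Nodup → (M.map Prod.snd).Nodup → (∀ e ∈ l, e.1 ∈ A ∧ e.2 ∈ O) →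
      (∀ e ∈ l.foldl step M, e.1 ∈ A ∧ e.2 ∈ O ∧ r e.1 e.2 = true) ∧
      ((l.foldl step M).map Prod.fst).Nodup ∧ ((l.foldl step M).map Prod.snd).Nodup ∧
      M ⊆ l.foldl step M ∧ ∀ e ∈ l, r e.1 e.2 = true →
        e.1 ∈ (l.foldl step M).map Prod.fst ∨ e.2 ∈ (l.foldl step M).map Prod.snd := by
    intro l
    induction l with
    | nil => exact fun M h1 h2 h3 _ => ⟨h1, h2, h3, List.Subset.refl M, by simp⟩
    | cons e l ih =>
      intro M h1 h2 h3 h4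
      have hl : ∀ e ∈ l, e.1 ∈ A ∧ e.2 ∈ O := fun e he => h4 e (by simp [he])
      rw [List.foldl_cons]
      cases hc : (r e.1 e.2 && M.all fun p => !eq p.1 e.1 && !eq p.2 e.2)
      · have hs : step M e = M := by simp only [step, hc, cond_false]
        rw [hs]
        obtain ⟨k1, k2, k3, k4, k5⟩ := ih M h1 h2 h3 hl
        refine ⟨k1, k2, k3, k4, fun e' he' hr => ?_⟩
        rcases List.mem_cons.1 he' with rfl | he'
        · rw [hr, Bool.true_and, ← Bool.not_eq_true, List.all_eq_true] at hc
          push Not at hc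
          obtain ⟨p, hp, hp'⟩ := hc
          have : p.1 = e'.1 ∨ p.2 = e'.2 := by
            by_contra hcon
            push Not at hcon
            apply hp'
            rw [Bool.and_eq_true, Bool.not_eq_true', Bool.not_eq_true', ← Bool.not_eq_true,
              ← Bool.not_eq_true, heq, heq]
            exact hcon
          rcases this with h | h
          · exact Or.inl (h ▸ List.mem_map_of_mem (k4 hp))
          · exact Or.inr (h ▸ List.mem_map_of_mem (k4 hp))
        · exact k5 e' he' hr
      · have hs : step M e = e :: M := by simp only [step, hc, cond_true]
        rw [hs]
        rw [Bool.and_eq_true, List.all_eq_true] at hc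
        have hd : ∀ p ∈ M, p.1 ≠ e.1 ∧ p.2 ≠ e.2 := by
          intro p hp
          have := hc.2 p hp
          rwa [Bool.and_eq_true, Bool.not_eq_true', Bool.not_eq_true', ← Bool.not_eq_true,
              ← Bool.not_eq_true, heq, heq] at this
        obtain ⟨k1, k2, k3, k4, k5⟩ := ih (e :: M) (by
            intro e' he'
            rcases List.mem_cons.1 he' with rfl | he'
            · exact ⟨(h4 e' (by simp)).1, (h4 e' (by simp)).2, hc.1⟩
            · exact h1 e' he') (by
            rw [List.map_cons, List.nodup_cons]
            refine ⟨fun h => ?_, h2⟩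
            obtain ⟨p, hp, hp'⟩ := List.mem_map.1 h
            exact (hd p hp).1 hp') (by
            rw [List.map_cons, List.nodup_cons]
            refine ⟨fun h => ?_, h3⟩
            obtain ⟨p, hp, hp'⟩ := List.mem_map.1 h
            exact (hd p hp).2 hp') hl
        refine ⟨k1, k2, k3, fun x hx => k4 (by simp [hx]), fun e' he' hr => ?_⟩
        rcases List.mem_cons.1 he' with rfl | he'
        · exact Or.inl (List.mem_map_of_mem (k4 (by simp)))
        · exact k5 e' he' hr
  obtain ⟨k1, k2, k3, -, k5⟩ := key (A.flatMap fun a => O.map fun o => (a, o)) [] (by simp)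
    (by simp) (by simp) (by
      intro e he
      obtain ⟨a, ha, he⟩ := List.mem_flatMap.1 he
      obtain ⟨o, ho, rfl⟩ := List.mem_map.1 he
      exact ⟨ha, ho⟩)
  exact ⟨k1, k2, k3, fun a ha o ho hr => k5 (a, o)
    (List.mem_flatMap.2 ⟨a, ha, List.mem_map.2 ⟨o, ho, rfl⟩⟩) hr⟩

/-- The number of different neighbourhoods in `O` is bounded in terms of a maximal matching. -/
theorem exists_labels {r : V → V → Prop} {A O : Set V} (M : List (V × V))
    (hM : ∀ a ∈ A, ∀ o ∈ O, r a o → a ∈ M.map Prod.fst ∨ o ∈ M.map Prod.snd) :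
    ∃ T : Finset (Set V), T.card ≤ 2 ^ M.length + M.length ∧ ∀ u ∈ A, {w ∈ O | r u w} ∈ T := by
  classical
  -- An unmatched vertex of `A` has only matched neighbours in `O`, so its neighbourhood is one of
  -- at most `2 ^ |M|` subsets. The matched vertices of `A` contribute at most `|M|` further
  -- neighbourhoods.
  refine ⟨(M.map Prod.snd).toFinset.powerset.image (fun s : Finset V => (s : Set V)) ∪
    (M.map Prod.fst).toFinset.image (fun u => {w ∈ O | r u w}), ?_, fun u hu => ?_⟩
  · refine (Finset.card_union_le _ _).trans (Nat.add_le_add ?_ ?_)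
    · refine Finset.card_image_le.trans ?_
      rw [Finset.card_powerset]
      exact Nat.pow_le_pow_right (by omega) ((List.toFinset_card_le _).trans (by simp))
    · exact Finset.card_image_le.trans ((List.toFinset_card_le _).trans (by simp))
  · rw [Finset.mem_union]
    by_cases h : u ∈ M.map Prod.fst
    · exact Or.inr (Finset.mem_image.2 ⟨u, by simpa using h, rfl⟩)
    · refine Or.inl (Finset.mem_image.2 ⟨(M.map Prod.snd).toFinset.filter (fun w => w ∈ O ∧ r u w),
        Finset.mem_powerset.2 (Finset.filter_subset _ _), ?_⟩)
      ext w
      simp only [Finset.coe_filter, List.mem_toFinset, Set.mem_ofPred_eq]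
      exact ⟨fun h => h.2, fun hw => ⟨(hM u hu w hw.1 hw.2).resolve_left h, hw⟩⟩

end

/-- A list of disjoint edges across the cut is at most as long as a largest matching. -/
theorem length_le_mm {V : Type*} [Finite V] {G : SimpleGraph V} {A : Set V} (M : List (V × V))
    (h : ∀ e ∈ M, e.1 ∈ A ∧ e.2 ∉ A ∧ G.Adj e.1 e.2) (h1 : (M.map Prod.fst).Nodup)
    (h2 : (M.map Prod.snd).Nodup) : M.length ≤ mm G A := by
  classical
  have i1 : ∀ e ∈ M, ∀ e' ∈ M, e.1 = e'.1 → e = e' := fun e he e' he' =>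
    List.inj_on_of_nodup_map h1 he he'
  have i2 : ∀ e ∈ M, ∀ e' ∈ M, e.2 = e'.2 → e = e' := fun e he e' he' =>
    List.inj_on_of_nodup_map h2 he he'
  let H : (G.between A Aᶜ).Subgraph :=
    { verts := {v | ∃ e ∈ M, v = e.1 ∨ v = e.2}
      Adj := fun u v => (u, v) ∈ M ∨ (v, u) ∈ M
      adj_sub := by
        rintro u v (huv | huv)
        · have := h _ huv
          exact ⟨this.2.2, Or.inl ⟨this.1, this.2.1⟩⟩
        · have := h _ huv
          exact ⟨this.2.2.symm, Or.inr ⟨this.2.1, this.1⟩⟩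
      edge_vert := by
        rintro u v (huv | huv)
        · exact ⟨_, huv, Or.inl rfl⟩
        · exact ⟨_, huv, Or.inr rfl⟩
      symm := ⟨fun _ _ h => h.symm⟩ }
  have hH : H.IsMatching := by
    rintro v ⟨e, he, rfl | rfl⟩
    · refine ⟨e.2, Or.inl he, ?_⟩
      rintro w (hw | hw)
      · exact congrArg Prod.snd (i1 _ hw _ he rfl)
      · exact absurd (h e he).1 (h _ hw).2.1
    · refine ⟨e.1, Or.inr he, ?_⟩
      rintro w (hw | hw)
      · exact absurd (h _ hw).1 (h e he).2.1
      · exact congrArg Prod.fst (i2 _ hw _ he rfl)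
  have hc : H.edgeSet.ncard = M.length := by
    have : H.edgeSet = ((M.map fun e => s(e.1, e.2)).toFinset : Set (Sym2 V)) := by
      ext q
      induction q with
      | _ u v =>
        simp only [SimpleGraph.Subgraph.mem_edgeSet, List.coe_toFinset, List.mem_map,
          Set.mem_ofPred_eq, H]
        constructor
        · rintro (h | h)
          · exact ⟨_, h, rfl⟩
          · exact ⟨_, h, Sym2.eq_swap⟩
        · rintro ⟨⟨a, b⟩, he, hq⟩
          rcases Sym2.eq_iff.1 hq with ⟨rfl, rfl⟩ | ⟨rfl, rfl⟩
          · exact Or.inl he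
          · exact Or.inr he
    rw [this, Set.ncard_coe_finset, List.toFinset_card_of_nodup, List.length_map]
    refine (List.nodup_map_iff_inj_on (List.Nodup.of_map _ h1)).2 fun e he e' he' hq => ?_
    rcases Sym2.eq_iff.1 hq with ⟨h3, -⟩ | ⟨h3, -⟩
    · exact i1 e he e' he' h3
    · exact absurd (h e he).1 (h3 ▸ (h e' he').2.1)
  refine le_csSup ?_ ⟨H, hH, hc⟩
  -- `mm` is a supremum in `ℕ`, which dominates the members of the set only if the set is bounded;
  -- any crude bound does.
  refine ⟨Nat.card (Sym2 V), ?_⟩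
  rintro _ ⟨M', -, rfl⟩
  rw [← Set.ncard_univ]
  exact Set.ncard_le_ncard (Set.subset_univ _)

/-! ## Labels -/

section
variable {V : Type*} {r : V → V → Prop} {U A B : Set V}

open Classical in
/-- A vertex of `A` is labelled by its neighbourhood in `U \ A`. -/
noncomputable def lam (r : V → V → Prop) (U A : Set V) (u : V) : Option (Set V) :=
  if u ∈ A then some {w | w ∈ U ∧ w ∉ A ∧ r u w} else none

/-- Labels of the end points of the paths. -/
def lab {Λ : Type*} (l : V → Λ) (m : Multiset (V × V)) : Multiset (Λ × Λ) := m.map (Prod.map l l)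

/-- The end points of all paths lie in `A`. -/
def EndsIn (A : Set V) (m : Multiset (V × V)) : Prop := ∀ e ∈ m, e.1 ∈ A ∧ e.2 ∈ A

theorem lam_some {u : V} (h : u ∈ A) : lam r U A u = some {w | w ∈ U ∧ w ∉ A ∧ r u w} := if_pos h

theorem lam_none {u : V} (h : u ∉ A) : lam r U A u = none := if_neg h

theorem lam_eq_none {u : V} : lam r U A u = none ↔ u ∉ A := by
  by_cases h : u ∈ A
  · simp [lam_some h, h]
  · simp [lam_none h, h]

/-- The value `none` is reserved for the vertices outside `A`, so that a label also decides
membership in `A`. -/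
theorem lam_mem {u v : V} (h : lam r U A u = lam r U A v) : u ∈ A ↔ v ∈ A := by
  rw [← not_iff_not, ← lam_eq_none (r := r) (U := U), h, lam_eq_none]

theorem lam_rel {u v w : V} (h : lam r U A u = lam r U A v) (hu : u ∈ A) (hw : w ∈ U) (hwA : w ∉ A) :
    r u w ↔ r v w := by
  have hv := (lam_mem h).1 hu
  rw [lam_some hu, lam_some hv, Option.some_inj] at h
  have := Set.ext_iff.1 h w
  simpa [hw, hwA] using this

theorem lab_factor {Λ Λ' : Type*} {l : V → Λ} {l' : V → Λ'} (g : Λ → Λ') (m : Multiset (V × V))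
    (hA : EndsIn A m) (h : ∀ u ∈ A, l' u = g (l u)) : lab l' m = (lab l m).map (Prod.map g g) := by
  rw [lab, lab, Multiset.map_map]
  refine Multiset.map_congr rfl fun e he => ?_
  exact Prod.ext (h _ (hA e he).1) (h _ (hA e he).2)

theorem lab_add {Λ : Type*} {l : V → Λ} (m m' : Multiset (V × V)) :
    lab l (m + m') = lab l m + lab l m' := Multiset.map_add _ _ _

theorem exists_of_lab {Λ : Type*} {l : V → Λ} {m m' : Multiset (V × V)} (h : lab l m = lab l m')
    {e : V × V} (he : e ∈ m') : ∃ e' ∈ m, l e'.1 = l e.1 ∧ l e'.2 = l e.2 := by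
  have : Prod.map l l e ∈ lab l m := h ▸ Multiset.mem_map_of_mem _ he
  obtain ⟨e', he', h'⟩ := Multiset.mem_map.1 this
  simp only [Prod.mk.injEq, Prod.map] at h'
  exact ⟨e', he', h'⟩

theorem EndsIn.of_lab {m m' : Multiset (V × V)} (hm : EndsIn A m)
    (h : lab (lam r U A) m = lab (lam r U A) m') : EndsIn A m' := fun e he => by
  obtain ⟨e', he', h1, h2⟩ := exists_of_lab h he
  exact ⟨(lam_mem h1).1 (hm e' he').1, (lam_mem h2).1 (hm e' he').2⟩

/-- The pair of the labels with respect to two disjoint sets. -/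
noncomputable def lamPair (r : V → V → Prop) (U A B : Set V) (u : V) :
    Option (Set V) × Option (Set V) :=
  (lam r U A u, lam r U B u)

/-- On `A` the second component of the pair is constantly `none`, so the pair carries no more
information than the label with respect to `A`. -/
theorem lab_pair_left {m m' : Multiset (V × V)} (hAB : Disjoint A B) (hm : EndsIn A m)
    (h : lab (lam r U A) m = lab (lam r U A) m') :
    lab (lamPair r U A B) m = lab (lamPair r U A B) m' := by
  have hl : ∀ u ∈ A, lamPair r U A B u = (fun x => (x, none)) (lam r U A u) := fun u hu => by
    rw [lamPair, lam_none (Set.disjoint_left.1 hAB hu)]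
  rw [lab_factor (l := lam r U A) (fun x => (x, none)) _ hm hl, lab_factor (l := lam r U A) (fun x => (x, none)) _ (hm.of_lab h) hl, h]

theorem lab_pair_right {m m' : Multiset (V × V)} (hAB : Disjoint A B) (hm : EndsIn B m)
    (h : lab (lam r U B) m = lab (lam r U B) m') :
    lab (lamPair r U A B) m = lab (lamPair r U A B) m' := by
  have hl : ∀ u ∈ B, lamPair r U A B u = (fun x => (none, x)) (lam r U B u) := fun u hu => by
    rw [lamPair, lam_none (Set.disjoint_right.1 hAB hu)]
  rw [lab_factor (l := lam r U B) (fun x => (none, x)) _ hm hl, lab_factor (l := lam r U B) (fun x => (none, x)) _ (hm.of_lab h) hl, h]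

/-- The neighbourhood outside `A ∪ B` of a vertex of `A` is a restriction of its neighbourhood
outside `A`; likewise for `B`. So the labels after a join are coarser than the pairs of labels that
are used during the join. -/
theorem lam_union_of_pair {u v : V} (h : lamPair r U A B u = lamPair r U A B v) :
    lam r U (A ∪ B) u = lam r U (A ∪ B) v := by
  rw [lamPair, lamPair, Prod.mk.injEq] at h
  by_cases hu : u ∈ A ∪ B
  · have hv : v ∈ A ∪ B := hu.imp (lam_mem h.1).1 (lam_mem h.2).1
    rw [lam_some hu, lam_some hv, Option.some_inj]
    ext w
    change (_ ∧ _ ∧ _) ↔ (_ ∧ _ ∧ _)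
    refine and_congr_right fun hw => and_congr_right fun hwn => ?_
    rw [Set.mem_union, not_or] at hwn
    rcases hu with hu | hu
    · exact lam_rel h.1 hu hw hwn.1
    · exact lam_rel h.2 hu hw hwn.2
  · have hv : v ∉ A ∪ B := fun hv => hu (hv.imp (lam_mem h.1).2 (lam_mem h.2).2)
    rw [lam_none hu, lam_none hv]

/-- Coarser labels. -/
theorem lab_coarsen {Λ Λ' : Type*} {l : V → Λ} {l' : V → Λ'} (h : ∀ u v, l u = l v → l' u = l' v)
    {m m' : Multiset (V × V)} (hm : lab l m = lab l m') : lab l' m = lab l' m' := by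
  classical
  rcases isEmpty_or_nonempty Λ' with hΛ | ⟨⟨x⟩⟩
  · have : IsEmpty V := ⟨fun v => hΛ.false (l' v)⟩
    rw [Multiset.eq_zero_of_forall_notMem (s := m) fun e _ => this.false e.1,
      Multiset.eq_zero_of_forall_notMem (s := m') fun e _ => this.false e.1]
  -- The map through which `l'` factors; its value at labels that do not occur is arbitrary.
  let g : Λ → Λ' := fun a => if h : ∃ u, l u = a then l' h.choose else x
  have hg : ∀ u ∈ Set.univ, l' u = g (l u) := fun u _ => by
    have hu : ∃ v, l v = l u := ⟨u, rfl⟩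
    simp only [g, dif_pos hu]
    exact h _ _ hu.choose_spec.symm
  rw [lab_factor (A := Set.univ) g m (fun _ _ => ⟨trivial, trivial⟩) hg,
    lab_factor (A := Set.univ) g m' (fun _ _ => ⟨trivial, trivial⟩) hg, hm]

theorem PathSys.endsIn [Inhabited V] {L : List (List V)} (h : PathSys r A L) : EndsIn A (endsOf L) := by
  intro e he
  obtain ⟨p, hp, rfl⟩ := List.mem_map.1 (Multiset.mem_coe.1 he)
  exact ⟨(h.mem _).1 (List.mem_flatten.2 ⟨p, hp, ends_fst_mem (h.ne p hp)⟩),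
    (h.mem _).1 (List.mem_flatten.2 ⟨p, hp, ends_snd_mem (h.ne p hp)⟩)⟩

/-- The two ends of a crossing edge are exchanged one after the other: the label of `b` decides its
adjacency to `c` on the other side, and then the label of `c` decides its adjacency to `b'`. This is
the hypothesis under which merges can be replayed. -/
theorem lamPair_cross (hr : ∀ u v, r u v → r v u) (hA : A ⊆ U) (hB : B ⊆ U) (hAB : Disjoint A B)
    {b b' c c' : V} (h1 : lamPair r U A B b = lamPair r U A B b')
    (h2 : lamPair r U A B c = lamPair r U A B c')
    (h : r b c ∧ ((b ∈ A ∧ c ∈ B) ∨ (b ∈ B ∧ c ∈ A))) :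
    r b' c' ∧ ((b' ∈ A ∧ c' ∈ B) ∨ (b' ∈ B ∧ c' ∈ A)) := by
  rw [lamPair, lamPair, Prod.mk.injEq] at h1 h2
  obtain ⟨hbc, ⟨hb, hc⟩ | ⟨hb, hc⟩⟩ := h
  · have hb' := (lam_mem h1.1).1 hb
    refine ⟨?_, Or.inl ⟨hb', (lam_mem h2.2).1 hc⟩⟩
    have k1 := (lam_rel h1.1 hb (hB hc) (Set.disjoint_right.1 hAB hc)).1 hbc
    exact hr _ _ ((lam_rel h2.2 hc (hA hb') (Set.disjoint_left.1 hAB hb')).1 (hr _ _ k1))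
  · have hb' := (lam_mem h1.2).1 hb
    refine ⟨?_, Or.inr ⟨hb', (lam_mem h2.1).1 hc⟩⟩
    have k1 := (lam_rel h1.2 hb (hA hc) (Set.disjoint_left.1 hAB hc)).1 hbc
    exact hr _ _ ((lam_rel h2.1 hc (hB hb') (Set.disjoint_right.1 hAB hb')).1 (hr _ _ k1))

end

/-! ## The join operation -/

/-- The vertices below a node, and the states there. -/
abbrev Entry : Type := List ℕ × List St

/-- The matching given to `trim` is maximal for the new cut. It serves as a certificate that a state
with more than twice as many paths cannot come from a Hamiltonian cycle; no maximum matching has to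
be computed. -/
def join (G : List (List Bool)) (e₁ e₂ : Entry) : Entry :=
  (e₁.1 ++ e₂.1, trim G (e₁.1 ++ e₂.1) (outside G (e₁.1 ++ e₂.1))
    (greedy (mat G) (fun u v => u == v) (e₁.1 ++ e₂.1) (outside G (e₁.1 ++ e₂.1)))
    (saturate G e₁.1 e₂.1 (combine e₁.2 e₂.2)))

/-- `G` is the symmetric adjacency matrix of a graph on its row numbers. -/
structure IsMat (G : List (List Bool)) : Prop where
  symm : ∀ u v, mat G u v = true → mat G v u = true
  lt : ∀ u v, mat G u v = true → u < G.length

section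
variable {G : List (List Bool)} {A B : List ℕ} {S S' : List St} {f : ℕ → ℕ}

/-- The label of a vertex of `A`. -/
noncomputable def lamOf (G : List (List Bool)) (A : List ℕ) : ℕ → Option (Set ℕ) :=
  lam (fun u v => mat G u v = true) {v | v < G.length} {v | v ∈ A}

/-- Every state is realized by a system of paths. -/
def Sound (G : List (List Bool)) (e : Entry) : Prop :=
  ∀ s ∈ e.2, ∃ L, PathSys (fun u v => mat G u v = true) {v | v ∈ e.1} L ∧
    lab (lamOf G e.1) (endsOf L) = lab (lamOf G e.1) (s : Multiset (ℕ × ℕ))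

/-- The traces of the cycle `f` are found. -/
def Complete (f : ℕ → ℕ) (G : List (List Bool)) (e : Entry) : Prop :=
  ∀ L, Compat f {v | v ∈ e.1} L → ∃ s ∈ e.2,
    lab (lamOf G e.1) (endsOf L) = lab (lamOf G e.1) (s : Multiset (ℕ × ℕ))

/-- `f` is a permutation of the vertices along edges. -/
structure IsTour (G : List (List Bool)) (f : ℕ → ℕ) : Prop where
  inj : Function.Injective f
  adj : ∀ u, u < G.length → mat G u (f u) = true
  surj : ∀ v, v < G.length → ∃ u, u < G.length ∧ f u = v

theorem cross_iff {u v : ℕ} : cross G A B u v = true ↔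
    mat G u v = true ∧ ((u ∈ {v | v ∈ A} ∧ v ∈ {v | v ∈ B}) ∨ (u ∈ {v | v ∈ B} ∧ v ∈ {v | v ∈ A})) := by
  simp [cross, memb_iff]

theorem setOf_append : ({v | v ∈ A ++ B} : Set ℕ) = {v | v ∈ A} ∪ {v | v ∈ B} := by
  ext; simp

theorem sameNb_iff {u v : ℕ} (hu : u ∈ A) (hv : v ∈ A) :
    sameNb G (outside G A) u v = true ↔ lamOf G A u = lamOf G A v := by
  rw [lamOf, lam_some (by exact hu), lam_some (by exact hv), Option.some_inj, sameNb,
    List.all_eq_true, Set.ext_iff]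
  simp only [mem_outside, beq_iff_eq]
  refine forall_congr' fun w => ?_
  constructor
  · intro h
    change (_ ∧ _ ∧ _) ↔ (_ ∧ _ ∧ _)
    refine and_congr_right fun h1 => and_congr_right fun h2 => ?_
    rw [h ⟨h1, h2⟩]
  · intro h h1
    have h2 : (_ ∧ _ ∧ _) ↔ (_ ∧ _ ∧ _) := h
    rw [Bool.eq_iff_iff]
    exact ⟨fun k => (h2.1 ⟨h1.1, h1.2, k⟩).2.2, fun k => (h2.2 ⟨h1.1, h1.2, k⟩).2.2⟩

theorem reprOf_spec {u : ℕ} (hu : u ∈ A) :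
    reprOf G A (outside G A) u ∈ A ∧ lamOf G A (reprOf G A (outside G A) u) = lamOf G A u := by
  have hmem : u ∈ A.filter fun v => sameNb G (outside G A) u v := by
    rw [List.mem_filter]
    exact ⟨hu, (sameNb_iff hu hu).2 rfl⟩
  obtain ⟨v, l, hl⟩ : ∃ v l, (A.filter fun v => sameNb G (outside G A) u v) = v :: l :=
    List.exists_cons_of_ne_nil (List.ne_nil_of_mem hmem)
  have hv : v ∈ A.filter fun v => sameNb G (outside G A) u v := by rw [hl]; simp
  rw [List.mem_filter] at hv
  rw [reprOf, hl, List.headD_cons]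
  exact ⟨hv.1, ((sameNb_iff hu hv.1).1 hv.2).symm⟩

theorem lab_relabel {s : St}
    (hs : EndsIn {v | v ∈ A} (s : Multiset (ℕ × ℕ))) :
    lab (lamOf G A) (relabel G A (outside G A) s : St) = lab (lamOf G A) (s : Multiset (ℕ × ℕ)) := by
  rw [relabel, lab, lab, Multiset.map_coe, Multiset.map_coe, List.map_map]
  congr 1
  refine List.map_congr_left fun e he => ?_
  have := hs e (Multiset.mem_coe.2 he)
  exact Prod.ext (reprOf_spec this.1).2 (reprOf_spec this.2).2

theorem alive_iff {A : List ℕ} {u : ℕ} :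
    alive G (outside G A) u = true ↔ ∃ w, w < G.length ∧ w ∉ A ∧ mat G u w = true := by
  simp [alive, mem_outside, and_assoc]

theorem lamOf_union {u v : ℕ} (h : lamPair (fun u v => mat G u v = true) {v | v < G.length}
    {v | v ∈ A} {v | v ∈ B} u = lamPair (fun u v => mat G u v = true) {v | v < G.length}
    {v | v ∈ A} {v | v ∈ B} v) : lamOf G (A ++ B) u = lamOf G (A ++ B) v := by
  rw [lamOf, setOf_append]; exact lam_union_of_pair h

/-- Concatenation and merging are followed with the pair labels, which determine the edges between
the two sets: a merge of stored pairs is replayed on the realizing paths. Afterwards the labels are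
coarsened to those of the union, which relabelling by representatives does not change. The realizing
paths need not end at the stored vertices, only at vertices with the same labels. -/
theorem Sound.join (hG : IsMat G) {e₁ e₂ : Entry} (h₁ : ∀ v ∈ e₁.1, v < G.length)
    (h₂ : ∀ v ∈ e₂.1, v < G.length) (hd : e₁.1.Disjoint e₂.1) (hs₁ : Sound G e₁)
    (hs₂ : Sound G e₂) : Sound G (join G e₁ e₂) := by
  have hAB : Disjoint {v | v ∈ e₁.1} {v | v ∈ e₂.1} := Set.disjoint_left.2 hd
  have hAB' : ∀ v ∈ e₁.1 ++ e₂.1, v < G.length := fun v hv =>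
    (List.mem_append.1 hv).elim (h₁ v) (h₂ v)
  let r : ℕ → ℕ → Prop := fun u v => mat G u v = true
  let l := lamPair r {v | v < G.length} {v | v ∈ e₁.1} {v | v ∈ e₂.1}
  have ht := tame_combine (S := e₁.2) (S' := e₂.2) (Q := fun s => ∃ L,
      PathSys r {v | v ∈ e₁.1 ++ e₂.1} L ∧ lab l (endsOf L) = lab l (s : Multiset (ℕ × ℕ))) (by
    intro s hs t ht
    obtain ⟨L₁, k1, k2⟩ := hs₁ s hs
    obtain ⟨L₂, k3, k4⟩ := hs₂ t ht
    refine ⟨L₁ ++ L₂, setOf_append ▸ k1.append k3 hAB, ?_⟩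
    rw [endsOf_append, lab_add, ← Multiset.coe_add, lab_add,
      lab_pair_left hAB k1.endsIn k2, lab_pair_right hAB k3.endsIn k4])
  have ht := ht.saturate (G := G) (A := e₁.1) (B := e₂.1) (by
    rintro s ⟨L, k1, k2⟩ t ht
    obtain ⟨s', k3, k4⟩ := (mem_merges ht).lift (lam := l) (fun b b' c c' hb hc h => by
      rw [cross_iff] at h ⊢
      exact lamPair_cross (r := r) hG.symm (fun v => h₁ v) (fun v => h₂ v) hAB hb hc h) k2.symm
    obtain ⟨L', k5, rfl, -⟩ := k1.merge (X := fun u v => cross G e₁.1 e₂.1 u v = true)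
      (fun u v h => (cross_iff.1 h).1) k3
    exact ⟨L', k5, k4.symm⟩)
  have ht := tame_trim (G := G) (A := e₁.1 ++ e₂.1) (O := outside G (e₁.1 ++ e₂.1))
    (M := greedy (mat G) (fun u v => u == v) (e₁.1 ++ e₂.1) (outside G (e₁.1 ++ e₂.1)))
    (I := SMWidth.saturate G e₁.1 e₂.1 (combine e₁.2 e₂.2)) (Q := fun s => ∃ L,
      PathSys r {v | v ∈ e₁.1 ++ e₂.1} L ∧
      lab (lamOf G (e₁.1 ++ e₂.1)) (endsOf L) = lab (lamOf G (e₁.1 ++ e₂.1)) (s : Multiset (ℕ × ℕ))) (by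
    intro s hs _
    obtain ⟨L, k1, k2⟩ := ht.all s hs
    have k3 := lab_coarsen (l' := lamOf G (e₁.1 ++ e₂.1)) (fun u v h => lamOf_union h) k2
    refine ⟨L, k1, ?_⟩
    rw [lab_relabel (k1.endsIn.of_lab k3), k3])
  exact ht.all

theorem PathSys.length_le {n : ℕ} {r : ℕ → ℕ → Prop} {A : Set ℕ} {L : List (List ℕ)}
    (h : PathSys r A L) (hA : ∀ v ∈ A, v < n) : L.length ≤ n := by
  have h1 := h.nodup_map (fun p => (ends p).1) fun p hp => ends_fst_mem (h.ne p hp)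
  rw [← List.length_map (f := fun p => (ends p).1), ← List.length_range (n := n)]
  refine (List.subperm_of_subset h1 fun v hv => ?_).length_le
  obtain ⟨p, hp, rfl⟩ := List.mem_map.1 hv
  exact List.mem_range.2 (hA _ ((h.mem _).1 (List.mem_flatten.2 ⟨p, hp, ends_fst_mem (h.ne p hp)⟩)))

theorem card_eq_of_lab {Λ : Type*} {l : ℕ → Λ} {m m' : Multiset (ℕ × ℕ)} (h : lab l m = lab l m') :
    Multiset.card m = Multiset.card m' := by
  simpa [lab] using congrArg Multiset.card h

/-- The trace of the tour on the union is cut into its traces on the two parts, for which states are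
known. The merges that undo the cutting are replayed on the concatenation of these states, so
`saturate` finds the result. It survives `trim`: its paths are as few as those of a trace, and its
ends have the labels of vertices where the tour passes outside. -/
theorem Complete.join (hG : IsMat G) (hf : IsTour G f) {e₁ e₂ : Entry}
    (h₁ : ∀ v ∈ e₁.1, v < G.length) (h₂ : ∀ v ∈ e₂.1, v < G.length) (hd : e₁.1.Disjoint e₂.1)
    (hs₁ : Complete f G e₁) (hs₂ : Complete f G e₂) : Complete f G (join G e₁ e₂) := by
  have hAB : Disjoint {v | v ∈ e₁.1} {v | v ∈ e₂.1} := Set.disjoint_left.2 hd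
  have hAB' : ∀ v ∈ e₁.1 ++ e₂.1, v < G.length := fun v hv =>
    (List.mem_append.1 hv).elim (h₁ v) (h₂ v)
  let r : ℕ → ℕ → Prop := fun u v => mat G u v = true
  let l := lamPair r {v | v < G.length} {v | v ∈ e₁.1} {v | v ∈ e₂.1}
  intro L hL
  have hL' : Compat f {v | v ∈ e₁.1 ++ e₂.1} L := hL
  have hLl : L.length ≤ G.length := hL'.sys.length_le hAB'
  obtain ⟨L₁, L₂, k1, k2, k3⟩ := Compat.divide (X := fun u v => cross G e₁.1 e₂.1 u v = true)
    hf.inj (setOf_append (A := e₁.1) (B := e₂.1) ▸ hL') hAB (fun u v huv h => cross_iff.2 ⟨by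
      rw [← huv]
      exact hf.adj u (h.elim (fun h => h₁ u h.1) fun h => h₂ u h.1), h⟩)
  obtain ⟨s₁, m1, m2⟩ := hs₁ L₁ k1
  obtain ⟨s₂, m3, m4⟩ := hs₂ L₂ k2
  obtain ⟨t, ht, hst⟩ := exists_mem_combine m1 m3
  have k4 : lab l (endsOf L₁ + endsOf L₂) = lab l (t : Multiset (ℕ × ℕ)) := by
    rw [← Multiset.coe_eq_coe.2 hst, ← Multiset.coe_add, lab_add, lab_add,
      lab_pair_left hAB k1.sys.endsIn m2, lab_pair_right hAB k2.sys.endsIn m4]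
  obtain ⟨t', k5, k6⟩ := Mrg.lifts (lam := l) (fun b b' c c' hb hc h => by
      rw [cross_iff] at h ⊢
      exact lamPair_cross (r := r) hG.symm (fun v => h₁ v) (fun v => h₂ v) hAB hb hc h) k4 k3
  have hlen : t.length ≤ G.length := by
    have := card_eq_of_lab k4
    rw [← endsOf_append] at this
    simp only [endsOf, Multiset.coe_card, List.length_map] at this
    rw [← this]
    exact (k1.sys.append k2.sys hAB).length_le fun v hv => hv.elim (h₁ v) (h₂ v)
  obtain ⟨s, hs, rfl⟩ := exists_mem_saturate ht hlen k5
  have k7 := lab_coarsen (l' := lamOf G (e₁.1 ++ e₂.1)) (fun u v h => lamOf_union h) k6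
  have hin := hL'.sys.endsIn
  have halive : ∀ u v, lamOf G (e₁.1 ++ e₂.1) u = lamOf G (e₁.1 ++ e₂.1) v → u ∈ e₁.1 ++ e₂.1 →
      ∀ w, w < G.length → w ∉ e₁.1 ++ e₂.1 → mat G u w = true →
      alive G (outside G (e₁.1 ++ e₂.1)) v = true := fun u v h hu w hw hw' hr =>
    alive_iff.2 ⟨w, hw, hw', (lam_rel h hu hw hw').1 hr⟩
  have hok : okState G (outside G (e₁.1 ++ e₂.1)) (greedy (mat G) (fun u v => u == v)
      (e₁.1 ++ e₂.1) (outside G (e₁.1 ++ e₂.1))) s = true := by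
    rw [okState, Bool.and_eq_true, decide_eq_true_eq, List.all_eq_true]
    constructor
    · have h1 := card_eq_of_lab k7
      simp only [endsOf, Multiset.coe_card, List.length_map] at h1
      rw [← h1]
      set M := greedy (mat G) (fun u v => u == v) (e₁.1 ++ e₂.1) (outside G (e₁.1 ++ e₂.1)) with hM
      -- By maximality the ends of the matching cover every edge by which the tour leaves the set;
      -- hence the factor 2 in `okState`.
      have := hL'.length_le hf.inj (M.map Prod.fst ++ M.map Prod.snd) (fun u hu hfu => by
        obtain ⟨-, -, -, h5⟩ := greedy_spec (r := mat G) (eq := fun u v => u == v)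
          (A := e₁.1 ++ e₂.1) (O := outside G (e₁.1 ++ e₂.1)) (by simp)
        have ha := hf.adj u (hAB' u hu)
        rw [List.mem_append, List.mem_append]
        rcases h5 u hu (f u) (mem_outside.2 ⟨hG.lt _ _ (hG.symm _ _ ha), hfu⟩) ha with h | h
        · exact Or.inl (Or.inl h)
        · exact Or.inr (Or.inr h))
      simpa using this
    · intro e he
      obtain ⟨e', he', q1, q2⟩ := exists_of_lab k7 (Multiset.mem_coe.2 he)
      obtain ⟨p, hp, rfl⟩ := List.mem_map.1 (Multiset.mem_coe.1 he')
      have hp' := hin _ he'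
      rw [Bool.and_eq_true]
      constructor
      -- The tour enters the start of a path from a vertex that lies outside, because the paths of a
      -- trace are maximal; the ends are treated alike.
      · obtain ⟨u, hu, hfu⟩ := hf.surj (ends p).1 (hAB' _ hp'.1)
        exact halive _ _ q1 hp'.1 u hu (hL'.head p hp u hfu) (hG.symm _ _ (hfu ▸ hf.adj u hu))
      · have ha := hf.adj (ends p).2 (hAB' _ hp'.2)
        exact halive _ _ q2 hp'.2 _ (hG.lt _ _ (hG.symm _ _ ha)) (hL'.last p hp) ha
  obtain ⟨s', hs', hp⟩ := exists_mem_trim (A := e₁.1 ++ e₂.1) hs hok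
  refine ⟨s', hs', k7.trans ?_⟩
  rw [← Multiset.coe_eq_coe.2 hp]
  exact (lab_relabel (hin.of_lab k7)).symm

end

/-! ## The number of states -/

/-- A bound for the number of states at a join. -/
def stBound (n k : ℕ) : ℕ := (n + 2) ^ 4 * (4 ^ (k + 2) + 1) ^ (4 * k)

/-- Entries with few states. -/
structure Fine (n k : ℕ) (e : Entry) : Prop where
  nodup : e.1.Nodup
  lt : ∀ v ∈ e.1, v < n
  pairwise : e.2.Pairwise fun s t => ¬ s.Perm t
  len : ∀ s ∈ e.2, s.length ≤ e.1.length
  reps : ∃ R : Finset ℕ, (∀ v ∈ R, v ∈ e.1) ∧ (∀ s ∈ e.2, ∀ p ∈ s, p.1 ∈ R ∧ p.2 ∈ R) ∧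
    (R.card ≤ 1 ∨ R.card ≤ 2 ^ (k + 1) ∧ ∀ s ∈ e.2, s.length ≤ 2 * k)

theorem length_le_of_nodup {l : List ℕ} {n : ℕ} (h : l.Nodup) (hl : ∀ v ∈ l, v < n) :
    l.length ≤ n := by
  rw [← List.length_range (n := n)]
  exact (List.subperm_of_subset h fun v hv => List.mem_range.2 (hl v hv)).length_le

/-- With a single representative only one pair is possible, so a state is determined by its length.
Otherwise a state consists of at most `2k` out of at most `4 ^ (k + 1)` pairs. -/
theorem Fine.length_le {n k : ℕ} {e : Entry} (h : Fine n k e) :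
    e.2.length ≤ (n + 1) * (4 ^ (k + 1) + 1) ^ (2 * k) := by
  classical
  obtain ⟨R, -, h2, h3⟩ := h.reps
  have hn : ∀ s ∈ e.2, s.length ≤ n := fun s hs =>
    (h.len s hs).trans (length_le_of_nodup h.nodup h.lt)
  rcases h3 with h3 | ⟨h3, h4⟩
  · refine (length_le_of_pairwise (R ×ˢ R) (R ×ˢ R) n 0 e.2 h.pairwise fun s hs =>
      ⟨hn s hs, fun p hp => Finset.mem_product.2 (h2 s hs p hp), ?_⟩).trans ?_
    · rw [Nat.le_zero, List.length_eq_zero_iff, List.filter_eq_nil_iff]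
      intro p hp
      simpa using h2 s hs p hp
    · rw [pow_zero, mul_one, Finset.card_product]
      refine (Nat.pow_le_pow_right (by omega) (Nat.mul_le_mul h3 h3)).trans ?_
      rw [mul_one, pow_one]
      exact Nat.le_mul_of_pos_right _ (by positivity)
  · refine (length_le_of_pairwise (R ×ˢ R) ∅ n (2 * k) e.2 h.pairwise fun s hs =>
      ⟨hn s hs, fun p hp => Finset.mem_product.2 (h2 s hs p hp),
        List.length_filter_le _ _ |>.trans (h4 s hs)⟩).trans ?_
    rw [Finset.card_empty, pow_zero, Finset.card_product]
    refine Nat.mul_le_mul (by omega) (Nat.pow_le_pow_left (Nat.succ_le_succ ?_) _)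
    refine (Nat.mul_le_mul h3 h3).trans_eq ?_
    rw [← mul_pow]; norm_num

/-- The number of starts and ends outside `Z`. -/
def outCount (Z : Finset ℕ) (s : Multiset (ℕ × ℕ)) : ℕ :=
  s.countP (fun p => p.1 ∉ Z) + s.countP (fun p => p.2 ∉ Z)

/-- The states that come up at a join. -/
structure Mid (n k : ℕ) (R Z : Finset ℕ) (s : St) : Prop where
  len : s.length ≤ n
  mem : ∀ p ∈ s, p.1 ∈ R ∧ p.2 ∈ R
  out : outCount Z s ≤ 4 * k ∨ s.length ≤ 4 * k

/-- A merge deletes one end and one start and keeps all the others, so neither the length nor the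
number of ends outside `Z` can grow. -/
theorem Mid.merges {n k : ℕ} {R Z : Finset ℕ} {s t : St} {G : List (List Bool)} {A B : List ℕ}
    (h : Mid n k R Z s) (ht : t ∈ merges G A B s) : Mid n k R Z t := by
  obtain ⟨a, b, c, d, u, h1, -, h2⟩ := mem_merges ht
  have l1 := congrArg Multiset.card h1
  have l2 := congrArg Multiset.card h2
  simp only [Multiset.coe_card, Multiset.card_cons] at l1 l2
  have hlt : t.length ≤ s.length := by omega
  have hs : ∀ p ∈ (a, b) ::ₘ (c, d) ::ₘ u, p.1 ∈ R ∧ p.2 ∈ R := fun p hp =>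
    h.mem p (Multiset.mem_coe.1 (h1 ▸ hp))
  refine ⟨hlt.trans h.len, fun p hp => ?_, h.out.imp (fun h => le_trans ?_ h) hlt.trans⟩
  · rw [← Multiset.mem_coe, h2, Multiset.mem_cons] at hp
    rcases hp with rfl | hp
    · exact ⟨(hs (a, b) (by simp)).1, (hs (c, d) (by simp)).2⟩
    · exact hs p (by simp [hp])
  · rw [outCount, outCount, h1, h2]
    simp only [Multiset.countP_cons]
    omega

/-- At most four pairs have both vertices in `Z`, and for these only the multiplicities matter,
which gives the polynomial factor. Every other pair has a start or an end outside `Z`, so there are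
at most `4k` of them, each out of at most `4 ^ (k + 2)`. -/
theorem Mid.small {n m k : ℕ} {R Z : Finset ℕ} {J : List St} (hR : R.card ≤ 2 ^ (k + 2))
    (hZ : Z.card ≤ 2) (hmn : m ≤ n) (hRn : ∀ v ∈ R, v < n) (hJ : Tame (Mid m k R Z) J) :
    Small n (stBound n k) J := by
  classical
  refine ⟨?_, fun t ht => ⟨(hJ.all t ht).len.trans hmn, fun p hp => ?_⟩⟩
  · refine (length_le_of_pairwise (R ×ˢ R) (Z ×ˢ Z) n (4 * k) J hJ.pairwise fun s hs =>
      ⟨(hJ.all s hs).len.trans hmn,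
        fun p hp => Finset.mem_product.2 ((hJ.all s hs).mem p hp), ?_⟩).trans ?_
    · rcases (hJ.all s hs).out with h | h
      · refine le_trans ?_ h
        rw [outCount, Multiset.coe_countP, Multiset.coe_countP, ← List.countP_eq_length_filter]
        induction s with
        | nil => simp
        | cons p s ih =>
          simp only [List.countP_cons, Finset.mem_product, not_and_or, decide_eq_true_eq]
          have h4 : ∀ (P Q : Prop) [Decidable P] [Decidable Q],
              (if P ∨ Q then 1 else 0) ≤ (if P then 1 else 0) + if Q then 1 else 0 := by
            intro P Q _ _
            by_cases hP : P <;> by_cases hQ : Q <;> simp [hP, hQ]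
          have h5 := h4 (p.1 ∉ Z) (p.2 ∉ Z)
          have h6 : ∀ s : St, List.countP (fun e => decide (e ∉ Z ×ˢ Z)) s ≤
              List.countP (fun p => decide (p.1 ∉ Z)) s + List.countP (fun p => decide (p.2 ∉ Z)) s := by
            intro s
            induction s with
            | nil => simp
            | cons p s ih =>
              simp only [List.countP_cons, Finset.mem_product, not_and_or, decide_eq_true_eq] at ih ⊢
              have h5 := h4 (p.1 ∉ Z) (p.2 ∉ Z)
              omega
          have h7 := h6 s
          simp only [Finset.mem_product, not_and_or] at h7
          omega
      · exact (List.length_filter_le _ _).trans h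
    · rw [stBound, Finset.card_product, Finset.card_product]
      refine Nat.mul_le_mul ?_ (Nat.pow_le_pow_left (Nat.succ_le_succ ?_) _)
      · refine (Nat.pow_le_pow_left (by omega) _).trans (Nat.pow_le_pow_right (n := n + 2) (by omega)
          (Nat.mul_le_mul hZ hZ))
      · refine (Nat.mul_le_mul hR hR).trans_eq ?_
        rw [← mul_pow]; norm_num
  · have := (hJ.all t ht).mem p hp
    exact ⟨(hRn _ this.1).le, (hRn _ this.2).le⟩

/-- `Z` collects the representatives of those sides that have at most one. Two such sides put
nothing outside `Z`; next to one such side, the other contributes at most `2k` pairs and so `4k`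
starts and ends; without such a side the states have at most `2k + 2k` pairs altogether. -/
theorem Fine.mid {n k : ℕ} {e₁ e₂ : Entry} (h₁ : Fine n k e₁) (h₂ : Fine n k e₂) :
    ∃ R Z : Finset ℕ, R.card ≤ 2 ^ (k + 2) ∧ Z.card ≤ 2 ∧ (∀ v ∈ R, v ∈ e₁.1 ++ e₂.1) ∧
      ∀ s ∈ e₁.2, ∀ t ∈ e₂.2, Mid (e₁.1 ++ e₂.1).length k R Z (s ++ t) := by
  classical
  obtain ⟨R₁, a1, a2, a3⟩ := h₁.reps
  obtain ⟨R₂, b1, b2, b3⟩ := h₂.reps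
  have hp : 1 ≤ 2 ^ (k + 1) := Nat.one_le_two_pow
  have hR : (R₁ ∪ R₂).card ≤ 2 ^ (k + 2) := by
    refine (Finset.card_union_le _ _).trans ?_
    rw [pow_succ 2 (k + 1), mul_two]
    exact Nat.add_le_add (a3.elim (fun h => h.trans hp) And.left) (b3.elim (fun h => h.trans hp) And.left)
  have key : ∀ Z : Finset ℕ, (∀ s ∈ e₁.2, ∀ t ∈ e₂.2, outCount Z (s ++ t : St) ≤ 4 * k ∨
      (s ++ t).length ≤ 4 * k) → ∀ s ∈ e₁.2, ∀ t ∈ e₂.2,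
      Mid (e₁.1 ++ e₂.1).length k (R₁ ∪ R₂) Z (s ++ t) := by
    refine fun Z hZ s hs t ht => ⟨?_, fun p hp => ?_, hZ s hs t ht⟩
    · rw [List.length_append, List.length_append]
      exact Nat.add_le_add (h₁.len s hs) (h₂.len t ht)
    · rw [Finset.mem_union, Finset.mem_union]
      exact (List.mem_append.1 hp).elim (fun h => ⟨Or.inl (a2 s hs p h).1, Or.inl (a2 s hs p h).2⟩)
        fun h => ⟨Or.inr (b2 t ht p h).1, Or.inr (b2 t ht p h).2⟩
  have hmem : ∀ v ∈ R₁ ∪ R₂, v ∈ e₁.1 ++ e₂.1 := fun v hv => List.mem_append.2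
    ((Finset.mem_union.1 hv).imp (a1 v) (b1 v))
  have zero : ∀ (Z R : Finset ℕ) (s : St), R ⊆ Z → (∀ p ∈ s, p.1 ∈ R ∧ p.2 ∈ R) →
      outCount Z s = 0 := by
    intro Z R s hZ hs
    rw [outCount, Multiset.countP_eq_zero.2, Multiset.countP_eq_zero.2]
    · exact fun p hp => not_not.2 (hZ (hs p (Multiset.mem_coe.1 hp)).2)
    · exact fun p hp => not_not.2 (hZ (hs p (Multiset.mem_coe.1 hp)).1)
  have two : ∀ (Z : Finset ℕ) (s : St), outCount Z s ≤ 2 * s.length := by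
    intro Z s
    have h1 := Multiset.countP_le_card (fun p : ℕ × ℕ => p.1 ∉ Z) (s : Multiset (ℕ × ℕ))
    have h2 := Multiset.countP_le_card (fun p : ℕ × ℕ => p.2 ∉ Z) (s : Multiset (ℕ × ℕ))
    rw [Multiset.coe_card] at h1 h2
    rw [outCount]; omega
  have add : ∀ (Z : Finset ℕ) (s t : St), outCount Z (s ++ t : St) = outCount Z s + outCount Z t := by
    intro Z s t
    rw [outCount, outCount, outCount, ← Multiset.coe_add, Multiset.countP_add, Multiset.countP_add]
    omega
  rcases a3 with a3 | ⟨-, a3⟩ <;> rcases b3 with b3 | ⟨-, b3⟩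
  · refine ⟨R₁ ∪ R₂, R₁ ∪ R₂, hR, (Finset.card_union_le _ _).trans (by omega), hmem, key _ ?_⟩
    intro s hs t ht
    rw [add, zero _ _ s Finset.subset_union_left (a2 s hs),
      zero _ _ t Finset.subset_union_right (b2 t ht)]
    omega
  · refine ⟨R₁ ∪ R₂, R₁, hR, by omega, hmem, key _ fun s hs t ht => ?_⟩
    rw [add, zero _ _ s (Finset.Subset.refl _) (a2 s hs)]
    have := two R₁ t
    have := b3 t ht
    omega
  · refine ⟨R₁ ∪ R₂, R₂, hR, by omega, hmem, key _ fun s hs t ht => ?_⟩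
    rw [add, zero _ _ t (Finset.Subset.refl _) (b2 t ht)]
    have := two R₂ s
    have := a3 s hs
    omega
  · refine ⟨R₁ ∪ R₂, ∅, hR, by simp, hmem, key _ fun s hs t ht => ?_⟩
    have := a3 s hs
    have := b3 t ht
    rw [List.length_append]
    omega

/-- `combine` runs through all pairs of states, so their number has to respect the same bound as the
lists that arise. -/
theorem Fine.prod_le {n k : ℕ} {e₁ e₂ : Entry} (h₁ : Fine n k e₁) (h₂ : Fine n k e₂) :
    (e₁.2.length + 1) * (e₂.2.length + 1) ≤ stBound n k + 1 := by
  set x := (4 ^ (k + 1) + 1) ^ (2 * k) with hx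
  have hx1 : 1 ≤ x := Nat.one_le_pow _ _ (Nat.succ_pos _)
  have key : ∀ e : Entry, Fine n k e → e.2.length + 1 ≤ (n + 2) * x := fun e h => by
    have := h.length_le
    rw [← hx] at this
    nlinarith
  refine (Nat.mul_le_mul (key e₁ h₁) (key e₂ h₂)).trans ?_
  have hxx : x * x ≤ (4 ^ (k + 2) + 1) ^ (4 * k) := by
    rw [hx, ← pow_add, show 2 * k + 2 * k = 4 * k by ring]
    exact Nat.pow_le_pow_left (Nat.succ_le_succ (Nat.pow_le_pow_right (by omega) (by omega))) _
  calc (n + 2) * x * ((n + 2) * x) = (n + 2) ^ 2 * (x * x) := by ring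
    _ ≤ (n + 2) ^ 4 * (4 ^ (k + 2) + 1) ^ (4 * k) :=
        Nat.mul_le_mul (Nat.pow_le_pow_right (by omega) (by omega)) hxx
    _ ≤ _ := Nat.le_succ _

/-- The representative is the first member of the class in `A`, and the class depends only on the
label. It is not empty, so the default value does not matter. -/
theorem reprOf_congr {G : List (List Bool)} {A : List ℕ} {u v : ℕ} (hu : u ∈ A) (hv : v ∈ A)
    (h : lamOf G A u = lamOf G A v) : reprOf G A (outside G A) u = reprOf G A (outside G A) v := by
  have e : (A.filter fun w => sameNb G (outside G A) u w) =
      A.filter fun w => sameNb G (outside G A) v w := by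
    refine List.filter_congr fun w hw => ?_
    rw [Bool.eq_iff_iff, sameNb_iff hu hw, sameNb_iff hv hw, h]
  have hmem : u ∈ A.filter fun w => sameNb G (outside G A) u w := by
    rw [List.mem_filter]
    exact ⟨hu, (sameNb_iff hu hu).2 rfl⟩
  rw [reprOf, reprOf, ← e]
  cases hl : A.filter fun w => sameNb G (outside G A) u w with
  | nil => rw [hl] at hmem; simp at hmem
  | cons a l => rfl

theorem two_pow_add_le (k : ℕ) : 2 ^ k + k ≤ 2 ^ (k + 1) := by
  have := (Nat.lt_two_pow_self (n := k)).le
  rw [pow_succ]; omega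

/-! ### The width of a cut controls the result of a join -/

section
variable {n : ℕ} {Γ : SimpleGraph (Fin n)} {G : List (List Bool)}

/-- The matrix `G` belongs to the graph `Γ`. -/
structure IsMatOf (Γ : SimpleGraph (Fin n)) (G : List (List Bool)) : Prop where
  len : G.length = n
  adj : ∀ u v : Fin n, mat G u v = true ↔ Γ.Adj u v
  lt : ∀ u v, mat G u v = true → u < n ∧ v < n

theorem IsMatOf.isMat (h : IsMatOf Γ G) : IsMat G where
  symm u v huv := by
    obtain ⟨hu, hv⟩ := h.lt u v huv
    exact (h.adj ⟨v, hv⟩ ⟨u, hu⟩).2 ((h.adj ⟨u, hu⟩ ⟨v, hv⟩).1 huv).symm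
  lt u v huv := h.len ▸ (h.lt u v huv).1

theorem greedy_length_le (h : IsMatOf Γ G) {A : List ℕ} (hA : ∀ v ∈ A, v < n) :
    (greedy (mat G) (fun u v => u == v) A (outside G A)).length ≤ mm Γ {v | v.1 ∈ A} := by
  obtain ⟨h1, h2, h3, -⟩ := greedy_spec (r := mat G) (eq := fun u v => u == v)
    (A := A) (O := outside G A) (by simp)
  set M := greedy (mat G) (fun u v => u == v) A (outside G A)
  by_cases hn : n = 0
  · have hM0 : M = [] := List.eq_nil_iff_forall_not_mem.2 fun e he => by
      have := hA _ (h1 e he).1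
      omega
    simp [hM0]
  -- Any map to `Fin n` that is the identity on numbers below `n` would do; only such numbers occur
  -- in the matching.
  let c : ℕ → Fin n := fun u => ⟨u % n, Nat.mod_lt _ (by omega)⟩
  have hc : ∀ u, u < n → (c u).1 = u := fun u hu => Nat.mod_eq_of_lt hu
  have hM : ∀ e ∈ M, e.1 < n ∧ e.2 < n := fun e he => h.lt _ _ (h1 e he).2.2
  have := length_le_mm (G := Γ) (A := {v | v.1 ∈ A}) (M.map fun e => (c e.1, c e.2)) (by
      intro e he
      obtain ⟨e, he', rfl⟩ := List.mem_map.1 he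
      have hlt := hM e he'
      obtain ⟨k1, k2, k3⟩ := h1 e he'
      refine ⟨?_, ?_, ?_⟩
      · change (c e.1).1 ∈ A
        rwa [hc _ hlt.1]
      · change ¬ (c e.2).1 ∈ A
        rw [hc _ hlt.2]
        exact (mem_outside.1 k2).2
      · rw [← h.adj, hc _ hlt.1, hc _ hlt.2]
        exact k3) (by
      rw [List.map_map, List.Nodup, List.pairwise_map]
      rw [List.Nodup, List.pairwise_map] at h2
      refine h2.imp_of_mem fun {e e'} he he' hne hcc => hne ?_
      have := congrArg Fin.val hcc
      simpa [hc _ (hM e he).1, hc _ (hM e' he').1] using this) (by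
      rw [List.map_map, List.Nodup, List.pairwise_map]
      rw [List.Nodup, List.pairwise_map] at h3
      refine h3.imp_of_mem fun {e e'} he he' hne hcc => hne ?_
      have := congrArg Fin.val hcc
      simpa [hc _ (hM e he).2, hc _ (hM e' he').2] using this)
  simpa using this

theorem lamOf_eq_of_split (h : IsMatOf Γ G) {A : List ℕ} (hA : ∀ v ∈ A, v < n)
    (hs : IsSplit Γ {v | v.1 ∈ A}) {u v : ℕ} (hu : u ∈ A) (hv : v ∈ A)
    (hu' : alive G (outside G A) u = true) (hv' : alive G (outside G A) v = true) :
    lamOf G A u = lamOf G A v := by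
  rw [alive_iff] at hu' hv'
  have mk : ∀ (x : ℕ) (hx : x < n) (w : Fin n), w ∈ Γ.neighborSet ⟨x, hx⟩ ∩ {v | v.1 ∈ A}ᶜ ↔
      w.1 < G.length ∧ w.1 ∉ A ∧ mat G x w = true := by
    intro x hx w
    rw [Set.mem_inter_iff, SimpleGraph.mem_neighborSet, ← h.adj]
    change _ ∧ ¬ _ ↔ _
    rw [h.len]
    exact ⟨fun k => ⟨w.2, k.2, k.1⟩, fun k => ⟨k.2.2, k.2.1⟩⟩
  have hne : ∀ (x : ℕ) (hx : x < n), (∃ w, w < G.length ∧ w ∉ A ∧ mat G x w = true) →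
      (Γ.neighborSet ⟨x, hx⟩ ∩ {v | v.1 ∈ A}ᶜ).Nonempty := by
    rintro x hx ⟨w, hw, hw'⟩
    exact ⟨⟨w, h.len ▸ hw⟩, (mk x hx _).2 ⟨hw, hw'⟩⟩
  have := hs.2.2 ⟨u, hA u hu⟩ hu ⟨v, hA v hv⟩ hv (hne u _ hu') (hne v _ hv')
  rw [lamOf, lam_some (by exact hu), lam_some (by exact hv), Option.some_inj]
  ext w
  change (w < G.length ∧ w ∉ A ∧ mat G u w = true) ↔ (w < G.length ∧ w ∉ A ∧ mat G v w = true)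
  by_cases hw : w < G.length
  · have hw' : w < n := h.len ▸ hw
    have := Set.ext_iff.1 this ⟨w, hw'⟩
    rwa [mk, mk] at this
  · simp [hw]

/-- After `trim` only representatives of vertices with a neighbour outside are left. At a split
these all have the same label, hence the same representative. Otherwise the greedy matching has at
most `mm ≤ k` edges, which bounds the number of paths through `okState` and the number of labels
through `exists_labels`. -/
theorem Fine.join {k : ℕ} {e₁ e₂ : Entry} (h : IsMatOf Γ G) (h₁ : Fine n k e₁) (h₂ : Fine n k e₂)
    (hd : e₁.1.Disjoint e₂.1) (hk : sm Γ {v | v.1 ∈ e₁.1 ++ e₂.1} ≤ k) :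
    Fine n k (join G e₁ e₂) := by
  classical
  obtain ⟨R, Z, r1, r2, r3, r4⟩ := h₁.mid h₂
  set A := e₁.1 ++ e₂.1 with hAdef
  set M := greedy (mat G) (fun u v => u == v) A (outside G A) with hM
  have hA : ∀ v ∈ A, v < n := fun v hv => (List.mem_append.1 hv).elim (h₁.lt v) (h₂.lt v)
  have hAn : A.Nodup := h₁.nodup.append h₂.nodup hd
  have ht := (tame_combine (Q := Mid A.length k R Z) r4).saturate (G := G) (A := e₁.1) (B := e₂.1)
    fun s hs t ht => hs.merges ht
  let R' : Finset ℕ := ((A.filter fun u => alive G (outside G A) u).map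
    (reprOf G A (outside G A))).toFinset
  have hR' : ∀ v, v ∈ R' ↔ ∃ u ∈ A, alive G (outside G A) u = true ∧ reprOf G A (outside G A) u = v := by
    intro v
    simp only [R', List.mem_toFinset, List.mem_map, List.mem_filter, and_assoc]
  have ht := tame_trim (G := G) (A := A) (O := outside G A) (M := M)
    (I := saturate G e₁.1 e₂.1 (combine e₁.2 e₂.2)) (Q := fun s => s.length ≤ A.length ∧
      (∀ p ∈ s, p.1 ∈ R' ∧ p.2 ∈ R') ∧ s.length ≤ 2 * M.length) (by
    intro s hs hok
    have hm := ht.all s hs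
    rw [okState, Bool.and_eq_true, decide_eq_true_eq, List.all_eq_true] at hok
    refine ⟨by simpa [relabel] using hm.len, fun p hp => ?_, ?_⟩
    · obtain ⟨e, he, rfl⟩ := List.mem_map.1 hp
      have h1 := hm.mem e he
      have h2 := hok.2 e he
      rw [Bool.and_eq_true] at h2
      exact ⟨(hR' _).2 ⟨_, r3 _ h1.1, h2.1, rfl⟩, (hR' _).2 ⟨_, r3 _ h1.2, h2.2, rfl⟩⟩
    · have := hok.1
      rw [List.length_append] at this
      simp only [relabel, List.length_map]
      omega)
  refine ⟨hAn, hA, ht.pairwise, fun s hs => (ht.all s hs).1, R', fun v hv => ?_,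
    fun s hs => (ht.all s hs).2.1, ?_⟩
  · obtain ⟨u, hu, -, rfl⟩ := (hR' v).1 hv
    exact (reprOf_spec hu).1
  · by_cases hsp : IsSplit Γ {v | v.1 ∈ A}
    · refine Or.inl (Finset.card_le_one.2 fun v hv v' hv' => ?_)
      obtain ⟨u, hu, hu', rfl⟩ := (hR' v).1 hv
      obtain ⟨w, hw, hw', rfl⟩ := (hR' v').1 hv'
      exact reprOf_congr hu hw (lamOf_eq_of_split h hA hsp hu hw hu' hw')
    · rw [sm, if_neg hsp] at hk
      have hMk : M.length ≤ k := (greedy_length_le h hA).trans hk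
      refine Or.inr ⟨?_, fun s hs => (ht.all s hs).2.2.trans (by omega)⟩
      obtain ⟨T, hT, hT'⟩ := exists_labels (r := fun u v => mat G u v = true)
        (A := {v | v ∈ A}) (O := {v | v ∈ outside G A}) M (by
          obtain ⟨-, -, -, h5⟩ := greedy_spec (r := mat G) (eq := fun u v => u == v)
            (A := A) (O := outside G A) (by simp)
          exact h5)
      have h1 : T.card ≤ 2 ^ (k + 1) := by
        refine hT.trans (le_trans ?_ (two_pow_add_le k))
        exact Nat.add_le_add (Nat.pow_le_pow_right (by omega) hMk) hMk
      refine le_trans ?_ h1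
      refine Finset.card_le_card_of_injOn (fun v => {w ∈ {v | v ∈ outside G A} | mat G v w = true})
        (fun v hv => ?_) ?_
      · obtain ⟨u, hu, -, rfl⟩ := (hR' v).1 hv
        exact hT' _ (reprOf_spec hu).1
      · intro v hv v' hv' hvv
        obtain ⟨u, hu, -, rfl⟩ := (hR' v).1 hv
        obtain ⟨w, hw, -, rfl⟩ := (hR' v').1 hv'
        refine reprOf_congr hu hw ?_
        rw [← (reprOf_spec hu).2, ← (reprOf_spec hw).2, lamOf,
          lam_some (by exact (reprOf_spec hu).1), lam_some (by exact (reprOf_spec hw).1),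
          Option.some_inj]
        ext x
        have := Set.ext_iff.1 hvv x
        simp only [Set.mem_ofPred_eq, mem_outside] at this ⊢
        simpa only [and_assoc] using this

end

/-! ## The algorithm -/

/-- The input: the matrices of the graph and the tree, and the leaves of the vertices. -/
abbrev Input : Type := List (List Bool) × List (List Bool) × List ℕ × Unit

/-- The entries that have been computed, with the edges of the tree that they belong to. -/
abbrev Log : Type := List ((ℕ × ℕ) × Entry)

/-- Entries of the log may contain exponentially many states, so the calculus `Sm` does not apply to
it. This and the following functions are plain folds, whose costs are computed from `foldCost`. -/
def seen (log : Log) (p : ℕ × ℕ) : Bool := log.foldl (fun b e => bif eqPair e.1 p then true else b) false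

def lookup (log : Log) (p : ℕ × ℕ) : Entry :=
  log.foldl (fun a e => bif eqPair e.1 p then e.2 else a) ([], [])

/-- The neighbours of `x` other than `y` in the tree. -/
def children (X : Input) (p : ℕ × ℕ) : List ℕ :=
  (List.range X.2.1.length).filter fun z => mat X.2.1 z p.1 && !(z == p.2)

/-- The entry of the vertices at `x` itself. -/
def own (X : Input) (x : ℕ) : Entry :=
  ((List.range X.1.length).filter fun v => X.2.2.1.getD v X.2.1.length == x,
    [((List.range X.1.length).filter fun v => X.2.2.1.getD v X.2.1.length == x).map fun v => (v, v)])

def ready (log : Log) (x : ℕ) (cs : List ℕ) : Bool :=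
  cs.foldl (fun b z => bif b then seen log (z, x) else false) true

/-- At an inner node the entry `e` is that of the empty set with the empty state, a neutral start
for the joins; at a leaf there is nothing to join. -/
def joinAll (G : List (List Bool)) (log : Log) (x : ℕ) (cs : List ℕ) (e : Entry) : Entry :=
  cs.foldl (fun a z => join G a (lookup log (z, x))) e

def step (X : Input) (log : Log) (p : ℕ × ℕ) : Log :=
  bif ready log p.1 (children X p) then
    (p, joinAll X.1 log p.1 (children X p) (own X p.1)) :: log else log

/-- As many rounds over all edges of the tree as the tree has nodes. -/
def schedule (X : Input) : List (ℕ × ℕ) :=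
  (List.range X.2.1.length).flatMap fun _ => (List.range X.2.1.length).flatMap fun x =>
    ((List.range X.2.1.length).filter fun y => mat X.2.1 x y).map fun y => (x, y)

/-- Whether the only path of the state forms a cycle with the vertex `0`. -/
def closing (G : List (List Bool)) (s : St) : Bool :=
  s.length == 1 && s.all fun e => mat G e.1 0 && mat G e.2 0

/-- The answer that is read off the entries of the edges into the leaf of the vertex `0`. -/
def answer (X : Input) (log : Log) : Bool :=
  ((List.range X.2.1.length).filter fun c => mat X.2.1 c (X.2.2.1.headD 0)).foldl
    (fun b c => (lookup log (c, X.2.2.1.headD 0)).2.foldl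
      (fun b s => bif closing X.1 s then true else b) b) false

/-- The test is needed: on two adjacent vertices the single vertex other than `0` would pass as a
path that closes up with `0`. -/
def solve (X : Input) : Bool :=
  bif decide (3 ≤ X.1.length) then answer X ((schedule X).foldl (step X) []) else false

/-! ## The cost of a join -/

theorem Cmp.ofSm {α β : Type} [Enc α] [Enc β] {f : α → β} (h : Sm f) : ∃ c, Cmp f c ∧ PB c := by
  obtain ⟨c, K, h1, h2, -⟩ := h.cost
  exact ⟨c, h1, K, h2⟩

/-- The cost of the first branch needs a bound only where the test succeeds. A step of the algorithm
uses this, as joins are under control only once all children are present. -/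
theorem Big.cond_dom {ι : Type} {D : ι → Prop} {s w a b : ι → ℕ} {p : ι → Bool}
    (ha : Big (fun i => D i ∧ p i = true) s w a) (hb : Big D s w b) :
    Big D s w (fun i => bif p i then a i else b i) := by
  obtain ⟨K, hK⟩ := ha
  obtain ⟨L, hL⟩ := hb
  refine ⟨K + L, fun i hi => ?_⟩
  dsimp only
  cases hp : p i
  · exact (hL i hi).trans (Nat.mul_le_mul_left _ (pow_mono (b := K + L) (by omega)))
  · exact (hK i ⟨hi, hp⟩).trans (Nat.mul_le_mul_left _ (pow_mono (b := K + L) (by omega)))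

theorem Big.ofPB {ι α : Type} [Enc α] {D : ι → Prop} {s w : ι → ℕ} {c : α → ℕ} (hc : PB c)
    (hw : ∀ i, 1 ≤ w i) (g : ι → α) (hg : ∀ i, D i → bd (s i) (g i)) : Big D s w fun i => c (g i) := by
  obtain ⟨K, hK⟩ := hc
  exact Big.poly hw fun i hi => hK _ _ (hg i hi)

/-- The conditions under which the cost of a join is bounded. -/
def JoinDom (s N : ℕ) (G : List (List Bool)) (e₁ e₂ : Entry) : Prop :=
  bd s G ∧ ∃ n k, n ≤ s ∧ stBound n k = N ∧ Fine n k e₁ ∧ Fine n k e₂ ∧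
    (e₁.1 ++ e₂.1).length ≤ n

theorem Fine.bd_fst {n k s : ℕ} {e : Entry} (h : Fine n k e) (hn : n ≤ s) : bd s e.1 :=
  ⟨(length_le_of_nodup h.nodup h.lt).trans hn, fun v hv => (h.lt v hv).le.trans hn⟩

theorem Fine.bd_state {n k s : ℕ} {e : Entry} (h : Fine n k e) (hn : n ≤ s) {t : St}
    (ht : t ∈ e.2) : bd s t := by
  obtain ⟨R, h1, h2, -⟩ := h.reps
  refine ⟨(h.len t ht).trans (h.bd_fst hn).1, fun p hp => ?_⟩
  have := h2 t ht p hp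
  exact ⟨(h.bd_fst hn).2 _ (h1 _ this.1), (h.bd_fst hn).2 _ (h1 _ this.2)⟩

theorem Small.mono {n s N : ℕ} {J : List St} (h : Small n N J) (hn : n ≤ s) : Small s N J :=
  ⟨h.1, fun t ht => bd_mono hn (h.2 t ht)⟩

/-- The invariant `Mid` from `Fine.mid` holds for all concatenations and is closed under merging. By
`Mid.small` it keeps every list below `N` during `combine` and `saturate`, hence also the list that
`trim` receives. -/
theorem join_cmp : ∃ c, Cmp (fun x : List (List Bool) × Entry × Entry => join x.1 x.2.1 x.2.2) c ∧
    Big (fun i : ℕ × ℕ × (List (List Bool) × Entry × Entry) =>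
      JoinDom i.1 i.2.1 i.2.2.1 i.2.2.2.1 i.2.2.2.2)
      (fun i => i.1) (fun i => (i.2.1 + 1) ^ 2) fun i => c i.2.2 := by
  have hA : Sm fun x : List (List Bool) × List ℕ × List ℕ => x.2.1 ++ x.2.2 :=
    Sm.append Sm.id.snd.fst Sm.id.snd.snd
  have hO : Sm fun x : List (List Bool) × List ℕ × List ℕ => outside x.1 (x.2.1 ++ x.2.2) :=
    Sm.outside Sm.id.fst hA
  have hM : Sm fun x : List (List Bool) × List ℕ × List ℕ =>
      greedy (mat x.1) (fun u v => u == v) (x.2.1 ++ x.2.2) (outside x.1 (x.2.1 ++ x.2.2)) :=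
    Sm.greedy Sm.id.fst hA hO
  have hX : Sm fun x : List (List Bool) × List ℕ × List ℕ => (((x.1, x.2.1 ++ x.2.2,
      outside x.1 (x.2.1 ++ x.2.2)), greedy (mat x.1) (fun u v => u == v) (x.2.1 ++ x.2.2)
        (outside x.1 (x.2.1 ++ x.2.2))) : Ctx × List (ℕ × ℕ)) :=
    Sm.pair (Sm.pair Sm.id.fst (Sm.pair hA hO)) hM
  obtain ⟨a, Ka, ha, ha', -⟩ := hA.cost
  obtain ⟨b, Kb, hb, hb', hb''⟩ := hX.cost
  obtain ⟨c, hc, hc'⟩ := combine_cmp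
  obtain ⟨d, hd, hd'⟩ := saturate_cmp
  obtain ⟨e, he, he'⟩ := trim_cmp
  let I := List (List Bool) × Entry × Entry
  let x₁ : I → List (List Bool) × List ℕ × List ℕ := fun x => (x.1, x.2.1.1, x.2.2.1)
  let x₂ : I → List St := fun x => combine x.2.1.2 x.2.2.2
  let x₃ : I → List St := fun x => saturate x.1 x.2.1.1 x.2.2.1 (combine x.2.1.2 x.2.2.2)
  let x₄ : I → Ctx × List (ℕ × ℕ) := fun x => ((x.1, x.2.1.1 ++ x.2.2.1,
      outside x.1 (x.2.1.1 ++ x.2.2.1)), greedy (mat x.1) (fun u v => u == v) (x.2.1.1 ++ x.2.2.1)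
        (outside x.1 (x.2.1.1 ++ x.2.2.1)))
  have p1 : Cmp x₁ fun _ => 20 :=
    (Cmp.id.fst.pair (Cmp.id.snd.fst.fst.pair Cmp.id.snd.snd.fst)).mono fun _ => by omega
  have p2 : Cmp x₂ fun x => c (x.2.1.2, x.2.2.2) + 20 :=
    (hc.comp (Cmp.id.snd.fst.snd.pair Cmp.id.snd.snd.snd)).mono fun x => by omega
  have p3 : Cmp x₃ fun x => d (x₁ x, x₂ x) + c (x.2.1.2, x.2.2.2) + 60 :=
    (hd.comp (p1.pair p2)).mono fun x => by simp only [x₁, x₂]; omega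
  have p4 : Cmp x₄ fun x => b (x₁ x) + 40 := (hb.comp p1).mono fun x => by omega
  have p5 : Cmp (fun x : I => x.2.1.1 ++ x.2.2.1) fun x => a (x₁ x) + 40 :=
    (ha.comp p1).mono fun x => by omega
  have p6 : Cmp (fun x : I => join x.1 x.2.1 x.2.2) fun x => a (x₁ x) + b (x₁ x) +
      c (x.2.1.2, x.2.2.2) + d (x₁ x, x₂ x) + e (x₄ x, x₃ x) + 200 :=
    (p5.pair (he.comp (p4.pair p3))).mono fun x => by omega
  refine ⟨_, p6, ?_⟩
  have hw : ∀ i : ℕ × ℕ × I, 1 ≤ (i.2.1 + 1) ^ 2 := fun i => Nat.one_le_pow _ _ (by omega)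
  have hQ : ∀ i : ℕ × ℕ × I, JoinDom i.1 i.2.1 i.2.2.1 i.2.2.2.1 i.2.2.2.2 →
      bd i.1 ((i.2.2.1, i.2.2.2.1.1, i.2.2.2.2.1) : Ctx) ∧
      ∃ Q : St → Prop, (∀ J, Tame Q J → Small i.1 i.2.1 J) ∧
      (∀ s ∈ i.2.2.2.1.2, ∀ t ∈ i.2.2.2.2.2, Q (s ++ t)) ∧
      ∀ s, Q s → ∀ t ∈ merges i.2.2.1 i.2.2.2.1.1 i.2.2.2.2.1 s, Q t := by
    rintro ⟨s, N, G, e₁, e₂⟩ ⟨hG, n, k, hn, rfl, h₁, h₂, hl⟩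
    obtain ⟨R, Z, r1, r2, r3, r4⟩ := h₁.mid h₂
    refine ⟨⟨hG, h₁.bd_fst hn, h₂.bd_fst hn⟩, _, fun J hJ => ?_, r4, fun s hs t ht => hs.merges ht⟩
    exact (Mid.small r1 r2 hl (fun v hv => (List.mem_append.1 (r3 v hv)).elim (h₁.lt v) (h₂.lt v))
      hJ).mono hn
  have q2 : Big (fun i : ℕ × ℕ × I => JoinDom i.1 i.2.1 i.2.2.1 i.2.2.2.1 i.2.2.2.2)
      (fun i => i.1) (fun i => (i.2.1 + 1) ^ 2) fun i => c (i.2.2.2.1.2, i.2.2.2.2.2) := by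
    refine hc'.comap (fun i : ℕ × ℕ × I => (i.1, i.2.1, (i.2.2.2.1.2, i.2.2.2.2.2))) fun i hi => ?_
    obtain ⟨-, Q, h1, h2, -⟩ := hQ i hi
    obtain ⟨hG, n, k, hn, hN, h₁, h₂, hl⟩ := hi
    exact ⟨Q, h1, h2, fun s hs => h₁.bd_state hn hs, fun s hs => h₂.bd_state hn hs,
      hN ▸ h₁.prod_le h₂⟩
  have q3 : Big (fun i : ℕ × ℕ × I => JoinDom i.1 i.2.1 i.2.2.1 i.2.2.2.1 i.2.2.2.2)
      (fun i => i.1) (fun i => (i.2.1 + 1) ^ 2) fun i => d ((i.2.2.1, i.2.2.2.1.1, i.2.2.2.2.1),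
        combine i.2.2.2.1.2 i.2.2.2.2.2) := by
    refine hd'.comap (fun i : ℕ × ℕ × I => (i.1, i.2.1, ((i.2.2.1, i.2.2.2.1.1, i.2.2.2.2.1),
        combine i.2.2.2.1.2 i.2.2.2.2.2))) fun i hi => ?_
    obtain ⟨h0, Q, h1, h2, h3⟩ := hQ i hi
    exact ⟨h0, Q, h1, tame_combine h2, h3⟩
  have q4 : Big (fun i : ℕ × ℕ × I => JoinDom i.1 i.2.1 i.2.2.1 i.2.2.2.1 i.2.2.2.2)
      (fun i => i.1) (fun i => (i.2.1 + 1) ^ 2) fun i => e (((i.2.2.1, i.2.2.2.1.1 ++ i.2.2.2.2.1,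
        outside i.2.2.1 (i.2.2.2.1.1 ++ i.2.2.2.2.1)), greedy (mat i.2.2.1) (fun u v => u == v)
        (i.2.2.2.1.1 ++ i.2.2.2.2.1) (outside i.2.2.1 (i.2.2.2.1.1 ++ i.2.2.2.2.1))),
        saturate i.2.2.1 i.2.2.2.1.1 i.2.2.2.2.1 (combine i.2.2.2.1.2 i.2.2.2.2.2)) := by
    refine (he'.comap (fun i : ℕ × ℕ × I => ((i.1 + 2) ^ (Kb + 1), i.2.1, (((i.2.2.1,
        i.2.2.2.1.1 ++ i.2.2.2.2.1, outside i.2.2.1 (i.2.2.2.1.1 ++ i.2.2.2.2.1)),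
        greedy (mat i.2.2.1) (fun u v => u == v) (i.2.2.2.1.1 ++ i.2.2.2.2.1)
        (outside i.2.2.1 (i.2.2.2.1.1 ++ i.2.2.2.2.1))),
        saturate i.2.2.1 i.2.2.2.1.1 i.2.2.2.2.1 (combine i.2.2.2.1.2 i.2.2.2.2.2))))
        fun i hi => ?_).base
    obtain ⟨h0, Q, h1, h2, h3⟩ := hQ i hi
    exact ⟨bd_mono (pow_mono (by omega)) (hb'' _ _ h0),
      (h1 _ ((tame_combine h2).saturate h3)).mono (le_pow_one _ (by omega))⟩
  refine Big.add (Big.add (Big.add (Big.add (Big.add ?_ ?_) q2) q3) q4) (Big.const hw _)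
  · exact Big.poly hw fun i hi => ha' _ _ (hQ i hi).1
  · exact Big.poly hw fun i hi => hb' _ _ (hQ i hi).1

/-! ## The cost of the algorithm -/

theorem Big.fold_poly {ι α β γ : Type} {D : ι → Prop} {s w : ι → ℕ} {f : γ → β → α → β}
    {c : γ × β × α → ℕ} {x : ι → γ} {l : ι → List α} {b : ι → β} (K : ℕ) (hw : ∀ i, 1 ≤ w i)
    (hl : ∀ i, D i → (l i).length ≤ (s i + 2) ^ K)
    (h : Big (fun j : ι × List α × α => D j.1 ∧ ∃ l₂, l j.1 = j.2.1 ++ j.2.2 :: l₂)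
      (fun j => s j.1) (fun j => w j.1)
      (fun j => c (x j.1, j.2.1.foldl (f (x j.1)) (b j.1), j.2.2))) :
    Big D s w fun i => Cmp.foldCost f c (x i) (l i) (b i) :=
  (Big.fold (w' := fun _ => 1) hw (Big.add (Big.poly (fun _ => le_rfl) hl)
    (Big.const (fun _ => le_rfl) 1)) h).weight fun i _ => (by simp)

/-- The keys of the log are bounded. -/
def LogDom (s : ℕ) (log : Log) : Prop := log.length ≤ s ∧ ∀ e ∈ log, bd s e.1

theorem LogDom.mono {s s' : ℕ} {log : Log} (h : LogDom s log) (hs : s ≤ s') : LogDom s' log :=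
  ⟨h.1.trans hs, fun e he => bd_mono hs (h.2 e he)⟩

theorem JoinDom.mono {s s' N : ℕ} {G : List (List Bool)} {e₁ e₂ : Entry} (h : JoinDom s N G e₁ e₂)
    (hs : s ≤ s') : JoinDom s' N G e₁ e₂ := by
  obtain ⟨h1, n, k, h2, h3⟩ := h
  exact ⟨bd_mono hs h1, n, k, h2.trans hs, h3⟩

theorem eqPair_cmp : ∃ c, Cmp (fun x : (ℕ × ℕ) × (ℕ × ℕ) => eqPair x.1 x.2) c ∧ PB c :=
  Cmp.ofSm (Sm.eqPair Sm.id.fst Sm.id.snd)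

/-- Only the keys are inspected, so the cost does not depend on the number of states in the entries;
the same is true of `lookup`, which hands over a pointer. -/
theorem seen_cmp : ∃ c, Cmp (fun x : Log × ℕ × ℕ => seen x.1 x.2) c ∧
    Big (fun i : ℕ × Log × ℕ × ℕ => LogDom i.1 i.2.1 ∧ bd i.1 i.2.2)
      (fun i => i.1) (fun _ => 1) fun i => c i.2 := by
  obtain ⟨c, h1, h2⟩ := eqPair_cmp
  have h3 : Cmp (fun x : (ℕ × ℕ) × Bool × ((ℕ × ℕ) × Entry) =>
      bif eqPair x.2.2.1 x.1 then true else x.2.1) fun x => c (x.2.2.1, x.1) + 40 :=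
    ((h1.comp (Cmp.id.snd.snd.fst.pair Cmp.id.fst)).cond Cmp.true' Cmp.id.snd.fst).mono fun x => by
      cases eqPair x.2.2.1 x.1 <;> simp only [cond_true, cond_false] <;> omega
  have h4 := Cmp.foldl (f := fun (p : Log × ℕ × ℕ) b (e : (ℕ × ℕ) × Entry) =>
    bif eqPair e.1 p.2 then true else b) (h3.comp (Cmp.id.fst.snd.pair (Cmp.id.snd))) Cmp.id.fst
    (Cmp.false' (α := Log × ℕ × ℕ))
  refine ⟨_, h4, ?_⟩
  have hw : ∀ i : ℕ × Log × ℕ × ℕ, 1 ≤ 1 := fun _ => le_rfl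
  have hw' : ∀ i : (ℕ × Log × ℕ × ℕ) × Log × ((ℕ × ℕ) × Entry), 1 ≤ 1 := fun _ => le_rfl
  refine Big.add (Big.add (Big.const hw _) ?_) (Big.const hw _)
  refine Big.fold_poly 1 hw (l := fun i : ℕ × Log × ℕ × ℕ => i.2.1) (b := fun _ => false) (x := fun i => i.2)
    ?_ ?_
  · exact fun i hi => hi.1.1.trans (le_pow_one _ le_rfl)
  refine Big.add (Big.add (Big.const hw' _) (Big.add ?_ (Big.const hw' _))) (Big.const hw' _)
  refine Big.ofPB h2 hw' (fun i : (ℕ × Log × ℕ × ℕ) × Log × ((ℕ × ℕ) × Entry) => (i.2.2.1, i.1.2.2)) ?_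
  rintro ⟨i, l₁, e⟩ ⟨⟨h5, h6⟩, l₂, h7⟩
  exact ⟨h5.2 e (by simp only at h7; rw [h7]; simp), h6⟩

theorem lookup_cmp : ∃ c, Cmp (fun x : Log × ℕ × ℕ => lookup x.1 x.2) c ∧
    Big (fun i : ℕ × Log × ℕ × ℕ => LogDom i.1 i.2.1 ∧ bd i.1 i.2.2)
      (fun i => i.1) (fun _ => 1) fun i => c i.2 := by
  obtain ⟨c, h1, h2⟩ := eqPair_cmp
  have h3 : Cmp (fun x : (ℕ × ℕ) × Entry × ((ℕ × ℕ) × Entry) =>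
      bif eqPair x.2.2.1 x.1 then x.2.2.2 else x.2.1) fun x => c (x.2.2.1, x.1) + 40 :=
    ((h1.comp (Cmp.id.snd.snd.fst.pair Cmp.id.fst)).cond Cmp.id.snd.snd.snd Cmp.id.snd.fst).mono
    fun x => by
      cases eqPair x.2.2.1 x.1 <;> simp only [cond_true, cond_false] <;> omega
  have h4 := Cmp.foldl (f := fun (p : Log × ℕ × ℕ) (a : Entry) (e : (ℕ × ℕ) × Entry) =>
    bif eqPair e.1 p.2 then e.2 else a) (h3.comp (Cmp.id.fst.snd.pair (Cmp.id.snd))) Cmp.id.fst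
    ((Cmp.nil (α := Log × ℕ × ℕ)).pair Cmp.nil)
  refine ⟨_, h4, ?_⟩
  have hw : ∀ i : ℕ × Log × ℕ × ℕ, 1 ≤ 1 := fun _ => le_rfl
  have hw' : ∀ i : (ℕ × Log × ℕ × ℕ) × Log × ((ℕ × ℕ) × Entry), 1 ≤ 1 := fun _ => le_rfl
  refine Big.add (Big.add (Big.const hw _) ?_) (Big.const hw _)
  refine Big.fold_poly 1 hw (l := fun i : ℕ × Log × ℕ × ℕ => i.2.1) (b := fun _ => ([], [])) (x := fun i => i.2)
    ?_ ?_
  · exact fun i hi => hi.1.1.trans (le_pow_one _ le_rfl)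
  refine Big.add (Big.add (Big.const hw' _) (Big.add ?_ (Big.const hw' _))) (Big.const hw' _)
  refine Big.ofPB h2 hw' (fun i : (ℕ × Log × ℕ × ℕ) × Log × ((ℕ × ℕ) × Entry) => (i.2.2.1, i.1.2.2)) ?_
  rintro ⟨i, l₁, e⟩ ⟨⟨h5, h6⟩, l₂, h7⟩
  exact ⟨h5.2 e (by simp only at h7; rw [h7]; simp), h6⟩

theorem ready_cmp : ∃ c, Cmp (fun x : Log × ℕ × List ℕ => ready x.1 x.2.1 x.2.2) c ∧
    Big (fun i : ℕ × Log × ℕ × List ℕ => LogDom i.1 i.2.1 ∧ bd i.1 i.2.2)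
      (fun i => i.1) (fun _ => 1) fun i => c i.2 := by
  obtain ⟨c, h1, h2⟩ := seen_cmp
  have h3 : Cmp (fun x : (Log × ℕ × List ℕ) × Bool × ℕ =>
      bif x.2.1 then seen x.1.1 (x.2.2, x.1.2.1) else false) fun x =>
        c (x.1.1, (x.2.2, x.1.2.1)) + 40 :=
    (Cmp.cond Cmp.id.snd.fst (h1.comp (Cmp.id.fst.fst.pair (Cmp.id.snd.snd.pair Cmp.id.fst.snd.fst)))
      Cmp.false').mono fun x => by
        cases x.2.1 <;> simp only [cond_true, cond_false] <;> omega
  have h4 := Cmp.foldl (f := fun (p : Log × ℕ × List ℕ) (b : Bool) z =>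
    bif b then seen p.1 (z, p.2.1) else false) h3 Cmp.id.snd.snd
    (Cmp.true' (α := Log × ℕ × List ℕ))
  refine ⟨_, h4, ?_⟩
  have hw : ∀ i : ℕ × Log × ℕ × List ℕ, 1 ≤ 1 := fun _ => le_rfl
  have hw' : ∀ i : (ℕ × Log × ℕ × List ℕ) × List ℕ × ℕ, 1 ≤ 1 := fun _ => le_rfl
  refine Big.add (Big.add (Big.const hw _) ?_) (Big.const hw _)
  refine Big.fold_poly 1 hw (l := fun i : ℕ × Log × ℕ × List ℕ => i.2.2.2)
    (b := fun _ => true) (x := fun i => i.2)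
    ?_ ?_
  · exact fun i hi => hi.2.2.1.trans (le_pow_one _ le_rfl)
  refine Big.add ?_ (Big.const hw' _)
  refine h2.comap (fun i : (ℕ × Log × ℕ × List ℕ) × List ℕ × ℕ =>
    (i.1.1, (i.1.2.1, (i.2.2, i.1.2.2.1)))) ?_
  rintro ⟨i, l₁, e⟩ ⟨⟨h5, h6⟩, l₂, h7⟩
  exact ⟨h5, h6.2.2 e (by simp only at h7; rw [h7]; simp), h6.1⟩

theorem joinAll_cmp : ∃ c, Cmp (fun x : (List (List Bool) × Log × ℕ) × List ℕ × Entry =>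
      joinAll x.1.1 x.1.2.1 x.1.2.2 x.2.1 x.2.2) c ∧
    Big (fun i : ℕ × ℕ × ((List (List Bool) × Log × ℕ) × List ℕ × Entry) => LogDom i.1 i.2.2.1.2.1 ∧
      bd i.1 i.2.2.1.2.2 ∧ bd i.1 i.2.2.2.1 ∧ ∀ l₁ z l₂, i.2.2.2.1 = l₁ ++ z :: l₂ →
        JoinDom i.1 i.2.1 i.2.2.1.1 (joinAll i.2.2.1.1 i.2.2.1.2.1 i.2.2.1.2.2 l₁ i.2.2.2.2)
          (lookup i.2.2.1.2.1 (z, i.2.2.1.2.2)))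
      (fun i => i.1) (fun i => (i.2.1 + 1) ^ 2) fun i => c i.2.2 := by
  obtain ⟨c, h1, h2⟩ := lookup_cmp
  obtain ⟨d, h3, h4⟩ := join_cmp
  have h5 : Cmp (fun x : (List (List Bool) × Log × ℕ) × Entry × ℕ =>
      join x.1.1 x.2.1 (lookup x.1.2.1 (x.2.2, x.1.2.2))) fun x =>
        c (x.1.2.1, (x.2.2, x.1.2.2)) + d (x.1.1, x.2.1, lookup x.1.2.1 (x.2.2, x.1.2.2)) + 60 :=
    (h3.comp (Cmp.id.fst.fst.pair (Cmp.id.snd.fst.pair (h1.comp (Cmp.id.fst.snd.fst.pair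
      (Cmp.id.snd.snd.pair Cmp.id.fst.snd.snd)))))).mono fun x => by dsimp only; omega
  have h6 := Cmp.foldlAux (f := fun (x : List (List Bool) × Log × ℕ) (a : Entry) (z : ℕ) =>
    join x.1 a (lookup x.2.1 (z, x.2.2))) h5
  refine ⟨_, h6, ?_⟩
  have hw : ∀ i : ℕ × ℕ × ((List (List Bool) × Log × ℕ) × List ℕ × Entry), 1 ≤ (i.2.1 + 1) ^ 2 :=
    fun i => Nat.one_le_pow _ _ (by omega)
  have hw' : ∀ i : (ℕ × ℕ × ((List (List Bool) × Log × ℕ) × List ℕ × Entry)) × List ℕ × ℕ,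
    1 ≤ (i.1.2.1 + 1) ^ 2 := fun i => Nat.one_le_pow _ _ (by omega)
  refine Big.fold_poly 1 hw
    (l := fun i : ℕ × ℕ × ((List (List Bool) × Log × ℕ) × List ℕ × Entry) => i.2.2.2.1)
    (b := fun i => i.2.2.2.2) (x := fun i => i.2.2.1)
    ?_ ?_
  · exact fun i hi => hi.2.2.1.1.trans (le_pow_one _ le_rfl)
  refine Big.add (Big.add ?_ ?_) (Big.const hw' _)
  · refine (h2.comap (fun i : (ℕ × ℕ × ((List (List Bool) × Log × ℕ) × List ℕ × Entry)) × List ℕ × ℕ =>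
      (i.1.1, (i.1.2.2.1.2.1, (i.2.2, i.1.2.2.1.2.2)))) ?_).weight fun i _ => hw' i
    rintro ⟨i, l₁, e⟩ ⟨⟨h5, h6, h8, -⟩, l₂, h7⟩
    exact ⟨h5, h8.2 e (by simp only at h7; rw [h7]; simp), h6⟩
  · refine h4.comap (fun i : (ℕ × ℕ × ((List (List Bool) × Log × ℕ) × List ℕ × Entry)) × List ℕ × ℕ =>
      (i.1.1, i.1.2.1, (i.1.2.2.1.1, joinAll i.1.2.2.1.1 i.1.2.2.1.2.1 i.1.2.2.1.2.2 i.2.1 i.1.2.2.2.2,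
        lookup i.1.2.2.1.2.1 (i.2.2, i.1.2.2.1.2.2)))) ?_
    rintro ⟨i, l₁, e⟩ ⟨⟨-, -, -, h5⟩, l₂, h7⟩
    exact h5 l₁ e l₂ h7

section
variable {α : Type} [Enc α] {X : α → Input} {p : α → ℕ × ℕ} {x : α → ℕ}

theorem Sm.children (hX : Sm X) (hp : Sm p) : Sm fun a => children (X a) (p a) := by
  have h1 : Sm fun y : α × ℕ => SMWidth.mat (X y.1).2.1 y.2 (p y.1).1 :=
    Sm.mat (hX.comp Sm.id.fst).snd.fst Sm.id.snd (hp.comp Sm.id.fst).fst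
  have h2 : Sm fun y : α × ℕ => !(y.2 == (p y.1).2) :=
    (Sm.eqNat Sm.id.snd (hp.comp Sm.id.fst).snd).not'
  unfold SMWidth.children
  exact Sm.filter (Sm.range hX.snd.fst.length)
    (p := fun a z => SMWidth.mat (X a).2.1 z (p a).1 && !(z == (p a).2)) (Sm.and' h1 h2)

theorem Sm.own (hX : Sm X) (hx : Sm x) : Sm fun a => own (X a) (x a) := by
  have h1 : Sm fun y : α × ℕ => (X y.1).2.2.1.getD y.2 (X y.1).2.1.length :=
    Sm.getD (hX.comp Sm.id.fst).snd.snd.fst Sm.id.snd (hX.comp Sm.id.fst).snd.fst.length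
  have h2 : Sm fun a => (List.range (X a).1.length).filter fun v =>
      (X a).2.2.1.getD v (X a).2.1.length == x a :=
    Sm.filter (Sm.range hX.fst.length)
      (p := fun a v => (X a).2.2.1.getD v (X a).2.1.length == x a)
      (Sm.eqNat h1 (hx.comp Sm.id.fst))
  unfold SMWidth.own
  exact Sm.pair h2 (Sm.consList (Sm.map h2 (g := fun _ v => (v, v)) (Sm.pair Sm.id.snd Sm.id.snd)) Sm.nil)

theorem Sm.schedule (hX : Sm X) : Sm fun a => schedule (X a) := by
  have hr : ∀ {β : Type} [Enc β] (g : β → α) (hg : Sm g), Sm fun y => List.range (X (g y)).2.1.length :=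
    fun g hg => Sm.range (hX.comp hg).snd.fst.length
  have h1 : Sm fun y : ((α × ℕ) × ℕ) × ℕ => SMWidth.mat (X y.1.1.1).2.1 y.1.2 y.2 :=
    Sm.mat (hX.comp Sm.id.fst.fst.fst).snd.fst Sm.id.fst.snd Sm.id.snd
  have h2 : Sm fun y : (α × ℕ) × ℕ => ((List.range (X y.1.1).2.1.length).filter
      fun z => SMWidth.mat (X y.1.1).2.1 y.2 z).map fun z => (y.2, z) :=
    Sm.map (Sm.filter (hr _ Sm.id.fst.fst) h1) (g := fun (y : (α × ℕ) × ℕ) z => (y.2, z))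
      (Sm.pair Sm.id.fst.snd Sm.id.snd)
  have h3 : Sm fun y : α × ℕ => (List.range (X y.1).2.1.length).flatMap fun x =>
      ((List.range (X y.1).2.1.length).filter
      fun z => SMWidth.mat (X y.1).2.1 x z).map fun z => (x, z) := Sm.flatMap (hr _ Sm.id.fst) h2
  unfold SMWidth.schedule
  exact Sm.flatMap (hr _ Sm.id) h3

theorem Sm.closing {G : α → List (List Bool)} {s : α → St} (hG : Sm G) (hs : Sm s) :
    Sm fun a => closing (G a) (s a) := by
  have h1 : Sm fun y : α × ℕ × ℕ => SMWidth.mat (G y.1) y.2.1 0 :=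
    Sm.mat (hG.comp Sm.id.fst) Sm.id.snd.fst Sm.zero
  have h2 : Sm fun y : α × ℕ × ℕ => SMWidth.mat (G y.1) y.2.2 0 :=
    Sm.mat (hG.comp Sm.id.fst) Sm.id.snd.snd Sm.zero
  unfold SMWidth.closing
  exact Sm.and' (Sm.eqNat hs.length Sm.zero.succ)
    (Sm.all hs (p := fun a e => SMWidth.mat (G a) e.1 0 && SMWidth.mat (G a) e.2 0) (Sm.and' h1 h2))

end

/-- The conditions under which the cost of a step is bounded. -/
def StepDom (s N : ℕ) (X : Input) (log : Log) (p : ℕ × ℕ) : Prop :=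
  ready log p.1 (children X p) = true → ∀ l₁ z l₂, children X p = l₁ ++ z :: l₂ →
    JoinDom s N X.1 (joinAll X.1 log p.1 l₁ (own X p.1)) (lookup log (z, p.1))

theorem step_cmp : ∃ c, Cmp (fun x : Input × Log × ℕ × ℕ => step x.1 x.2.1 x.2.2) c ∧
    Big (fun i : ℕ × ℕ × (Input × Log × ℕ × ℕ) => bd i.1 i.2.2.1 ∧ LogDom i.1 i.2.2.2.1 ∧
      bd i.1 i.2.2.2.2 ∧ StepDom i.1 i.2.1 i.2.2.1 i.2.2.2.1 i.2.2.2.2)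
      (fun i => i.1) (fun i => (i.2.1 + 1) ^ 2) fun i => c i.2.2 := by
  obtain ⟨a, Ka, ha, ha', ha''⟩ :=
    (Sm.children (X := fun y : Input × ℕ × ℕ => y.1) Sm.id.fst Sm.id.snd).cost
  obtain ⟨b, Kb, hb, hb', hb''⟩ :=
    (Sm.own (X := fun y : Input × ℕ × ℕ => y.1) (x := fun y => y.2.1) Sm.id.fst Sm.id.snd.fst).cost
  obtain ⟨c, hc, hc'⟩ := ready_cmp
  obtain ⟨d, hd, hd'⟩ := joinAll_cmp
  let I := Input × Log × ℕ × ℕ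
  let x₁ : I → Input × ℕ × ℕ := fun x => (x.1, x.2.2)
  let x₂ : I → List ℕ := fun x => children x.1 x.2.2
  let x₃ : I → Log × ℕ × List ℕ := fun x => (x.2.1, x.2.2.1, children x.1 x.2.2)
  let x₄ : I → (List (List Bool) × Log × ℕ) × List ℕ × Entry := fun x =>
    ((x.1.1, x.2.1, x.2.2.1), children x.1 x.2.2, own x.1 x.2.2.1)
  have p1 : Cmp x₁ fun _ => 10 := (Cmp.id.fst.pair Cmp.id.snd.snd).mono fun _ => by omega
  have p2 : Cmp x₂ fun x => a (x₁ x) + 20 := (ha.comp p1).mono fun _ => by omega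
  have p3 : Cmp x₃ fun x => a (x₁ x) + 40 :=
    (Cmp.id.snd.fst.pair (Cmp.id.snd.snd.fst.pair p2)).mono fun _ => by omega
  have p4 : Cmp x₄ fun x => a (x₁ x) + b (x₁ x) + 80 :=
    ((Cmp.id.fst.fst.pair (Cmp.id.snd.fst.pair Cmp.id.snd.snd.fst)).pair
      (p2.pair (hb.comp p1))).mono fun _ => by omega
  have p5 : Cmp (fun x : I => step x.1 x.2.1 x.2.2) fun x => a (x₁ x) + 200 + c (x₃ x) +
      bif ready x.2.1 x.2.2.1 (children x.1 x.2.2) then a (x₁ x) + b (x₁ x) + d (x₄ x) else 0 :=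
    (Cmp.cond (hc.comp p3) (Cmp.consList (Cmp.id.snd.snd.pair (hd.comp p4)) Cmp.id.snd.fst)
      Cmp.id.snd.fst).mono fun x => by
        dsimp only [x₃]
        cases ready x.2.1 x.2.2.1 (children x.1 x.2.2) <;> simp only [cond_true, cond_false] <;> omega
  refine ⟨_, p5, ?_⟩
  have hw : ∀ i : ℕ × ℕ × I, 1 ≤ (i.2.1 + 1) ^ 2 := fun i => Nat.one_le_pow _ _ (by omega)
  have q1 : ∀ i : ℕ × ℕ × I, bd i.1 i.2.2.1 ∧ LogDom i.1 i.2.2.2.1 ∧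
      bd i.1 i.2.2.2.2 ∧ StepDom i.1 i.2.1 i.2.2.1 i.2.2.2.1 i.2.2.2.2 → bd i.1 (x₁ i.2.2) :=
    fun i hi => ⟨hi.1, hi.2.2.1⟩
  refine Big.add (Big.add (Big.add ?_ (Big.const hw _)) ?_) (Big.cond_dom (Big.add (Big.add ?_ ?_) ?_)
    (Big.const hw _))
  · exact Big.poly hw fun i hi => ha' _ _ (q1 i hi)
  · refine ((hc'.comap (fun i : ℕ × ℕ × I => ((i.1 + 2) ^ (Ka + 1), x₃ i.2.2))
      fun i hi => ?_).base).weight fun i _ => hw i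
    exact ⟨hi.2.1.mono (le_pow_one _ (by omega)), bd_mono (le_pow_one _ (by omega)) hi.2.2.1.1,
      bd_mono (pow_mono (by omega)) (ha'' _ _ (q1 i hi))⟩
  · exact Big.poly hw fun i hi => ha' _ _ (q1 i hi.1)
  · exact Big.poly hw fun i hi => hb' _ _ (q1 i hi.1)
  · refine (hd'.comap (fun i : ℕ × ℕ × I => ((i.1 + 2) ^ (Ka + 1), i.2.1, x₄ i.2.2))
      fun i hi => ?_).base
    obtain ⟨hi, hr⟩ := hi
    exact ⟨hi.2.1.mono (le_pow_one _ (by omega)), bd_mono (le_pow_one _ (by omega)) hi.2.2.1.1,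
      bd_mono (pow_mono (by omega)) (ha'' _ _ (q1 i hi)),
      fun l₁ z l₂ h => (hi.2.2.2 hr l₁ z l₂ h).mono (le_pow_one _ (by omega))⟩

theorem lookup_mem (log : Log) (p : ℕ × ℕ) :
    (lookup log p = ([], []) ∧ ∀ e ∈ log, e.1 ≠ p) ∨ (p, lookup log p) ∈ log := by
  have key : ∀ (log : Log) (a : Entry), (log.foldl (fun a e => bif eqPair e.1 p then e.2 else a) a = a ∧
      ∀ e ∈ log, e.1 ≠ p) ∨ (p, log.foldl (fun a e => bif eqPair e.1 p then e.2 else a) a) ∈ log := by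
    intro log
    induction log with
    | nil => exact fun a => Or.inl ⟨rfl, by simp⟩
    | cons e log ih =>
      intro a
      rw [List.foldl_cons]
      cases he : eqPair e.1 p
      · rw [cond_false]
        refine (ih a).imp (fun h => ⟨h.1, fun e' he' => ?_⟩) (List.mem_cons_of_mem _)
        rcases List.mem_cons.1 he' with rfl | he'
        · exact fun h => by rw [eqPair_iff.2 h] at he; exact absurd he (by simp)
        · exact h.2 e' he'
      · rw [cond_true]
        rcases ih e.2 with h | h
        · rw [h.1, ← eqPair_iff.1 he]; exact Or.inr (by simp)
        · exact Or.inr (List.mem_cons_of_mem _ h)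
  exact key log ([], [])

theorem log_keys (X : Input) (l : List (ℕ × ℕ)) :
    (l.foldl (step X) []).length ≤ l.length ∧ ∀ e ∈ l.foldl (step X) [], e.1 ∈ l := by
  have key : ∀ (l : List (ℕ × ℕ)) (log : Log), (l.foldl (step X) log).length ≤ log.length + l.length ∧
      ∀ e ∈ l.foldl (step X) log, e ∈ log ∨ e.1 ∈ l := by
    intro l
    induction l with
    | nil => simp
    | cons p l ih =>
      intro log
      rw [List.foldl_cons]
      obtain ⟨h1, h2⟩ := ih (step X log p)
      have h3 : (step X log p).length ≤ log.length + 1 ∧ ∀ e ∈ step X log p, e ∈ log ∨ e.1 = p := by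
        rw [step]
        cases ready log p.1 (children X p)
        · exact ⟨by simp, fun e he => Or.inl he⟩
        · refine ⟨by simp, fun e he => ?_⟩
          rw [cond_true, List.mem_cons] at he
          rcases he with rfl | he
          · exact Or.inr rfl
          · exact Or.inl he
      refine ⟨by rw [List.length_cons]; omega, fun e he => ?_⟩
      rcases h2 e he with h | h
      · exact (h3.2 e h).imp id fun h => by rw [h]; simp
      · exact Or.inr (List.mem_cons_of_mem _ h)
  simpa using key l []

theorem table_cmp : ∃ c, Cmp (fun X : Input => (schedule X).foldl (step X) []) c ∧
    Big (fun i : ℕ × ℕ × Input => bd i.1 i.2.2 ∧ ∀ l₁ p l₂, schedule i.2.2 = l₁ ++ p :: l₂ →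
      StepDom i.1 i.2.1 i.2.2 (l₁.foldl (step i.2.2) []) p)
      (fun i => i.1) (fun i => (i.2.1 + 1) ^ 2) fun i => c i.2.2 := by
  obtain ⟨a, Ka, ha, ha', ha''⟩ := (Sm.schedule (X := fun X : Input => X) Sm.id).cost
  obtain ⟨c, hc, hc'⟩ := step_cmp
  refine ⟨_, Cmp.foldl (f := fun (X : Input) (log : Log) p => step X log p) hc ha Cmp.nil, ?_⟩
  have hw : ∀ i : ℕ × ℕ × Input, 1 ≤ (i.2.1 + 1) ^ 2 := fun i => Nat.one_le_pow _ _ (by omega)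
  refine Big.add (Big.add (Big.add ?_ (Big.const hw _)) ?_) (Big.const hw _)
  · exact Big.poly hw fun i hi => ha' _ _ hi.1
  · refine Big.fold_poly Ka hw
      (l := fun i : ℕ × ℕ × Input => schedule i.2.2) (b := fun _ => []) (x := fun i => i.2.2)
      ?_ ?_
    · exact fun i hi => (ha'' _ _ hi.1).1
    refine (hc'.comap (fun i : (ℕ × ℕ × Input) × List (ℕ × ℕ) × ℕ × ℕ =>
      ((i.1.1 + 2) ^ (Ka + 1), i.1.2.1, (i.1.2.2, i.2.1.foldl (step i.1.2.2) [], i.2.2))) ?_).base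
    rintro ⟨⟨s, N, X⟩, l₁, p⟩ ⟨⟨hX, hS⟩, l₂, hl⟩
    have hb : bd ((s + 2) ^ (Ka + 1)) (schedule X) := bd_mono (pow_mono (by omega)) (ha'' _ _ hX)
    have hl' : schedule X = l₁ ++ p :: l₂ := hl
    have hlog := log_keys X l₁
    refine ⟨bd_mono (le_pow_one _ (by omega)) hX, ⟨hlog.1.trans (le_trans ?_ hb.1), fun e he =>
      hb.2 _ ?_⟩, hb.2 p (by rw [hl']; simp), fun hr m₁ z m₂ hm =>
        (hS l₁ p l₂ hl hr m₁ z m₂ hm).mono (le_pow_one _ (by omega))⟩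
    · rw [hl', List.length_append]; omega
    · rw [hl']; exact List.mem_append_left _ (hlog.2 e he)

theorem answer_cmp : ∃ c, Cmp (fun x : Input × Log => answer x.1 x.2) c ∧
    Big (fun i : ℕ × ℕ × (Input × Log) => bd i.1 i.2.2.1 ∧ LogDom i.1 i.2.2.2 ∧
      ∀ e ∈ i.2.2.2, Small i.1 i.2.1 e.2.2)
      (fun i => i.1) (fun i => i.2.1 + 1) fun i => c i.2.2 := by
  have s1 : Sm fun x : Input => x.2.2.1.headD 0 := Sm.headD Sm.id.snd.snd.fst Sm.zero
  have s2 : Sm fun x : Input => (List.range x.2.1.length).filter fun c => mat x.2.1 c (x.2.2.1.headD 0) :=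
    Sm.filter (Sm.range Sm.id.snd.fst.length) (p := fun (x : Input) c => mat x.2.1 c (x.2.2.1.headD 0))
      (Sm.mat Sm.id.fst.snd.fst Sm.id.snd (s1.comp Sm.id.fst))
  obtain ⟨a, Ka, ha, ha', ha''⟩ := s1.cost
  obtain ⟨b, Kb, hb, hb', hb''⟩ := s2.cost
  obtain ⟨c, hc, hc'⟩ := lookup_cmp
  obtain ⟨d, hd, hd'⟩ := Cmp.ofSm (Sm.closing (G := fun y : List (List Bool) × St => y.1) Sm.id.fst Sm.id.snd)
  have p1 : Cmp (fun x : List (List Bool) × Bool × St => bif closing x.1 x.2.2 then true else x.2.1)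
      fun x => d (x.1, x.2.2) + 40 :=
    (Cmp.cond (hd.comp (Cmp.id.fst.pair Cmp.id.snd.snd)) Cmp.true' Cmp.id.snd.fst).mono fun x => by
      cases closing x.1 x.2.2 <;> simp only [cond_true, cond_false] <;> omega
  have p2 := Cmp.foldlAux (f := fun (G : List (List Bool)) (b : Bool) (s : St) =>
    bif closing G s then true else b) p1
  let x₁ : (Input × Log) × Bool × ℕ → Log × ℕ × ℕ := fun x => (x.1.2, x.2.2, x.1.1.2.2.1.headD 0)
  have p3 : Cmp x₁ fun x => a x.1.1 + 40 :=
    (Cmp.id.fst.snd.pair (Cmp.id.snd.snd.pair (ha.comp Cmp.id.fst.fst))).mono fun x => by omega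
  have p4 : Cmp (fun x : (Input × Log) × Bool × ℕ => (lookup x.1.2 (x.2.2, x.1.1.2.2.1.headD 0)).2.foldl
      (fun b s => bif closing x.1.1.1 s then true else b) x.2.1) fun x => a x.1.1 + c (x₁ x) +
      Cmp.foldCost (fun (G : List (List Bool)) (b : Bool) (s : St) => bif closing G s then true else b)
        (fun x => d (x.1, x.2.2) + 40) x.1.1.1 (lookup x.1.2 (x.2.2, x.1.1.2.2.1.headD 0)).2 x.2.1 + 100 :=
    (p2.comp (Cmp.id.fst.fst.fst.pair ((hc.comp p3).snd.pair Cmp.id.snd.fst))).mono fun x => by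
      dsimp only [x₁]; omega
  have p5 := Cmp.foldl (f := fun (x : Input × Log) (b : Bool) (c : ℕ) =>
    (lookup x.2 (c, x.1.2.2.1.headD 0)).2.foldl (fun b s => bif closing x.1.1 s then true else b) b) p4
    (hb.comp Cmp.id.fst) Cmp.false'
  refine ⟨_, p5, ?_⟩
  let I := ℕ × ℕ × (Input × Log)
  have hw : ∀ i : I, 1 ≤ i.2.1 + 1 := fun i => by omega
  have hw' : ∀ i : I × List ℕ × ℕ, 1 ≤ i.1.2.1 + 1 := fun i => by omega
  have hw1' : ∀ i : (I × List ℕ × ℕ) × List St × St, 1 ≤ 1 := fun i => le_rfl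
  refine Big.add (Big.add (Big.add (Big.add (Big.add (Big.const hw _) ?_) (Big.const hw _))
    (Big.const hw _)) ?_) (Big.const hw _)
  · exact Big.poly hw fun i hi => hb' _ _ hi.1
  · refine Big.fold_poly Kb hw
      (l := fun i : I => (List.range i.2.2.1.2.1.length).filter fun c =>
        mat i.2.2.1.2.1 c (i.2.2.1.2.2.1.headD 0)) (b := fun _ => false) (x := fun i => i.2.2)
      ?_ ?_
    · exact fun i hi => (hb'' _ _ hi.1).1
    refine Big.add (Big.add (Big.add ?_ ?_) ?_) (Big.const hw' _)
    · exact Big.poly hw' fun i hi => ha' _ _ hi.1.1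
    · refine ((hc'.comap (fun i : I × List ℕ × ℕ => ((i.1.1 + 2) ^ (Ka + Kb + 1),
        (i.1.2.2.2, i.2.2, i.1.2.2.1.2.2.1.headD 0))) ?_).base).weight fun i _ => hw' i
      rintro ⟨i, l₁, p⟩ ⟨⟨h1, h2, h3⟩, l₂, hl⟩
      refine ⟨h2.mono (le_pow_one _ (by omega)), bd_mono (pow_mono (by omega))
        ((hb'' _ _ h1).2 p (by simp only at hl; rw [hl]; simp)), bd_mono (pow_mono (by omega))
        (ha'' _ _ h1)⟩
    · have hL : ∀ i : I × List ℕ × ℕ, (bd i.1.1 i.1.2.2.1 ∧ LogDom i.1.1 i.1.2.2.2 ∧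
          ∀ e ∈ i.1.2.2.2, Small i.1.1 i.1.2.1 e.2.2) →
          Small i.1.1 i.1.2.1 (lookup i.1.2.2.2 (i.2.2, i.1.2.2.1.2.2.1.headD 0)).2 := by
        intro i hi
        rcases lookup_mem i.1.2.2.2 (i.2.2, i.1.2.2.1.2.2.1.headD 0) with h | h
        · rw [h.1]; exact ⟨by simp, by simp⟩
        · exact hi.2.2 _ h
      refine Big.weight (w := fun i => (i.1.2.1 + 1) * 1) (Big.fold (w := fun _ => 1)
        (w' := fun i => i.1.2.1 + 1) (fun _ => le_rfl)
        (l := fun i : I × List ℕ × ℕ => (lookup i.1.2.2.2 (i.2.2, i.1.2.2.1.2.2.1.headD 0)).2)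
        (b := _) (x := fun i => i.1.2.2.1.1) (Big.self.mono ?_) ?_) fun i _ => (by simp)
      · exact fun i hi => Nat.succ_le_succ (hL i hi.1).1
      refine Big.add ?_ (Big.const hw1' _)
      refine Big.ofPB hd' hw1' (fun i : (I × List ℕ × ℕ) × List St × St =>
        (i.1.1.2.2.1.1, i.2.2)) ?_
      rintro ⟨⟨i, l₁, p⟩, m₁, t⟩ ⟨⟨h1, l₂, hl⟩, m₂, hm⟩
      exact ⟨h1.1.1, (hL (i, l₁, p) h1).2 t (by simp only at hm; rw [hm]; simp)⟩

theorem solve_cmp : ∃ c, Cmp solve c ∧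
    Big (fun i : ℕ × ℕ × Input => bd i.1 i.2.2 ∧ (∀ l₁ p l₂, schedule i.2.2 = l₁ ++ p :: l₂ →
      StepDom i.1 i.2.1 i.2.2 (l₁.foldl (step i.2.2) []) p) ∧
      ∀ e ∈ (schedule i.2.2).foldl (step i.2.2) [], Small i.1 i.2.1 e.2.2)
      (fun i => i.1) (fun i => (i.2.1 + 1) ^ 2) fun i => c i.2.2 := by
  obtain ⟨Ka, ha⟩ := (Sm.schedule (X := fun X : Input => X) Sm.id).bb
  obtain ⟨b, hb, hb'⟩ := Cmp.ofSm (Sm.le (f := fun X : Input => 3) (g := fun X => X.1.length)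
    Sm.zero.succ.succ.succ Sm.id.fst.length)
  obtain ⟨c, hc, hc'⟩ := table_cmp
  obtain ⟨d, hd, hd'⟩ := answer_cmp
  have p1 : Cmp solve fun X => b X + c X + d (X, (schedule X).foldl (step X) []) + 40 :=
    (Cmp.cond hb (hd.comp (Cmp.id.pair hc)) Cmp.false').mono fun x => by
      cases decide (3 ≤ x.1.length) <;> simp only [cond_true, cond_false] <;> omega
  refine ⟨_, p1, ?_⟩
  have hw : ∀ i : ℕ × ℕ × Input, 1 ≤ (i.2.1 + 1) ^ 2 := fun i => Nat.one_le_pow _ _ (by omega)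
  refine Big.add (Big.add (Big.add ?_ ?_) ?_) (Big.const hw _)
  · exact Big.ofPB hb' hw (fun i : ℕ × ℕ × Input => i.2.2) fun i hi => hi.1
  · exact hc'.comap (fun i : ℕ × ℕ × Input => i) fun i hi => ⟨hi.1, hi.2.1⟩
  · refine ((hd'.comap (fun i : ℕ × ℕ × Input => ((i.1 + 2) ^ (Ka + 1), i.2.1,
      (i.2.2, (schedule i.2.2).foldl (step i.2.2) []))) ?_).base).weight fun i _ =>
        Nat.le_self_pow (by omega) _
    rintro ⟨s, N, X⟩ ⟨h1, -, h3⟩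
    have hb : bd ((s + 2) ^ (Ka + 1)) (schedule X) := bd_mono (pow_mono (by omega)) (ha _ _ h1)
    have hlog := log_keys X (schedule X)
    exact ⟨bd_mono (le_pow_one _ (by omega)) h1, ⟨hlog.1.trans hb.1, fun e he => hb.2 _ (hlog.2 e he)⟩,
      fun e he => (h3 e he).mono (le_pow_one _ (by omega))⟩

/-! ## Correctness of the table -/

section
variable {n : ℕ}

/-- The entry `e` describes the set `A` correctly. -/
structure Good (k : ℕ) (G : List (List Bool)) (A : Set (Fin n)) (e : Entry) : Prop where
  mem : ∀ v : Fin n, v.1 ∈ e.1 ↔ v ∈ A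
  fine : Fine n k e
  sound : Sound G e
  complete : ∀ f, IsTour G f → Complete f G e

theorem Good.disjoint {k : ℕ} {G : List (List Bool)} {A B : Set (Fin n)} {e₁ e₂ : Entry}
    (h₁ : Good k G A e₁) (h₂ : Good k G B e₂) (hAB : Disjoint A B) : e₁.1.Disjoint e₂.1 := by
  intro v hv hv'
  have hn := h₁.fine.lt v hv
  exact Set.disjoint_left.1 hAB ((h₁.mem ⟨v, hn⟩).1 hv) ((h₂.mem ⟨v, hn⟩).1 hv')

variable {k : ℕ} {Γ : SimpleGraph (Fin n)} {G : List (List Bool)}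

theorem Good.join {A B : Set (Fin n)} {e₁ e₂ : Entry} (hG : IsMatOf Γ G)
    (h₁ : Good k G A e₁) (h₂ : Good k G B e₂) (hAB : Disjoint A B) (hk : sm Γ (A ∪ B) ≤ k) :
    Good k G (A ∪ B) (join G e₁ e₂) := by
  have hd := h₁.disjoint h₂ hAB
  have hm : ∀ v : Fin n, v.1 ∈ e₁.1 ++ e₂.1 ↔ v ∈ A ∪ B := fun v => by
    rw [List.mem_append, h₁.mem, h₂.mem]; rfl
  have hs : {v : Fin n | v.1 ∈ e₁.1 ++ e₂.1} = A ∪ B := Set.ext hm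
  have l₁ : ∀ v ∈ e₁.1, v < G.length := hG.len ▸ h₁.fine.lt
  have l₂ : ∀ v ∈ e₂.1, v < G.length := hG.len ▸ h₂.fine.lt
  exact ⟨hm, h₁.fine.join hG h₂.fine hd (hs ▸ hk), h₁.sound.join hG.isMat l₁ l₂ hd h₂.sound,
    fun f hf => (h₁.complete f hf).join hG.isMat hf l₁ l₂ hd (h₂.complete f hf)⟩

theorem Good.joinDom {A B : Set (Fin n)} {e₁ e₂ : Entry} {s : ℕ} (hs : bd s G) (hn : n ≤ s)
    (h₁ : Good k G A e₁) (h₂ : Good k G B e₂) (hAB : Disjoint A B) :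
    JoinDom s (stBound n k) G e₁ e₂ :=
  ⟨hs, n, k, hn, rfl, h₁.fine, h₂.fine, length_le_of_nodup
    (h₁.fine.nodup.append h₂.fine.nodup (h₁.disjoint h₂ hAB)) fun v hv =>
      (List.mem_append.1 hv).elim (h₁.fine.lt v) (h₂.fine.lt v)⟩

/-- What the algorithm needs to know about the input: `sd x y` is the set of the vertices on the side
of `x` of the edge `xy`, `os x` is the set of the vertices at `x`, and `ht` is a height. -/
structure Decomp (k : ℕ) (Γ : SimpleGraph (Fin n)) (X : Input) (sd : ℕ → ℕ → Set (Fin n))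
    (os : ℕ → Set (Fin n)) (ht : ℕ → ℕ → ℕ) : Prop where
  isMat : IsMatOf Γ X.1
  own_iff : ∀ x (v : Fin n), v ∈ os x ↔ X.2.2.1.getD v X.2.1.length = x
  sub : ∀ x, (os x).Subsingleton
  union : ∀ x y, mat X.2.1 x y = true → sd x y = os x ∪ ⋃ z ∈ children X (x, y), sd z x
  disj_own : ∀ x y, mat X.2.1 x y = true → ∀ z ∈ children X (x, y), Disjoint (os x) (sd z x)
  disj : ∀ x y, mat X.2.1 x y = true → ∀ z ∈ children X (x, y), ∀ z' ∈ children X (x, y),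
    z ≠ z' → Disjoint (sd z x) (sd z' x)
  length : ∀ x y, mat X.2.1 x y = true → (children X (x, y)).length ≤ 2
  empty : ∀ x y, mat X.2.1 x y = true → children X (x, y) = [] ∨ os x = ∅
  lt : ∀ x y, mat X.2.1 x y = true → x < X.2.1.length ∧ y < X.2.1.length
  height : ∀ x y, mat X.2.1 x y = true → ht x y < X.2.1.length ∧
    ∀ z ∈ children X (x, y), ht z x < ht x y
  width : ∀ x y, mat X.2.1 x y = true → sm Γ (sd x y) ≤ k

variable {X : Input} {sd : ℕ → ℕ → Set (Fin n)} {os : ℕ → Set (Fin n)} {ht : ℕ → ℕ → ℕ}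

theorem mem_children {x y z : ℕ} :
    z ∈ children X (x, y) ↔ z < X.2.1.length ∧ mat X.2.1 z x = true ∧ z ≠ y := by
  simp [children]

theorem nodup_children {p : ℕ × ℕ} : (children X p).Nodup := List.nodup_range.filter _

theorem flatten_singleton {V : Type*} {L : List (List V)} {v : V} (hL : ∀ p ∈ L, p ≠ [])
    (h : L.flatten = [v]) : L = [[v]] := by
  match L with
  | [] => simp at h
  | [] :: L => exact absurd rfl (hL [] (by simp))
  | (a :: p) :: L =>
    simp only [List.flatten_cons, List.cons_append, List.cons.injEq, List.append_eq_nil_iff] at h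
    obtain ⟨rfl, rfl, h⟩ := h
    match L with
    | [] => rfl
    | p :: L =>
      rw [List.flatten_cons, List.append_eq_nil_iff] at h
      exact absurd h.1 (hL p (by simp))

/-- At most one vertex sits at a node, so the system of paths is forced: it is empty or consists of
one trivial path. The entry is of the kind with at most one representative. -/
theorem Decomp.good_own (hX : Decomp k Γ X sd os ht) (x : ℕ) : Good k X.1 (os x) (own X x) := by
  have hmem : ∀ v, v ∈ (own X x).1 ↔ ∃ h : v < n, (⟨v, h⟩ : Fin n) ∈ os x := by
    intro v
    simp only [own, List.mem_filter, List.mem_range, beq_iff_eq, hX.isMat.len, hX.own_iff]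
    exact ⟨fun h => ⟨h.1, h.2⟩, fun ⟨h, h'⟩ => ⟨h, h'⟩⟩
  have hnd : (own X x).1.Nodup := List.nodup_range.filter _
  have hcase : (own X x).1 = [] ∨ ∃ v, (own X x).1 = [v] := by
    match hl : (own X x).1 with
    | [] => exact Or.inl rfl
    | [v] => exact Or.inr ⟨v, rfl⟩
    | u :: v :: l =>
      rw [hl] at hnd hmem
      obtain ⟨hu, hu'⟩ := (hmem u).1 (by simp)
      obtain ⟨hv, hv'⟩ := (hmem v).1 (by simp)
      have := congrArg Fin.val (hX.sub x hu' hv')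
      simp only at this
      simp [this] at hnd
  have hS : (own X x).2 = [(own X x).1.map fun v => (v, v)] := rfl
  have hlt : ∀ v ∈ (own X x).1, v < n := fun v hv => ((hmem v).1 hv).1
  refine ⟨fun v => ?_, ⟨hnd, hlt, by rw [hS]; simp, by rw [hS]; simp,
    (own X x).1.toFinset, fun v hv => List.mem_toFinset.1 hv, ?_, Or.inl ?_⟩, ?_, ?_⟩
  · rw [hmem]; exact ⟨fun ⟨_, h⟩ => h, fun h => ⟨v.2, h⟩⟩
  · rw [hS]
    intro s hs p hp
    rw [List.mem_singleton.1 hs] at hp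
    obtain ⟨v, hv, rfl⟩ := List.mem_map.1 hp
    exact ⟨List.mem_toFinset.2 hv, List.mem_toFinset.2 hv⟩
  · rw [List.toFinset_card_of_nodup hnd]
    rcases hcase with h | ⟨v, h⟩ <;> simp [h]
  · intro s hs
    rw [hS, List.mem_singleton] at hs
    subst hs
    refine ⟨(own X x).1.map fun v => [v], ⟨by simp, by simp, ?_, ?_⟩, ?_⟩
    · rw [← List.flatMap_def]; simpa using hnd
    · intro v; rw [← List.flatMap_def]; simp
    · congr 1
      rw [endsOf, List.map_map]
      rfl
  · intro f hf L hL
    refine ⟨_, by rw [hS]; exact List.mem_singleton.2 rfl, ?_⟩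
    congr 1
    rcases hcase with h | ⟨v, h⟩
    · have : L = [] := List.eq_nil_iff_forall_not_mem.2 fun p hp => by
        have := (hL.sys.mem _).1 (List.mem_flatten.2 ⟨p, hp, ends_fst_mem (hL.sys.ne p hp)⟩)
        rw [h] at this
        simp at this
      rw [this, h]; rfl
    · have h1 : L.flatten.Perm [v] := (List.perm_ext_iff_of_nodup hL.sys.nodup (by simp)).2
        fun w => by rw [hL.sys.mem, h]; rfl
      rw [flatten_singleton hL.sys.ne (List.perm_singleton.1 h1), h]
      rfl

/-- All entries of the table are correct. -/
def LogOK (k : ℕ) (X : Input) (sd : ℕ → ℕ → Set (Fin n)) (log : Log) : Prop :=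
  ∀ e ∈ log, mat X.2.1 e.1.1 e.1.2 = true ∧ Good k X.1 (sd e.1.1 e.1.2) e.2

theorem seen_iff {log : Log} {p : ℕ × ℕ} : seen log p = true ↔ ∃ e ∈ log, e.1 = p := by
  have key : ∀ (log : Log) (b : Bool), log.foldl (fun b e => bif eqPair e.1 p then true else b) b = true ↔
      b = true ∨ ∃ e ∈ log, e.1 = p := by
    intro log
    induction log with
    | nil => simp
    | cons e log ih =>
      intro b
      rw [List.foldl_cons, ih]
      simp only [List.mem_cons, exists_eq_or_imp, ← eqPair_iff]
      cases eqPair e.1 p <;> simp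
  exact (key log false).trans (by simp)

theorem ready_iff {log : Log} {x : ℕ} {cs : List ℕ} :
    ready log x cs = true ↔ ∀ z ∈ cs, seen log (z, x) = true := by
  have key : ∀ (cs : List ℕ) (b : Bool),
      cs.foldl (fun b z => bif b then seen log (z, x) else false) b = true ↔
      b = true ∧ ∀ z ∈ cs, seen log (z, x) = true := by
    intro cs
    induction cs with
    | nil => simp
    | cons z cs ih =>
      intro b
      rw [List.foldl_cons, ih, List.forall_mem_cons, ← and_assoc]
      cases b <;> simp
  exact (key cs true).trans (by simp)

theorem LogOK.lookup {log : Log} (h : LogOK k X sd log) {p : ℕ × ℕ} (hp : seen log p = true) :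
    Good k X.1 (sd p.1 p.2) (lookup log p) := by
  rcases lookup_mem log p with h1 | h1
  · obtain ⟨e, he, he'⟩ := seen_iff.1 hp
    exact absurd he' (h1.2 e he)
  · exact (h _ h1).2

/-- The children are joined one after the other, so all partial unions must have small width,
although only the sides of tree edges are known to have it. The conclusion for each prefix also
supplies the hypotheses of the next join, which the bound for the cost needs as well. -/
theorem Decomp.good_prefix (hX : Decomp k Γ X sd os ht) {log : Log} (h : LogOK k X sd log) {x y : ℕ}
    (hxy : mat X.2.1 x y = true) (hr : ready log x (children X (x, y)) = true) (P : List ℕ) :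
    ∀ R, children X (x, y) = P ++ R →
      Good k X.1 (os x ∪ ⋃ z ∈ P, sd z x) (joinAll X.1 log x P (own X x)) ∧
      ∀ z R', R = z :: R' → Good k X.1 (sd z x) (lookup log (z, x)) ∧
        Disjoint (os x ∪ ⋃ z ∈ P, sd z x) (sd z x) := by
  induction P using List.reverseRecOn with
  | nil =>
    intro R hR
    refine ⟨by simpa [joinAll] using hX.good_own x, ?_⟩
    rintro z R' rfl
    have hz : z ∈ children X (x, y) := by rw [hR]; simp
    exact ⟨h.lookup (ready_iff.1 hr z hz), by simpa using hX.disj_own x y hxy z hz⟩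
  | append_singleton P z ih =>
    intro R hR
    obtain ⟨h1, h2⟩ := ih (z :: R) (by rw [hR]; simp)
    obtain ⟨h3, h4⟩ := h2 z R rfl
    have hu : (os x ∪ ⋃ w ∈ P ++ [z], sd w x) = (os x ∪ ⋃ w ∈ P, sd w x) ∪ sd z x := by
      ext v
      simp only [Set.mem_union, Set.mem_iUnion, List.mem_append, List.mem_singleton, exists_prop]
      constructor
      · rintro (h | ⟨w, h | rfl, h'⟩)
        · exact Or.inl (Or.inl h)
        · exact Or.inl (Or.inr ⟨w, h, h'⟩)
        · exact Or.inr h'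
      · rintro ((h | ⟨w, h, h'⟩) | h)
        · exact Or.inl h
        · exact Or.inr ⟨w, Or.inl h, h'⟩
        · exact Or.inr ⟨z, Or.inr rfl, h⟩
    have hz : z ∈ children X (x, y) := by rw [hR]; simp
    have hos : os x = ∅ := (hX.empty x y hxy).resolve_left (List.ne_nil_of_mem hz)
    have hk : sm Γ (os x ∪ ⋃ w ∈ P ++ [z], sd w x) ≤ k := by
      -- With an empty own set and at most two children, a partial union is the side of the first
      -- child or the whole side of `(x, y)`; anything else would require a third child.
      have hl := hX.length x y hxy
      match P, R with
      | [], R =>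
        rw [hos]
        simpa using hX.width z x (mem_children.1 hz).2.1
      | P, [] =>
        rw [List.append_nil] at hR
        rw [← hR, ← hX.union x y hxy]
        exact hX.width x y hxy
      | a :: P, b :: R =>
        rw [hR] at hl
        simp at hl
        omega
    constructor
    · have : joinAll X.1 log x (P ++ [z]) (own X x) =
          join X.1 (joinAll X.1 log x P (own X x)) (lookup log (z, x)) := by simp [joinAll]
      rw [this, hu]
      rw [hu] at hk
      exact h1.join hX.isMat h3 h4 hk
    · rintro w R' rfl
      have hw : w ∈ children X (x, y) := by rw [hR]; simp
      refine ⟨h.lookup (ready_iff.1 hr w hw), ?_⟩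
      rw [Set.disjoint_union_left, Set.disjoint_iUnion₂_left]
      refine ⟨hX.disj_own x y hxy w hw, fun u hu => hX.disj x y hxy u ?_ w hw ?_⟩
      · rw [hR]; exact List.mem_append_left _ hu
      · have := nodup_children (X := X) (p := (x, y))
        rw [hR, List.nodup_append] at this
        exact this.2.2 u hu w (by simp)

theorem Decomp.step_ok (hX : Decomp k Γ X sd os ht) {log : Log} (h : LogOK k X sd log) {p : ℕ × ℕ}
    (hp : mat X.2.1 p.1 p.2 = true) : LogOK k X sd (step X log p) := by
  rw [step]
  cases hr : ready log p.1 (children X p)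
  · exact h
  · intro e he
    rw [cond_true, List.mem_cons] at he
    rcases he with rfl | he
    · refine ⟨hp, ?_⟩
      have := (hX.good_prefix h hp hr (children X p) [] (by simp)).1
      rwa [← hX.union p.1 p.2 hp] at this
    · exact h e he

theorem Decomp.stepDom (hX : Decomp k Γ X sd os ht) {log : Log} (h : LogOK k X sd log) {p : ℕ × ℕ}
    (hp : mat X.2.1 p.1 p.2 = true) {s : ℕ} (hs : bd s X.1) (hn : n ≤ s) :
    StepDom s (stBound n k) X log p := by
  intro hr l₁ z l₂ hl
  obtain ⟨h1, h2⟩ := hX.good_prefix h hp hr l₁ (z :: l₂) hl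
  obtain ⟨h3, h4⟩ := h2 z l₂ rfl
  exact h1.joinDom hs hn h3 h4

theorem mem_schedule {p : ℕ × ℕ} (h : p ∈ schedule X) : mat X.2.1 p.1 p.2 = true := by
  simp only [schedule, List.mem_flatMap, List.mem_map, List.mem_filter] at h
  obtain ⟨-, -, x, -, y, ⟨-, h⟩, rfl⟩ := h
  exact h

theorem Decomp.foldl_ok (hX : Decomp k Γ X sd os ht) {l : List (ℕ × ℕ)}
    (hl : ∀ p ∈ l, mat X.2.1 p.1 p.2 = true) : LogOK k X sd (l.foldl (step X) []) :=
  foldl_inv (LogOK k X sd) (by simp [LogOK]) fun _ p hp h => hX.step_ok h (hl p hp)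

theorem subset_step (log : Log) (p : ℕ × ℕ) : log ⊆ step X log p := by
  rw [step]
  cases ready log p.1 (children X p)
  · exact List.Subset.refl _
  · exact List.subset_cons_self _ _

theorem subset_foldl_step (log : Log) (l : List (ℕ × ℕ)) : log ⊆ l.foldl (step X) log :=
  foldl_inv (fun l => log ⊆ l) (List.Subset.refl log) fun l p _ h => List.Subset.trans h (subset_step l p)

theorem seen_mono {log log' : Log} (h : log ⊆ log') {p : ℕ × ℕ} (hp : seen log p = true) :
    seen log' p = true := by
  obtain ⟨e, he, he'⟩ := seen_iff.1 hp
  exact seen_iff.2 ⟨e, h he, he'⟩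

/-- After `j` rounds all edges of height below `j` are present, because the children of an edge have
smaller height. Heights are below the number of nodes, which is the number of rounds. -/
theorem Decomp.seen_table (hX : Decomp k Γ X sd os ht) {x y : ℕ} (hxy : mat X.2.1 x y = true) :
    seen ((schedule X).foldl (step X) []) (x, y) = true := by
  set R := (List.range X.2.1.length).flatMap fun x =>
    ((List.range X.2.1.length).filter fun y => mat X.2.1 x y).map fun y => (x, y) with hR
  have key : ∀ (l : List ℕ) (j : ℕ) (log : Log), (∀ x y, mat X.2.1 x y = true → ht x y < j →
      seen log (x, y) = true) → ∀ x y, mat X.2.1 x y = true → ht x y < j + l.length →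
      seen ((l.flatMap fun _ => R).foldl (step X) log) (x, y) = true := by
    intro l
    induction l with
    | nil => exact fun j log h x y hxy hj => h x y hxy hj
    | cons a l ih =>
      intro j log h x y hxy hj
      rw [List.flatMap_cons, List.foldl_append]
      refine ih (j + 1) _ (fun x y hxy hj => ?_) x y hxy (by rw [List.length_cons] at hj; omega)
      have hmem : (x, y) ∈ R := by
        rw [hR, List.mem_flatMap]
        refine ⟨x, List.mem_range.2 (hX.lt x y hxy).1, List.mem_map.2 ⟨y, ?_, rfl⟩⟩
        rw [List.mem_filter]
        exact ⟨List.mem_range.2 (hX.lt x y hxy).2, hxy⟩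
      obtain ⟨l₁, l₂, hl⟩ := List.append_of_mem hmem
      rw [hl, List.foldl_append, List.foldl_cons]
      refine seen_mono (subset_foldl_step _ _) ?_
      have hr : ready (l₁.foldl (step X) log) x (children X (x, y)) = true :=
        ready_iff.2 fun z hz => seen_mono (subset_foldl_step _ _)
          (h z x (mem_children.1 hz).2.1 (by have := (hX.height x y hxy).2 z hz; omega))
      rw [step, hr, cond_true]
      exact seen_iff.2 ⟨_, List.mem_cons_self, rfl⟩
  refine key (List.range X.2.1.length) 0 [] (fun _ _ _ h => absurd h (by omega)) x y hxy ?_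
  rw [List.length_range, zero_add]
  exact (hX.height x y hxy).1

/-- The product bound is applied to an entry and itself, which bounds the square of its length plus
one. -/
theorem Decomp.small_table (hX : Decomp k Γ X sd os ht) {s : ℕ} (hn : n ≤ s) :
    ∀ e ∈ (schedule X).foldl (step X) [], Small s (stBound n k) e.2.2 := by
  intro e he
  have h1 := (hX.foldl_ok (fun p hp => mem_schedule hp) e he).2.fine
  refine ⟨?_, fun t ht => h1.bd_state hn ht⟩
  have h2 := h1.prod_le h1
  nlinarith

end

/-! ## The sides of a branch decomposition -/

section
variable {V W : Type*} {T : SimpleGraph W}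

/-- The vertices that can be reached from `z` without entering `x`. -/
def branch (T : SimpleGraph W) (z x : W) : Set W :=
  {w | Relation.ReflTransGen (fun a b => T.Adj a b ∧ b ≠ x) z w}

theorem self_mem_branch (z x : W) : z ∈ branch T z x := Relation.ReflTransGen.refl

theorem ne_of_mem_branch {z x w : W} (hzx : z ≠ x) (h : w ∈ branch T z x) : w ≠ x := by
  cases h with
  | refl => exact hzx
  | tail _ h => exact h.2

/-- A walk that never visits `x` cannot use an edge at `x`, whatever its other end `y` is. -/
theorem reachable_of_mem_branch {z x w : W} (hzx : z ≠ x) (h : w ∈ branch T z x) (y : W) :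
    (T.deleteEdges {s(y, x)}).Reachable z w := by
  induction h with
  | refl => exact SimpleGraph.Reachable.refl _
  | @tail a b hza hab ih =>
    refine ih.trans (SimpleGraph.Adj.reachable ?_)
    have ha : a ≠ x := ne_of_mem_branch hzx hza
    rw [SimpleGraph.deleteEdges_adj]
    refine ⟨hab.1, fun h => ?_⟩
    rcases Sym2.mem_iff.1 ((Set.mem_singleton_iff.1 h) ▸ Sym2.mem_mk_right y x) with h | h
    · exact ha h.symm
    · exact hab.2 h.symm

theorem not_reachable_of_adj (hT : T.IsAcyclic) {z x : W} (hzx : T.Adj z x) :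
    ¬ (T.deleteEdges {s(z, x)}).Reachable z x :=
  SimpleGraph.isBridge_iff.1 (SimpleGraph.isAcyclic_iff_forall_isBridge.1 hT hzx)

/-- Conversely, `zx` is a bridge of an acyclic graph, so without this edge a walk from `z` never
meets `x`. Thus branches are the components in the definition of `side`. -/
theorem mem_branch_of_reachable (hT : T.IsAcyclic) {z x w : W} (hzx : T.Adj z x)
    (h : (T.deleteEdges {s(z, x)}).Reachable z w) : w ∈ branch T z x := by
  rw [SimpleGraph.reachable_iff_reflTransGen] at h
  induction h with
  | refl => exact self_mem_branch _ _
  | @tail a b hza hab ih =>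
    refine Relation.ReflTransGen.tail ih ⟨(SimpleGraph.deleteEdges_adj.1 hab).1, ?_⟩
    rintro rfl
    exact not_reachable_of_adj hT hzx
      ((SimpleGraph.reachable_iff_reflTransGen _ _).2 (hza.tail hab))

/-- A common vertex would connect `z'` to `z` without using the edge `z'x`, and the edge `zx` would
then lead on to `x`, although `z'x` is a bridge. -/
theorem disjoint_branch (hT : T.IsAcyclic) {x z z' : W} (hz : T.Adj z x) (hz' : T.Adj z' x)
    (h : z ≠ z') : Disjoint (branch T z x) (branch T z' x) := by
  refine Set.disjoint_left.2 fun w hw hw' => not_reachable_of_adj hT hz' ?_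
  refine ((reachable_of_mem_branch hz'.ne hw' z').trans
    (reachable_of_mem_branch hz.ne hw z').symm).trans (SimpleGraph.Adj.reachable ?_)
  rw [SimpleGraph.deleteEdges_adj]
  refine ⟨hz, fun hh => ?_⟩
  rcases Sym2.mem_iff.1 ((Set.mem_singleton_iff.1 hh) ▸ Sym2.mem_mk_left z x) with hh | hh
  · exact h hh
  · exact hz.ne hh

/-- A walk in the branch is followed from its last visit to `x`: the next vertex is the neighbour
`z`. For the converse, a walk in the branch of `z` cannot enter `y`, since the branches of `z` and
`y` at `x` are disjoint. -/
theorem mem_branch_iff (hT : T.IsAcyclic) {x y w : W} (hxy : T.Adj x y) :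
    w ∈ branch T x y ↔ w = x ∨ ∃ z, T.Adj z x ∧ z ≠ y ∧ w ∈ branch T z x := by
  constructor
  · intro h
    induction h with
    | refl => exact Or.inl rfl
    | @tail a b _ hab ih =>
      rcases eq_or_ne b x with hb | hb
      · exact Or.inl hb
      rcases ih with rfl | ⟨z, h1, h2, h3⟩
      · exact Or.inr ⟨b, hab.1.symm, hab.2, self_mem_branch _ _⟩
      · exact Or.inr ⟨z, h1, h2, Relation.ReflTransGen.tail h3 ⟨hab.1, hb⟩⟩
  · rintro (rfl | ⟨z, h1, h2, h3⟩)
    · exact self_mem_branch _ _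
    · have key : ∀ w, w ∈ branch T z x → w ∈ branch T x y := fun w hw => by
        induction hw with
        | refl => exact Relation.ReflTransGen.single ⟨h1.symm, h2⟩
        | @tail a b hza hab ih =>
          refine Relation.ReflTransGen.tail ih ⟨hab.1, ?_⟩
          rintro rfl
          exact Set.disjoint_left.1 (disjoint_branch hT h1 hxy.symm h2) (hza.tail hab)
            (self_mem_branch _ _)
      exact key w h3

/-- Each time a walk leaves the leaf `r` it does so through `c`, so the part after its last visit to
`r` is a walk from `c` that avoids `r`. -/
theorem mem_branch_of_leaf (hT : T.Connected) {c r w : W} (hr : ∀ a, T.Adj r a → a = c)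
    (hw : w ≠ r) : w ∈ branch T c r := by
  have h := (SimpleGraph.reachable_iff_reflTransGen _ _).1 (hT.preconnected r w)
  induction h with
  | refl => exact absurd rfl hw
  | @tail a b hra hab ih =>
    rcases eq_or_ne a r with rfl | ha
    · rw [hr b hab]; exact self_mem_branch _ _
    · exact Relation.ReflTransGen.tail (ih ha) ⟨hab, hw⟩

theorem BranchDecomposition.mem_side (D : BranchDecomposition V W) {x y : W} (h : D.tree.Adj x y)
    (v : V) : v ∈ D.side x y ↔ (D.δ.symm v).1 ∈ branch D.tree x y :=
  ⟨mem_branch_of_reachable D.isTree.isAcyclic h, fun h' => reachable_of_mem_branch h.ne h' x⟩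

end

/-! ## The input -/

open Classical in
/-- The adjacency matrix of a graph. -/
noncomputable def rows {n : ℕ} (Γ : SimpleGraph (Fin n)) : List (List Bool) :=
  List.ofFn fun i => List.ofFn fun j => decide (Γ.Adj i j)

theorem isMatOf_rows {n : ℕ} (Γ : SimpleGraph (Fin n)) : IsMatOf Γ (rows Γ) := by
  have key : ∀ u v, mat (rows Γ) u v = true ↔ ∃ (hu : u < n) (hv : v < n), Γ.Adj ⟨u, hu⟩ ⟨v, hv⟩ := by
    intro u v
    by_cases hu : u < n
    · by_cases hv : v < n
      · simp [mat, rows, List.getD_eq_getElem?_getD, hu, hv]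
      · simp [mat, rows, List.getD_eq_getElem?_getD, hu, hv]
    · simp [mat, rows, List.getD_eq_getElem?_getD, hu]
  refine ⟨by simp [rows], fun u v => ?_, fun u v h => ?_⟩
  · rw [key]; exact ⟨fun ⟨_, _, h⟩ => h, fun h => ⟨u.2, v.2, h⟩⟩
  · obtain ⟨hu, hv, -⟩ := (key u v).1 h
    exact ⟨hu, hv⟩

theorem enc_rows {n : ℕ} (Γ : SimpleGraph (Fin n)) : enc (rows Γ) = Data.ofGraph Γ := by
  classical
  have h : ∀ p : Prop, ∀ [Decidable p], enc (decide p) = Data.ofProp p := fun p _ => by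
    by_cases hp : p <;> simp [hp, Data.ofProp]
  simp only [rows, Data.ofGraph, enc, List.map_ofFn]
  congr 2
  funext i
  simp only [Function.comp, List.map_ofFn]
  congr 2
  funext j
  exact h _

theorem bd_rows {n s : ℕ} (Γ : SimpleGraph (Fin n)) (hn : n ≤ s) : bd s (rows Γ) := by
  refine ⟨by simpa [rows] using hn, fun r hr => ?_⟩
  obtain ⟨i, rfl⟩ := List.mem_ofFn.1 hr
  exact ⟨by simpa using hn, fun _ _ => trivial⟩

variable {n m : ℕ} (Γ : SimpleGraph (Fin n)) (D : BranchDecomposition (Fin n) (Fin m))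

/-- The input of the algorithm. -/
noncomputable def input : Input :=
  (rows Γ, rows D.tree, List.ofFn fun v => (D.δ.symm v).1.1, ())

theorem enc_input : enc (input Γ D) = encodeInput Γ D := by
  have h : enc (List.ofFn fun v => (D.δ.symm v).1.1) =
      Data.ofList (List.ofFn fun v : Fin n => Data.ofNat (D.δ.symm v).1) := by
    simp only [enc, List.map_ofFn]
    congr 2
  simp only [input, enc_pair, enc_rows, h]
  rfl

theorem bd_input : bd (n + m) (input Γ D) := by
  refine ⟨bd_rows _ (by omega), bd_rows _ (by omega), ⟨by simp [input], fun v hv => ?_⟩, trivial⟩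
  obtain ⟨i, rfl⟩ := List.mem_ofFn.1 hv
  exact (D.δ.symm i).1.2.le.trans (by omega)

theorem length_rows {n : ℕ} (Γ : SimpleGraph (Fin n)) : (rows Γ).length = n := (isMatOf_rows Γ).len

/-- The set of the vertices on the side of `x` of the edge `xy`. -/
def sideOf (x y : ℕ) : Set (Fin n) :=
  {v | ∃ (hx : x < m) (hy : y < m), (D.δ.symm v).1 ∈ branch D.tree ⟨x, hx⟩ ⟨y, hy⟩}

open Classical in
/-- The number of nodes of the tree on the side of `x` of the edge `xy`. -/
noncomputable def heightOf (x y : ℕ) : ℕ :=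
  if h : x < m ∧ y < m then (branch D.tree ⟨x, h.1⟩ ⟨y, h.2⟩).ncard else 0

theorem mem_sideOf {x y : Fin m} {v : Fin n} :
    v ∈ sideOf D x y ↔ (D.δ.symm v).1 ∈ branch D.tree x y :=
  ⟨fun ⟨_, _, h⟩ => h, fun h => ⟨x.2, y.2, h⟩⟩

theorem heightOf_eq (x y : Fin m) : heightOf D x y = (branch D.tree x y).ncard := by
  simp [heightOf]

theorem mem_children_input {x y : Fin m} {z : ℕ} : z ∈ children (input Γ D) (x, y) ↔
    ∃ z' : Fin m, z'.1 = z ∧ D.tree.Adj z' x ∧ z' ≠ y := by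
  rw [mem_children]
  constructor
  · rintro ⟨h1, h2, h3⟩
    obtain ⟨hz, -⟩ := (isMatOf_rows D.tree).lt _ _ h2
    exact ⟨⟨z, hz⟩, rfl, ((isMatOf_rows D.tree).adj ⟨z, hz⟩ x).1 h2, fun h => h3 (by rw [← h])⟩
  · rintro ⟨z', rfl, h1, h2⟩
    refine ⟨by simp [input, length_rows], ((isMatOf_rows D.tree).adj z' x).2 h1, fun h => h2 (Fin.ext h)⟩

theorem decomp_input : Decomp (D.smWidth Γ) Γ (input Γ D) (sideOf D)
    (fun x => {v | (D.δ.symm v).1.1 = x}) (heightOf D) := by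
  have hT := D.isTree.isAcyclic
  have lift : ∀ (P : ℕ → ℕ → Prop), (∀ x y : Fin m, D.tree.Adj x y → P x y) →
      ∀ x y, mat (input Γ D).2.1 x y = true → P x y := fun P h x y hxy => by
    obtain ⟨hx, hy⟩ := (isMatOf_rows D.tree).lt x y hxy
    exact h ⟨x, hx⟩ ⟨y, hy⟩ (((isMatOf_rows D.tree).adj ⟨x, hx⟩ ⟨y, hy⟩).1 hxy)
  refine ⟨isMatOf_rows Γ, ?_, ?_, lift _ ?_, lift _ ?_, lift _ ?_, lift _ ?_, lift _ ?_, ?_,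
    lift _ ?_, lift _ ?_⟩
  · intro x v
    simp [input, List.getD_eq_getElem?_getD]
  · intro x u hu v hv
    refine D.δ.symm.injective (Subtype.ext (Fin.ext ?_))
    exact hu.trans hv.symm
  · intro x y hxy
    ext v
    simp only [Set.mem_union, Set.mem_iUnion, mem_sideOf, mem_branch_iff hT hxy, Set.mem_ofPred_eq,
      mem_children_input, Fin.ext_iff]
    constructor
    · rintro (h | ⟨z, h1, h2, h3⟩)
      · exact Or.inl h
      · exact Or.inr ⟨z, ⟨z, rfl, h1, h2⟩, mem_sideOf D |>.2 h3⟩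
    · rintro (h | ⟨_, ⟨z, rfl, h1, h2⟩, h3⟩)
      · exact Or.inl h
      · exact Or.inr ⟨z, h1, h2, (mem_sideOf D).1 h3⟩
  · intro x y _ z hz
    obtain ⟨z, rfl, h1, -⟩ := (mem_children_input Γ D).1 hz
    refine Set.disjoint_left.2 fun v hv hv' => ?_
    exact ne_of_mem_branch h1.ne ((mem_sideOf D).1 hv') (Fin.ext hv)
  · intro x y _ z hz z' hz' hne
    obtain ⟨z, rfl, h1, -⟩ := (mem_children_input Γ D).1 hz
    obtain ⟨z', rfl, h1', -⟩ := (mem_children_input Γ D).1 hz'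
    refine Set.disjoint_left.2 fun v hv hv' => ?_
    exact Set.disjoint_left.1 (disjoint_branch hT h1 h1' fun h => hne (by rw [h]))
      ((mem_sideOf D).1 hv) ((mem_sideOf D).1 hv')
  all_goals
    -- The children of `(x, y)` together with `y` are distinct neighbours of `x`. Degree at most
    -- three leaves at most two children, and a leaf has none.
    have hcard : ∀ x y : Fin m, D.tree.Adj x y →
        (children (input Γ D) (x, y)).length + 1 ≤ (D.tree.neighborSet x).ncard := fun x y hxy => by
      have h1 : (y.1 :: children (input Γ D) (x, y)).Nodup :=
        List.nodup_cons.2 ⟨fun h => by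
          obtain ⟨z, hz, -, h⟩ := (mem_children_input Γ D).1 h
          exact h (Fin.ext hz), nodup_children⟩
      have h2 : ((y.1 :: children (input Γ D) (x, y)).toFinset : Set ℕ) ⊆
          Fin.val '' D.tree.neighborSet x := fun z hz => by
        rw [Finset.mem_coe, List.mem_toFinset, List.mem_cons] at hz
        rcases hz with rfl | hz
        · exact ⟨y, hxy, rfl⟩
        · obtain ⟨z, rfl, h, -⟩ := (mem_children_input Γ D).1 hz
          exact ⟨z, h.symm, rfl⟩
      have h3 := Set.ncard_le_ncard h2 (Set.toFinite _)
      rwa [Set.ncard_coe_finset, List.toFinset_card_of_nodup h1, List.length_cons,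
        Set.ncard_image_of_injective _ Fin.val_injective] at h3
  · intro x y hxy
    have := hcard x y hxy
    have := D.subcubic x
    omega
  · intro x y hxy
    by_cases hx : IsLeaf D.tree x
    · have h1 : (D.tree.neighborSet x).ncard ≤ 1 := hx
      have := hcard x y hxy
      exact Or.inl (List.eq_nil_of_length_eq_zero (by omega))
    · refine Or.inr (Set.eq_empty_iff_forall_notMem.2 fun v hv => hx ?_)
      rw [← Fin.ext (show (D.δ.symm v).1.1 = x.1 from hv)]
      exact (D.δ.symm v).2
  · intro x y h
    have := (isMatOf_rows D.tree).lt x y h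
    simpa [input, length_rows] using this
  · intro x y hxy
    rw [heightOf_eq]
    constructor
    -- The branch misses `y`, so its size is below the number of nodes; the branch of a child misses
    -- `x`, so it is strictly smaller.
    · have h1 : branch D.tree x y ⊂ Set.univ := by
        refine Set.ssubset_univ_iff.2 fun h => ?_
        exact ne_of_mem_branch hxy.ne (h ▸ Set.mem_univ y : y ∈ branch D.tree x y) rfl
      have h2 := Set.ncard_lt_ncard h1
      rw [Set.ncard_univ, Nat.card_fin] at h2
      simpa [input, length_rows] using h2
    · intro z hz
      obtain ⟨z, rfl, h1, h2⟩ := (mem_children_input Γ D).1 hz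
      rw [heightOf_eq]
      refine Set.ncard_lt_ncard ⟨fun w hw => (mem_branch_iff hT hxy).2 (Or.inr ⟨z, h1, h2, hw⟩),
        fun h => ?_⟩
      exact ne_of_mem_branch h1.ne (h (self_mem_branch x y)) rfl
  · intro x y hxy
    have h1 : sideOf D x y = D.side x y := Set.ext fun v => by
      rw [mem_sideOf, D.mem_side hxy]
    rw [h1]
    -- A supremum in `ℕ` is an upper bound only if the family is bounded; here it is finite.
    exact le_ciSup (f := fun e : D.tree.Dart => sm Γ (D.side e.fst e.snd))
      ((Set.toFinite (Set.range fun p : Fin m × Fin m => sm Γ (D.side p.1 p.2))).subset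
        (by rintro _ ⟨e, rfl⟩; exact ⟨e.toProd, rfl⟩)).bddAbove
      (SimpleGraph.Dart.mk (x, y) hxy)

/-! ## Hamiltonian cycles as lists -/

section
variable {V : Type*} [DecidableEq V] {G : SimpleGraph V}

/-- The list runs through a Hamiltonian cycle of the graph. -/
structure IsHamList (G : SimpleGraph V) (h : List V) : Prop where
  nodup : h.Nodup
  mem : ∀ v, v ∈ h
  len : 3 ≤ h.length
  adj : ∀ u, G.Adj u (h.formPerm u)

omit [DecidableEq V] in
theorem exists_walk_of_isChain : ∀ (l : List V) (a b : V), (a :: (l ++ [b])).IsChain G.Adj →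
    ∃ p : G.Walk a b, p.support = a :: (l ++ [b])
  | [], a, b, h => ⟨SimpleGraph.Walk.cons (by simpa using h) SimpleGraph.Walk.nil, by simp⟩
  | c :: l, a, b, h => by
    obtain ⟨h1, h2⟩ := List.isChain_cons_cons.1 h
    obtain ⟨p, hp⟩ := exists_walk_of_isChain l c b h2
    exact ⟨SimpleGraph.Walk.cons h1 p, by simp [hp]⟩

theorem getVert_of_support {a : V} {l : List V} {p : G.Walk a a} (hp : p.support = a :: (l ++ [a]))
    (hn : (a :: l).Nodup) {i : ℕ} (hi : i < (a :: l).length) :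
    p.getVert i = (a :: l)[i] ∧ p.getVert (i + 1) = (a :: l).formPerm ((a :: l)[i]) := by
  have hl : p.length = l.length + 1 := by
    have := p.length_support
    rw [hp] at this
    simp at this
    omega
  have hg : ∀ j, p.getVert j = (a :: (l ++ [a])).getD j a := by
    intro j
    rw [← hp]
    by_cases hj : j ≤ p.length
    · rw [SimpleGraph.Walk.getVert_eq_support_getElem p hj, List.getD_eq_getElem]
    · rw [p.getVert_of_length_le (by omega), List.getD_eq_default _ _ (by rw [p.length_support]; omega)]
  have h1 : ∀ j (hj : j < (a :: l).length), p.getVert j = (a :: l)[j] := fun j hj => by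
    rw [hg, List.getD_eq_getElem _ _ (by simp at hj ⊢; omega)]
    exact List.getElem_append_left (as := a :: l) hj
  refine ⟨h1 i hi, ?_⟩
  rw [List.formPerm_apply_getElem _ hn]
  by_cases h : i < l.length
  · rw [h1 _ (by simpa using h)]
    congr 1
    rw [Nat.mod_eq_of_lt (by simpa using h)]
  · have : i = l.length := by simp at hi; omega
    subst this
    have : p.getVert (l.length + 1) = a := by rw [← hl, p.getVert_length]
    rw [this]
    simp

theorem toSubgraph_adj_iff_formPerm {a : V} {l : List V} {p : G.Walk a a}
    (hp : p.support = a :: (l ++ [a])) (hn : (a :: l).Nodup) (hm : ∀ v, v ∈ a :: l) (u v : V) :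
    p.toSubgraph.Adj u v ↔ (a :: l).formPerm u = v ∨ (a :: l).formPerm v = u := by
  have hl : p.length = (a :: l).length := by
    have := p.length_support
    rw [hp] at this
    simp at this ⊢
    omega
  rw [SimpleGraph.Walk.toSubgraph_adj_iff]
  constructor
  · rintro ⟨i, h1, h2⟩
    obtain ⟨h3, h4⟩ := getVert_of_support hp hn (hl ▸ h2)
    rw [h3, h4, Sym2.eq_iff] at h1
    rcases h1 with ⟨rfl, rfl⟩ | ⟨rfl, rfl⟩
    · exact Or.inl rfl
    · exact Or.inr rfl
  · have key : ∀ u, ∃ i, s(p.getVert i, p.getVert (i + 1)) = s(u, (a :: l).formPerm u) ∧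
        i < p.length := fun u => by
      obtain ⟨i, hi, rfl⟩ := List.getElem_of_mem (hm u)
      obtain ⟨h3, h4⟩ := getVert_of_support hp hn hi
      exact ⟨i, by rw [h3, h4], hl ▸ hi⟩
    rintro (rfl | rfl)
    · exact key u
    · rw [Sym2.eq_swap]; exact key v

theorem IsHamList.exists_cycle {h : List V} (hh : IsHamList G h) :
    ∃ (a : V) (p : G.Walk a a), p.IsHamiltonianCycle ∧
      ∀ u v, p.toSubgraph.Adj u v ↔ h.formPerm u = v ∨ h.formPerm v = u := by
  match h, hh with
  | [], hh => exact absurd hh.len (by simp)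
  | a :: l, hh =>
    have hc : (a :: (l ++ [a])).IsChain G.Adj := by
      rw [List.isChain_iff_getElem]
      intro i hi
      simp only [List.length_cons, List.length_append, List.length_nil] at hi
      have h1 := hh.adj ((a :: l)[i]'(by simp; omega))
      rw [List.formPerm_apply_getElem _ hh.nodup] at h1
      convert h1 using 1
      · exact List.getElem_append_left (as := a :: l) (bs := [a]) (i := i) (by simp; omega)
      · by_cases h : i < l.length
        · simp only [List.length_cons, Nat.mod_eq_of_lt (Nat.succ_lt_succ h), List.getElem_cons_succ]
          rw [List.getElem_append_left h]
        · have : i = l.length := by omega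
          subst this
          simp
    obtain ⟨p, hp⟩ := exists_walk_of_isChain l a a hc
    have hl : p.length = l.length + 1 := by
      have := p.length_support
      rw [hp] at this
      simp at this
      omega
    have hlen : 3 ≤ l.length + 1 := hh.len
    have hnil : ¬ p.Nil := fun hn => by
      have := SimpleGraph.Walk.length_eq_zero_iff.2 hn
      omega
    have hperm : (l ++ [a]).Perm (a :: l) := List.perm_append_singleton a l
    refine ⟨a, p, ?_, toSubgraph_adj_iff_formPerm hp hh.nodup hh.mem⟩
    rw [SimpleGraph.Walk.isHamiltonianCycle_iff_isCycle_and_support_count_tail_eq_one]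
    refine ⟨SimpleGraph.Walk.isCycle_iff_isPath_tail_and_le_length.2 ⟨?_, by omega⟩, fun v => ?_⟩
    · rw [SimpleGraph.Walk.isPath_def, SimpleGraph.Walk.support_tail_of_not_nil _ hnil, hp,
        List.tail_cons, hperm.nodup_iff]
      exact hh.nodup
    · rw [hp, List.tail_cons, hperm.count_eq]
      exact List.count_eq_one_of_mem hh.nodup (hh.mem v)

theorem exists_isHamList {a : V} {p : G.Walk a a} (hp : p.IsHamiltonianCycle) :
    ∃ h, IsHamList G h ∧ ∀ u v, p.toSubgraph.Adj u v ↔ h.formPerm u = v ∨ h.formPerm v = u := by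
  have hnil : ¬ p.Nil := hp.isCycle.not_nil
  obtain ⟨l, hl⟩ : ∃ l, p.support = a :: (l ++ [a]) := by
    have h1 : p.support.tail ≠ [] := fun h => by
      have := p.length_support
      have h3 := hp.isCycle.three_le_length
      have h4 := congrArg List.length h
      rw [List.length_tail, List.length_nil] at h4
      omega
    refine ⟨p.support.tail.dropLast, ?_⟩
    have h2 : p.support.tail.getLast h1 = a := by
      rw [List.getLast_tail]
      exact p.getLast_support
    conv_lhs => rw [← p.cons_tail_support]
    congr 1
    conv_lhs => rw [← List.dropLast_append_getLast h1, h2]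
  have hperm : (l ++ [a]).Perm (a :: l) := List.perm_append_singleton a l
  have hc := (SimpleGraph.Walk.isHamiltonianCycle_iff_isCycle_and_support_count_tail_eq_one.1 hp).2
  simp only [hl, List.tail_cons, hperm.count_eq] at hc
  have hn : (a :: l).Nodup := List.nodup_iff_count_le_one.2 fun v => (hc v).le
  have hm : ∀ v, v ∈ a :: l := fun v => List.count_pos_iff.1 (by rw [hc v]; exact one_pos)
  have hadj := toSubgraph_adj_iff_formPerm hl hn hm
  refine ⟨a :: l, ⟨hn, hm, ?_, fun u => ((hadj u _).2 (Or.inl rfl)).adj_sub⟩, hadj⟩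
  have h1 := hp.isCycle.three_le_length
  have h2 := p.length_support
  rw [hl] at h2
  simp at h2 ⊢
  omega

end

section
variable {V : Type*} [DecidableEq V] {G : SimpleGraph V}

theorem isChain_formPerm {h : List V} (hn : h.Nodup) : h.IsChain fun u v => h.formPerm u = v := by
  rw [List.isChain_iff_getElem]
  intro i hi
  exact List.formPerm_apply_lt_getElem _ hn _ hi

theorem IsHamList.isRotated {h h' : List V} (hh : IsHamList G h) (hr : h ~r h') : IsHamList G h' where
  nodup := hr.nodup_iff.1 hh.nodup
  mem v := hr.mem_iff.1 (hh.mem v)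
  len := hr.perm.length_eq ▸ hh.len
  adj u := List.formPerm_eq_of_isRotated hh.nodup hr ▸ hh.adj u

theorem IsHamList.exists_cons {h : List V} (hh : IsHamList G h) (a : V) :
    ∃ l, h ~r a :: l := by
  obtain ⟨l₁, l₂, rfl⟩ := List.append_of_mem (hh.mem a)
  exact ⟨l₂ ++ l₁, ⟨l₁.length, by rw [List.rotate_append_length_eq]; simp⟩⟩

variable [Inhabited V]

omit [DecidableEq V] in
theorem ends_eq_getElem {h : List V} (hh : 0 < h.length) :
    ends h = (h[0], h[h.length - 1]) := by
  simp [ends, List.head?_eq_getElem?, List.getLast?_eq_getElem?, hh]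

theorem formPerm_ends_snd {h : List V} (hn : h.Nodup) (h0 : h ≠ []) :
    h.formPerm (ends h).2 = (ends h).1 := by
  have hl := List.length_pos_of_ne_nil h0
  rw [ends_eq_getElem hl, List.formPerm_apply_getElem _ hn]
  simp only [Nat.sub_add_cancel hl, Nat.mod_self]

theorem IsHamList.of_isChain {h : List V} (hn : h.Nodup) (hm : ∀ v, v ∈ h) (hl : 3 ≤ h.length)
    (hc : h.IsChain G.Adj) (he : G.Adj (ends h).2 (ends h).1) : IsHamList G h := by
  refine ⟨hn, hm, hl, fun u => ?_⟩
  obtain ⟨i, hi, rfl⟩ := List.getElem_of_mem (hm u)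
  by_cases h' : i + 1 < h.length
  · rw [List.formPerm_apply_lt_getElem _ hn _ h']
    exact List.isChain_iff_getElem.1 hc i h'
  · rw [ends_eq_getElem (by omega)] at he
    rw [List.formPerm_apply_getElem _ hn]
    have : i + 1 = h.length := by omega
    simp only [this, Nat.mod_self]
    have : i = h.length - 1 := by omega
    subst this
    exact he

end

/-! ## Correctness of the answer -/

theorem foldl_or {α : Type*} {f : Bool → α → Bool} {Q : α → Prop}
    (h : ∀ b a, f b a = true ↔ b = true ∨ Q a) (l : List α) (b : Bool) :
    l.foldl f b = true ↔ b = true ∨ ∃ a ∈ l, Q a := by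
  induction l generalizing b with
  | nil => simp
  | cons a l ih => rw [List.foldl_cons, ih, h]; simp [or_assoc]

theorem answer_iff {X : Input} {log : Log} : answer X log = true ↔ ∃ c < X.2.1.length,
    mat X.2.1 c (X.2.2.1.headD 0) = true ∧
      ∃ s ∈ (lookup log (c, X.2.2.1.headD 0)).2, closing X.1 s = true := by
  have h1 : ∀ (b : Bool) (s : St), (bif closing X.1 s then true else b) = true ↔
      b = true ∨ closing X.1 s = true := fun b s => by
    cases closing X.1 s <;> simp
  refine (foldl_or (Q := fun c => ∃ s ∈ (lookup log (c, X.2.2.1.headD 0)).2, closing X.1 s = true)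
    (fun b c => foldl_or h1 _ b) _ _).trans ?_
  simp [and_assoc]

theorem closing_iff {G : List (List Bool)} {s : St} : closing G s = true ↔
    ∃ x y, s = [(x, y)] ∧ mat G x 0 = true ∧ mat G y 0 = true := by
  match s with
  | [] => simp [closing]
  | [(x, y)] => simp [closing]
  | _ :: _ :: _ => simp [closing]

section
variable {n k : ℕ} {Γ : SimpleGraph (Fin n)} {G : List (List Bool)} {e : Entry}

theorem exists_lamOf_eq {A : List ℕ} {L : List (List ℕ)} {x y : ℕ}
    (h : lab (lamOf G A) (endsOf L) = lab (lamOf G A) (([(x, y)] : St) : Multiset (ℕ × ℕ))) :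
    ∃ p, L = [p] ∧ lamOf G A (ends p).1 = lamOf G A x ∧ lamOf G A (ends p).2 = lamOf G A y := by
  have h1 := card_eq_of_lab h
  simp only [endsOf, Multiset.coe_card, List.length_map, List.length_singleton] at h1
  obtain ⟨p, rfl⟩ := List.length_eq_one_iff.1 h1
  refine ⟨p, rfl, ?_⟩
  simpa [lab, endsOf, Prod.ext_iff] using h

theorem mat_iff_of_lamOf {A : List ℕ} {u v w : ℕ} (h : lamOf G A u = lamOf G A v) (hu : u ∈ A)
    (hw : w ∉ A) (hl : w < G.length) : mat G u w = true ↔ mat G v w = true :=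
  lam_rel (r := fun u v => mat G u v = true) h hu hl hw

/-- A realization of the state is a single path through all vertices other than `0`. Its ends have
the labels of the stored vertices, and as `0` lies outside the set, the labels decide adjacency to
`0`; so the path closes up with `0`. -/
theorem exists_isHamList_of_closing (hG : IsMatOf Γ G) (hn : 3 ≤ n)
    (he : Good k G {v : Fin n | v.1 ≠ 0} e) {s : St} (hs : s ∈ e.2) (hc : closing G s = true) :
    ∃ h, IsHamList Γ h := by
  obtain ⟨x, y, rfl, hx, hy⟩ := closing_iff.1 hc
  obtain ⟨L, hL, hlab⟩ := he.sound _ hs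
  obtain ⟨p, rfl, h1, h2⟩ := exists_lamOf_eq hlab
  have hp := hL.ne p (by simp)
  have hmem : ∀ v, v ∈ p ↔ v ∈ e.1 := fun v => by simpa using hL.mem v
  have h0 : 0 ∉ e.1 := fun h => (he.mem ⟨0, by omega⟩).1 h rfl
  have hlen : 0 < G.length := by rw [hG.len]; omega
  rw [← mat_iff_of_lamOf h1 ((hmem _).1 (ends_fst_mem hp)) h0 hlen] at hx
  rw [← mat_iff_of_lamOf h2 ((hmem _).1 (ends_snd_mem hp)) h0 hlen] at hy
  have : NeZero n := ⟨by omega⟩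
  let g : ℕ → Fin n := Fin.ofNat n
  have hg : ∀ v < n, (g v).1 = v := fun v hv => Nat.mod_eq_of_lt hv
  have hadj : ∀ u v, mat G u v = true → Γ.Adj (g u) (g v) := fun u v h => by
    obtain ⟨hu, hv⟩ := hG.lt u v h
    rw [← hG.adj, hg u hu, hg v hv]
    exact h
  have hlt : ∀ v ∈ 0 :: p, v < n := fun v hv => by
    rcases List.mem_cons.1 hv with rfl | hv
    · omega
    · exact he.fine.lt v ((hmem v).1 hv)
  have hnd : (0 :: p).Nodup := List.nodup_cons.2 ⟨fun h => h0 ((hmem 0).1 h), by simpa using hL.nodup⟩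
  have hall : ∀ v : Fin n, v ∈ (0 :: p).map g := fun v => by
    refine List.mem_map.2 ⟨v.1, ?_, Fin.ext (hg v.1 v.2)⟩
    by_cases hv : v.1 = 0
    · simp [hv]
    · exact List.mem_cons_of_mem _ ((hmem _).2 ((he.mem v).2 hv))
  have hnd' : ((0 :: p).map g).Nodup := List.Nodup.map_on (fun u hu v hv huv => by
    rw [← hg u (hlt u hu), ← hg v (hlt v hv), huv]) hnd
  let _ : Inhabited (Fin n) := ⟨0⟩
  refine ⟨(0 :: p).map g, IsHamList.of_isChain hnd' hall ?_ ?_ ?_⟩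
  · have h1 : ((0 :: p).map g).toFinset = Finset.univ :=
      Finset.eq_univ_iff_forall.2 fun v => List.mem_toFinset.2 (hall v)
    rw [← List.toFinset_card_of_nodup hnd', h1, Finset.card_univ, Fintype.card_fin]
    exact hn
  · rw [List.isChain_map]
    have h3 : (0 :: p).IsChain fun u v => mat G u v = true := by
      match p, hp with
      | a :: q, _ =>
        exact List.isChain_cons_cons.2 ⟨hG.isMat.symm _ _ (by simpa [ends] using hx),
          hL.chain _ (by simp)⟩
    exact h3.imp hadj
  · have h4 : ends ((0 :: p).map g) = (g 0, g (ends p).2) := by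
      simp [ends, List.getLast?_cons, List.getLast?_eq_some_getLast hp]
    rw [h4]
    exact hadj _ _ hy

/-- Rotated to begin with `0`, the cycle has the rest of its list as its only path in the trace.
Completeness yields a state with the same labels, whose ends are therefore adjacent to `0`. -/
theorem exists_closing_of_isHamList (hG : IsMatOf Γ G) (he : Good k G {v : Fin n | v.1 ≠ 0} e)
    {h : List (Fin n)} (hh : IsHamList Γ h) : ∃ s ∈ e.2, closing G s = true := by
  have hn : 0 < n := by
    match h, hh.len with
    | a :: _, _ => exact a.pos
  obtain ⟨p, hr⟩ := hh.exists_cons ⟨0, hn⟩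
  replace hh := hh.isRotated hr
  clear hr h
  -- Numbers that are not vertices are fixed, which keeps `f` injective on all of `ℕ`.
  let f : ℕ → ℕ := fun u => if hu : u < n then (((⟨0, hn⟩ :: p).formPerm ⟨u, hu⟩ : Fin n) : ℕ) else u
  have hf : ∀ u : Fin n, f u = (⟨0, hn⟩ :: p).formPerm u := fun u => by simp [f]
  have hf' : ∀ u, ¬ u < n → f u = u := fun u hu => by simp [f, hu]
  have hlt : ∀ u, f u < n ↔ u < n := fun u => by
    by_cases hu : u < n
    · simp only [hu, iff_true]
      rw [hf ⟨u, hu⟩]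
      exact Fin.is_lt _
    · rw [hf' u hu]
  have hinj : Function.Injective f := fun u v huv => by
    by_cases hu : u < n
    · have hv := (hlt v).1 (huv ▸ (hlt u).2 hu)
      rw [hf ⟨u, hu⟩, hf ⟨v, hv⟩] at huv
      exact congrArg Fin.val (Equiv.injective _ (Fin.ext huv))
    · have hv : ¬ v < n := fun hv => hu ((hlt u).1 (huv ▸ (hlt v).2 hv))
      rwa [hf' u hu, hf' v hv] at huv
  have htour : IsTour G f := by
    refine ⟨hinj, fun u hu => ?_, fun v hv => ?_⟩
    · rw [hG.len] at hu
      have := (hG.adj _ _).2 (hh.adj ⟨u, hu⟩)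
      rwa [← hf ⟨u, hu⟩] at this
    · rw [hG.len] at hv ⊢
      refine ⟨((⟨0, hn⟩ :: p).formPerm.symm ⟨v, hv⟩ : Fin n), Fin.is_lt _, ?_⟩
      rw [hf, Equiv.apply_symm_apply]
  have hp0 : p ≠ [] := by
    rintro rfl
    exact absurd hh.len (by simp)
  have hp : p.map Fin.val ≠ [] := by simpa using hp0
  have hchain : ((⟨0, hn⟩ :: p).map Fin.val).IsChain fun u v => f u = v := by
    rw [List.isChain_map]
    exact (isChain_formPerm hh.nodup).imp fun u v h => by rw [hf, h]
  have hmem : ∀ v, v ∈ p.map Fin.val ↔ v ∈ e.1 := fun v => by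
    constructor
    · rintro h
      obtain ⟨w, hw, rfl⟩ := List.mem_map.1 h
      refine (he.mem w).2 fun h0 => (List.nodup_cons.1 hh.nodup).1 ?_
      rwa [show (⟨0, hn⟩ : Fin n) = w from Fin.ext h0.symm]
    · intro h
      have hv := he.fine.lt v h
      have h0 : v ≠ 0 := (he.mem ⟨v, hv⟩).1 h
      refine List.mem_map.2 ⟨⟨v, hv⟩, ?_, rfl⟩
      rcases List.mem_cons.1 (hh.mem ⟨v, hv⟩) with h | h
      · exact absurd (congrArg Fin.val h) h0
      · exact h
  have h0 : 0 ∉ e.1 := fun h => (he.mem ⟨0, hn⟩).1 h rfl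
  have hfst : f 0 = (ends (p.map Fin.val)).1 := by
    match p, hp0, hchain with
    | a :: q, _, hc => simpa [ends] using (List.isChain_cons_cons.1 hc).1
  have hsnd : f (ends (p.map Fin.val)).2 = 0 := by
    let _ : Inhabited (Fin n) := ⟨⟨0, hn⟩⟩
    have h1 := formPerm_ends_snd hh.nodup (by simp)
    have h2 : (ends (p.map Fin.val)).2 = ((ends (⟨0, hn⟩ :: p)).2 : Fin n) := by
      simp [ends, List.getLast?_cons, List.getLast?_eq_some_getLast hp0]
    rw [h2, hf, h1]
    rfl
  obtain ⟨s, hs, hlab⟩ := he.complete f htour [p.map Fin.val] ⟨⟨by simpa using hp0,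
    fun q hq => by
      rw [List.mem_singleton.1 hq]
      exact hchain.of_cons,
    by simpa using (List.nodup_cons.1 hh.nodup).2.map Fin.val_injective, by simpa using hmem⟩,
    fun q hq => by rw [List.mem_singleton.1 hq, hsnd]; exact h0,
    fun q hq u hu => by
      rw [List.mem_singleton.1 hq, ← hfst] at hu
      rw [hinj hu]; exact h0⟩
  have hlen : 0 < G.length := by rw [hG.len]; exact hn
  have h1 := card_eq_of_lab hlab
  simp only [endsOf, Multiset.coe_card, List.length_map, List.length_singleton] at h1
  obtain ⟨⟨x, y⟩, rfl⟩ := List.length_eq_one_iff.1 h1.symm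
  obtain ⟨q, hq, h2, h3⟩ := exists_lamOf_eq hlab
  obtain rfl : p.map Fin.val = q := by simpa using hq
  refine ⟨_, hs, closing_iff.2 ⟨x, y, rfl, ?_, ?_⟩⟩
  · rw [← mat_iff_of_lamOf h2 ((hmem _).1 (ends_fst_mem hp)) h0 hlen, ← hfst]
    exact hG.isMat.symm _ _ (htour.adj 0 hlen)
  · have h4 := (hmem _).1 (ends_snd_mem hp)
    rw [← mat_iff_of_lamOf h3 h4 h0 hlen]
    have h5 := htour.adj _ ((he.fine.lt _ h4).trans_eq hG.len.symm)
    rwa [hsnd] at h5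

end

/-! ## The algorithm decides Hamiltonicity in the required time -/

variable {n m : ℕ} (Γ : SimpleGraph (Fin n)) (D : BranchDecomposition (Fin n) (Fin m))

theorem headD_input (hn : 0 < n) : (input Γ D).2.2.1.headD 0 = (D.δ.symm ⟨0, hn⟩).1.1 := by
  simp [input, List.headD_eq_head?_getD, List.head?_eq_getElem?, hn]

/-- With at least two vertices the tree is not a single node, so the leaf of `v` has exactly one
neighbour, and everything else lies on the side of this neighbour. -/
theorem exists_leaf_edge (hn : 1 < n) (v : Fin n) : ∃ c, D.tree.Adj c (D.δ.symm v).1 ∧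
    ∀ c', D.tree.Adj c' (D.δ.symm v).1 → sideOf D c' (D.δ.symm v).1 = {u | u ≠ v} := by
  have : Nontrivial (Fin n) := Fin.nontrivial_iff_two_le.2 hn
  obtain ⟨u, hu⟩ := exists_ne v
  have hne : (D.δ.symm u).1 ≠ (D.δ.symm v).1 := fun h => hu (D.δ.symm.injective (Subtype.ext h))
  obtain ⟨c, hc⟩ : ∃ c, D.tree.Adj (D.δ.symm v).1 c := by
    rcases ((SimpleGraph.reachable_iff_reflTransGen _ _).1
      (D.isTree.connected.preconnected (D.δ.symm v).1 (D.δ.symm u).1)).cases_head with h | ⟨c, hc, -⟩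
    · exact absurd h.symm hne
    · exact ⟨c, hc⟩
  refine ⟨c, hc.symm, fun c' hc' => ?_⟩
  have huniq : ∀ a, D.tree.Adj (D.δ.symm v).1 a → a = c' := fun a ha =>
    (Set.ncard_le_one (Set.toFinite _)).1 (D.δ.symm v).2 a ha c' hc'.symm
  ext w
  rw [mem_sideOf]
  constructor
  · rintro h rfl
    exact ne_of_mem_branch hc'.ne h rfl
  · intro hw
    exact mem_branch_of_leaf D.isTree.connected huniq fun h =>
      hw (D.δ.symm.injective (Subtype.ext h))

theorem IsHamList.three_le {h : List (Fin n)} (hh : IsHamList Γ h) : 3 ≤ n :=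
  hh.len.trans ((List.Nodup.length_le_card hh.nodup).trans_eq (Fintype.card_fin n))

theorem solve_iff_isHamList : solve (input Γ D) = true ↔ ∃ h, IsHamList Γ h := by
  have hX := decomp_input Γ D
  have hlen : (input Γ D).1.length = n := hX.isMat.len
  rw [solve, hlen]
  by_cases hn : 3 ≤ n
  swap
  · simp only [hn, decide_false, cond_false, Bool.false_eq_true, false_iff]
    rintro ⟨h, hh⟩
    exact hn hh.three_le
  have hn0 : 0 < n := by omega
  simp only [hn, decide_true, cond_true]
  obtain ⟨c, hc, hside⟩ := exists_leaf_edge D (by omega : 1 < n) ⟨0, hn0⟩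
  have hset : {u : Fin n | u ≠ ⟨0, hn0⟩} = {v | v.1 ≠ 0} :=
    Set.ext fun u => not_congr Fin.ext_iff
  have hgood : ∀ c', mat (input Γ D).2.1 c' (D.δ.symm ⟨0, hn0⟩).1.1 = true →
      Good (D.smWidth Γ) (input Γ D).1 {v : Fin n | v.1 ≠ 0}
        (lookup ((schedule (input Γ D)).foldl (step (input Γ D)) []) (c', (D.δ.symm ⟨0, hn0⟩).1.1)) := by
    intro c' hc'
    have h := (hX.foldl_ok fun p hp => mem_schedule hp).lookup (hX.seen_table hc')
    obtain ⟨hlt, -⟩ := (isMatOf_rows D.tree).lt _ _ hc'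
    have h2 := hside ⟨c', hlt⟩ (((isMatOf_rows D.tree).adj ⟨c', hlt⟩ _).1 hc')
    rw [hset] at h2
    exact h2 ▸ h
  rw [answer_iff, headD_input Γ D hn0]
  constructor
  · rintro ⟨c', -, hc', s, hs, h⟩
    exact exists_isHamList_of_closing hX.isMat hn (hgood c' hc') hs h
  · rintro ⟨h, hh⟩
    have hc' := ((isMatOf_rows D.tree).adj c (D.δ.symm ⟨0, hn0⟩).1).2 hc
    obtain ⟨s, hs, h⟩ := exists_closing_of_isHamList hX.isMat (hgood c hc') hh
    exact ⟨c, (hX.lt _ _ hc').1, hc', s, hs, h⟩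

theorem exists_isHamList_iff {V : Type*} [DecidableEq V] {G : SimpleGraph V} :
    (∃ h, IsHamList G h) ↔ ∃ (a : V) (p : G.Walk a a), p.IsHamiltonianCycle :=
  ⟨fun ⟨_, hh⟩ => let ⟨a, p, hp, _⟩ := hh.exists_cycle; ⟨a, p, hp⟩,
    fun ⟨_, _, hp⟩ => let ⟨h, hh, _⟩ := exists_isHamList hp; ⟨h, hh⟩⟩

theorem stBound_le (n k : ℕ) :
    (stBound n k + 1) ^ 2 ≤ 4 * (n + 2) ^ 8 * (2 ^ 50 * 2 ^ (24 * k ^ 2)) := by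
  have h0 : 1 ≤ stBound n k := Nat.one_le_iff_ne_zero.2 (by rw [stBound]; positivity)
  have h1 : 4 ^ (k + 2) + 1 ≤ 2 ^ (2 * k + 5) := by
    have : (4 : ℕ) ^ (k + 2) = 2 ^ (2 * k + 4) := by
      rw [show (4 : ℕ) = 2 ^ 2 by norm_num, ← pow_mul]; congr 1
    rw [this, show 2 ^ (2 * k + 5) = 2 ^ (2 * k + 4) * 2 from pow_succ _ _]
    have := Nat.one_le_two_pow (n := 2 * k + 4)
    omega
  -- The right side minus the left side is `2 (2k - 5)^2`.
  have h2 : (2 * k + 5) * (8 * k) ≤ 50 + 24 * k ^ 2 := by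
    zify
    nlinarith [sq_nonneg (2 * (k : ℤ) - 5)]
  calc (stBound n k + 1) ^ 2 ≤ (2 * stBound n k) ^ 2 := Nat.pow_le_pow_left (by omega) 2
    _ = 4 * (n + 2) ^ 8 * (4 ^ (k + 2) + 1) ^ (8 * k) := by
      rw [stBound, mul_pow, mul_pow, ← pow_mul, ← pow_mul, ← mul_assoc]
      congr 2
      ring
    _ ≤ 4 * (n + 2) ^ 8 * (2 ^ 50 * 2 ^ (24 * k ^ 2)) := by
      refine Nat.mul_le_mul_left _ ((Nat.pow_le_pow_left h1 _).trans ?_)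
      rw [← pow_mul, ← pow_add]
      exact Nat.pow_le_pow_right (by norm_num) h2

theorem exists_program : ∃ (P : Prog) (C c : ℕ), ∀ (n m : ℕ) (G : SimpleGraph (Fin n))
    (D : BranchDecomposition (Fin n) (Fin m)),
    ∃ (y : Data) (t : ℕ), Run P (encodeInput G D) y t ∧
      (y ≠ Data.nil ↔ ∃ (a : Fin n) (p : G.Walk a a), p.IsHamiltonianCycle) ∧
      t ≤ C * (n + m) ^ c * 2 ^ (24 * (D.smWidth G) ^ 2) := by
  obtain ⟨c, ⟨P, hP⟩, K, hK⟩ := solve_cmp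
  refine ⟨P, 4 * 3 ^ (8 + K) * 2 ^ 50, 8 + K, fun n m G D => ?_⟩
  obtain ⟨t, ht, hr⟩ := hP (input G D)
  rw [enc_input] at hr
  refine ⟨_, t, hr, ?_, ht.trans ?_⟩
  · rw [← exists_isHamList_iff, ← solve_iff_isHamList G D]
    cases solve (input G D) <;> simp
  have hX := decomp_input G D
  have hb := bd_input G D
  have h1 : c (input G D) ≤ (stBound n (D.smWidth G) + 1) ^ 2 * (n + m + 2) ^ K := by
    refine hK (n + m, stBound n (D.smWidth G), input G D) ⟨hb, ?_, hX.small_table (by omega)⟩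
    intro l₁ p l₂ hl
    refine hX.stepDom (hX.foldl_ok fun q hq => mem_schedule (X := input G D) ?_)
      (mem_schedule (X := input G D) ?_) hb.1 (by omega)
    · simp only at hl; rw [hl]; simp [hq]
    · simp only at hl; rw [hl]; simp
  -- A tree has a node, so `n + m` is positive and `s + 2 ≤ 3 * s`; this removes the shift from the
  -- polynomial.
  have hm : 1 ≤ m := by
    obtain ⟨x⟩ := D.isTree.connected.nonempty
    exact x.pos
  set s := n + m with hs
  set k := D.smWidth G
  calc c (input G D) ≤ (stBound n k + 1) ^ 2 * (s + 2) ^ K := h1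
    _ ≤ 4 * (s + 2) ^ 8 * (2 ^ 50 * 2 ^ (24 * k ^ 2)) * (s + 2) ^ K := by
      refine Nat.mul_le_mul_right _ ((stBound_le n k).trans ?_)
      gcongr
      omega
    _ = 4 * 2 ^ 50 * (s + 2) ^ (8 + K) * 2 ^ (24 * k ^ 2) := by rw [pow_add]; ring
    _ ≤ 4 * 2 ^ 50 * (3 * s) ^ (8 + K) * 2 ^ (24 * k ^ 2) := by gcongr; omega
    _ = 4 * 3 ^ (8 + K) * 2 ^ 50 * s ^ (8 + K) * 2 ^ (24 * k ^ 2) := by rw [mul_pow]; ring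

/-! ## Traces of Hamiltonian cycles -/

section
variable {V : Type*} [Inhabited V] {f : V → V} {A : Set V} {L : List (List V)}

omit [Inhabited V] in
theorem follows_mem {u v : V} (h : Follows L u v) : u ∈ L.flatten ∧ v ∈ L.flatten := by
  obtain ⟨p, hp, h⟩ := h
  exact ⟨List.mem_flatten.2 ⟨p, hp, h.subset (by simp)⟩, List.mem_flatten.2 ⟨p, hp, h.subset (by simp)⟩⟩

omit [Inhabited V] in
theorem rel_of_infix {r : V → V → Prop} {p : List V} {u v : V} (hp : p.IsChain r)
    (h : [u, v] <:+: p) : r u v := by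
  obtain ⟨s, t, rfl⟩ := h
  have h1 := (List.isChain_append.1 hp).1
  have h2 := (List.isChain_append.1 h1).2.1
  simpa using h2

omit [Inhabited V] in
theorem apply_of_infix {p : List V} {u v : V} (hp : p.IsChain fun u v => f u = v)
    (h : [u, v] <:+: p) : f u = v :=
  rel_of_infix (r := fun u v => f u = v) hp h

theorem eq_ends_snd_or_infix {p : List V} {u : V} (hc : p.IsChain fun u v => f u = v) (hu : u ∈ p) :
    u = (ends p).2 ∨ [u, f u] <:+: p := by
  obtain ⟨s, t, rfl⟩ := List.append_of_mem hu
  match t with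
  | [] => left; simp [ends]
  | v :: t =>
    right
    have : f u = v := apply_of_infix hc ⟨s, t, by simp⟩
    exact ⟨s, t, by simp [this]⟩

theorem eq_ends_fst_or_infix {p : List V} {u : V} (hc : p.IsChain fun u v => f u = v) (hu : u ∈ p) :
    u = (ends p).1 ∨ ∃ w, f w = u ∧ [w, u] <:+: p := by
  obtain ⟨s, t, rfl⟩ := List.append_of_mem hu
  rcases List.eq_nil_or_concat s with rfl | ⟨s, w, rfl⟩
  · left; simp [ends]
  · right
    have h : [w, u] <:+: s.concat w ++ u :: t := ⟨s, t, by simp⟩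
    exact ⟨w, apply_of_infix hc h, h⟩

theorem Compat.follows_iff (h : Compat f A L) {u v : V} :
    Follows L u v ↔ u ∈ A ∧ v ∈ A ∧ f u = v := by
  constructor
  · intro hf
    obtain ⟨h1, h2⟩ := follows_mem hf
    obtain ⟨p, hp, hi⟩ := hf
    exact ⟨(h.sys.mem u).1 h1, (h.sys.mem v).1 h2, apply_of_infix (h.sys.chain p hp) hi⟩
  · rintro ⟨hu, hv, rfl⟩
    obtain ⟨p, hp, hup⟩ := List.mem_flatten.1 ((h.sys.mem u).2 hu)
    rcases eq_ends_snd_or_infix (h.sys.chain p hp) hup with rfl | h1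
    · exact absurd hv (h.last p hp)
    · exact ⟨p, hp, h1⟩

theorem formPerm_eq_iff [DecidableEq V] {g : List V} (hn : g.Nodup) {u v : V} (hu : u ∈ g) :
    g.formPerm u = v ↔ [u, v] <:+: g ∨ (u = (ends g).2 ∧ v = (ends g).1) := by
  have hg : g ≠ [] := List.ne_nil_of_mem hu
  constructor
  · rintro rfl
    rcases eq_ends_snd_or_infix (isChain_formPerm hn) hu with h | h
    · refine Or.inr ⟨h, ?_⟩
      conv_lhs => rw [h]
      exact formPerm_ends_snd hn hg
    · exact Or.inl h
  · rintro (h | ⟨rfl, rfl⟩)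
    · exact apply_of_infix (isChain_formPerm hn) h
    · exact formPerm_ends_snd hn hg

/-- The list begins outside `A` and ends in `A`, so the closing edge of the cycle crosses the cut.
No path of the trace then wraps around, and cutting the list at its crossing edges gives the traces
on both sides. -/
theorem exists_traces (hf : Function.Injective f) {h : List V} (hn : h.Nodup) (hm : ∀ v, v ∈ h)
    (hc : h.IsChain fun u v => f u = v) (he : f (ends h).2 = (ends h).1) (h1 : (ends h).1 ∉ A)
    (h2 : (ends h).2 ∈ A) {X : V → V → Prop} (hX : ∀ u, ¬(u ∈ A ↔ f u ∈ A) → X u (f u)) :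
    ∃ L₁ L₂, Compat f A L₁ ∧ Compat f Aᶜ L₂ ∧
      Relation.ReflTransGen (Mrg X) (endsOf L₁ + endsOf L₂) {ends h} := by
  have h0 : h ≠ [] := List.ne_nil_of_mem (hm default)
  obtain ⟨q, ps, g1, g2, g3, g4, g5⟩ := exists_pieces (X := X) f A h h0 hc fun u v huv hA => by
    obtain rfl := apply_of_infix hc huv
    exact hX u hA
  have hq := (g2 q (by simp)).1
  have hq1 : (ends q).1 = (ends h).1 := by
    rw [← g1]
    match q, hq with
    | a :: q, _ => simp [ends]
  obtain ⟨L₁, L₂, k1, k2, k3⟩ := exists_pieces_divide (f := f) (A := A) (D := Set.univ)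
    (L' := q :: ps) (by rwa [g1]) (by simpa [g1] using hm) g2
    (fun x hx => Or.inr <| (g3 x hx).elim (fun h' => by rw [h', he]; tauto) fun h' => h')
    (fun x hx u hu => Or.inr <| by
      rcases List.mem_cons.1 hx with rfl | hx
      · obtain rfl : u = (ends h).2 := hf (by rw [hu, hq1, he])
        rw [he]; tauto
      · obtain ⟨w, hw, hw'⟩ := g4 x hx
        obtain rfl : u = w := hf (by rw [hu, hw])
        exact hw')
  rw [Set.univ_inter] at k1
  rw [← Set.compl_eq_univ_sdiff] at k2
  refine ⟨L₁, L₂, k1, k2, ?_⟩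
  rw [← endsOf_append, endsOf_perm k3, endsOf_cons]
  have := g5 (ends q).1 0
  rwa [add_zero, hq1, ← hq1, Prod.mk.eta, hq1, Prod.mk.eta] at this

end

/-! ### Certificates as traces of Hamiltonian cycles -/

section
variable {V : Type*} [DecidableEq V] {G : SimpleGraph V} {A : Set V} {h : List V}

/-- The list is started in `A`, and its longest initial segment within `A` is moved to the end. -/
theorem IsHamList.exists_rotation [Inhabited V] (hh : IsHamList G h) (hA : A.Nonempty)
    (hA' : A ≠ Set.univ) : ∃ h', h ~r h' ∧ (ends h').1 ∉ A ∧ (ends h').2 ∈ A := by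
  classical
  obtain ⟨a, ha⟩ := hA
  obtain ⟨b, hb⟩ := (Set.ne_univ_iff_exists_notMem A).1 hA'
  obtain ⟨l, hl⟩ := hh.exists_cons a
  have hb' : b ∈ a :: l := hl.mem_iff.1 (hh.mem b)
  set l₁ := (a :: l).takeWhile fun v => decide (v ∈ A) with h₁
  set l₂ := (a :: l).dropWhile fun v => decide (v ∈ A) with h₂
  have h12 : l₁ ++ l₂ = a :: l := List.takeWhile_append_dropWhile
  have hall : ∀ v ∈ l₁, v ∈ A := fun v hv => by simpa using List.mem_takeWhile_imp hv
  have h1 : l₁ ≠ [] := by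
    rw [h₁, List.takeWhile_cons]
    simp [ha]
  have h2 : l₂ ≠ [] := fun h0 => by
    rw [h0, List.append_nil] at h12
    exact hb (hall b (h12 ▸ hb'))
  refine ⟨l₂ ++ l₁, hl.trans ⟨l₁.length, by rw [← h12, List.rotate_append_length_eq]⟩, ?_⟩
  rw [ends_append h2 h1]
  refine ⟨?_, hall _ (ends_snd_mem h1)⟩
  have := List.head_dropWhile_not (p := fun v => decide (v ∈ A)) h2
  simpa [ends, List.head?_eq_some_head h2] using this

/-- `H` consists of the edges of the Hamiltonian cycle `h` within `A`. -/
structure IsTrace (h : List V) (A : Set V) (H : G.Subgraph) : Prop where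
  verts : H.verts = A
  adj : ∀ u v, H.Adj u v ↔ u ∈ A ∧ v ∈ A ∧ (h.formPerm u = v ∨ h.formPerm v = u)

theorem IsHamCycle.exists_isHamList {w : G.Subgraph} (hw : IsHamCycle w) :
    ∃ h, IsHamList G h ∧ IsTrace h Set.univ w := by
  obtain ⟨a, p, hp, rfl⟩ := hw
  obtain ⟨h, hh, hadj⟩ := SMWidth.exists_isHamList hp
  refine ⟨h, hh, Set.eq_univ_of_forall fun v => ?_, by simpa using hadj⟩
  exact SimpleGraph.Walk.mem_verts_toSubgraph p |>.2 (hp.mem_support v)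

theorem IsHamList.exists_isHamCycle (hh : IsHamList G h) :
    ∃ w : G.Subgraph, IsHamCycle w ∧ IsTrace h Set.univ w := by
  obtain ⟨a, p, hp, hadj⟩ := hh.exists_cycle
  refine ⟨p.toSubgraph, ⟨a, p, hp, rfl⟩, Set.eq_univ_of_forall fun v => ?_, by simpa using hadj⟩
  exact SimpleGraph.Walk.mem_verts_toSubgraph p |>.2 (hp.mem_support v)

/-- Edges are added only across the cut, so the cycle has no edges within `A` or within `Aᶜ` other
than those of `x` and `z`. Completion thereby becomes a statement about successors on one cyclic
list. -/
theorem completesTo_iff {x z : G.Subgraph} (hx : x.verts = A) (hz : z.verts = Aᶜ) :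
    CompletesTo x z ↔ ∃ h, IsHamList G h ∧ IsTrace h A x ∧ IsTrace h Aᶜ z := by
  constructor
  · rintro ⟨w, ⟨-, hle, hw⟩, hc⟩
    obtain ⟨h, hh, ht⟩ := hc.exists_isHamList
    have hadj : ∀ u v, w.Adj u v ↔ h.formPerm u = v ∨ h.formPerm v = u := by simpa using ht.adj
    refine ⟨h, hh, ⟨hx, fun u v => ?_⟩, ⟨hz, fun u v => ?_⟩⟩
    · rw [← hadj]
      refine ⟨fun huv => ⟨hx ▸ huv.fst_mem, hx ▸ huv.snd_mem, hle.2 (Or.inl huv)⟩, ?_⟩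
      rintro ⟨hu, hv, huv⟩
      rcases hw u v huv with h' | h' | h' | h'
      · exact h'
      · exact absurd hu (hz ▸ h'.fst_mem : u ∈ Aᶜ)
      · exact absurd hv (hz ▸ h'.2 : v ∈ Aᶜ)
      · exact absurd hu (hz ▸ h'.1 : u ∈ Aᶜ)
    · rw [← hadj]
      refine ⟨fun huv => ⟨hz ▸ huv.fst_mem, hz ▸ huv.snd_mem, hle.2 (Or.inr huv)⟩, ?_⟩
      rintro ⟨hu, hv, huv⟩
      rcases hw u v huv with h' | h' | h' | h'
      · exact absurd (hx ▸ h'.fst_mem : u ∈ A) hu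
      · exact h'
      · exact absurd (hx ▸ h'.1) hu
      · exact absurd (hx ▸ h'.2) hv
  · rintro ⟨h, hh, h1, h2⟩
    obtain ⟨w, hw, ht⟩ := hh.exists_isHamCycle
    have hadj : ∀ u v, w.Adj u v ↔ h.formPerm u = v ∨ h.formPerm v = u := by simpa using ht.adj
    refine ⟨w, ⟨⟨?_, Or.inr hw⟩, ⟨?_, ?_⟩, ?_⟩, hw⟩
    · rw [ht.verts, hx, hz, Set.union_compl_self]
    · rw [ht.verts]; exact Set.subset_univ _
    · rintro u v (huv | huv)
      · exact (hadj u v).2 ((h1.adj u v).1 huv).2.2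
      · exact (hadj u v).2 ((h2.adj u v).1 huv).2.2
    · intro u v huv
      rw [hadj] at huv
      rw [h1.adj, h2.adj, hx, hz]
      by_cases hu : u ∈ A <;> by_cases hv : v ∈ A <;> simp [hu, hv, huv]

theorem IsTrace.adj_iff_follows [Inhabited V] {H : G.Subgraph} (ht : IsTrace h A H)
    {L : List (List V)} (hL : Compat h.formPerm A L) {u v : V} :
    H.Adj u v ↔ Follows L u v ∨ Follows L v u := by
  rw [ht.adj, hL.follows_iff, hL.follows_iff]
  tauto

theorem IsHamList.exists_traces [Inhabited V] (hh : IsHamList G h) (hA : A.Nonempty)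
    (hA' : A ≠ Set.univ) : ∃ h', h ~r h' ∧ (ends h').1 ∉ A ∧ (ends h').2 ∈ A ∧
      ∃ L₁ L₂, Compat h.formPerm A L₁ ∧ Compat h.formPerm Aᶜ L₂ ∧
        Relation.ReflTransGen (Mrg fun u v => G.Adj u v ∧ ((u ∈ A ∧ v ∈ Aᶜ) ∨ (u ∈ Aᶜ ∧ v ∈ A)))
          (endsOf L₁ + endsOf L₂) {ends h'} := by
  obtain ⟨h', hr, h1, h2⟩ := hh.exists_rotation hA hA'
  have hh' := hh.isRotated hr
  rw [List.formPerm_eq_of_isRotated hh.nodup hr]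
  refine ⟨h', hr, h1, h2, SMWidth.exists_traces (Equiv.injective _) hh'.nodup hh'.mem
    (isChain_formPerm hh'.nodup) (formPerm_ends_snd hh'.nodup (List.ne_nil_of_mem (hh'.mem default)))
    h1 h2 fun u hu => ⟨hh'.adj u, ?_⟩⟩
  simp only [Set.mem_compl_iff]
  tauto

end

/-! ## The paths of a certificate -/

section
variable {V : Type*} [DecidableEq V] {G : SimpleGraph V} {A : Set V} {h : List V} {H : G.Subgraph}
  {L : List (List V)}

theorem PathSys.eq_of_mem {r : V → V → Prop} (hL : PathSys r A L) {p q : List V} (hp : p ∈ L)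
    (hq : q ∈ L) {v : V} (hvp : v ∈ p) (hvq : v ∈ q) : p = q := by
  by_contra hne
  have h1 := (List.nodup_flatten.1 hL.nodup).2
  have : ∀ L : List (List V), L.Pairwise List.Disjoint → p ∈ L → q ∈ L → p.Disjoint q := by
    intro L hL
    induction hL with
    | nil => simp
    | cons ha _ ih =>
      intro hp hq
      rcases List.mem_cons.1 hp with hp' | hp' <;> rcases List.mem_cons.1 hq with hq' | hq'
      · exact absurd (hp'.trans hq'.symm) hne
      · exact hp' ▸ ha _ hq'
      · exact hq' ▸ (ha _ hp').symm
      · exact ih hp' hq'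
  exact this L h1 hp hq hvp hvq

/-- Otherwise two steps along the cycle would fix `v`, which is impossible as the length is at least
3. Hence a vertex whose two cycle neighbours lie in `A` really has degree two in the trace. -/
theorem IsHamList.formPerm_ne_symm (hh : IsHamList G h) (v : V) :
    h.formPerm v ≠ h.formPerm.symm v := by
  intro hv
  have h2 : (h.formPerm ^ 2) v = v := by
    rw [pow_two, Equiv.Perm.mul_apply, hv, Equiv.apply_symm_apply]
  obtain ⟨i, hi, rfl⟩ := List.getElem_of_mem (hh.mem v)
  rw [List.formPerm_pow_apply_getElem _ hh.nodup, hh.nodup.getElem_inj_iff] at h2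
  have := hh.len
  rcases Nat.lt_or_ge (i + 2) h.length with h3 | h3
  · rw [Nat.mod_eq_of_lt h3] at h2; omega
  · rw [Nat.mod_eq_sub_mod h3, Nat.mod_eq_of_lt (by omega)] at h2; omega

omit [DecidableEq V] in
theorem reflTransGen_head {r : V → V → Prop} : ∀ {l : List V} {a : V}, (a :: l).IsChain r →
    ∀ w ∈ a :: l, Relation.ReflTransGen r a w
  | [], a, _, w, hw => by rw [List.mem_singleton.1 hw]
  | b :: l, a, hc, w, hw => by
    obtain ⟨h1, h2⟩ := List.isChain_cons_cons.1 hc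
    rcases List.mem_cons.1 hw with rfl | hw
    · exact Relation.ReflTransGen.refl
    · exact Relation.ReflTransGen.head h1 (reflTransGen_head h2 w hw)

omit [DecidableEq V] in
theorem reachable_coe {u v : V} (hu : u ∈ H.verts) (hv : v ∈ H.verts)
    (huv : Relation.ReflTransGen H.Adj u v) : H.coe.Reachable ⟨u, hu⟩ ⟨v, hv⟩ := by
  induction huv with
  | refl => exact SimpleGraph.Reachable.refl _
  | @tail a b _ hab ih => exact (ih hab.fst_mem).trans (SimpleGraph.Adj.reachable hab)

variable [Inhabited V]

/-- The two vertices lie on the same path. -/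
theorem IsTrace.reachable_iff (ht : IsTrace h A H) (hL : Compat h.formPerm A L) (u v : H.verts) :
    H.coe.Reachable u v ↔ ∃ p ∈ L, u.1 ∈ p ∧ v.1 ∈ p := by
  have hmem : ∀ w ∈ H.verts, ∃ p ∈ L, w ∈ p := fun w hw =>
    List.mem_flatten.1 ((hL.sys.mem w).2 (ht.verts ▸ hw))
  constructor
  · intro huv
    rw [SimpleGraph.reachable_iff_reflTransGen] at huv
    induction huv with
    | refl =>
      obtain ⟨p, hp, hup⟩ := hmem u u.2
      exact ⟨p, hp, hup, hup⟩
    | @tail a b _ hab ih =>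
      obtain ⟨p, hp, hup, hap⟩ := ih
      have : ∃ q ∈ L, a.1 ∈ q ∧ b.1 ∈ q := by
        rcases (ht.adj_iff_follows hL).1 hab with ⟨q, hq, hi⟩ | ⟨q, hq, hi⟩
        · exact ⟨q, hq, hi.subset (by simp), hi.subset (by simp)⟩
        · exact ⟨q, hq, hi.subset (by simp), hi.subset (by simp)⟩
      obtain ⟨q, hq, haq, hbq⟩ := this
      obtain rfl := hL.sys.eq_of_mem hp hq hap haq
      exact ⟨p, hp, hup, hbq⟩
  · rintro ⟨p, hp, hup, hvp⟩
    have hA : ∀ w ∈ p, w ∈ A := fun w hw => (hL.sys.mem w).1 (List.mem_flatten.2 ⟨p, hp, hw⟩)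
    match p, hL.sys.ne p hp with
    | a :: l, _ =>
      have hc : (a :: l).IsChain H.Adj := by
        refine List.isChain_iff_forall_rel_of_append_cons_cons.2 fun u v s t hi => ?_
        exact (ht.adj_iff_follows hL).2 (Or.inl ⟨_, hp, s, t, by rw [hi]; simp⟩)
      have ha : a ∈ H.verts := ht.verts ▸ hA a (by simp)
      exact (reachable_coe ha u.2 (reflTransGen_head hc _ hup)).symm.trans
        (reachable_coe ha v.2 (reflTransGen_head hc _ hvp))

theorem IsTrace.ends_mem (ht : IsTrace h A H) (hL : Compat h.formPerm A L) {p : List V} (hp : p ∈ L) :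
    (ends p).1 ∈ H.verts ∧ (ends p).2 ∈ H.verts := by
  rw [ht.verts]
  exact hL.sys.endsIn _ (Multiset.mem_coe.2 (List.mem_map_of_mem hp))

/-- The component of a path of `L`. -/
def IsTrace.component (ht : IsTrace h A H) (hL : Compat h.formPerm A L) (i : Fin L.length) :
    H.coe.ConnectedComponent :=
  H.coe.connectedComponentMk ⟨(ends L[i]).1, (ht.ends_mem hL (List.getElem_mem i.2)).1⟩

theorem IsTrace.mem_component (ht : IsTrace h A H) (hL : Compat h.formPerm A L) (i : Fin L.length)
    (w : H.verts) : w ∈ (ht.component hL i).supp ↔ w.1 ∈ L[i] := by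
  rw [SimpleGraph.ConnectedComponent.mem_supp_iff, IsTrace.component, SimpleGraph.ConnectedComponent.eq,
    ht.reachable_iff hL]
  have hi := List.getElem_mem i.2
  have hm := ends_fst_mem (hL.sys.ne _ hi)
  constructor
  · rintro ⟨p, hp, h1, h2⟩
    obtain rfl := hL.sys.eq_of_mem hp hi h2 hm
    exact h1
  · exact fun hw => ⟨_, hi, hw, hm⟩

/-- The components of a trace are the paths of the list system: adjacent vertices lie on a common
path, and paths are disjoint. This translates statements on certificates into statements on lists.
-/
theorem IsTrace.component_bijective (ht : IsTrace h A H) (hL : Compat h.formPerm A L) :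
    Function.Bijective (ht.component hL) := by
  constructor
  · intro i j hij
    have hi := ends_fst_mem (hL.sys.ne _ (List.getElem_mem i.2))
    have h1 := (ht.mem_component hL i ⟨_, (ht.ends_mem hL (List.getElem_mem i.2)).1⟩).2 hi
    rw [hij, ht.mem_component] at h1
    have hnd := hL.sys.nodup_map (fun p => (ends p).1) fun p hp => ends_fst_mem (hL.sys.ne p hp)
    have hLij := hL.sys.eq_of_mem (List.getElem_mem i.2) (List.getElem_mem j.2) hi h1
    exact Fin.ext (((List.Nodup.of_map _ hnd).getElem_inj_iff).1 hLij)
  · intro c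
    induction c using SimpleGraph.ConnectedComponent.ind with | _ w =>
    obtain ⟨p, hp, hw⟩ := List.mem_flatten.1 ((hL.sys.mem w).2 (ht.verts ▸ w.2))
    obtain ⟨i, hi, rfl⟩ := List.getElem_of_mem hp
    exact ⟨⟨i, hi⟩, ((ht.mem_component hL ⟨i, hi⟩ w).2 hw).symm⟩

theorem IsTrace.ncard_paths_le (ht : IsTrace h A H) (hL : Compat h.formPerm A L) :
    (paths H).ncard ≤ L.length := by
  have := Finite.of_surjective _ (ht.component_bijective hL).2
  calc (paths H).ncard ≤ (Set.univ : Set H.coe.ConnectedComponent).ncard :=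
        Set.ncard_le_ncard (Set.subset_univ _) (Set.toFinite _)
    _ = L.length := by
      rw [Set.ncard_univ, ← Nat.card_congr (Equiv.ofBijective _ (ht.component_bijective hL)),
        Nat.card_fin]

omit [DecidableEq V] in
theorem Compat.last_iff {f : V → V} (hL : Compat f A L) {p : List V} (hp : p ∈ L) {w : V} (hw : w ∈ p) :
    f w ∉ A ↔ w = (ends p).2 := by
  refine ⟨fun hf => ?_, fun hw => hw ▸ hL.last p hp⟩
  rcases eq_ends_snd_or_infix (hL.sys.chain p hp) hw with h1 | h1
  · exact h1
  · exact absurd ((hL.sys.mem _).1 (List.mem_flatten.2 ⟨p, hp, h1.subset (by simp)⟩)) hf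

omit [DecidableEq V] in
theorem Compat.head_iff {f : Equiv.Perm V} (hL : Compat f A L) {p : List V} (hp : p ∈ L) {w : V}
    (hw : w ∈ p) : f.symm w ∉ A ↔ w = (ends p).1 := by
  refine ⟨fun hf => ?_, fun hw => hL.head p hp _ (by rw [hw, Equiv.apply_symm_apply])⟩
  rcases eq_ends_fst_or_infix (hL.sys.chain p hp) hw with h1 | ⟨u, rfl, h1⟩
  · exact h1
  · rw [Equiv.symm_apply_apply] at hf
    exact absurd ((hL.sys.mem _).1 (List.mem_flatten.2 ⟨p, hp, h1.subset (by simp)⟩)) hf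

omit [Inhabited V] in
theorem IsTrace.mem_neighborSet (ht : IsTrace h A H) {w v : V} (hw : w ∈ A) :
    v ∈ H.neighborSet w ↔ v ∈ A ∧ (v = h.formPerm w ∨ v = h.formPerm.symm w) := by
  rw [SimpleGraph.Subgraph.mem_neighborSet, ht.adj, Equiv.eq_symm_apply, eq_comm (a := v)]
  tauto

omit [Inhabited V] in
-- The neighbours in the trace are those among the successor and the predecessor that lie in `A`,
-- and these two are different.
theorem IsTrace.ncard_neighborSet (hh : IsHamList G h) (ht : IsTrace h A H) {w : V} (hw : w ∈ A) :
    (H.neighborSet w).ncard ≤ 1 ↔ h.formPerm w ∉ A ∨ h.formPerm.symm w ∉ A := by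
  have hsub : H.neighborSet w ⊆ {h.formPerm w, h.formPerm.symm w} := fun v hv =>
    ((ht.mem_neighborSet hw).1 hv).2
  have hfin : (H.neighborSet w).Finite := (Set.toFinite _).subset hsub
  rw [Set.ncard_le_one hfin]
  constructor
  · intro h1
    by_contra! h2
    exact hh.formPerm_ne_symm w (h1 _ ((ht.mem_neighborSet hw).2 ⟨h2.1, Or.inl rfl⟩) _
      ((ht.mem_neighborSet hw).2 ⟨h2.2, Or.inr rfl⟩))
  · rintro h1 u hu v hv
    obtain ⟨hu, hu'⟩ := (ht.mem_neighborSet hw).1 hu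
    obtain ⟨hv, hv'⟩ := (ht.mem_neighborSet hw).1 hv
    rcases h1 with h1 | h1
    · rw [hu'.resolve_left fun e => h1 (e ▸ hu), hv'.resolve_left fun e => h1 (e ▸ hv)]
    · rw [hu'.resolve_right fun e => h1 (e ▸ hu), hv'.resolve_right fun e => h1 (e ▸ hv)]

/-- The vertices of degree at most one in a component are the first and the last vertex of its list,
where the cycle enters and leaves `A`. So each path of a trace has exactly one class. -/
theorem IsTrace.hasPathClass_iff (hh : IsHamList G h) (ht : IsTrace h A H)
    (hL : Compat h.formPerm A L) (i : Fin L.length) (q : Sym2 (Set V)) :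
    HasPathClass H (ht.component hL i) q ↔
      q = s(G.neighborSet (ends L[i]).1 \ A, G.neighborSet (ends L[i]).2 \ A) := by
  have hi := List.getElem_mem i.2
  obtain ⟨h1, h2⟩ := ht.ends_mem hL hi
  have hset : {w | w ∈ (ht.component hL i).supp ∧ (H.neighborSet w).ncard ≤ 1} =
      ({⟨(ends L[i]).1, h1⟩, ⟨(ends L[i]).2, h2⟩} : Set H.verts) := by
    ext w
    rw [Set.mem_ofPred_eq, ht.mem_component, Set.mem_insert_iff, Set.mem_singleton_iff, Subtype.ext_iff,
      Subtype.ext_iff]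
    have hwA : w.1 ∈ A := ht.verts ▸ w.2
    constructor
    · rintro ⟨hw, hd⟩
      rw [ht.ncard_neighborSet hh hwA, hL.last_iff hi hw, hL.head_iff hi hw] at hd
      exact hd.symm
    · intro hw
      have hw' : w.1 ∈ L[i] := by
        rcases hw with hw | hw <;> rw [hw]
        · exact ends_fst_mem (hL.sys.ne _ hi)
        · exact ends_snd_mem (hL.sys.ne _ hi)
      rw [ht.ncard_neighborSet hh hwA, hL.last_iff hi hw', hL.head_iff hi hw']
      exact ⟨hw', hw.symm⟩
  rw [HasPathClass, hset]
  constructor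
  · rintro ⟨u, v, huv, rfl⟩
    simp only [ht.verts]
    rcases Set.pair_eq_pair_iff.1 huv with ⟨rfl, rfl⟩ | ⟨rfl, rfl⟩
    · rfl
    · exact Sym2.eq_swap
  · rintro rfl
    exact ⟨_, _, rfl, by simp only [ht.verts]⟩

end

/-! ## The number of paths of an important certificate -/

section
variable {V : Type*} [DecidableEq V] {G : SimpleGraph V} {A : Set V} {h : List V} {H : G.Subgraph}
  {L : List (List V)}

/-- The edges by which the cycle leaves the paths have distinct ends in `A` and, the successor map
being injective, distinct ends outside; they form a matching across the cut. -/
theorem IsHamList.length_le_mm [Inhabited V] [Finite V] (hh : IsHamList G h)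
    (hL : Compat h.formPerm A L) : L.length ≤ mm G A := by
  have h1 := SMWidth.length_le_mm (G := G) (A := A)
    (L.map fun p => ((ends p).2, h.formPerm (ends p).2)) (fun e he => by
      obtain ⟨p, hp, rfl⟩ := List.mem_map.1 he
      exact ⟨(hL.sys.endsIn _ (Multiset.mem_coe.2 (List.mem_map_of_mem hp))).2, hL.last p hp,
        hh.adj _⟩)
    (by
      rw [List.map_map]
      exact hL.sys.nodup_map _ fun p hp => ends_snd_mem (hL.sys.ne p hp))
    (by
      rw [List.map_map]
      have := (hL.sys.nodup_map _ fun p hp => ends_snd_mem (hL.sys.ne p hp)).map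
        h.formPerm.injective
      rwa [List.map_map] at this)
  rwa [List.length_map] at h1

theorem IsHamList.exists_compat [Inhabited V] (hh : IsHamList G h) (hA : A ≠ Set.univ) :
    ∃ L, Compat h.formPerm A L := by
  rcases A.eq_empty_or_nonempty with rfl | h0
  · exact ⟨[], ⟨by simp, by simp, by simp, by simp⟩, by simp, by simp⟩
  · obtain ⟨-, -, -, -, L, -, hL, -⟩ := hh.exists_traces h0 hA
    exact ⟨L, hL⟩

/-- An acyclic component would be a finite tree with an edge, hence have a vertex of degree one; but
on a cycle the successor and the predecessor are two different neighbours. -/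
theorem IsTrace.paths_eq_empty [Finite V] (hh : IsHamList G h) (ht : IsTrace h Set.univ H) :
    paths H = ∅ := by
  classical
  refine Set.eq_empty_iff_forall_notMem.2 fun c hc => ?_
  have hadj : ∀ u v, H.Adj u v ↔ h.formPerm u = v ∨ h.formPerm v = u := by simpa using ht.adj
  have hT : c.toSimpleGraph.IsTree := ⟨c.connected_toSimpleGraph, hc⟩
  have key : ∀ u : c.supp, ∀ w, H.Adj u w → ∃ w' : c.supp, w'.1.1 = w ∧ c.toSimpleGraph.Adj u w' :=
    fun u w huw => ⟨⟨⟨w, huw.snd_mem⟩, c.mem_supp_of_adj_mem_supp u.2 huw⟩, rfl, huw⟩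
  obtain ⟨a⟩ := c.connected_toSimpleGraph.nonempty
  obtain ⟨b, -, hb⟩ := key a _ ((hadj a.1.1 _).2 (Or.inl rfl))
  have : Nontrivial c.supp := ⟨a, b, hb.ne⟩
  have := Fintype.ofFinite c.supp
  obtain ⟨v, hv⟩ := hT.exists_vert_degree_one_of_nontrivial
  obtain ⟨x, hx, hvx⟩ := key v _ ((hadj v.1.1 _).2 (Or.inl rfl))
  obtain ⟨y, hy, hvy⟩ := key v (h.formPerm.symm v.1.1)
    ((hadj v.1.1 _).2 (Or.inr (Equiv.apply_symm_apply _ _)))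
  obtain ⟨z, -, hz⟩ := SimpleGraph.degree_eq_one_iff_existsUnique_adj.1 hv
  refine hh.formPerm_ne_symm v.1.1 ?_
  rw [← hx, ← hy, hz x hvx, hz y hvy]

theorem IsImportant.exists_isTrace (hH : IsImportant A H) :
    ∃ h, IsHamList G h ∧ IsTrace h A H := by
  obtain ⟨hx, z, hz, hc⟩ := hH
  obtain ⟨h, hh, ht, -⟩ := (completesTo_iff hx.1 hz.1).1 hc
  exact ⟨h, hh, ht⟩

theorem IsImportant.ncard_paths_le [Finite V] (hH : IsImportant A H) :
    (paths H).ncard ≤ mm G A := by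
  obtain ⟨h, hh, ht⟩ := hH.exists_isTrace
  rcases eq_or_ne A Set.univ with rfl | hA
  · rw [ht.paths_eq_empty hh, Set.ncard_empty]
    exact Nat.zero_le _
  · have : Inhabited V := ⟨h.head (List.length_pos_iff.1 (by have := hh.len; omega))⟩
    obtain ⟨L, hL⟩ := hh.exists_compat hA
    exact (ht.ncard_paths_le hL).trans (hh.length_le_mm hL)

end

/-! ## Exchanging certificates -/

section
variable {V : Type*} [Inhabited V] {A : Set V} {L L' : List (List V)} {r : V → V → Prop}

theorem ends_reverse (p : List V) : ends p.reverse = (ends p).swap := by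
  simp [ends]

/-- Turning some of the paths around, so that the labels of the ends come in the given order. -/
theorem exists_oriented {Λ : Type*} (l : V → Λ) (L : List (List V)) (m : Multiset (Λ × Λ))
    (h : ((lab l (endsOf L)).map fun e => s(e.1, e.2)) = m.map fun e => s(e.1, e.2)) :
    ∃ L', List.Forall₂ (fun p q => q = p ∨ q = p.reverse) L L' ∧ lab l (endsOf L') = m := by
  induction L generalizing m with
  | nil =>
    refine ⟨[], List.Forall₂.nil, ?_⟩
    have : m.map (fun e => s(e.1, e.2)) = 0 := h.symm
    rw [Multiset.map_eq_zero.1 this]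
    rfl
  | cons p L ih =>
    rw [endsOf_cons, lab, Multiset.map_cons, Multiset.map_cons] at h
    have hmem : s(l (ends p).1, l (ends p).2) ∈ m.map fun e => s(e.1, e.2) := by
      rw [← h]; exact Multiset.mem_cons_self _ _
    obtain ⟨e, he, hpe⟩ := Multiset.mem_map.1 hmem
    obtain ⟨m', rfl⟩ := Multiset.exists_cons_of_mem he
    rw [Multiset.map_cons, hpe] at h
    obtain ⟨L', h1, h2⟩ := ih m' ((Multiset.cons_inj_right _).1 h)
    rcases Sym2.eq_iff.1 hpe with ⟨h3, h4⟩ | ⟨h3, h4⟩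
    · refine ⟨p :: L', List.Forall₂.cons (Or.inl rfl) h1, ?_⟩
      rw [endsOf_cons, lab, Multiset.map_cons, ← lab, h2]
      congr 1
      exact Prod.ext h3.symm h4.symm
    · refine ⟨p.reverse :: L', List.Forall₂.cons (Or.inr rfl) h1, ?_⟩
      rw [endsOf_cons, lab, Multiset.map_cons, ← lab, h2, ends_reverse]
      congr 1
      exact Prod.ext h3.symm h4.symm

omit [Inhabited V] in
theorem flatten_perm_of_oriented (h : List.Forall₂ (fun p q => q = p ∨ q = p.reverse) L L') :
    L.flatten.Perm L'.flatten := by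
  induction h with
  | nil => exact List.Perm.refl _
  | @cons p q _ _ hpq _ ih =>
    rw [List.flatten_cons, List.flatten_cons]
    refine List.Perm.append ?_ ih
    rcases hpq with rfl | rfl
    · exact List.Perm.refl _
    · exact (List.reverse_perm p).symm

theorem exists_of_oriented (h : List.Forall₂ (fun p q => q = p ∨ q = p.reverse) L L') :
    ∀ q ∈ L', ∃ p ∈ L, q = p ∨ q = p.reverse := by
  induction h with
  | nil => simp
  | @cons p q l l' hpq _ ih =>
    intro x hx
    rcases List.mem_cons.1 hx with rfl | hx
    · exact ⟨p, by simp, hpq⟩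
    · obtain ⟨p', hp', h'⟩ := ih x hx
      exact ⟨p', List.mem_cons_of_mem _ hp', h'⟩

omit [Inhabited V] in
theorem oriented_symm (h : List.Forall₂ (fun p q => q = p ∨ q = p.reverse) L L') :
    List.Forall₂ (fun p q => q = p ∨ q = p.reverse) L' L := by
  refine (List.Forall₂.imp (fun p q hpq => ?_) h).flip
  rcases hpq with rfl | rfl
  · exact Or.inl rfl
  · exact Or.inr (List.reverse_reverse p).symm

theorem PathSys.oriented (hr : ∀ u v, r u v → r v u) (hL : PathSys r A L)
    (h : List.Forall₂ (fun p q => q = p ∨ q = p.reverse) L L') : PathSys r A L' where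
  ne q hq := by
    obtain ⟨p, hp, rfl | rfl⟩ := exists_of_oriented h q hq
    · exact hL.ne _ hp
    · simpa using hL.ne _ hp
  chain q hq := by
    obtain ⟨p, hp, rfl | rfl⟩ := exists_of_oriented h q hq
    · exact hL.chain _ hp
    · rw [List.isChain_reverse]
      exact (hL.chain _ hp).imp fun u v => hr u v
  nodup := (flatten_perm_of_oriented h).nodup_iff.1 hL.nodup
  mem v := by rw [← hL.mem, (flatten_perm_of_oriented h).mem_iff]

theorem follows_of_oriented (h : List.Forall₂ (fun p q => q = p ∨ q = p.reverse) L L') {u v : V}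
    (hf : Follows L' u v) : Follows L u v ∨ Follows L v u := by
  obtain ⟨q, hq, hi⟩ := hf
  obtain ⟨p, hp, rfl | rfl⟩ := exists_of_oriented h q hq
  · exact Or.inl ⟨_, hp, hi⟩
  · refine Or.inr ⟨_, hp, List.reverse_infix.1 ?_⟩
    exact hi

theorem follows_oriented_iff (h : List.Forall₂ (fun p q => q = p ∨ q = p.reverse) L L') (u v : V) :
    Follows L' u v ∨ Follows L' v u ↔ Follows L u v ∨ Follows L v u := by
  constructor
  · rintro (hf | hf)
    · exact follows_of_oriented h hf
    · exact (follows_of_oriented h hf).symm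
  · rintro (hf | hf)
    · exact follows_of_oriented (oriented_symm h) hf
    · exact (follows_of_oriented (oriented_symm h) hf).symm

omit [Inhabited V] in
theorem follows_append {u v : V} : Follows (L ++ L') u v ↔ Follows L u v ∨ Follows L' u v := by
  simp only [Follows, List.mem_append, or_and_right, exists_or]

end

/-! ### The exchange of traces with equal path classes -/

section
variable {V : Type*} [DecidableEq V] [Inhabited V] {G : SimpleGraph V} {A : Set V} {h : List V}

/-- The classes of the paths of `L`. -/
def classes (G : SimpleGraph V) (A : Set V) (L : List (List V)) : Multiset (Sym2 (Set V)) :=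
  (lab (fun u => G.neighborSet u \ A) (endsOf L)).map fun e => s(e.1, e.2)

theorem IsHamList.pathSys (hh : IsHamList G h) {L : List (List V)} (hL : Compat h.formPerm A L) :
    PathSys G.Adj A L :=
  { hL.sys with chain := fun p hp => (hL.sys.chain p hp).imp (R := fun u v => h.formPerm u = v) fun u _ huv =>
      huv ▸ hh.adj u }

omit [DecidableEq V] [Inhabited V] in
theorem lam_eq_some {u : V} (hu : u ∈ A) :
    lam G.Adj Set.univ A u = some (G.neighborSet u \ A) := by
  rw [lam_some hu]
  congr 1
  ext w
  simp [and_comm]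

omit [Inhabited V] in
theorem IsTrace.of_follows {H : G.Subgraph} {L : List (List V)} (hv : H.verts = A)
    (hadj : ∀ u v, H.Adj u v ↔ Follows L u v ∨ Follows L v u)
    (h1 : ∀ u v, Follows L u v → h.formPerm u = v)
    (h2 : ∀ u v, u ∈ A → v ∈ A → h.formPerm u = v → Follows L u v) : IsTrace h A H := by
  refine ⟨hv, fun u v => ⟨fun huv => ⟨hv ▸ huv.fst_mem, hv ▸ huv.snd_mem, ?_⟩, ?_⟩⟩
  · exact ((hadj u v).1 huv).imp (h1 u v) (h1 v u)
  · rintro ⟨hu, hv, huv⟩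
    exact (hadj u v).2 (huv.imp (h2 u v hu hv) (h2 v u hv hu))

/-- If the paths of a trace `x` within `A` of some Hamiltonian cycle have the same classes as those of
the Hamiltonian cycle `h`, then `x` can take the place of the latter. -/
theorem exists_exchange {h₁ : List V} {x z : G.Subgraph} {Lx : List (List V)}
    (hA : A.Nonempty) (hA' : A ≠ Set.univ) (hx : IsHamList G h₁) (htx : IsTrace h₁ A x)
    (hLx : Compat h₁.formPerm A Lx) (hh : IsHamList G h) (htz : IsTrace h Aᶜ z)
    (hst : ∀ Ly, Compat h.formPerm A Ly → classes G A Lx = classes G A Ly) :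
    ∃ g, IsHamList G g ∧ IsTrace g A x ∧ IsTrace g Aᶜ z := by
  obtain ⟨h', hr, he1, he2, Ly, Lz, hLy, hLz, hmrg⟩ := hh.exists_traces hA hA'
  have hh' := hh.isRotated hr
  -- Path classes are unordered, whereas merges act on directed paths; so the paths of `x` are
  -- turned around until their ordered labels agree with those of `h`.
  obtain ⟨Lx', hor, hlab⟩ := exists_oriented _ Lx _ (hst Ly hLy)
  have hsx := (hx.pathSys hLx).oriented (r := G.Adj) (fun _ _ h => h.symm) hor
  have hsz := hh.pathSys hLz
  have hdis : Disjoint A Aᶜ := disjoint_compl_right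
  have hlam : lab (lam G.Adj Set.univ A) (endsOf Ly) = lab (lam G.Adj Set.univ A) (endsOf Lx') := by
    rw [lab_factor (l := fun u => G.neighborSet u \ A) some _ hLy.sys.endsIn fun u hu => lam_eq_some hu,
      lab_factor (l := fun u => G.neighborSet u \ A) some _ hsx.endsIn fun u hu => lam_eq_some hu, hlab]
  have hpair := lab_pair_left hdis hLy.sys.endsIn hlam
  have hX : ∀ b b' c c', lamPair G.Adj Set.univ A Aᶜ b = lamPair G.Adj Set.univ A Aᶜ b' →
      lamPair G.Adj Set.univ A Aᶜ c = lamPair G.Adj Set.univ A Aᶜ c' →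
      (G.Adj b c ∧ ((b ∈ A ∧ c ∈ Aᶜ) ∨ (b ∈ Aᶜ ∧ c ∈ A))) →
      (G.Adj b' c' ∧ ((b' ∈ A ∧ c' ∈ Aᶜ) ∨ (b' ∈ Aᶜ ∧ c' ∈ A))) := fun b b' c c' h1 h2 h3 =>
    lamPair_cross (r := G.Adj) (fun _ _ h => h.symm) (Set.subset_univ _) (Set.subset_univ _) hdis h1 h2 h3
  -- The merges that assemble `h'` from its two traces are replayed with the paths of `x` in place
  -- of `Ly`.
  obtain ⟨s, hs, hs'⟩ := Mrg.lifts hX (s₂ := endsOf Lx' + endsOf Lz) (by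
    have := congrArg (· + lab (lamPair G.Adj Set.univ A Aᶜ) (endsOf Lz)) hpair
    simp only [← lab_add] at this
    exact this) hmrg
  rw [← endsOf_append] at hs
  obtain ⟨L, hL, hLs, hf1, hf2⟩ := (hsx.append hsz hdis).merges (fun u v h => h.1) hs
  rw [← hLs] at hs'
  have hcard := congrArg Multiset.card hs'
  rw [Multiset.card_map, Multiset.card_map, Multiset.card_singleton, endsOf, Multiset.coe_card,
    List.length_map] at hcard
  -- A single pair of ends is left, as for `h'`, so all paths have been merged into one.
  obtain ⟨g, rfl⟩ := List.length_eq_one_iff.1 hcard.symm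
  have hends : Prod.map (lamPair G.Adj Set.univ A Aᶜ) (lamPair G.Adj Set.univ A Aᶜ) (ends h') =
      Prod.map (lamPair G.Adj Set.univ A Aᶜ) (lamPair G.Adj Set.univ A Aᶜ) (ends g) := by
    simpa [endsOf] using hs'
  rw [Prod.ext_iff] at hends
  have h0 : h' ≠ [] := List.ne_nil_of_mem (hh'.mem default)
  -- The ends of `g` have the labels of those of `h'`, whose closing edge crosses the cut by the
  -- choice of the rotation; so `g` closes up along a crossing edge too.
  have hclose : G.Adj (ends g).2 (ends g).1 ∧
      (((ends g).2 ∈ A ∧ (ends g).1 ∈ Aᶜ) ∨ ((ends g).2 ∈ Aᶜ ∧ (ends g).1 ∈ A)) := by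
    refine hX _ _ _ _ hends.2 hends.1 ⟨?_, Or.inl ⟨he2, he1⟩⟩
    have := hh'.adj (ends h').2
    rwa [formPerm_ends_snd hh'.nodup h0] at this
  have hgn : g.Nodup := by simpa using hL.nodup
  have hgm : ∀ v, v ∈ g := fun v => by simpa [Set.union_compl_self] using hL.mem v
  have hg : IsHamList G g := by
    refine IsHamList.of_isChain hgn hgm ?_ (hL.chain g (by simp)) hclose.1
    rw [((List.perm_ext_iff_of_nodup hgn hh.nodup).2 fun v => by simp [hgm, hh.mem]).length_eq]
    exact hh.len
  have hfol : ∀ u v, Follows [g] u v ↔ [u, v] <:+: g := fun u v => by simp [Follows]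
  have hto : ∀ u v, Follows Lx' u v ∨ Follows Lz u v → g.formPerm u = v := fun u v huv =>
    (formPerm_eq_iff hgn (hgm u)).2 (Or.inl ((hfol u v).1 (hf1 u v (follows_append.2 huv))))
  have hfrom : ∀ u v, g.formPerm u = v → (Follows Lx' u v ∨ Follows Lz u v) ∨
      ((u ∈ A ∧ v ∈ Aᶜ) ∨ (u ∈ Aᶜ ∧ v ∈ A)) := fun u v huv => by
    rcases (formPerm_eq_iff hgn (hgm u)).1 huv with h1 | ⟨rfl, rfl⟩
    · exact (hf2 u v ((hfol u v).2 h1)).imp follows_append.1 And.right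
    · exact Or.inr hclose.2
  refine ⟨g, hg, IsTrace.of_follows (L := Lx') htx.verts (fun u v => ?_) (fun u v huv => hto u v (Or.inl huv))
    fun u v hu hv huv => ?_, IsTrace.of_follows (L := Lz) htz.verts (fun u v => htz.adj_iff_follows hLz)
    (fun u v huv => hto u v (Or.inr huv)) fun u v hu hv huv => ?_⟩
  · rw [htx.adj_iff_follows hLx, follows_oriented_iff hor]
  · rcases hfrom u v huv with (h1 | h1) | h1 | h1
    · exact h1
    · exact absurd hu ((hsz.mem u).1 (follows_mem h1).1)
    · exact absurd hv h1.2
    · exact absurd hu h1.1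
  · rcases hfrom u v huv with (h1 | h1) | h1 | h1
    · exact absurd ((hsx.mem u).1 (follows_mem h1).1) hu
    · exact h1
    · exact absurd h1.1 hu
    · exact absurd h1.2 hv

end

/-! ## Preserving sets -/

section
variable {V : Type*} [DecidableEq V] {G : SimpleGraph V} {A : Set V} {h : List V} {H : G.Subgraph}
  {L : List (List V)}

/-- The classes of the paths of a certificate. -/
noncomputable def state (H : G.Subgraph) : Multiset (Sym2 (Set V)) :=
  ∑ᶠ P : paths H, {Classical.epsilon (HasPathClass H P)}

omit [DecidableEq V] in
-- The class chosen for a path depends only on the predicate `HasPathClass`, which the bijection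
-- preserves. Hence certificates with different states are never path equivalent.
theorem PathEquivalent.state_eq {H' : G.Subgraph} (hH : PathEquivalent H H') : state H = state H' := by
  obtain ⟨σ, hσ⟩ := hH
  rw [state, state, ← finsum_comp_equiv σ]
  refine finsum_congr fun P => ?_
  rw [funext fun q => propext (hσ P q)]

theorem IsTrace.state_eq [Inhabited V] (hh : IsHamList G h) (ht : IsTrace h A H)
    (hL : Compat h.formPerm A L) (hH : H.coe.IsAcyclic) : state H = classes G A L := by
  have hall : ∀ c, c ∈ paths H := fun c => hH.induce _
  let e : Fin L.length ≃ paths H :=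
    (Equiv.ofBijective _ (ht.component_bijective hL)).trans
      (Equiv.subtypeUnivEquiv hall).symm
  have he : ∀ i, (e i).1 = ht.component hL i := fun i => rfl
  rw [state, ← finsum_comp_equiv e, finsum_eq_sum_of_fintype]
  have h1 : ∀ i : Fin L.length, Classical.epsilon (HasPathClass H (e i)) =
      s(G.neighborSet (ends L[i]).1 \ A, G.neighborSet (ends L[i]).2 \ A) := fun i => by
    have := (ht.hasPathClass_iff hh hL i _).2 rfl
    rw [he]
    exact (ht.hasPathClass_iff hh hL i _).1 (Classical.epsilon_spec ⟨_, this⟩)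
  simp only [h1]
  refine (Fin.sum_univ_fun_getElem L fun p =>
    ({s(G.neighborSet (ends p).1 \ A, G.neighborSet (ends p).2 \ A)} : Multiset (Sym2 (Set V)))).trans ?_
  rw [classes, lab, endsOf, Multiset.map_coe, Multiset.map_coe, List.map_map, List.map_map]
  clear hL ht hall e he h1 hh
  induction L with
  | nil => rfl
  | cons p L ih => rw [List.map_cons, List.sum_cons, ih]; rfl

theorem IsImportant.isAcyclic (hH : IsImportant A H) (hA : A ≠ Set.univ) : H.coe.IsAcyclic := by
  obtain ⟨⟨hv, hH | hH⟩, -⟩ := hH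
  · exact hH.1
  · obtain ⟨_, -, ht⟩ := hH.exists_isHamList
    exact absurd (hv.symm.trans ht.verts) hA

/-- The certificate without edges. -/
def edgeless (G : SimpleGraph V) (A : Set V) : G.Subgraph where
  verts := A
  Adj _ _ := False
  adj_sub h := h.elim
  edge_vert h := h.elim

theorem edgeless_mem_cert : edgeless G A ∈ cert G A := by
  refine ⟨rfl, Or.inl ⟨?_, fun v => ?_⟩⟩
  · have : (edgeless G A).coe = ⊥ := by
      ext u v
      exact Iff.rfl
    rw [this]
    exact SimpleGraph.isAcyclic_bot
  · have : (edgeless G A).neighborSet v = ∅ := Set.eq_empty_iff_forall_notMem.2 fun _ h => h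
    rw [this, Set.ncard_empty]
    exact Nat.zero_le _

/-- One certificate for each value of a function suffices if it determines which certificates
complete to a Hamiltonian cycle. -/
theorem exists_preserving [Finite V] {Λ : Type*} (st : G.Subgraph → Λ)
    (h1 : ∀ x y, IsImportant A x → IsImportant A y → st x = st y → ∀ z ∈ cert G Aᶜ,
      CompletesTo y z → CompletesTo x z)
    (h2 : ∀ x y, PathEquivalent x y → st x = st y) :
    ∃ S ⊆ cert G A, Preserves A S (cert G A) ∧
      (∀ x ∈ S, ∀ y ∈ S, x ≠ y → ¬ PathEquivalent x y) ∧
      S.ncard ≤ (st '' {x | IsImportant A x}).ncard + 1 := by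
  by_cases hI : ∃ x : G.Subgraph, IsImportant A x
  · obtain ⟨x₀, hx₀⟩ := hI
    have hrep : ∀ s, ∃ x, IsImportant A x ∧ (s ∈ st '' {x | IsImportant A x} → st x = s) := fun s => by
      by_cases hs : s ∈ st '' {x | IsImportant A x}
      · obtain ⟨x, hx, rfl⟩ := hs
        exact ⟨x, hx, fun _ => rfl⟩
      · exact ⟨x₀, hx₀, fun h => absurd h hs⟩
    choose rep hr1 hr2 using hrep
    refine ⟨rep '' (st '' {x | IsImportant A x}), ?_, ?_, ?_, ?_⟩
    · rintro _ ⟨s, -, rfl⟩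
      exact (hr1 s).1
    · intro y hy
      by_cases hyI : IsImportant A y
      · have hs : st y ∈ st '' {x | IsImportant A x} := ⟨y, hyI, rfl⟩
        exact ⟨rep (st y), ⟨_, hs, rfl⟩, h1 _ _ (hr1 _) hyI (hr2 _ hs)⟩
      · exact ⟨rep (st x₀), ⟨_, ⟨x₀, hx₀, rfl⟩, rfl⟩, fun z hz hc => absurd ⟨hy, z, hz, hc⟩ hyI⟩
    · rintro _ ⟨s, hs, rfl⟩ _ ⟨s', hs', rfl⟩ hne he
      refine hne (congrArg rep ?_)
      rw [← hr2 s hs, ← hr2 s' hs', h2 _ _ he]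
    · exact (Set.ncard_image_le (Set.toFinite _)).trans (Nat.le_succ _)
  -- If no certificate is important, nothing has to be preserved, but the set must still have a
  -- member to offer to each certificate.
  · refine ⟨{edgeless G A}, by simpa using edgeless_mem_cert, fun y hy => ⟨_, rfl, fun z hz hc =>
      absurd ⟨y, hy, z, hz, hc⟩ hI⟩, ?_, by simp⟩
    rintro x rfl y rfl hne
    exact absurd rfl hne

/-- The empty set has only one certificate. For the whole vertex set an important certificate
already is a Hamiltonian cycle, and the certificate of the empty complement adds nothing. So a
constant function can serve as the state. -/
theorem exists_preserving_of_trivial [Finite V] (hA : A = ∅ ∨ A = Set.univ) :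
    ∃ S ⊆ cert G A, Preserves A S (cert G A) ∧
      (∀ x ∈ S, ∀ y ∈ S, x ≠ y → ¬ PathEquivalent x y) ∧ S.ncard ≤ 2 := by
  obtain ⟨S, hS, hS1, hS2, hS3⟩ := exists_preserving (G := G) (A := A) (fun _ => ()) (by
    intro x y hx hy _ z hz hc
    rcases hA with rfl | rfl
    · have hxy : x = y := by
        have hv : ∀ x : G.Subgraph, x.verts = ∅ → ∀ u v, ¬ x.Adj u v := fun x hx u v huv => by
          have := huv.fst_mem
          rw [hx] at this
          exact this
        refine SimpleGraph.Subgraph.ext (hx.1.1.trans hy.1.1.symm) ?_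
        funext u v
        exact propext (iff_of_false (hv x hx.1.1 u v) (hv y hy.1.1 u v))
      rwa [hxy]
    · obtain ⟨h, hh, ht⟩ := hx.exists_isTrace
      refine (completesTo_iff hx.1.1 hz.1).2 ⟨h, hh, ht, hz.1, fun u v => ?_⟩
      rw [Set.compl_univ]
      refine iff_of_false (fun huv => ?_) fun h => h.1
      have := huv.fst_mem
      rw [hz.1, Set.compl_univ] at this
      exact this) (fun _ _ _ => rfl)
  refine ⟨S, hS, hS1, hS2, hS3.trans (Nat.succ_le_succ ?_)⟩
  exact (Set.ncard_le_ncard (Set.subset_univ _) (Set.toFinite _)).trans_eq (by simp)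

end

/-! ## The number of states -/

section
variable {V : Type*} [DecidableEq V] [Inhabited V] {G : SimpleGraph V} {A : Set V} {h : List V}
  {L : List (List V)}

theorem nonempty_of_compat (hh : IsHamList G h) (hL : Compat h.formPerm A L) {e : V × V}
    (he : e ∈ endsOf L) : (G.neighborSet e.1 \ A).Nonempty ∧ (G.neighborSet e.2 \ A).Nonempty := by
  obtain ⟨p, hp, rfl⟩ := List.mem_map.1 (Multiset.mem_coe.1 he)
  refine ⟨⟨h.formPerm.symm (ends p).1, ?_, hL.head p hp _ (Equiv.apply_symm_apply _ _)⟩,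
    ⟨h.formPerm (ends p).2, hh.adj _, hL.last p hp⟩⟩
  have := hh.adj (h.formPerm.symm (ends p).1)
  rw [Equiv.apply_symm_apply] at this
  exact this.symm

omit [DecidableEq V] in
theorem card_classes : Multiset.card (classes G A L) = L.length := by
  simp [classes, lab, endsOf]

omit [DecidableEq V] in
theorem mem_classes {q : Sym2 (Set V)} : q ∈ classes G A L ↔
    ∃ e ∈ endsOf L, s(G.neighborSet e.1 \ A, G.neighborSet e.2 \ A) = q := by
  simp [classes, lab]

/-- The cycle passes outside at both ends of every path of a trace, so these ends have neighbours
outside, and at a split they all have the same neighbourhood there. Only the number of paths remains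
free. -/
theorem classes_of_isSplit (hs : IsSplit G A) : ∃ B : Set V, ∀ h, IsHamList G h → ∀ L,
    Compat h.formPerm A L → classes G A L = Multiset.replicate L.length s(B, B) := by
  obtain ⟨B, hB⟩ : ∃ B : Set V, ∀ u ∈ A, (G.neighborSet u \ A).Nonempty → G.neighborSet u \ A = B := by
    by_cases h0 : ∃ u ∈ A, (G.neighborSet u \ A).Nonempty
    · obtain ⟨u, hu, hu'⟩ := h0
      exact ⟨G.neighborSet u \ A, fun v hv hv' => hs.2.2 v hv u hu hv' hu'⟩
    · exact ⟨∅, fun u hu hu' => absurd ⟨u, hu, hu'⟩ h0⟩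
  refine ⟨B, fun h hh L hL => Multiset.eq_replicate.2 ⟨card_classes, fun q hq => ?_⟩⟩
  obtain ⟨e, he, rfl⟩ := mem_classes.1 hq
  obtain ⟨h1, h2⟩ := hL.sys.endsIn e he
  obtain ⟨h3, h4⟩ := nonempty_of_compat hh hL he
  rw [hB _ h1 h3, hB _ h2 h4]

theorem exists_neighborhoods {V : Type} [Finite V] (G : SimpleGraph V) (A : Set V) :
    ∃ T : Finset (Set V), T.card ≤ 2 ^ mm G A + mm G A ∧ ∀ u ∈ A, G.neighborSet u \ A ∈ T := by
  classical
  have := Fintype.ofFinite V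
  obtain ⟨h1, h2, h3, h4⟩ := greedy_spec (r := fun u v => decide (G.Adj u v))
    (eq := fun u v => decide (u = v)) (A := (Finset.univ.filter (· ∈ A)).toList)
    (O := (Finset.univ.filter (· ∉ A)).toList) (by simp)
  simp only [Finset.mem_toList, Finset.mem_filter, Finset.mem_univ, true_and, decide_eq_true_eq] at h1 h4
  have hlen := length_le_mm _ h1 h2 h3
  obtain ⟨T, hT, hT'⟩ := exists_labels (r := G.Adj) (A := A) (O := Aᶜ) _ h4
  refine ⟨T, hT.trans (Nat.add_le_add (Nat.pow_le_pow_right (by omega) hlen) hlen), fun u hu => ?_⟩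
  convert hT' u hu using 1
  ext w
  simp [and_comm]

theorem choose_pow_le {t k : ℕ} (ht : t ≤ 2 ^ k + k) :
    ((t + 1).choose 2 + 1) ^ k ≤ 67 ^ 3 * 4 ^ k ^ 2 := by
  have h0 : ∀ k ≥ 4, 4 * k ≤ 2 ^ k := fun k hk => by
    induction k, hk using Nat.le_induction with
    | base => norm_num
    | succ k hk ih => rw [pow_succ]; omega
  have h1 : (t + 1).choose 2 ≤ (2 ^ k + k + 1).choose 2 := Nat.choose_le_choose 2 (by omega)
  rcases Nat.lt_or_ge k 4 with hk | hk
  -- For `k = 3` this is `12.choose 2 = 66`, the source of the constant `67 ^ 3`. From `k = 4` on,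
  -- `4 * k ≤ 2 ^ k` makes the number of classes plus one at most `4 ^ k`.
  · have h2 : (2 ^ k + k + 1).choose 2 ≤ 66 := by interval_cases k <;> decide
    calc ((t + 1).choose 2 + 1) ^ k ≤ 67 ^ k := Nat.pow_le_pow_left (by omega) k
      _ ≤ 67 ^ 3 := Nat.pow_le_pow_right (by norm_num) (by omega)
      _ ≤ 67 ^ 3 * 4 ^ k ^ 2 := Nat.le_mul_of_pos_right _ (by positivity)
  · have h2 := h0 k hk
    have h3 : (t + 1).choose 2 + 1 ≤ 4 ^ k := by
      have h4 : (4 : ℕ) ^ k = 2 ^ k * 2 ^ k := by rw [← mul_pow]; norm_num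
      have h5 : 16 ≤ 2 ^ k := (by norm_num : 16 = 2 ^ 4).le.trans (Nat.pow_le_pow_right (by norm_num) hk)
      have h6 : 2 * (2 ^ k + k + 1).choose 2 ≤ (2 ^ k + k + 1) * (2 ^ k + k) := by
        rw [Nat.choose_two_right]
        exact Nat.mul_div_le _ _
      rw [h4]
      nlinarith
    calc ((t + 1).choose 2 + 1) ^ k ≤ (4 ^ k) ^ k := Nat.pow_le_pow_left h3 k
      _ = 4 ^ k ^ 2 := by rw [← pow_mul, pow_two]
      _ ≤ 67 ^ 3 * 4 ^ k ^ 2 := Nat.le_mul_of_pos_left _ (by norm_num)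

/-- The number of the states of a cut of small width. -/
theorem ncard_states_le {V : Type} [DecidableEq V] [Inhabited V] [Fintype V] {G : SimpleGraph V}
    {A : Set V} (hA : A ≠ Set.univ) {k : ℕ} (hk : sm G A ≤ k) :
    (state '' {x : G.Subgraph | IsImportant A x}).ncard ≤
      67 ^ 3 * (Fintype.card V + 4 ^ k ^ 2) := by
  classical
  have hpos : 1 ≤ 4 ^ k ^ 2 := Nat.one_le_pow _ _ (by norm_num)
  have hst : ∀ x : G.Subgraph, IsImportant A x → ∃ h, IsHamList G h ∧ ∃ L, Compat h.formPerm A L ∧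
      state x = classes G A L := fun x hx => by
    obtain ⟨h, hh, ht⟩ := hx.exists_isTrace
    obtain ⟨L, hL⟩ := hh.exists_compat hA
    exact ⟨h, hh, L, hL, ht.state_eq hh hL (hx.isAcyclic hA)⟩
  by_cases hs : IsSplit G A
  · obtain ⟨B, hB⟩ := classes_of_isSplit hs
    have hsub : state '' {x : G.Subgraph | IsImportant A x} ⊆
        ((Finset.range (Fintype.card V + 1)).image fun j => Multiset.replicate j s(B, B) : Finset _) := by
      rintro _ ⟨x, hx, rfl⟩
      obtain ⟨h, hh, L, hL, he⟩ := hst x hx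
      rw [he, hB h hh L hL]
      refine Finset.mem_coe.2 (Finset.mem_image.2 ⟨L.length, Finset.mem_range.2 (Nat.lt_succ_of_le ?_), rfl⟩)
      have := (hL.sys.nodup_map (fun p => (ends p).1) fun p hp =>
        ends_fst_mem (hL.sys.ne p hp)).length_le_card
      rwa [List.length_map] at this
    refine (Set.ncard_le_ncard hsub (Finset.finite_toSet _)).trans ?_
    rw [Set.ncard_coe_finset]
    refine Finset.card_image_le.trans ?_
    rw [Finset.card_range]
    nlinarith
  · have hk' : mm G A ≤ k := by rwa [sm, if_neg hs] at hk
    obtain ⟨T, hT, hT'⟩ := exists_neighborhoods G A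
    have hfin : (state '' {x : G.Subgraph | IsImportant A x}).Finite := Set.toFinite _
    -- A state is a multiset of at most `k` unordered pairs from `T`; unordered pairs number
    -- `(T.card + 1).choose 2`.
    have h1 := card_multiset_le T.sym2 k hfin.toFinset (fun m hm => by
      obtain ⟨x, hx, rfl⟩ := hfin.mem_toFinset.1 hm
      obtain ⟨h, hh, L, hL, he⟩ := hst x hx
      rw [he]
      refine ⟨card_classes.trans_le ((hh.length_le_mm hL).trans hk'), fun q hq => ?_⟩
      obtain ⟨e, he, rfl⟩ := mem_classes.1 hq
      obtain ⟨h1, h2⟩ := hL.sys.endsIn e he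
      exact Finset.mk_mem_sym2_iff.2 ⟨hT' _ h1, hT' _ h2⟩)
    rw [← Set.ncard_eq_toFinset_card _ hfin, Finset.card_sym2] at h1
    have h2 := choose_pow_le (t := T.card) (k := k)
      (hT.trans (Nat.add_le_add (Nat.pow_le_pow_right (by omega) hk') hk'))
    exact (h1.trans h2).trans (Nat.mul_le_mul_left _ (Nat.le_add_left _ _))

theorem exists_preserving_set {V : Type} [DecidableEq V] [Fintype V] (G : SimpleGraph V) (A : Set V)
    {k : ℕ} (hk : sm G A ≤ k) :
    ∃ S ⊆ cert G A, Preserves A S (cert G A) ∧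
      (∀ x ∈ S, ∀ y ∈ S, x ≠ y → ¬ PathEquivalent x y) ∧
      S.ncard ≤ (67 ^ 3 + 2) * (Fintype.card V + 4 ^ k ^ 2) := by
  have hpos : 1 ≤ 4 ^ k ^ 2 := Nat.one_le_pow _ _ (by norm_num)
  by_cases hA : A = ∅ ∨ A = Set.univ
  · obtain ⟨S, hS, hS1, hS2, hS3⟩ := exists_preserving_of_trivial (G := G) hA
    exact ⟨S, hS, hS1, hS2, hS3.trans (by nlinarith)⟩
  push Not at hA
  obtain ⟨a, -⟩ := hA.1
  have : Inhabited V := ⟨a⟩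
  obtain ⟨S, hS, hS1, hS2, hS3⟩ := exists_preserving (G := G) (A := A) state (fun x y hx hy hxy z hz hc => by
    obtain ⟨h₁, hh₁, htx⟩ := hx.exists_isTrace
    obtain ⟨Lx, hLx⟩ := hh₁.exists_compat hA.2
    obtain ⟨h, hh, hty, htz⟩ := (completesTo_iff hy.1.1 hz.1).1 hc
    refine (completesTo_iff hx.1.1 hz.1).2 (exists_exchange hA.1 hA.2 hh₁ htx hLx hh htz
      fun Ly hLy => ?_)
    rw [← htx.state_eq hh₁ hLx (hx.isAcyclic hA.2), hxy, hty.state_eq hh hLy (hy.isAcyclic hA.2)])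
    fun x y h => h.state_eq
  -- There is one certificate per state, plus one in reserve for the case without important
  -- certificates; the summand 2 in the constant also covers the trivial cuts.
  refine ⟨S, hS, hS1, hS2, hS3.trans ?_⟩
  have := ncard_states_le (G := G) hA.2 hk
  nlinarith

end

end SMWidth

theorem mainTheorem4 :
    -- the algorithm and its running time
    (∃ (P : SMWidth.Prog) (C c : ℕ), ∀ (n m : ℕ) (G : SimpleGraph (Fin n))
        (D : SMWidth.BranchDecomposition (Fin n) (Fin m)),
      ∃ (y : SMWidth.Data) (t : ℕ), SMWidth.Run P (SMWidth.encodeInput G D) y t ∧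
        (y ≠ SMWidth.Data.nil ↔
          ∃ (a : Fin n) (p : G.Walk a a), p.IsHamiltonianCycle) ∧
        t ≤ C * (n + m) ^ c * 2 ^ (24 * (D.smWidth G) ^ 2)) ∧
    -- the number of paths of an important certificate
    (∀ (n : ℕ) (G : SimpleGraph (Fin n)) (A : Set (Fin n)) (H : G.Subgraph),
      SMWidth.IsImportant A H → (SMWidth.paths H).ncard ≤ SMWidth.mm G A) ∧
    -- the size of a set of certificates that preserves all of them
    (∃ C : ℕ, ∀ (n k : ℕ) (G : SimpleGraph (Fin n)) (A : Set (Fin n)), SMWidth.sm G A ≤ k →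
      ∃ S ⊆ SMWidth.cert G A, SMWidth.Preserves A S (SMWidth.cert G A) ∧
        (∀ x ∈ S, ∀ y ∈ S, x ≠ y → ¬ SMWidth.PathEquivalent x y) ∧
        S.ncard ≤ C * (n + 4 ^ (k ^ 2))) := by
  refine ⟨SMWidth.exists_program, fun n G A H hH => hH.ncard_paths_le, 67 ^ 3 + 2,
    fun n k G A hk => ?_⟩
  have h := SMWidth.exists_preserving_set G A hk
  rwa [Fintype.card_fin] at h
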